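/- **Setting.** Let $d,k\ge 1$, let $Q\in\mathbb R^{d\times d}$, $R\in\mathbb R^{k\times k}$ be positive definite, and consider the linear system $x_1=0$, $x_{t+1}=A_\star x_t+B_\star u_t+w_t$ with $A_\star\in\mathbb R^{d\times d}$, $B_\star\in\mathbb R^{d\times k}$ and i.i.d. noise $w_t\sim\mathcal N(0,\sigma^2 I_d)$, $\sigma>0$, with cost $c_t=x_t^TQx_t+u_t^TRu_t$ at time $t$. For $K\in\mathbb R^{k\times d}$ let $J(K)=\lim_{n\to\infty}\frac1n\mathbb E\sum_{t=1}^n c_t\in[0,\infty]$ be the long-run cost of the policy $u_t=Kx_t$, let $K_\star$ be a minimizer of $J$ and $J_\star=J(K_\star)$. All matrix norms $\|\cdot\|$ are spectral norms. Assume that $\|Q\|,\|R\|\le\alpha_1$, $\|Q^{-1}\|,\|R^{-1}\|\le\alpha_0^{-1}$, $\|A_\star\|,\|B_\star\|\le\vartheta$, $J_\star\le\nu$, that $K_0$ is a policy with $J(K_0)\le\nu_0$, and that $K_\star K_\star^T\succeq\mu_\star I$, where $\alpha_0,\alpha_1,\vartheta,\nu,\nu_0,\mu_\star>0$. The learner knows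 $T,Q,R,A_\star,K_0,\alpha_0,\vartheta,\nu,\nu_0,\sigma$, but neither $B_\star$ nor $\mu_\star$. For $A\in\mathbb R^{d\times d}$, $B\in\mathbb R^{d\times k}$ let $\mathcal K(A,B)=-(R+B^TPB)^{-1}B^TPA$, where $P\succ0$ is the solution of $P=Q+A^TPA-A^TPB(R+B^TPB)^{-1}B^TPA$ ($\mathcal K(A,B)=0$ if there is none). **Algorithm** with parameters $T,\tau_0,x_b,\kappa,\lambda,\mu_0$ and inputs $Q,R,K_0,A_\star$. Let $n_T=\lfloor\log_4(T/\tau_0)\rfloor$ and $\tau_i=\tau_04^i$ for $0\le i\le n_T$, $\tau_{n_T+1}=T+1$; phase $i$ consists of the times $\tau_i\le t<\tau_{i+1}$. At the start of phase $i$ let $B_{\tau_i}=\arg\min_B\sum_{s=1}^{\tau_i-1}\|(x_{s+1}-A_\star x_s)-Bu_s\|^2+\lambda\|B\|_F^2$ and $K_{\tau_i}=\mathcal K(A_\star,B_{\tau_i})$. *Warm-up:* let $n_s$ be the first $i\le n_T$ with $K_{\tau_i}K_{\tau_i}^T\succeq\frac32\mu_02^{-i}I$ ($n_s=n_T+1$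 if there is none); for $t<\tau_{n_s}$ play $u_t=K_0x_t+\eta_t$, where the $\eta_t\sim\mathcal N(0,\sigma^2I_k)$ are i.i.d. and independent of $(w_t)$. *Main loop:* for $t\ge\tau_{n_s}$ in phase $i$, if $\|x_t\|^2>x_b$ or $\|K_{\tau_i}\|>\kappa$, abort and play $u_s=K_0x_s$ for all $s\ge t$; otherwise play $u_t=K_{\tau_i}x_t$. **Theorem.** There are universal polynomials $p_C,p_\varepsilon$ in $\alpha_0^{-1},\alpha_1,\vartheta,\nu,\nu_0,d,k,\sigma,\sigma^{-1}$, and $p_T,p_R$ in these quantities and $\mu_\star^{-1}$, such that for every system as above, with $C_0=p_C$ and $\varepsilon_0=p_\varepsilon^{-1}$, one has $C_0,\varepsilon_0>0$ and the following. 1. If $0\le\varepsilon\le\varepsilon_0$, $\|A-A_\star\|\le\varepsilon$ and $\|B-B_\star\|\le\varepsilon$, then $K=\mathcal K(A,B)$ satisfies $J(K)\le J_\star+C_0\varepsilon^2$ and $\|K-K_\star\|\le C_0\varepsilon$. 2. For every $T\ge p_T$, the algorithm run with $$\kappa_0=\sqrt{\tfrac{\nu_0}{\alpha_0\sigma^2}},\quad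 \kappa=\sqrt{\tfrac{\nu+\varepsilon_0^2C_0}{\alpha_0\sigma^2}},\quad x_b=135\,d\,\kappa^2\sigma^2\max\{(1+\vartheta)^2\kappa_0^6,4\kappa^6\}\log(4T),$$ $$\lambda=\kappa^2x_b,\quad \tau_0=\Big\lceil\tfrac{80k\lambda(1+\vartheta^2)}{\sigma^2\varepsilon_0^2}\Big\rceil,\quad \mu_0=4\kappa C_0\varepsilon_0$$ has integrable regret, and $$\mathbb E\Big[\sum_{t=1}^T\big(c_t-J_\star\big)\Big]\le p_R\cdot\log^2T .$$ -/

import Mathlib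

open MeasureTheory ProbabilityTheory Filter Matrix
-- Matrices carry the spectral (Euclidean operator) norm.
open scoped Matrix.Norms.L2Operator ENNReal

noncomputable section

namespace LQR

variable {d k : ℕ}

/-! ### The controlled linear system -/

/-- A record of states and actions, indexed by the time `t ≥ 1`: the first component holds the
states, the second one the actions.  Entries that have not been observed yet are `0`. -/
abbrev History (d k : ℕ) : Type := (ℕ → Fin d → ℝ) × (ℕ → Fin k → ℝ)

/-- An online policy: the action at time `t` is computed from the record available at time `t`
and from the private noise `η_t` of the learner. -/
abbrev Policy (d k : ℕ) : Type := ℕ → History d k → (Fin k → ℝ) → (Fin k → ℝ)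

/-- Interaction of a policy with the system `x_{t+1} = A x_t + B u_t + w_t`, started at `x_1 = 0`.
The record `run … n` holds exactly `x_1, …, x_{n+1}` and `u_1, …, u_n`; all later entries are `0`,
so that a policy cannot look into the future. -/
def run (π : Policy d k) (A : Matrix (Fin d) (Fin d) ℝ) (B : Matrix (Fin d) (Fin k) ℝ)
    (w : ℕ → Fin d → ℝ) (η : ℕ → Fin k → ℝ) : ℕ → History d k
  | 0 => (fun _ => 0, fun _ => 0)
  | n + 1 =>
    let h := run π A B w η n
    let u := π (n + 1) h (η (n + 1))
    (Function.update h.1 (n + 2) (A *ᵥ h.1 (n + 1) + B *ᵥ u + w (n + 1)),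
      Function.update h.2 (n + 1) u)

/-- The state `x_t`, for `t ≥ 1`. -/
def state (π : Policy d k) (A : Matrix (Fin d) (Fin d) ℝ) (B : Matrix (Fin d) (Fin k) ℝ)
    (w : ℕ → Fin d → ℝ) (η : ℕ → Fin k → ℝ) (t : ℕ) : Fin d → ℝ :=
  (run π A B w η t).1 t

/-- The action `u_t`, for `t ≥ 1`. -/
def action (π : Policy d k) (A : Matrix (Fin d) (Fin d) ℝ) (B : Matrix (Fin d) (Fin k) ℝ)
    (w : ℕ → Fin d → ℝ) (η : ℕ → Fin k → ℝ) (t : ℕ) : Fin k → ℝ :=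
  (run π A B w η t).2 t

/-- The instantaneous cost `c_t = x_tᵀ Q x_t + u_tᵀ R u_t`. -/
def stageCost (Q : Matrix (Fin d) (Fin d) ℝ) (R : Matrix (Fin k) (Fin k) ℝ)
    (π : Policy d k) (A : Matrix (Fin d) (Fin d) ℝ) (B : Matrix (Fin d) (Fin k) ℝ)
    (w : ℕ → Fin d → ℝ) (η : ℕ → Fin k → ℝ) (t : ℕ) : ℝ :=
  state π A B w η t ⬝ᵥ (Q *ᵥ state π A B w η t)
    + action π A B w η t ⬝ᵥ (R *ᵥ action π A B w η t)

/-- The linear policy `u_t = K x_t`. -/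
def linearPolicy (K : Matrix (Fin k) (Fin d) ℝ) : Policy d k := fun t h _ => K *ᵥ h.1 t

/-- The process noise `w_t ~ N(0, σ² I_d)` and the private noise `η_t ~ N(0, σ² I_k)`, `t ∈ ℕ`, all
independent: all coordinates are independent centred real Gaussians of variance `σ²`. -/
structure IsGaussianNoise {Ω : Type*} [MeasurableSpace Ω] (Pr : Measure Ω) (σ : ℝ)
    (w : ℕ → Ω → Fin d → ℝ) (η : ℕ → Ω → Fin k → ℝ) : Prop where
  law_w : ∀ t i, HasLaw (fun ω => w t ω i) (gaussianReal 0 (Real.toNNReal (σ ^ 2))) Pr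
  law_η : ∀ t j, HasLaw (fun ω => η t ω j) (gaussianReal 0 (Real.toNNReal (σ ^ 2))) Pr
  indep : iIndepFun (Sum.elim (fun (p : ℕ × Fin d) (ω : Ω) => w p.1 ω p.2)
    (fun (p : ℕ × Fin k) (ω : Ω) => η p.1 ω p.2)) Pr

/-- The infinite horizon expected cost `J(K) = lim_n (1/n) E[∑_{t ≤ n} c_t]` of the linear policy
`K`, with values in `[0, ∞]`.  The costs are nonnegative when `Q, R ≻ 0`, and since `x_1 = 0` and
the noise is i.i.d. and centred, `E[c_t]` is nondecreasing in `t`: the limit exists in `[0, ∞]` and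
is the `limsup` below. -/
def infiniteHorizonCost {Ω : Type*} [MeasurableSpace Ω] (Pr : Measure Ω) (w : ℕ → Ω → Fin d → ℝ)
    (A : Matrix (Fin d) (Fin d) ℝ) (B : Matrix (Fin d) (Fin k) ℝ)
    (Q : Matrix (Fin d) (Fin d) ℝ) (R : Matrix (Fin k) (Fin k) ℝ)
    (K : Matrix (Fin k) (Fin d) ℝ) : ℝ≥0∞ :=
  limsup (fun n : ℕ =>
    (∫⁻ ω, ENNReal.ofReal (∑ t ∈ Finset.Icc 1 n,
      stageCost Q R (linearPolicy K) A B (fun s => w s ω) (fun _ => 0) t) ∂Pr) / (n : ℝ≥0∞)) atTop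

/-- The regret `∑_{t ≤ T} (c_t - J)` of a policy on one realization of the noise. -/
def regret (Q : Matrix (Fin d) (Fin d) ℝ) (R : Matrix (Fin k) (Fin k) ℝ) (J : ℝ)
    (π : Policy d k) (A : Matrix (Fin d) (Fin d) ℝ) (B : Matrix (Fin d) (Fin k) ℝ)
    (w : ℕ → Fin d → ℝ) (η : ℕ → Fin k → ℝ) (T : ℕ) : ℝ :=
  ∑ t ∈ Finset.Icc 1 T, (stageCost Q R π A B w η t - J)

/-! ### Certainty equivalent controller and least squares -/

/-- `P` is a positive definite solution of the discrete Riccati equation of `(A, B, Q, R)`. -/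
def IsRiccatiSolution (A : Matrix (Fin d) (Fin d) ℝ) (B : Matrix (Fin d) (Fin k) ℝ)
    (Q : Matrix (Fin d) (Fin d) ℝ) (R : Matrix (Fin k) (Fin k) ℝ)
    (P : Matrix (Fin d) (Fin d) ℝ) : Prop :=
  P.PosDef ∧ P = Q + Aᵀ * P * A - Aᵀ * P * B * (R + Bᵀ * P * B)⁻¹ * Bᵀ * P * A

open Classical in
/-- The optimal controller `-(R + Bᵀ P B)⁻¹ Bᵀ P A` of the system `(A, B)`, where `P` is the positive
definite solution of the Riccati equation, which is unique for `Q, R ≻ 0`.  If there is none (no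
linear policy stabilizes `(A, B)`), the controller is `0` by convention. -/
def optController (Q : Matrix (Fin d) (Fin d) ℝ) (R : Matrix (Fin k) (Fin k) ℝ)
    (A : Matrix (Fin d) (Fin d) ℝ) (B : Matrix (Fin d) (Fin k) ℝ) : Matrix (Fin k) (Fin d) ℝ :=
  if h : ∃ P, IsRiccatiSolution A B Q R P then
    -((R + Bᵀ * h.choose * B)⁻¹ * Bᵀ * h.choose * A)
  else 0

/-- The regularized least squares objective
`∑_{s=1}^{n-1} ‖(x_{s+1} - A x_s) - B u_s‖² + lam ‖B‖_F²`. -/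
def lsObjective (A : Matrix (Fin d) (Fin d) ℝ) (lam : ℝ) (h : History d k) (n : ℕ)
    (B : Matrix (Fin d) (Fin k) ℝ) : ℝ :=
  (∑ s ∈ Finset.Ico 1 n, ∑ i, (h.1 (s + 1) i - (A *ᵥ h.1 s) i - (B *ᵥ h.2 s) i) ^ 2)
    + lam * ∑ i, ∑ j, B i j ^ 2

open Classical in
/-- The minimizer of the regularized least squares objective (it exists and is unique when
`0 < lam`). -/
def lsEstimate (A : Matrix (Fin d) (Fin d) ℝ) (lam : ℝ) (h : History d k) (n : ℕ) :
    Matrix (Fin d) (Fin k) ℝ :=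
  if hB : ∃ B, ∀ B', lsObjective A lam h n B ≤ lsObjective A lam h n B' then hB.choose else 0

/-! ### The algorithm -/

/-- The input of the algorithm: horizon, cost matrices, the state transition matrix, an initial
controller and the numerical parameters.  Neither the matrix `B⋆` nor the constant `μ⋆` is part of
it. -/
structure AlgInput (d k : ℕ) where
  T : ℕ
  Q : Matrix (Fin d) (Fin d) ℝ
  R : Matrix (Fin k) (Fin k) ℝ
  A : Matrix (Fin d) (Fin d) ℝ
  K₀ : Matrix (Fin k) (Fin d) ℝ
  τ₀ : ℕ
  xb : ℝ
  κ : ℝ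
  lam : ℝ
  μ₀ : ℝ

namespace AlgInput

variable (I : AlgInput d k)

/-- Index of the last phase, `n_T = ⌊log₄ (T / τ₀)⌋`. -/
def nT : ℕ := ⌊Real.logb 4 ((I.T : ℝ) / (I.τ₀ : ℝ))⌋₊

/-- Phase `i ∈ {0, …, n_T}` starts at time `τ_i = τ₀ 4^i`; the last phase ends at time `T`. -/
def τ (i : ℕ) : ℕ := I.τ₀ * 4 ^ i

/-- The index of the phase that time `t ≥ τ₀` belongs to: the largest `i ≤ n_T` with `τ_i ≤ t`. -/
def phase (t : ℕ) : ℕ := Nat.findGreatest (fun i => I.τ i ≤ t) I.nT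

/-- The greedy controller `K_{τ_i}`, computed from the data that are available at time `τ_i`. -/
def greedy (h : History d k) (i : ℕ) : Matrix (Fin k) (Fin d) ℝ :=
  optController I.Q I.R I.A (lsEstimate I.A I.lam h (I.τ i))

/-- The test that ends the warm-up at the start of phase `i`: `K_{τ_i} K_{τ_i}ᵀ ⪰ (3/2) μ₀ 2^{-i} I`. -/
def breakTest (h : History d k) (i : ℕ) : Prop :=
  (I.greedy h i * (I.greedy h i)ᵀ - (3 * (I.μ₀ * (2 ^ i)⁻¹) / 2) • (1 : Matrix (Fin k) (Fin k) ℝ)).PosSemidef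

/-- Time `t` belongs to the warm-up: no phase `i` that has started by time `t` passed the test.
Thus the warm-up ends at time `τ_{n_s}`, where `n_s` is the first phase that passes the test. -/
def inWarmup (h : History d k) (t : ℕ) : Prop :=
  ∀ i ≤ I.nT, I.τ i ≤ t → ¬ I.breakTest h i

/-- The algorithm has aborted by time `t`: at some time `s ≤ t` after the warm-up,
`‖x_s‖² > x_b` or the controller of the phase of `s` has norm larger than `κ`. -/
def aborted (h : History d k) (t : ℕ) : Prop :=
  ∃ s ∈ Finset.Icc 1 t, ¬ I.inWarmup h s ∧
    (I.xb < h.1 s ⬝ᵥ h.1 s ∨ I.κ < ‖I.greedy h (I.phase s)‖)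

open Classical in
/-- The algorithm, at time `t`.  During the warm-up it plays `K₀ x_t + η_t ~ N(K₀ x_t, σ² I)`;
then it plays `K_{τ_i} x_t` in phase `i`; once it has aborted it plays `K₀ x_t` forever. -/
def policy : Policy d k := fun t h η =>
  if I.inWarmup h t then I.K₀ *ᵥ h.1 t + η
  else if I.aborted h t then I.K₀ *ᵥ h.1 t
  else I.greedy h (I.phase t) *ᵥ h.1 t

end AlgInput

/-- The parameters with which the algorithm is run, as functions of quantities that are known to the
learner. -/
def tunedInput (T : ℕ) (Q : Matrix (Fin d) (Fin d) ℝ) (R : Matrix (Fin k) (Fin k) ℝ)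
    (A : Matrix (Fin d) (Fin d) ℝ) (K₀ : Matrix (Fin k) (Fin d) ℝ)
    (α₀ ϑ ν ν₀ σ C₀ ε₀ : ℝ) : AlgInput d k :=
  let κ₀ : ℝ := √(ν₀ / (α₀ * σ ^ 2))
  let κ : ℝ := √((ν + ε₀ ^ 2 * C₀) / (α₀ * σ ^ 2))
  let xb : ℝ := 135 * d * κ ^ 2 * σ ^ 2 * max ((1 + ϑ) ^ 2 * κ₀ ^ 6) (4 * κ ^ 6) * Real.log (4 * T)
  let lam : ℝ := κ ^ 2 * xb
  { T := T
    Q := Q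
    R := R
    A := A
    K₀ := K₀
    τ₀ := ⌈80 * k * lam * (1 + ϑ ^ 2) / (σ ^ 2 * ε₀ ^ 2)⌉₊
    xb := xb
    κ := κ
    lam := lam
    μ₀ := 4 * κ * C₀ * ε₀ }

/-- The problem parameters, at which the polynomials that do not involve `μ⋆` are evaluated. -/
def params (d k : ℕ) (α₀ α₁ ϑ ν ν₀ σ : ℝ) : Fin 9 → ℝ :=
  ![α₀⁻¹, α₁, ϑ, ν, ν₀, (d : ℝ), (k : ℝ), σ, σ⁻¹]

/-- The problem parameters together with `μ⋆⁻¹`. -/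
def paramsμ (d k : ℕ) (α₀ α₁ ϑ ν ν₀ σ μ : ℝ) : Fin 10 → ℝ :=
  ![α₀⁻¹, α₁, ϑ, ν, ν₀, (d : ℝ), (k : ℝ), σ, σ⁻¹, μ⁻¹]

end LQR

end

/-! Completing the square in the Riccati equation turns regret into distance from the optimal
actions. The fresh noise adds exactly `σ² tr P = J⋆` to the expected value function in every step,
so the expected regret is at most the sum over `t ≤ T` of the expectations of `qf (R + Bᵀ P B) (u_t
- K⋆ x_t)` (`IsMeasurableNoise.integral_regret_le`). It remains to bound the accumulated `‖u_t - K⋆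
x_t‖²` by a polynomial times `log² T`.

Because `A⋆` is known, greedy play explores by itself. The process noise excites all states, so with
`u = K x` the Gram matrix of the actions of a phase of length of order `τ` is at least of order `τ K
Kᵀ`. If `K Kᵀ` is comparable to `K⋆ K⋆ᵀ ⪰ μ⋆ I`, the squared estimation error of `B⋆` is of order
`log T / (μ⋆ τ)` (`Setting.ls_error`, `Setting.controller_error`). A phase whose states have energy
of order `τ` thus costs about `log T / μ⋆`, whatever its length, and there are at most `log (4T)`
phases (`Tuned.deviation_le`).

The warm-up test provides the comparability without knowledge of `μ⋆`. Exploration up to `τ_j` makes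
`K_{τ_j}` accurate to a small multiple of `2^{-j}`. Passing the test makes `K_{τ_j}ᵀ v` large
compared with this error in every direction, so all later, equally accurate controllers agree with
`K⋆` up to a factor 2 in the sense of `compare_of_test`. Failing it forces `2^j ≤ 1/μ⋆`, so the
warm-up lasts at most about `τ₀ / μ⋆²` steps (`Tuned.exists_warmup_end`). Accuracy and stability are
proved together by induction over phases and times (`Tuned.phase_controller`, `Tuned.not_aborted`).

These statements are deterministic on the event `GoodRun`, whose complement has probability of order
`T⁻⁴` by Chernoff bounds and a union bound. Off this event the abort rule bounds the trajectory by
`x_b` and the noise energy (`Tuned.value_le`), and fourth moments make the contribution harmless.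

Sensitivity rests on one observation: a Lyapunov function of a system, slightly enlarged, is still
one after a small perturbation. Applied in both directions, this shows that the Riccati solution,
and with it the controller, is locally Lipschitz (`riccati_sensitivity`). The cost of a controller
error is quadratic, again by completing the square. That `K⋆` is the Riccati controller at all
follows by comparing the Lyapunov matrix of `K⋆` with the limit of value iteration
(`IsMeasurableNoise.exists_riccati_of_isMin`).

All parameters are dominated by `Z`, which is 1000 plus their sum, and estimates are carried out in
powers of `Y = Z⁵`, with `C₀ = Y⁷⁰` and `ε₀ = Y⁻¹⁰⁰`. Since `Y ≥ 1000`, a spare power of `Y` absorbs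
each numerical constant. -/

namespace LQR

/-! ### Euclidean norms and quadratic forms -/

/-- The Euclidean norm of a coordinate vector. -/
noncomputable def en {n : ℕ} (x : Fin n → ℝ) : ℝ := ‖WithLp.toLp 2 x‖

/-- The quadratic form `xᵀ P x`. -/
def qf {n : ℕ} (P : Matrix (Fin n) (Fin n) ℝ) (x : Fin n → ℝ) : ℝ := x ⬝ᵥ (P *ᵥ x)

section Norms

variable {m n : ℕ}

lemma en_nonneg (x : Fin n → ℝ) : 0 ≤ en x := norm_nonneg _

lemma en_sq (x : Fin n → ℝ) : en x ^ 2 = x ⬝ᵥ x := by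
  rw [en, EuclideanSpace.norm_sq_eq]
  simp [dotProduct, sq]

lemma en_sq_eq_sum (x : Fin n → ℝ) : en x ^ 2 = ∑ i, x i ^ 2 := by
  rw [en_sq]; simp [dotProduct, sq]

lemma en_zero : en (0 : Fin n → ℝ) = 0 := by simp [en]

lemma en_add_le (x y : Fin n → ℝ) : en (x + y) ≤ en x + en y := by
  rw [en, WithLp.toLp_add]; exact norm_add_le _ _

lemma en_smul (c : ℝ) (x : Fin n → ℝ) : en (c • x) = |c| * en x := by
  rw [en, WithLp.toLp_smul, norm_smul, Real.norm_eq_abs]; rfl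

lemma en_neg (x : Fin n → ℝ) : en (-x) = en x := by
  rw [en, WithLp.toLp_neg, norm_neg]; rfl

lemma en_sub_le (x y : Fin n → ℝ) : en (x - y) ≤ en x + en y := by
  rw [sub_eq_add_neg]; exact (en_add_le _ _).trans_eq (by rw [en_neg])

lemma en_sq_add_le (x y : Fin n → ℝ) : en (x + y) ^ 2 ≤ 2 * en x ^ 2 + 2 * en y ^ 2 := by
  have h := en_add_le x y
  nlinarith [en_nonneg x, en_nonneg y, en_nonneg (x + y), sq_nonneg (en x - en y)]

lemma abs_dot_le (x y : Fin n → ℝ) : |x ⬝ᵥ y| ≤ en x * en y := by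
  have h := abs_real_inner_le_norm (WithLp.toLp 2 y) (WithLp.toLp 2 x)
  have : inner ℝ (WithLp.toLp 2 y) (WithLp.toLp 2 x) = x ⬝ᵥ y := by
    rw [EuclideanSpace.inner_toLp_toLp]; simp
  rw [this, mul_comm] at h
  exact h

lemma dot_le (x y : Fin n → ℝ) : x ⬝ᵥ y ≤ en x * en y := (le_abs_self _).trans (abs_dot_le x y)

lemma sq_coord_le (x : Fin n → ℝ) (i : Fin n) : x i ^ 2 ≤ en x ^ 2 := by
  rw [en_sq_eq_sum]
  exact Finset.single_le_sum (f := fun i => x i ^ 2) (fun _ _ => sq_nonneg _) (Finset.mem_univ i)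

lemma en_mulVec (A : Matrix (Fin m) (Fin n) ℝ) (x : Fin n → ℝ) : en (A *ᵥ x) ≤ ‖A‖ * en x :=
  A.l2_opNorm_mulVec (WithLp.toLp 2 x)

lemma opNorm_le {A : Matrix (Fin m) (Fin n) ℝ} {c : ℝ} (hc : 0 ≤ c)
    (h : ∀ x, en (A *ᵥ x) ≤ c * en x) : ‖A‖ ≤ c := by
  rw [Matrix.l2_opNorm_def]
  refine ContinuousLinearMap.opNorm_le_bound _ hc fun x => ?_
  exact h (WithLp.ofLp x)

lemma norm_transpose' (A : Matrix (Fin m) (Fin n) ℝ) : ‖Aᵀ‖ = ‖A‖ := by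
  rw [← Matrix.l2_opNorm_conjTranspose A, Matrix.conjTranspose_eq_transpose_of_trivial]

lemma mulVec_dot (A : Matrix (Fin m) (Fin n) ℝ) (x : Fin n → ℝ) (y : Fin m → ℝ) :
    (A *ᵥ x) ⬝ᵥ y = x ⬝ᵥ (Aᵀ *ᵥ y) := by
  rw [Matrix.dotProduct_mulVec, Matrix.vecMul_transpose]

lemma dot_mulVec (A : Matrix (Fin m) (Fin n) ℝ) (x : Fin m → ℝ) (y : Fin n → ℝ) :
    x ⬝ᵥ (A *ᵥ y) = (Aᵀ *ᵥ x) ⬝ᵥ y := by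
  rw [mulVec_dot, Matrix.transpose_transpose]

lemma en_mulVec_sq_le (A : Matrix (Fin m) (Fin n) ℝ) (x : Fin n → ℝ) :
    en (A *ᵥ x) ^ 2 ≤ ‖A‖ ^ 2 * en x ^ 2 := by
  rw [← mul_pow]; exact pow_le_pow_left₀ (en_nonneg _) (en_mulVec A x) 2

/-- The spectral norm is at most the Frobenius norm. -/
lemma en_mulVec_sq_le_frobenius (A : Matrix (Fin m) (Fin n) ℝ) (x : Fin n → ℝ) :
    en (A *ᵥ x) ^ 2 ≤ (∑ i, en (A i) ^ 2) * en x ^ 2 := by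
  rw [en_sq_eq_sum, Finset.sum_mul]
  refine Finset.sum_le_sum fun i _ => ?_
  rw [← mul_pow, ← sq_abs]
  exact pow_le_pow_left₀ (abs_nonneg _) (abs_dot_le (A i) x) 2

lemma norm_le_of_rows {A : Matrix (Fin m) (Fin n) ℝ} {c : ℝ} (hc : 0 ≤ c)
    (h : ∑ i, en (A i) ^ 2 ≤ c ^ 2) : ‖A‖ ≤ c := by
  refine opNorm_le hc fun x => ?_
  refine le_of_sq_le_sq ?_ (mul_nonneg hc (en_nonneg x))
  rw [mul_pow]
  exact (en_mulVec_sq_le_frobenius A x).trans (by gcongr)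

lemma en_row_le (A : Matrix (Fin m) (Fin n) ℝ) (i : Fin m) : en (A i) ≤ ‖A‖ := by
  have h : Aᵀ *ᵥ (Pi.single i 1) = A i := by
    ext j; simp
  have h2 := en_mulVec Aᵀ (Pi.single i 1)
  rw [h, norm_transpose'] at h2
  have h3 : en (Pi.single i (1 : ℝ)) = 1 := by
    have : en (Pi.single i (1 : ℝ)) ^ 2 = 1 := by rw [en_sq]; simp
    nlinarith [en_nonneg (Pi.single i (1 : ℝ))]
  simpa [h3] using h2

end Norms

/-! ### Quadratic forms, the Loewner order and convergence of monotone sequences. -/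

section Forms

variable {m n : ℕ} {P P' : Matrix (Fin n) (Fin n) ℝ}

lemma qf_zero_right (P : Matrix (Fin n) (Fin n) ℝ) : qf P 0 = 0 := by simp [qf]

lemma qf_zero_left (x : Fin n → ℝ) : qf 0 x = 0 := by simp [qf]

lemma qf_add_left (P P' : Matrix (Fin n) (Fin n) ℝ) (x : Fin n → ℝ) :
    qf (P + P') x = qf P x + qf P' x := by simp [qf, Matrix.add_mulVec]

lemma qf_sub_left (P P' : Matrix (Fin n) (Fin n) ℝ) (x : Fin n → ℝ) :
    qf (P - P') x = qf P x - qf P' x := by simp [qf, Matrix.sub_mulVec]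

lemma qf_smul_left (c : ℝ) (P : Matrix (Fin n) (Fin n) ℝ) (x : Fin n → ℝ) :
    qf (c • P) x = c * qf P x := by simp [qf, Matrix.smul_mulVec]

lemma qf_smul_right (c : ℝ) (P : Matrix (Fin n) (Fin n) ℝ) (x : Fin n → ℝ) :
    qf P (c • x) = c ^ 2 * qf P x := by
  simp [qf, Matrix.mulVec_smul]; ring

lemma qf_one (x : Fin n → ℝ) : qf 1 x = en x ^ 2 := by rw [en_sq]; simp [qf]

lemma qf_conj (M : Matrix (Fin n) (Fin m) ℝ) (P : Matrix (Fin n) (Fin n) ℝ) (x : Fin m → ℝ) :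
    qf (Mᵀ * P * M) x = qf P (M *ᵥ x) := by
  rw [qf, qf, mulVec_dot, Matrix.mulVec_mulVec, Matrix.mulVec_mulVec, Matrix.mul_assoc]

lemma bilin_comm (hP : Pᵀ = P) (x y : Fin n → ℝ) : x ⬝ᵥ (P *ᵥ y) = y ⬝ᵥ (P *ᵥ x) := by
  rw [dot_mulVec, hP, dotProduct_comm]

lemma qf_add (hP : Pᵀ = P) (x y : Fin n → ℝ) :
    qf P (x + y) = qf P x + 2 * (x ⬝ᵥ (P *ᵥ y)) + qf P y := by
  simp only [qf, Matrix.mulVec_add, dotProduct_add, add_dotProduct]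
  rw [bilin_comm hP y x]; ring

lemma qf_sub (hP : Pᵀ = P) (x y : Fin n → ℝ) :
    qf P (x - y) = qf P x - 2 * (x ⬝ᵥ (P *ᵥ y)) + qf P y := by
  simp only [qf, Matrix.mulVec_sub, dotProduct_sub, sub_dotProduct]
  rw [bilin_comm hP y x]; ring

lemma posSemidef_iff_qf : P.PosSemidef ↔ Pᵀ = P ∧ ∀ x, 0 ≤ qf P x := by
  rw [Matrix.posSemidef_iff_dotProduct_mulVec]
  simp only [Matrix.IsHermitian, Matrix.conjTranspose_eq_transpose_of_trivial, star_trivial, qf]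

lemma posDef_iff_qf : P.PosDef ↔ Pᵀ = P ∧ ∀ x, x ≠ 0 → 0 < qf P x := by
  rw [Matrix.posDef_iff_dotProduct_mulVec]
  simp only [Matrix.IsHermitian, Matrix.conjTranspose_eq_transpose_of_trivial, star_trivial, qf]

lemma abs_qf_le (P : Matrix (Fin n) (Fin n) ℝ) (x : Fin n → ℝ) : |qf P x| ≤ ‖P‖ * en x ^ 2 := by
  refine (abs_dot_le _ _).trans ?_
  have := mul_le_mul_of_nonneg_left (en_mulVec P x) (en_nonneg x)
  nlinarith

lemma qf_le (P : Matrix (Fin n) (Fin n) ℝ) (x : Fin n → ℝ) : qf P x ≤ ‖P‖ * en x ^ 2 :=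
  (le_abs_self _).trans (abs_qf_le P x)

lemma en_pos {x : Fin n → ℝ} (hx : x ≠ 0) : 0 < en x := by
  refine lt_of_le_of_ne (en_nonneg x) fun h => hx ?_
  have := en_sq x
  rw [← h] at this
  exact dotProduct_self_eq_zero.1 (by simpa using this.symm)

/-- A symmetric matrix is bounded by its quadratic form. -/
lemma norm_le_of_abs_qf_le (hP : Pᵀ = P) {c : ℝ} (hc : 0 ≤ c)
    (h : ∀ x, |qf P x| ≤ c * en x ^ 2) : ‖P‖ ≤ c := by
  -- Polarization: subtracting the bounds of the form at `x + y` and `x - y` leaves four times the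
  -- bilinear term.
  have bil : ∀ x y, x ⬝ᵥ (P *ᵥ y) ≤ c / 2 * (en x ^ 2 + en y ^ 2) := by
    intro x y
    have h1 := (abs_le.1 (h (x + y))).2
    have h2 := (abs_le.1 (h (x - y))).1
    rw [qf_add hP] at h1
    rw [qf_sub hP] at h2
    have e1 : en (x + y) ^ 2 = en x ^ 2 + 2 * (x ⬝ᵥ y) + en y ^ 2 := by
      rw [← qf_one, qf_add Matrix.transpose_one, qf_one, qf_one, Matrix.one_mulVec]
    have e2 : en (x - y) ^ 2 = en x ^ 2 - 2 * (x ⬝ᵥ y) + en y ^ 2 := by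
      rw [← qf_one, qf_sub Matrix.transpose_one, qf_one, qf_one, Matrix.one_mulVec]
    rw [e1] at h1
    rw [e2] at h2
    nlinarith
  refine opNorm_le hc fun y => ?_
  by_cases h0 : P *ᵥ y = 0
  · rw [h0, en_zero]; exact mul_nonneg hc (en_nonneg y)
  by_cases hy : y = 0
  · subst hy; simp at h0
  have p1 := en_pos h0
  have p2 := en_pos hy
  -- The vector `P y` is rescaled to the length of `y`, where the arithmetic mean in `bil` loses
  -- nothing.
  have h3 := bil ((en y / en (P *ᵥ y)) • (P *ᵥ y)) y
  rw [smul_dotProduct, ← en_sq, en_smul, abs_of_pos (by positivity), smul_eq_mul] at h3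
  have e3 : en y / en (P *ᵥ y) * en (P *ᵥ y) ^ 2 = en y * en (P *ᵥ y) := by field_simp
  have e4 : en y / en (P *ᵥ y) * en (P *ᵥ y) = en y := by field_simp
  rw [e3, e4] at h3
  have : en y * en (P *ᵥ y) ≤ en y * (c * en y) := by nlinarith
  exact le_of_mul_le_mul_left this p2

lemma qf_single (P : Matrix (Fin n) (Fin n) ℝ) (i : Fin n) : qf P (Pi.single i 1) = P i i := by
  simp [qf]

lemma trace_eq_sum_qf (P : Matrix (Fin n) (Fin n) ℝ) :
    P.trace = ∑ i, qf P (Pi.single i 1) := by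
  simp [qf_single, Matrix.trace]

lemma trace_mono (h : ∀ x, qf P x ≤ qf P' x) : P.trace ≤ P'.trace := by
  rw [trace_eq_sum_qf, trace_eq_sum_qf]
  exact Finset.sum_le_sum fun i _ => h _

lemma entry_eq_qf (hP : Pᵀ = P) (i j : Fin n) :
    P i j = (qf P (Pi.single i 1 + Pi.single j 1) - P i i - P j j) / 2 := by
  rw [qf_add hP, qf_single, qf_single]
  simp
  ring

lemma eq_of_qf_eq (hP : Pᵀ = P) (hP' : P'ᵀ = P') (h : ∀ x, qf P x = qf P' x) : P = P' := by
  ext i j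
  rw [entry_eq_qf hP, entry_eq_qf hP', h, ← qf_single P, ← qf_single P, ← qf_single P',
    ← qf_single P', h, h]

-- Write `P = Sᵀ S`. Then the form is `‖S x‖²` and the trace is the squared Frobenius norm of `S`,
-- which dominates the spectral norm.
open scoped MatrixOrder in
lemma qf_le_trace (hP : P.PosSemidef) (x : Fin n → ℝ) : qf P x ≤ P.trace * en x ^ 2 := by
  obtain ⟨S, hS⟩ := CStarAlgebra.nonneg_iff_eq_star_mul_self.mp hP.nonneg
  rw [Matrix.star_eq_conjTranspose, Matrix.conjTranspose_eq_transpose_of_trivial] at hS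
  have h1 : qf P x = en (S *ᵥ x) ^ 2 := by
    have := qf_conj S 1 x
    rw [Matrix.mul_one, ← hS, qf_one] at this
    exact this
  have h2 : P.trace = ∑ i, en (S i) ^ 2 := by
    rw [hS, Matrix.trace, Finset.sum_congr rfl fun i _ => en_sq_eq_sum (S i), Finset.sum_comm]
    refine Finset.sum_congr rfl fun i _ => ?_
    simp [Matrix.mul_apply, sq]
  rw [h1, h2]
  exact en_mulVec_sq_le_frobenius S x

/-- A positive definite matrix is bounded below by the inverse norm of its inverse. -/
lemma mul_en_sq_le_qf (hP : P.PosDef) {α : ℝ} (hα : 0 < α) (h : ‖P⁻¹‖ ≤ α⁻¹) (x : Fin n → ℝ) :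
    α * en x ^ 2 ≤ qf P x := by
  have hsym := (posDef_iff_qf.1 hP).1
  have hU : IsUnit P.det := (Matrix.isUnit_iff_isUnit_det P).1 hP.isUnit
  -- Positivity at `x - α P⁻¹ x` gives `2 α ‖x‖² ≤ qf P x + α² qf P⁻¹ x`, and the last term is at
  -- most `α ‖x‖²`.
  have h0 := (posSemidef_iff_qf.1 hP.posSemidef).2 (x - α • (P⁻¹ *ᵥ x))
  have e : P *ᵥ (P⁻¹ *ᵥ x) = x := by
    rw [Matrix.mulVec_mulVec, Matrix.mul_nonsing_inv P hU, Matrix.one_mulVec]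
  rw [qf_sub hsym, qf_smul_right, Matrix.mulVec_smul, e, dotProduct_smul, ← en_sq] at h0
  have e2 : qf P (P⁻¹ *ᵥ x) = qf P⁻¹ x := by
    rw [qf, e, qf, dotProduct_comm]
  rw [e2, smul_eq_mul] at h0
  have h1 := (qf_le P⁻¹ x).trans (mul_le_mul_of_nonneg_right h (sq_nonneg (en x)))
  have h2 : α ^ 2 * qf P⁻¹ x ≤ α * en x ^ 2 := by
    calc α ^ 2 * qf P⁻¹ x ≤ α ^ 2 * (α⁻¹ * en x ^ 2) := by gcongr
      _ = α * en x ^ 2 := by field_simp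
  linarith

/-- A Loewner-monotone bounded sequence of symmetric matrices converges. -/
lemma exists_tendsto_of_monotone (X : ℕ → Matrix (Fin n) (Fin n) ℝ) (hs : ∀ i, (X i)ᵀ = X i)
    (hm : ∀ x, Monotone fun i => qf (X i) x) (hb : ∀ x, ∃ c, ∀ i, qf (X i) x ≤ c) :
    ∃ X', Tendsto X atTop (nhds X') := by
  have key : ∀ x, ∃ c, Tendsto (fun i => qf (X i) x) atTop (nhds c) := fun x => by
    obtain ⟨c, hc⟩ := hb x
    exact ⟨_, tendsto_atTop_ciSup (hm x) ⟨c, by rintro _ ⟨i, rfl⟩; exact hc i⟩⟩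
  choose c hc using key
  -- The form converges at every vector, and by polarization each matrix entry is a combination of
  -- three values of the form.
  refine ⟨Matrix.of fun i j => (c (Pi.single i 1 + Pi.single j 1) - c (Pi.single i 1)
    - c (Pi.single j 1)) / 2, ?_⟩
  refine tendsto_pi_nhds.2 fun i => tendsto_pi_nhds.2 fun j => ?_
  have : (fun a => X a i j) = fun a => (qf (X a) (Pi.single i 1 + Pi.single j 1)
      - qf (X a) (Pi.single i 1) - qf (X a) (Pi.single j 1)) / 2 := by
    ext a; rw [entry_eq_qf (hs a), qf_single, qf_single]
  rw [this]
  exact (((hc _).sub (hc _)).sub (hc _)).div_const 2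

lemma continuous_qf (x : Fin n → ℝ) :
    Continuous fun P : Matrix (Fin n) (Fin n) ℝ => qf P x := by
  unfold qf; fun_prop

lemma isClosed_posSemidef : IsClosed {P : Matrix (Fin n) (Fin n) ℝ | P.PosSemidef} := by
  have : {P : Matrix (Fin n) (Fin n) ℝ | P.PosSemidef}
      = {P | Pᵀ = P} ∩ ⋂ x, {P | 0 ≤ qf P x} := by
    ext P; simp [posSemidef_iff_qf]
  rw [this]
  refine (isClosed_eq (by fun_prop) continuous_id).inter (isClosed_iInter fun x => ?_)
  exact isClosed_le continuous_const (continuous_qf x)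

end Forms


/-! ### The Riccati equation -/

section Riccati

variable {d k : ℕ}

/-- The controller that is greedy with respect to the value matrix `P`. -/
noncomputable def ctrl (A : Matrix (Fin d) (Fin d) ℝ) (B : Matrix (Fin d) (Fin k) ℝ)
    (R : Matrix (Fin k) (Fin k) ℝ) (P : Matrix (Fin d) (Fin d) ℝ) : Matrix (Fin k) (Fin d) ℝ :=
  -((R + Bᵀ * P * B)⁻¹ * Bᵀ * P * A)

/-- The Riccati operator. -/
noncomputable def ric (A : Matrix (Fin d) (Fin d) ℝ) (B : Matrix (Fin d) (Fin k) ℝ)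
    (Q : Matrix (Fin d) (Fin d) ℝ) (R : Matrix (Fin k) (Fin k) ℝ)
    (P : Matrix (Fin d) (Fin d) ℝ) : Matrix (Fin d) (Fin d) ℝ :=
  Q + Aᵀ * P * A - Aᵀ * P * B * (R + Bᵀ * P * B)⁻¹ * Bᵀ * P * A

variable {A : Matrix (Fin d) (Fin d) ℝ} {B : Matrix (Fin d) (Fin k) ℝ}
  {Q : Matrix (Fin d) (Fin d) ℝ} {R : Matrix (Fin k) (Fin k) ℝ} {P : Matrix (Fin d) (Fin d) ℝ}

lemma posDef_gram (hR : R.PosDef) (hP : P.PosSemidef) : (R + Bᵀ * P * B).PosDef := by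
  refine hR.add_posSemidef ?_
  have := hP.conjTranspose_mul_mul_same B
  rwa [Matrix.conjTranspose_eq_transpose_of_trivial] at this

/-- The stationarity condition for minimizing `qf P (A x + B u) + qf R u` over `u`. It characterizes
the greedy controller without an inverse. -/
lemma gram_mul_ctrl (hR : R.PosDef) (hP : P.PosSemidef) :
    (R + Bᵀ * P * B) * ctrl A B R P = -(Bᵀ * P * A) := by
  have hU : IsUnit (R + Bᵀ * P * B).det :=
    (Matrix.isUnit_iff_isUnit_det _).1 (posDef_gram hR hP).isUnit
  rw [ctrl, Matrix.mul_neg]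
  congr 1
  simp only [Matrix.mul_assoc (R + Bᵀ * P * B)⁻¹]
  rw [Matrix.mul_nonsing_inv_cancel_left _ _ hU]

lemma ric_transpose (hQ : Qᵀ = Q) (hR : Rᵀ = R) (hP : Pᵀ = P) :
    (ric A B Q R P)ᵀ = ric A B Q R P := by
  simp only [ric, Matrix.transpose_add, Matrix.transpose_sub, Matrix.transpose_mul,
    Matrix.transpose_nonsing_inv, Matrix.transpose_transpose, hP, hQ, hR, Matrix.mul_assoc]

/-- Completing the square in the dynamic programming operator. -/
lemma complete_square (hR : R.PosDef) (hP : P.PosSemidef) (x : Fin d → ℝ) (u : Fin k → ℝ) :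
    qf P (A *ᵥ x + B *ᵥ u) + qf Q x + qf R u
      = qf (ric A B Q R P) x + qf (R + Bᵀ * P * B) (u - ctrl A B R P *ᵥ x) := by
  have hPs := (posSemidef_iff_qf.1 hP).1
  have hGs := (posDef_iff_qf.1 (posDef_gram (B := B) hR hP)).1
  have hG := gram_mul_ctrl (A := A) (B := B) hR hP
  have e1 : ∀ v : Fin k → ℝ, v ⬝ᵥ ((R + Bᵀ * P * B) *ᵥ (ctrl A B R P *ᵥ x))
      = -((A *ᵥ x) ⬝ᵥ (P *ᵥ (B *ᵥ v))) := by
    intro v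
    rw [Matrix.mulVec_mulVec, hG, Matrix.neg_mulVec, dotProduct_neg, bilin_comm hPs, mulVec_dot]
    simp only [Matrix.mulVec_mulVec, Matrix.mul_assoc]
  have e2 : qf (ric A B Q R P) x = qf Q x + qf P (A *ᵥ x)
      - qf (R + Bᵀ * P * B) (ctrl A B R P *ᵥ x) := by
    have e3 : Aᵀ * P * B * (R + Bᵀ * P * B)⁻¹ * Bᵀ * P * A = -(Aᵀ * P * B * ctrl A B R P) := by
      simp only [ctrl, Matrix.mul_neg, neg_neg, Matrix.mul_assoc]
    rw [ric, qf_sub_left, qf_add_left, qf_conj, e3]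
    congr 1
    rw [qf, qf, e1, Matrix.neg_mulVec, dotProduct_neg, mulVec_dot]
    simp only [Matrix.mulVec_mulVec, Matrix.mul_assoc]
  rw [qf_sub hGs, e2, e1, qf_add hPs, qf_add_left R _ u, qf_conj]
  ring

/-- Together with `qf_ric_eq` this says that the Riccati operator is a pointwise minimum over
actions of stage cost plus value. Monotonicity, comparison and uniqueness all come from this
variational form. -/
lemma qf_ric_le (hR : R.PosDef) (hP : P.PosSemidef) (x : Fin d → ℝ) (u : Fin k → ℝ) :
    qf (ric A B Q R P) x ≤ qf P (A *ᵥ x + B *ᵥ u) + qf Q x + qf R u := by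
  have := (posSemidef_iff_qf.1 (posDef_gram (B := B) hR hP).posSemidef).2 (u - ctrl A B R P *ᵥ x)
  rw [complete_square hR hP]; linarith

lemma qf_ric_eq (hR : R.PosDef) (hP : P.PosSemidef) (x : Fin d → ℝ) :
    qf (ric A B Q R P) x = qf P (A *ᵥ x + B *ᵥ (ctrl A B R P *ᵥ x)) + qf Q x
      + qf R (ctrl A B R P *ᵥ x) := by
  rw [complete_square hR hP, sub_self, qf_zero_right, add_zero]

lemma closedLoop_mulVec (K : Matrix (Fin k) (Fin d) ℝ) (x : Fin d → ℝ) :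
    (A + B * K) *ᵥ x = A *ᵥ x + B *ᵥ (K *ᵥ x) := by
  rw [Matrix.add_mulVec, Matrix.mulVec_mulVec]

lemma ric_posSemidef (hQ : Q.PosDef) (hR : R.PosDef) (hP : P.PosSemidef) :
    (ric A B Q R P).PosSemidef := by
  rw [posSemidef_iff_qf]
  refine ⟨ric_transpose (posDef_iff_qf.1 hQ).1 (posDef_iff_qf.1 hR).1 (posSemidef_iff_qf.1 hP).1,
    fun x => ?_⟩
  rw [qf_ric_eq hR hP]
  have h1 := (posSemidef_iff_qf.1 hP).2 (A *ᵥ x + B *ᵥ (ctrl A B R P *ᵥ x))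
  have h2 := (posSemidef_iff_qf.1 hQ.posSemidef).2 x
  have h3 := (posSemidef_iff_qf.1 hR.posSemidef).2 (ctrl A B R P *ᵥ x)
  linarith

/-- Evaluate the minimum for `P` at the action that is optimal for `P'`. -/
lemma qf_ric_mono {P' : Matrix (Fin d) (Fin d) ℝ} (hR : R.PosDef) (hP : P.PosSemidef)
    (hP' : P'.PosSemidef) (h : ∀ x, qf P x ≤ qf P' x) (x : Fin d → ℝ) :
    qf (ric A B Q R P) x ≤ qf (ric A B Q R P') x := by
  rw [qf_ric_eq hR hP']
  have := qf_ric_le (A := A) (B := B) (Q := Q) hR hP x (ctrl A B R P' *ᵥ x)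
  linarith [h (A *ᵥ x + B *ᵥ (ctrl A B R P' *ᵥ x))]

lemma tendsto_matrix_inv {n : ℕ} {M : Matrix (Fin n) (Fin n) ℝ} (hM : M.det ≠ 0)
    {X : ℕ → Matrix (Fin n) (Fin n) ℝ} (hX : Tendsto X atTop (nhds M)) :
    Tendsto (fun i => (X i)⁻¹) atTop (nhds M⁻¹) := by
  simp only [Matrix.inv_def, Ring.inverse_eq_inv']
  have hd : Tendsto (fun i => (X i).det) atTop (nhds M.det) :=
    ((Continuous.matrix_det continuous_id).tendsto M).comp hX
  have ha : Tendsto (fun i => (X i).adjugate) atTop (nhds M.adjugate) :=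
    ((Continuous.matrix_adjugate continuous_id).tendsto M).comp hX
  exact (hd.inv₀ hM).smul ha

lemma tendsto_ric (hR : R.PosDef) (hP : P.PosSemidef) {X : ℕ → Matrix (Fin d) (Fin d) ℝ}
    (hX : Tendsto X atTop (nhds P)) :
    Tendsto (fun i => ric A B Q R (X i)) atTop (nhds (ric A B Q R P)) := by
  have hmul : ∀ {a b c : ℕ} (F : Matrix (Fin a) (Fin b) ℝ) (F' : Matrix (Fin b) (Fin c) ℝ)
      (f : ℕ → Matrix (Fin a) (Fin b) ℝ) (g : ℕ → Matrix (Fin b) (Fin c) ℝ),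
      Tendsto f atTop (nhds F) → Tendsto g atTop (nhds F') →
      Tendsto (fun i => f i * g i) atTop (nhds (F * F')) := by
    intro a b c F F' f g hf hg
    have : Continuous fun p : Matrix (Fin a) (Fin b) ℝ × Matrix (Fin b) (Fin c) ℝ => p.1 * p.2 := by
      fun_prop
    exact (this.tendsto (F, F')).comp (hf.prodMk_nhds hg)
  have hU : (R + Bᵀ * P * B).det ≠ 0 :=
    ((Matrix.isUnit_iff_isUnit_det _).1 (posDef_gram hR hP).isUnit).ne_zero
  have hG : Tendsto (fun i => R + Bᵀ * X i * B) atTop (nhds (R + Bᵀ * P * B)) :=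
    tendsto_const_nhds.add
      (hmul _ _ _ _ (hmul _ _ _ _ tendsto_const_nhds hX) tendsto_const_nhds)
  have hI := tendsto_matrix_inv hU hG
  unfold ric
  refine (tendsto_const_nhds.add
      (hmul _ _ _ _ (hmul _ _ _ _ tendsto_const_nhds hX) tendsto_const_nhds)).sub ?_
  refine hmul _ _ _ _ (hmul _ _ _ _ (hmul _ _ _ _ (hmul _ _ _ _ (hmul _ _ _ _ (hmul _ _ _ _
    tendsto_const_nhds hX) tendsto_const_nhds) hI) tendsto_const_nhds) hX) tendsto_const_nhds

/-- Value iteration: the Riccati equation has a solution, bounded by every Lyapunov function of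
every linear controller. -/
theorem exists_riccati (hQ : Q.PosDef) (hR : R.PosDef) {X : Matrix (Fin d) (Fin d) ℝ}
    (hX : X.PosSemidef) {K : Matrix (Fin k) (Fin d) ℝ}
    (h : ∀ x, qf X ((A + B * K) *ᵥ x) + qf Q x + qf R (K *ᵥ x) ≤ qf X x) :
    ∃ P, IsRiccatiSolution A B Q R P ∧ ∀ x, qf P x ≤ qf X x := by
  -- The iteration starts at `0`, so it increases in the Loewner order. It stays below `X` because
  -- the actions of `K` are admissible in the minimum.
  set V : ℕ → Matrix (Fin d) (Fin d) ℝ := fun i => (ric A B Q R)^[i] 0 with hV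
  have hsucc : ∀ i, V (i + 1) = ric A B Q R (V i) := fun i =>
    Function.iterate_succ_apply' _ _ _
  have hpsd : ∀ i, (V i).PosSemidef := by
    intro i
    induction i with
    | zero => exact Matrix.PosSemidef.zero
    | succ i ih => rw [hsucc]; exact ric_posSemidef hQ hR ih
  have hmono : ∀ i x, qf (V i) x ≤ qf (V (i + 1)) x := by
    intro i
    induction i with
    | zero =>
      intro x
      have : V 0 = 0 := rfl
      rw [this, qf_zero_left]
      exact (posSemidef_iff_qf.1 (hpsd 1)).2 x
    | succ i ih =>
      intro x
      rw [hsucc, hsucc (i + 1)]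
      exact qf_ric_mono hR (hpsd i) (hpsd (i + 1)) ih x
  have hle : ∀ i x, qf (V i) x ≤ qf X x := by
    intro i
    induction i with
    | zero =>
      intro x
      have : V 0 = 0 := rfl
      rw [this, qf_zero_left]
      exact (posSemidef_iff_qf.1 hX).2 x
    | succ i ih =>
      intro x
      rw [hsucc]
      have h1 := qf_ric_le (A := A) (B := B) (Q := Q) hR (hpsd i) x (K *ᵥ x)
      rw [← closedLoop_mulVec] at h1
      linarith [h x, ih ((A + B * K) *ᵥ x)]
  obtain ⟨P, hP⟩ := exists_tendsto_of_monotone V (fun i => (posSemidef_iff_qf.1 (hpsd i)).1)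
    (fun x => monotone_nat_of_le_succ fun i => hmono i x) (fun x => ⟨_, fun i => hle i x⟩)
  have hPpsd : P.PosSemidef := isClosed_posSemidef.mem_of_tendsto hP (Eventually.of_forall hpsd)
  have hfix : P = ric A B Q R P := by
    have h1 := tendsto_ric (A := A) (B := B) (Q := Q) hR hPpsd hP
    have h2 := (tendsto_add_atTop_iff_nat 1).2 hP
    simp only [hsucc] at h2
    exact tendsto_nhds_unique h2 h1
  have hQP : ∀ x, qf Q x ≤ qf P x := fun x => by
    rw [hfix, qf_ric_eq hR hPpsd]
    have h1 := (posSemidef_iff_qf.1 hPpsd).2 (A *ᵥ x + B *ᵥ (ctrl A B R P *ᵥ x))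
    have h3 := (posSemidef_iff_qf.1 hR.posSemidef).2 (ctrl A B R P *ᵥ x)
    linarith
  refine ⟨P, ⟨?_, hfix⟩, fun x => ?_⟩
  · rw [posDef_iff_qf]
    refine ⟨(posSemidef_iff_qf.1 hPpsd).1, fun x hx => ?_⟩
    exact lt_of_lt_of_le ((posDef_iff_qf.1 hQ).2 x hx) (hQP x)
  · exact le_of_tendsto (((continuous_qf x).tendsto P).comp hP) (Eventually.of_forall
      fun i => hle i x)

/-- A positive definite matrix is bounded below. -/
lemma exists_pos_mul_le_qf {n : ℕ} {Q : Matrix (Fin n) (Fin n) ℝ} (hQ : Q.PosDef) :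
    ∃ a, 0 < a ∧ ∀ x, a * en x ^ 2 ≤ qf Q x := by
  have h0 : 0 < ‖Q⁻¹‖ + 1 := by positivity
  refine ⟨(‖Q⁻¹‖ + 1)⁻¹, by positivity, mul_en_sq_le_qf hQ (by positivity) ?_⟩
  rw [inv_inv]; linarith

lemma IsRiccatiSolution.qf_eq (h : IsRiccatiSolution A B Q R P) (hR : R.PosDef) (x : Fin d → ℝ) :
    qf P ((A + B * ctrl A B R P) *ᵥ x) + qf Q x + qf R (ctrl A B R P *ᵥ x) = qf P x := by
  have h1 := qf_ric_eq (A := A) (B := B) (Q := Q) hR h.1.posSemidef x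
  have h2 : ric A B Q R P = P := h.2.symm
  rw [h2] at h1
  rw [closedLoop_mulVec, h1]

lemma IsRiccatiSolution.qf_le_of (h : IsRiccatiSolution A B Q R P) (hR : R.PosDef)
    (x : Fin d → ℝ) (u : Fin k → ℝ) : qf P x ≤ qf P (A *ᵥ x + B *ᵥ u) + qf Q x + qf R u := by
  have h1 := qf_ric_le (A := A) (B := B) (Q := Q) hR h.1.posSemidef x u
  have h2 : ric A B Q R P = P := h.2.symm
  rwa [h2] at h1

/-- A form that decreases along the closed loop of a Riccati solution is nonpositive. -/
lemma nonpos_of_le_closedLoop (hQ : Q.PosDef) (hR : R.PosDef) (h : IsRiccatiSolution A B Q R P)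
    (D : Matrix (Fin d) (Fin d) ℝ)
    (hD : ∀ x, qf D x ≤ qf D ((A + B * ctrl A B R P) *ᵥ x)) (x : Fin d → ℝ) : qf D x ≤ 0 := by
  set M := A + B * ctrl A B R P
  obtain ⟨a, ha, haQ⟩ := exists_pos_mul_le_qf hQ
  -- The summand `a` keeps `p` positive even in dimension zero and gives `a / p ≤ 1`.
  set p := ‖P‖ + a with hp
  have hp0 : 0 < p := by positivity
  have hPp : ∀ x, qf P x ≤ p * en x ^ 2 := fun x =>
    (qf_le P x).trans (by rw [hp]; nlinarith [sq_nonneg (en x)])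
  have hPn : ∀ x, 0 ≤ qf P x := (posSemidef_iff_qf.1 h.1.posSemidef).2
  have haP : ∀ x, a * en x ^ 2 ≤ qf P x := fun x => by
    have := h.qf_eq hR x
    have h3 := (posSemidef_iff_qf.1 hR.posSemidef).2 (ctrl A B R P *ᵥ x)
    linarith [haQ x, hPn (M *ᵥ x)]
  set r := 1 - a / p with hr
  have hr0 : 0 ≤ r := by
    rw [hr, sub_nonneg, div_le_one hp0, hp]; linarith [norm_nonneg P]
  have hr1 : r < 1 := by
    have : 0 < a / p := by positivity
    linarith
  have hcon : ∀ x, qf P (M *ᵥ x) ≤ r * qf P x := fun x => by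
    have h1 := h.qf_eq hR x
    have h3 := (posSemidef_iff_qf.1 hR.posSemidef).2 (ctrl A B R P *ᵥ x)
    have h4 : a / p * qf P x ≤ a * en x ^ 2 := by
      calc a / p * qf P x ≤ a / p * (p * en x ^ 2) := by gcongr; exact hPp x
        _ = a * en x ^ 2 := by field_simp
    rw [hr, sub_mul, one_mul]
    linarith [haQ x]
  have hit : ∀ i, qf D x ≤ qf D ((fun y => M *ᵥ y)^[i] x) ∧
      qf P ((fun y => M *ᵥ y)^[i] x) ≤ r ^ i * qf P x := by
    intro i
    induction i with
    | zero => simp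
    | succ i ih =>
      rw [Function.iterate_succ_apply']
      refine ⟨ih.1.trans (hD _), (hcon _).trans ?_⟩
      rw [pow_succ', mul_assoc]
      exact mul_le_mul_of_nonneg_left ih.2 hr0
  have hbd : ∀ i, qf D x ≤ ‖D‖ / a * qf P x * r ^ i := fun i => by
    refine (hit i).1.trans ((qf_le D _).trans ?_)
    have h5 := (haP _).trans (hit i).2
    calc ‖D‖ * en ((fun y => M *ᵥ y)^[i] x) ^ 2
        = ‖D‖ / a * (a * en ((fun y => M *ᵥ y)^[i] x) ^ 2) := by field_simp
      _ ≤ ‖D‖ / a * (r ^ i * qf P x) := by gcongr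
      _ = _ := by ring
  have hlim : Tendsto (fun i => ‖D‖ / a * qf P x * r ^ i) atTop (nhds 0) := by
    simpa using (tendsto_pow_atTop_nhds_zero_of_lt_one hr0 hr1).const_mul (‖D‖ / a * qf P x)
  exact ge_of_tendsto' hlim hbd

/-- The greedy action of `P` is suboptimal for `P'`. Hence `P' - P` does not decrease along the
closed loop of `P`, and `nonpos_of_le_closedLoop` applies. -/
lemma IsRiccatiSolution.qf_le_qf (hQ : Q.PosDef) (hR : R.PosDef) {P' : Matrix (Fin d) (Fin d) ℝ}
    (h : IsRiccatiSolution A B Q R P) (h' : IsRiccatiSolution A B Q R P') (x : Fin d → ℝ) :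
    qf P' x ≤ qf P x := by
  have := nonpos_of_le_closedLoop hQ hR h (P' - P) (fun x => by
    rw [qf_sub_left, qf_sub_left]
    have h1 := h.qf_eq hR x
    have h2 := h'.qf_le_of hR x (ctrl A B R P *ᵥ x)
    rw [← closedLoop_mulVec] at h2
    linarith) x
  rw [qf_sub_left] at this
  linarith

theorem IsRiccatiSolution.unique (hQ : Q.PosDef) (hR : R.PosDef) {P' : Matrix (Fin d) (Fin d) ℝ}
    (h : IsRiccatiSolution A B Q R P) (h' : IsRiccatiSolution A B Q R P') : P = P' :=
  eq_of_qf_eq (posDef_iff_qf.1 h.1).1 (posDef_iff_qf.1 h'.1).1 fun x =>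
    le_antisymm (h'.qf_le_qf hQ hR h x) (h.qf_le_qf hQ hR h' x)

lemma optController_eq (hQ : Q.PosDef) (hR : R.PosDef) (h : IsRiccatiSolution A B Q R P) :
    optController Q R A B = ctrl A B R P := by
  have hex : ∃ P, IsRiccatiSolution A B Q R P := ⟨P, h⟩
  have h1 := IsRiccatiSolution.unique hQ hR hex.choose_spec h
  rw [optController, dif_pos hex, h1, ctrl]

/-! ### Sensitivity of the Riccati equation -/

/-- A Lyapunov function survives a small perturbation of the system. -/
lemma exists_riccati_of_near (hQ : Q.PosDef) (hR : R.PosDef) (hP : P.PosSemidef)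
    {K : Matrix (Fin k) (Fin d) ℝ}
    (h : ∀ x, qf P ((A + B * K) *ᵥ x) + qf Q x + qf R (K *ᵥ x) ≤ qf P x)
    {Y ε : ℝ} (hY : 1 ≤ Y) (hε : 0 ≤ ε) (hε1 : 12 * Y ^ 5 * ε ≤ 1 / 2)
    (hQY : ∀ x, Y⁻¹ * en x ^ 2 ≤ qf Q x) (hPY : ‖P‖ ≤ Y) (hA : ‖A‖ ≤ Y) (hB : ‖B‖ ≤ Y)
    (hK : ‖K‖ ≤ Y) {A' : Matrix (Fin d) (Fin d) ℝ} {B' : Matrix (Fin d) (Fin k) ℝ}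
    (hA' : ‖A' - A‖ ≤ ε) (hB' : ‖B' - B‖ ≤ ε) :
    ∃ P', IsRiccatiSolution A' B' Q R P' ∧
      ∀ x, qf P' x ≤ (1 + 24 * Y ^ 5 * ε) * qf P x := by
  have hY0 : 0 < Y := by linarith
  -- The perturbed successor state raises the value by at most `12 Y⁴ ε ‖x‖²`: twice the cross term
  -- plus the square, each bounded with `4 Y⁴ ε`. One more factor `Y` expresses this as a fraction
  -- of `Q`.
  set δ := 12 * Y ^ 5 * ε with hδ
  have hδ0 : 0 ≤ δ := by positivity
  have hPs := (posSemidef_iff_qf.1 hP).1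
  have hPn : ∀ x, 0 ≤ qf P x := (posSemidef_iff_qf.1 hP).2
  have hε' : ε ≤ 1 := by
    have : 1 ≤ Y ^ 5 := one_le_pow₀ hY
    nlinarith
  have key : ∀ x, qf P ((A' + B' * K) *ᵥ x) + (1 - δ) * (qf Q x + qf R (K *ᵥ x)) ≤ qf P x := by
    intro x
    set e := (A' - A) *ᵥ x + (B' - B) *ᵥ (K *ᵥ x) with he
    set y := (A + B * K) *ᵥ x with hy
    have hx0 := en_nonneg x
    have h1 : (A' + B' * K) *ᵥ x = y + e := by
      rw [he, hy, closedLoop_mulVec, closedLoop_mulVec, Matrix.sub_mulVec, Matrix.sub_mulVec]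
      abel
    have hKx : en (K *ᵥ x) ≤ Y * en x := (en_mulVec K x).trans (by gcongr)
    have hen : en e ≤ 2 * Y * ε * en x := by
      have t1 : en ((A' - A) *ᵥ x) ≤ ε * en x := (en_mulVec _ x).trans (by gcongr)
      have t2 : en ((B' - B) *ᵥ (K *ᵥ x)) ≤ ε * (Y * en x) :=
        (en_mulVec _ _).trans (mul_le_mul hB' hKx (en_nonneg _) hε)
      have t3 : ε * en x ≤ Y * (ε * en x) := by
        have : 0 ≤ ε * en x := by positivity
        nlinarith
      calc en e ≤ _ := en_add_le _ _
        _ ≤ ε * en x + ε * (Y * en x) := add_le_add t1 t2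
        _ ≤ 2 * Y * ε * en x := by linarith
    have hym : en y ≤ 2 * Y ^ 2 * en x := by
      have t1 : en (A *ᵥ x) ≤ Y * en x := (en_mulVec _ x).trans (by gcongr)
      have t2 : en (B *ᵥ (K *ᵥ x)) ≤ Y * (Y * en x) :=
        (en_mulVec _ _).trans (mul_le_mul hB hKx (en_nonneg _) hY0.le)
      have t3 : Y * en x ≤ Y * (Y * en x) := by
        have : 0 ≤ Y * en x := by positivity
        nlinarith
      calc en y ≤ _ := by rw [hy, closedLoop_mulVec]; exact en_add_le _ _
        _ ≤ Y * en x + Y * (Y * en x) := add_le_add t1 t2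
        _ ≤ 2 * Y ^ 2 * en x := by linarith
    have hcross : y ⬝ᵥ (P *ᵥ e) ≤ 4 * Y ^ 4 * ε * en x ^ 2 := by
      calc y ⬝ᵥ (P *ᵥ e) ≤ en y * en (P *ᵥ e) := dot_le _ _
        _ ≤ (2 * Y ^ 2 * en x) * (Y * (2 * Y * ε * en x)) := by
          refine mul_le_mul hym ?_ (en_nonneg _) (by positivity)
          exact (en_mulVec _ _).trans (mul_le_mul hPY hen (en_nonneg _) hY0.le)
        _ = _ := by ring
    have hqe : qf P e ≤ 4 * Y ^ 4 * ε * en x ^ 2 := by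
      have t1 : qf P e ≤ Y * (2 * Y * ε * en x) ^ 2 := by
        refine (qf_le P e).trans (mul_le_mul hPY ?_ (sq_nonneg _) hY0.le)
        exact pow_le_pow_left₀ (en_nonneg _) hen 2
      have t2 : Y ^ 3 * ε ^ 2 ≤ Y ^ 4 * ε := by
        have : ε ^ 2 ≤ ε := by nlinarith
        have h3 : Y ^ 3 ≤ Y ^ 4 := pow_le_pow_right₀ hY (by norm_num)
        exact mul_le_mul h3 this (sq_nonneg _) (by positivity)
      nlinarith [mul_le_mul_of_nonneg_right t2 (sq_nonneg (en x))]
    have h2 : 12 * Y ^ 4 * ε * en x ^ 2 ≤ δ * (qf Q x + qf R (K *ᵥ x)) := by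
      have t1 : en x ^ 2 ≤ Y * qf Q x := by
        have := mul_le_mul_of_nonneg_left (hQY x) hY0.le
        rwa [← mul_assoc, mul_inv_cancel₀ hY0.ne', one_mul] at this
      have t3 := (posSemidef_iff_qf.1 hR.posSemidef).2 (K *ᵥ x)
      calc 12 * Y ^ 4 * ε * en x ^ 2 ≤ 12 * Y ^ 4 * ε * (Y * qf Q x) := by gcongr
        _ = δ * qf Q x := by rw [hδ]; ring
        _ ≤ _ := by gcongr; linarith
    rw [h1, qf_add hPs]
    linarith [h x]
  have hc : 0 < 1 - δ := by linarith
  -- Dividing `key` by `1 - δ` restores the full stage cost, so `(1 - δ)⁻¹ P` is a Lyapunov function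
  -- of the perturbed system under the same controller.
  obtain ⟨P', hP', hle⟩ := exists_riccati (A := A') (B := B') hQ hR (X := (1 - δ)⁻¹ • P) (K := K)
    (hP.smul (by positivity)) (fun x => by
      rw [qf_smul_left, qf_smul_left]
      have := mul_le_mul_of_nonneg_left (key x) (inv_pos.2 hc).le
      rw [mul_add, ← mul_assoc (1 - δ)⁻¹ (1 - δ), inv_mul_cancel₀ hc.ne'] at this
      linarith)
  refine ⟨P', hP', fun x => (hle x).trans ?_⟩
  rw [qf_smul_left]
  refine mul_le_mul_of_nonneg_right ?_ (hPn x)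
  rw [inv_le_iff_one_le_mul₀ hc]
  have : 24 * Y ^ 5 * ε = 2 * δ := by rw [hδ]; ring
  rw [this]
  nlinarith

/-- The Riccati identity bounds `Kᵀ R K` by `P`. -/
lemma IsRiccatiSolution.norm_ctrl_le (h : IsRiccatiSolution A B Q R P) (hQ : Q.PosDef)
    (hR : R.PosDef) {Y p : ℝ} (hY : 0 < Y) (hp : 0 ≤ p)
    (hRY : ∀ x, Y⁻¹ * en x ^ 2 ≤ qf R x) (hP : ‖P‖ ≤ p) : ‖ctrl A B R P‖ ^ 2 ≤ Y * p := by
  have hle : ‖ctrl A B R P‖ ≤ √(Y * p) := by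
    refine opNorm_le (Real.sqrt_nonneg _) fun x => ?_
    refine le_of_sq_le_sq ?_ (mul_nonneg (Real.sqrt_nonneg _) (en_nonneg x))
    rw [mul_pow, Real.sq_sqrt (by positivity)]
    have h1 := h.qf_eq hR x
    have h2 := (posSemidef_iff_qf.1 hQ.posSemidef).2 x
    have h3 := (posSemidef_iff_qf.1 h.1.posSemidef).2 ((A + B * ctrl A B R P) *ᵥ x)
    have h4 : Y⁻¹ * en (ctrl A B R P *ᵥ x) ^ 2 ≤ p * en x ^ 2 := by
      have := (qf_le P x).trans (mul_le_mul_of_nonneg_right hP (sq_nonneg (en x)))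
      linarith [hRY (ctrl A B R P *ᵥ x)]
    have := mul_le_mul_of_nonneg_left h4 hY.le
    rwa [← mul_assoc, mul_inv_cancel₀ hY.ne', one_mul, ← mul_assoc] at this
  calc _ ≤ √(Y * p) ^ 2 := pow_le_pow_left₀ (norm_nonneg _) hle 2
    _ = _ := Real.sq_sqrt (by positivity)

lemma norm_mul3_sub_le {a b c e : ℕ} (X X' : Matrix (Fin a) (Fin b) ℝ)
    (S S' : Matrix (Fin b) (Fin c) ℝ) (T T' : Matrix (Fin c) (Fin e) ℝ) :
    ‖X' * S' * T' - X * S * T‖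
      ≤ ‖X' - X‖ * ‖S'‖ * ‖T'‖ + ‖X‖ * ‖S' - S‖ * ‖T'‖ + ‖X‖ * ‖S‖ * ‖T' - T‖ := by
  have : X' * S' * T' - X * S * T
      = (X' - X) * S' * T' + X * (S' - S) * T' + X * S * (T' - T) := by
    simp only [Matrix.sub_mul, Matrix.mul_sub, Matrix.mul_assoc]; abel
  rw [this]
  have h3 : ∀ {a b c e : ℕ} (X : Matrix (Fin a) (Fin b) ℝ)
    (S : Matrix (Fin b) (Fin c) ℝ) (T : Matrix (Fin c) (Fin e) ℝ),
      ‖X * S * T‖ ≤ ‖X‖ * ‖S‖ * ‖T‖ := fun X S T =>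
    (Matrix.l2_opNorm_mul _ _).trans (mul_le_mul_of_nonneg_right (Matrix.l2_opNorm_mul _ _)
      (norm_nonneg _))
  exact (norm_add₃_le).trans (add_le_add_three (h3 _ _ _) (h3 _ _ _) (h3 _ _ _))

/-- Local Lipschitz continuity of the optimal controller. -/
theorem riccati_sensitivity (hQ : Q.PosDef) (hR : R.PosDef) (h : IsRiccatiSolution A B Q R P)
    {Y ε : ℝ} (hY : 1000 ≤ Y) (hε : 0 ≤ ε) (hε1 : Y ^ 7 * ε ≤ 1)
    (hQY : ∀ x, Y⁻¹ * en x ^ 2 ≤ qf Q x) (hRY : ∀ x, Y⁻¹ * en x ^ 2 ≤ qf R x)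
    (hPY : ‖P‖ ≤ Y) (hA : ‖A‖ ≤ Y) (hB : ‖B‖ ≤ Y)
    {A' : Matrix (Fin d) (Fin d) ℝ} {B' : Matrix (Fin d) (Fin k) ℝ}
    (hA' : ‖A' - A‖ ≤ ε) (hB' : ‖B' - B‖ ≤ ε) :
    ∃ P', IsRiccatiSolution A' B' Q R P' ∧
      ‖optController Q R A' B' - optController Q R A B‖ ≤ Y ^ 14 * ε := by
  have hY0 : 0 < Y := by linarith
  have hY1 : 1 ≤ Y := by linarith
  have hK : ‖ctrl A B R P‖ ≤ Y := by
    have := h.norm_ctrl_le hQ hR hY0 hY0.le hRY hPY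
    nlinarith [norm_nonneg (ctrl A B R P)]
  have hYε : Y ^ 6 * ε ≤ 1 / 1000 := by
    have e : Y ^ 7 * ε = Y * (Y ^ 6 * ε) := by ring
    have : 0 ≤ Y ^ 6 * ε := by positivity
    nlinarith
  have hYε5 : Y ^ 5 * ε ≤ 1 / 1000000 := by
    have e : Y ^ 6 * ε = Y * (Y ^ 5 * ε) := by ring
    have : 0 ≤ Y ^ 5 * ε := by positivity
    nlinarith
  have hε2 : ε ≤ 1 := by
    have : 1 ≤ Y ^ 5 := one_le_pow₀ hY1
    nlinarith
  obtain ⟨P', hP', hle⟩ := exists_riccati_of_near hQ hR h.1.posSemidef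
    (fun x => (h.qf_eq hR x).le) hY1 hε (by linarith) hQY hPY hA hB hK hA' hB'
  have hPs := (posDef_iff_qf.1 h.1).1
  have hPs' := (posDef_iff_qf.1 hP'.1).1
  have hPn : ∀ x, 0 ≤ qf P x := (posSemidef_iff_qf.1 h.1.posSemidef).2
  have hPn' : ∀ x, 0 ≤ qf P' x := (posSemidef_iff_qf.1 hP'.1.posSemidef).2
  have hP'Y : ‖P'‖ ≤ 2 * Y := by
    refine norm_le_of_abs_qf_le hPs' (by positivity) fun x => ?_
    rw [abs_of_nonneg (hPn' x)]
    have h1 := (qf_le P x).trans (mul_le_mul_of_nonneg_right hPY (sq_nonneg (en x)))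
    have h2 : (1 + 24 * Y ^ 5 * ε) * qf P x ≤ 2 * qf P x :=
      mul_le_mul_of_nonneg_right (by linarith) (hPn x)
    linarith [hle x]
  have hK' : ‖ctrl A' B' R P'‖ ≤ 2 * Y := by
    have := hP'.norm_ctrl_le hQ hR hY0 (by positivity) hRY hP'Y
    nlinarith [norm_nonneg (ctrl A' B' R P')]
  have hA2 : ‖A'‖ ≤ 2 * Y := by
    have := norm_add_le (A' - A) A
    rw [sub_add_cancel] at this
    linarith
  have hB2 : ‖B'‖ ≤ 2 * Y := by
    have := norm_add_le (B' - B) B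
    rw [sub_add_cancel] at this
    linarith
  have hinv : ∀ x : Fin d → ℝ, (2 * Y)⁻¹ * en x ^ 2 ≤ qf Q x := fun x => by
    refine le_trans ?_ (hQY x)
    have : (2 * Y)⁻¹ ≤ Y⁻¹ := inv_anti₀ hY0 (by linarith)
    gcongr
  -- The perturbation argument is run backwards from the perturbed system, all of whose bounds are
  -- at most `2 Y`. Uniqueness identifies the result with `P`, so the two value matrices are bounded
  -- by each other.
  obtain ⟨P'', hP'', hle'⟩ := exists_riccati_of_near (Y := 2 * Y) hQ hR hP'.1.posSemidef
    (fun x => (hP'.qf_eq hR x).le) (by linarith) hε (by ring_nf at hYε5 ⊢; linarith) hinv hP'Y hA2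
    hB2 hK' (A' := A) (B' := B) (by rw [norm_sub_rev]; exact hA') (by rw [norm_sub_rev]; exact hB')
  obtain rfl := IsRiccatiSolution.unique hQ hR hP'' h
  have hdiff : ‖P' - P''‖ ≤ Y ^ 8 * ε := by
    refine norm_le_of_abs_qf_le (by rw [Matrix.transpose_sub, hPs, hPs']) (by positivity)
      fun x => ?_
    have h1 : qf P'' x ≤ 2 * Y * en x ^ 2 :=
      (qf_le P'' x).trans (mul_le_mul_of_nonneg_right (by linarith) (sq_nonneg (en x)))
    have h2 : qf P' x ≤ 2 * Y * en x ^ 2 :=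
      (qf_le P' x).trans (mul_le_mul_of_nonneg_right hP'Y (sq_nonneg (en x)))
    have hY2 : 1536 * Y ^ 6 * ε * en x ^ 2 ≤ Y ^ 8 * ε * en x ^ 2 := by
      have : 1536 * Y ^ 6 ≤ Y ^ 8 := by
        have : Y ^ 8 = Y ^ 2 * Y ^ 6 := by ring
        rw [this]
        have h3 : 1536 ≤ Y ^ 2 := by nlinarith
        gcongr
      gcongr
    have h3 : 24 * Y ^ 5 * ε * qf P'' x ≤ 24 * Y ^ 5 * ε * (2 * Y * en x ^ 2) := by gcongr
    have h4 : 24 * (2 * Y) ^ 5 * ε * qf P' x ≤ 24 * (2 * Y) ^ 5 * ε * (2 * Y * en x ^ 2) := by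
      gcongr
    have h5 : 0 ≤ Y ^ 6 * ε * en x ^ 2 := by positivity
    rw [qf_sub_left, abs_le]
    constructor
    · nlinarith [hle' x]
    · nlinarith [hle x]
  rw [optController_eq hQ hR hP', optController_eq hQ hR h]
  refine ⟨P', hP', ?_⟩
  set K := ctrl A B R P''
  set K' := ctrl A' B' R P'
  have hBT : ‖B'ᵀ - Bᵀ‖ ≤ ε := by rw [← Matrix.transpose_sub, norm_transpose']; exact hB'
  have hYe : 0 ≤ ε := hε
  have hpow : ∀ i : ℕ, i ≤ 9 → Y ^ i * ε ≤ Y ^ 9 * ε * Y := fun i hi => by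
    have : Y ^ i ≤ Y ^ 9 := pow_le_pow_right₀ hY1 hi
    have h0 : 0 ≤ Y ^ 9 * ε := by positivity
    nlinarith
  have hfac : ∀ {a : ℕ} (T T' : Matrix (Fin d) (Fin a) ℝ), ‖T‖ ≤ Y → ‖T'‖ ≤ 2 * Y →
      ‖T' - T‖ ≤ ε → ‖B'ᵀ * P' * T' - Bᵀ * P'' * T‖ ≤ Y ^ 11 * ε := by
    intro a T T' hT hT' hTT
    refine (norm_mul3_sub_le _ _ _ _ _ _).trans ?_
    rw [norm_transpose']
    have t1 : ‖B'ᵀ - Bᵀ‖ * ‖P'‖ * ‖T'‖ ≤ ε * (2 * Y) * (2 * Y) := by gcongr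
    have t2 : ‖B‖ * ‖P' - P''‖ * ‖T'‖ ≤ Y * (Y ^ 8 * ε) * (2 * Y) := by gcongr
    have t3 : ‖B‖ * ‖P''‖ * ‖T' - T‖ ≤ Y * Y * ε := by gcongr
    have p2 := hpow 2 (by norm_num)
    have h0 : 0 ≤ Y ^ 10 * ε := by positivity
    nlinarith
  -- The difference of the normal equations of the two controllers: only differences of `Bᵀ P A` and
  -- `Bᵀ P B` appear on the right.
  have hG : (R + Bᵀ * P'' * B) * (K' - K)
      = -(B'ᵀ * P' * A' - Bᵀ * P'' * A) - (B'ᵀ * P' * B' - Bᵀ * P'' * B) * K' := by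
    have e1 := gram_mul_ctrl (A := A) (B := B) hR h.1.posSemidef
    have e2 := gram_mul_ctrl (A := A') (B := B') hR hP'.1.posSemidef
    have : (R + Bᵀ * P'' * B) * (K' - K) = (R + B'ᵀ * P' * B') * K'
        - (B'ᵀ * P' * B' - Bᵀ * P'' * B) * K' - (R + Bᵀ * P'' * B) * K := by
      simp only [Matrix.mul_sub, Matrix.sub_mul, Matrix.add_mul]; abel
    rw [this, e1, e2]; abel
  have hGn : ‖(R + Bᵀ * P'' * B) * (K' - K)‖ ≤ Y ^ 13 * ε := by
    rw [hG]
    refine (norm_sub_le _ _).trans ?_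
    rw [norm_neg]
    have t1 := hfac A A' hA hA2 hA'
    have t2 := (Matrix.l2_opNorm_mul (B'ᵀ * P' * B' - Bᵀ * P'' * B) K').trans
      (mul_le_mul (hfac B B' hB hB2 hB') hK' (norm_nonneg _) (by positivity))
    have h0 : 0 ≤ Y ^ 11 * ε := by positivity
    have e : Y ^ 13 * ε = Y ^ 11 * ε * Y ^ 2 := by ring
    rw [e]
    have : 1 + 2 * Y ≤ Y ^ 2 := by nlinarith
    nlinarith
  refine opNorm_le (by positivity) fun x => ?_
  set y := (K' - K) *ᵥ x
  have h6 : en ((R + Bᵀ * P'' * B) *ᵥ y) ≤ Y ^ 13 * ε * en x := by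
    rw [Matrix.mulVec_mulVec]
    exact (en_mulVec _ x).trans (mul_le_mul_of_nonneg_right hGn (en_nonneg x))
  -- Removing the Gram matrix uses only its coercivity `R ⪰ Y⁻¹` and costs the last factor `Y`.
  have h7 : Y⁻¹ * en y ^ 2 ≤ en y * en ((R + Bᵀ * P'' * B) *ᵥ y) := by
    refine le_trans ?_ (dot_le _ _)
    have : qf (R + Bᵀ * P'' * B) y = qf R y + qf P'' (B *ᵥ y) := by rw [qf_add_left, qf_conj]
    change _ ≤ qf (R + Bᵀ * P'' * B) y
    rw [this]
    linarith [hRY y, hPn (B *ᵥ y)]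
  have h8 : Y⁻¹ * en y ≤ en ((R + Bᵀ * P'' * B) *ᵥ y) := by
    rcases (en_nonneg y).eq_or_lt with h9 | h9
    · rw [← h9, mul_zero]; exact en_nonneg _
    · refine le_of_mul_le_mul_left ?_ h9
      calc en y * (Y⁻¹ * en y) = Y⁻¹ * en y ^ 2 := by ring
        _ ≤ _ := h7
  have h9 := mul_le_mul_of_nonneg_left (h8.trans h6) hY0.le
  rw [← mul_assoc, mul_inv_cancel₀ hY0.ne', one_mul] at h9
  calc en y ≤ _ := h9
    _ = _ := by ring

/-- A controller near the optimal one is nearly optimal: the loss is quadratic. -/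
lemma IsRiccatiSolution.near_optimal (h : IsRiccatiSolution A B Q R P) (hQ : Q.PosDef)
    (hR : R.PosDef) {Y e : ℝ} (hY : 2 ≤ Y) (hRY : ‖R‖ ≤ Y) (hPY : ‖P‖ ≤ Y) (hB : ‖B‖ ≤ Y)
    {K : Matrix (Fin k) (Fin d) ℝ} (hK : ‖K - optController Q R A B‖ ≤ e) (x : Fin d → ℝ) :
    qf P ((A + B * K) *ᵥ x) + qf Q x + qf R (K *ᵥ x) ≤ qf P x + Y ^ 4 * e ^ 2 * en x ^ 2 := by
  rw [optController_eq hQ hR h] at hK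
  have h1 := complete_square (A := A) (B := B) (Q := Q) hR h.1.posSemidef x (K *ᵥ x)
  have h2 : ric A B Q R P = P := h.2.symm
  rw [h2, ← closedLoop_mulVec, ← Matrix.sub_mulVec] at h1
  rw [h1]
  gcongr
  have hn : ‖R + Bᵀ * P * B‖ ≤ Y ^ 4 := by
    have t1 : ‖Bᵀ * P * B‖ ≤ Y * Y * Y := by
      refine (Matrix.l2_opNorm_mul _ _).trans (mul_le_mul ?_ hB (norm_nonneg _) (by positivity))
      refine (Matrix.l2_opNorm_mul _ _).trans (mul_le_mul ?_ hPY (norm_nonneg _) (by positivity))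
      rwa [norm_transpose']
    refine (norm_add_le _ _).trans ?_
    have : Y + Y * Y * Y ≤ Y ^ 4 := by
      have h3 : 2 * Y ^ 3 ≤ Y ^ 4 := by nlinarith [pow_pos (by linarith : (0 : ℝ) < Y) 3]
      nlinarith [pow_pos (by linarith : (0 : ℝ) < Y) 2]
    linarith
  have he : 0 ≤ e := (norm_nonneg _).trans hK
  refine (qf_le _ _).trans ?_
  rw [mul_assoc]
  refine mul_le_mul hn ?_ (sq_nonneg _) (by positivity)
  refine (en_mulVec_sq_le _ _).trans ?_
  gcongr

end Riccati


/-! ### Trajectories -/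

section Trajectory

variable {d k : ℕ} (π : Policy d k) (A : Matrix (Fin d) (Fin d) ℝ) (B : Matrix (Fin d) (Fin k) ℝ)
  (w : ℕ → Fin d → ℝ) (η : ℕ → Fin k → ℝ)

lemma run_succ_fst (n : ℕ) : (run π A B w η (n + 1)).1 = Function.update (run π A B w η n).1 (n + 2)
    (A *ᵥ (run π A B w η n).1 (n + 1)
      + B *ᵥ (π (n + 1) (run π A B w η n) (η (n + 1))) + w (n + 1)) := rfl

lemma run_succ_snd (n : ℕ) : (run π A B w η (n + 1)).2 = Function.update (run π A B w η n).2 (n + 1)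
    (π (n + 1) (run π A B w η n) (η (n + 1))) := rfl

lemma run_fst_stable (s j : ℕ) :
    (run π A B w η (s + j)).1 (s + 1) = (run π A B w η s).1 (s + 1) := by
  induction j with
  | zero => rfl
  | succ j ih =>
    rw [← Nat.add_assoc, run_succ_fst, Function.update_of_ne (by omega), ih]

lemma run_snd_stable (s j : ℕ) :
    (run π A B w η (s + j)).2 s = (run π A B w η s).2 s := by
  induction j with
  | zero => rfl
  | succ j ih =>
    rw [← Nat.add_assoc, run_succ_snd, Function.update_of_ne (by omega), ih]

lemma run_fst_zero (n : ℕ) : (run π A B w η n).1 0 = 0 := by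
  induction n with
  | zero => rfl
  | succ n ih => rw [run_succ_fst, Function.update_of_ne (by omega), ih]

/-- Updates write only at later times, so any sufficiently long record can be read as the trajectory
itself. Index `0` is never written and stays zero. -/
lemma run_fst_eq_state {n s : ℕ} (h : s ≤ n + 1) : (run π A B w η n).1 s = state π A B w η s := by
  rcases s with _ | s
  · rw [run_fst_zero, state, run_fst_zero]
  · obtain ⟨j, rfl⟩ : ∃ j, n = s + j := ⟨n - s, by omega⟩
    rw [run_fst_stable, state, run_fst_stable]

lemma run_snd_eq_action {n s : ℕ} (h : s ≤ n) :
    (run π A B w η n).2 s = action π A B w η s := by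
  obtain ⟨j, rfl⟩ : ∃ j, n = s + j := ⟨n - s, by omega⟩
  rw [run_snd_stable, action]

lemma state_one : state π A B w η 1 = 0 := by
  rw [← run_fst_eq_state π A B w η (n := 0) le_rfl]; rfl

lemma action_succ (n : ℕ) :
    action π A B w η (n + 1) = π (n + 1) (run π A B w η n) (η (n + 1)) := by
  rw [action, run_succ_snd, Function.update_self]

lemma state_succ {t : ℕ} (ht : 1 ≤ t) : state π A B w η (t + 1)
    = A *ᵥ state π A B w η t + B *ᵥ action π A B w η t + w t := by
  obtain ⟨n, rfl⟩ : ∃ n, t = n + 1 := ⟨t - 1, by omega⟩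
  rw [← run_fst_eq_state π A B w η (n := n + 1) le_rfl, run_succ_fst, Function.update_self,
    ← action_succ π A B w η n, run_fst_eq_state π A B w η le_rfl]

lemma action_linearPolicy (K : Matrix (Fin k) (Fin d) ℝ) {t : ℕ} (ht : 1 ≤ t) :
    action (linearPolicy K) A B w η t = K *ᵥ state (linearPolicy K) A B w η t := by
  obtain ⟨n, rfl⟩ : ∃ n, t = n + 1 := ⟨t - 1, by omega⟩
  rw [action_succ, linearPolicy, run_fst_eq_state _ A B w η le_rfl]

/-- A policy is measurable if all its decisions are measurable functions of the data. -/
def MeasurablePolicy : Prop :=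
  ∀ t, Measurable fun p : History d k × (Fin k → ℝ) => π t p.1 p.2

variable {π} {Ω : Type*} {m : MeasurableSpace Ω}

lemma measurable_mulVec {p q : ℕ} (M : Matrix (Fin p) (Fin q) ℝ) :
    Measurable fun x : Fin q → ℝ => M *ᵥ x :=
  (by fun_prop : Continuous fun x : Fin q → ℝ => M *ᵥ x).measurable

/-- The σ-algebra on `Ω` is arbitrary and only noise up to time `n` enters. Taken with a σ-algebra
generated by part of the noise, this expresses adaptedness. -/
lemma measurable_run (hπ : MeasurablePolicy π) {w : ℕ → Ω → Fin d → ℝ} {η : ℕ → Ω → Fin k → ℝ}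
    (n : ℕ) (hw : ∀ s ≤ n, Measurable (w s)) (hη : ∀ s ≤ n, Measurable (η s)) :
    Measurable fun ω => run π A B (fun s => w s ω) (fun s => η s ω) n := by
  induction n with
  | zero => exact measurable_const
  | succ n ih =>
    have ih' := ih (fun s hs => hw s (by omega)) (fun s hs => hη s (by omega))
    have hu : Measurable fun ω => π (n + 1) (run π A B (fun s => w s ω) (fun s => η s ω) n)
        (η (n + 1) ω) := (hπ (n + 1)).comp (ih'.prodMk (hη (n + 1) le_rfl))
    have hx : ∀ s, Measurable fun ω => (run π A B (fun s => w s ω) (fun s => η s ω) n).1 s :=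
      fun s => (measurable_pi_apply s).comp (measurable_fst.comp ih')
    have hu' : ∀ s, Measurable fun ω => (run π A B (fun s => w s ω) (fun s => η s ω) n).2 s :=
      fun s => (measurable_pi_apply s).comp (measurable_snd.comp ih')
    refine Measurable.prodMk (measurable_pi_iff.2 fun s => ?_) (measurable_pi_iff.2 fun s => ?_)
    · by_cases h : s = n + 2
      · subst h
        simp only [Function.update_self]
        exact (((measurable_mulVec A).comp (hx _)).add ((measurable_mulVec B).comp hu)).add
          (hw (n + 1) le_rfl)
      · simp only [Function.update_of_ne h]; exact hx s
    · by_cases h : s = n + 1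
      · subst h
        simp only [Function.update_self]; exact hu
      · simp only [Function.update_of_ne h]; exact hu' s

lemma measurable_state (hπ : MeasurablePolicy π) {w : ℕ → Ω → Fin d → ℝ} {η : ℕ → Ω → Fin k → ℝ}
    (t : ℕ) (hw : ∀ s < t, Measurable (w s)) (hη : ∀ s < t, Measurable (η s)) :
    Measurable fun ω => state π A B (fun s => w s ω) (fun s => η s ω) t := by
  rcases t with _ | t
  · simp only [state, run_fst_zero]; exact measurable_const
  · simp only [← run_fst_eq_state π A B _ _ (le_refl (t + 1))]
    exact (measurable_pi_apply _).comp (measurable_fst.comp (measurable_run A B hπ t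
      (fun s hs => hw s (by omega)) (fun s hs => hη s (by omega))))

/-- In contrast to the state, the action may use the private noise of its own time, hence `s ≤ t`
for `η` but `s < t` for `w`. -/
lemma measurable_action (hπ : MeasurablePolicy π) {w : ℕ → Ω → Fin d → ℝ} {η : ℕ → Ω → Fin k → ℝ}
    (t : ℕ) (hw : ∀ s < t, Measurable (w s)) (hη : ∀ s ≤ t, Measurable (η s)) :
    Measurable fun ω => action π A B (fun s => w s ω) (fun s => η s ω) t := by
  rcases t with _ | t
  · simp only [action, run]; exact measurable_const
  · simp only [action_succ]
    exact (hπ (t + 1)).comp ((measurable_run A B hπ t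
      (fun s hs => hw s (by omega)) (fun s hs => hη s (by omega))).prodMk (hη (t + 1) le_rfl))

lemma measurablePolicy_linearPolicy (K : Matrix (Fin k) (Fin d) ℝ) :
    MeasurablePolicy (linearPolicy K) := fun t =>
  (measurable_mulVec K).comp ((measurable_pi_apply t).comp (measurable_fst.comp measurable_fst))

end Trajectory

/-! ### Independence of the noise from the past -/

section Noise

variable {d k : ℕ} {Ω : Type*} [mΩ : MeasurableSpace Ω] {Pr : Measure Ω}
  {σ : ℝ} {w : ℕ → Ω → Fin d → ℝ} {η : ℕ → Ω → Fin k → ℝ}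

/-- The index type of all the scalar noise variables. -/
abbrev NoiseIndex (d k : ℕ) : Type := (ℕ × Fin d) ⊕ (ℕ × Fin k)

/-- The time at which a noise variable is drawn. -/
def NoiseIndex.time : NoiseIndex d k → ℕ := Sum.elim Prod.fst Prod.fst

/-- The family of all the scalar noise variables. -/
def noise (w : ℕ → Ω → Fin d → ℝ) (η : ℕ → Ω → Fin k → ℝ) : NoiseIndex d k → Ω → ℝ :=
  Sum.elim (fun p ω => w p.1 ω p.2) (fun p ω => η p.1 ω p.2)

/-- The σ-algebra generated by the noise variables with index in `S`. -/
@[reducible] def noiseSigma (w : ℕ → Ω → Fin d → ℝ) (η : ℕ → Ω → Fin k → ℝ) (S : Set (NoiseIndex d k)) :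
    MeasurableSpace Ω := ⨆ i ∈ S, MeasurableSpace.comap (noise w η i) inferInstance

/-- Gaussian noise all of whose coordinates are measurable functions. -/
structure IsMeasurableNoise (Pr : Measure Ω) (σ : ℝ) (w : ℕ → Ω → Fin d → ℝ)
    (η : ℕ → Ω → Fin k → ℝ) : Prop extends IsGaussianNoise Pr σ w η where
  meas : ∀ e, Measurable (noise w η e)

lemma measurable_noise_of_mem {S : Set (NoiseIndex d k)} {e : NoiseIndex d k} (he : e ∈ S) :
    Measurable[noiseSigma w η S] (noise w η e) := by
  rw [measurable_iff_comap_le]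
  exact le_iSup₂ (f := fun i (_ : i ∈ S) => MeasurableSpace.comap (noise w η i) inferInstance) e he

lemma noiseSigma_mono {S S' : Set (NoiseIndex d k)} (h : S ⊆ S') :
    noiseSigma w η S ≤ noiseSigma w η S' :=
  iSup₂_le fun i hi => le_iSup₂ (f := fun i (_ : i ∈ S') =>
    MeasurableSpace.comap (noise w η i) inferInstance) i (h hi)

lemma measurable_w_of_subset {S : Set (NoiseIndex d k)} {t : ℕ}
    (h : ∀ i, Sum.inl (t, i) ∈ S) : Measurable[noiseSigma w η S] (w t) := by
  let _ := noiseSigma w η S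
  exact measurable_pi_iff.2 fun i => measurable_noise_of_mem (w := w) (η := η) (h i)

lemma measurable_η_of_subset {S : Set (NoiseIndex d k)} {t : ℕ}
    (h : ∀ i, Sum.inr (t, i) ∈ S) : Measurable[noiseSigma w η S] (η t) := by
  let _ := noiseSigma w η S
  exact measurable_pi_iff.2 fun i => measurable_noise_of_mem (w := w) (η := η) (h i)

namespace IsMeasurableNoise

variable (hN : IsMeasurableNoise Pr σ w η)
include hN

lemma sigma_le (S : Set (NoiseIndex d k)) : noiseSigma w η S ≤ mΩ :=
  iSup₂_le fun i _ => (measurable_iff_comap_le.1 (hN.meas i))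

lemma measurable_w (t : ℕ) : Measurable (w t) :=
  measurable_pi_iff.2 fun i => hN.meas (Sum.inl (t, i))

lemma measurable_η (t : ℕ) : Measurable (η t) :=
  measurable_pi_iff.2 fun i => hN.meas (Sum.inr (t, i))

lemma hasLaw (e : NoiseIndex d k) :
    HasLaw (noise w η e) (gaussianReal 0 (Real.toNNReal (σ ^ 2))) Pr := by
  rcases e with ⟨t, i⟩ | ⟨t, i⟩
  · exact hN.law_w t i
  · exact hN.law_η t i

/-- Disjoint subfamilies of an independent family generate independent σ-algebras. -/
lemma indepFun {β : Type*} [MeasurableSpace β] {S : Set (NoiseIndex d k)} {e : NoiseIndex d k}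
    (he : e ∉ S) {Y : Ω → β} (hY : Measurable[noiseSigma w η S] Y) :
    IndepFun Y (noise w η e) Pr := by
  have h := indep_iSup_of_disjoint (fun i => measurable_iff_comap_le.1 (hN.meas i))
    ((iIndepFun_iff_iIndep _ _ Pr).1 hN.indep) (Set.disjoint_singleton_right.2 he)
  rw [IndepFun_iff_Indep]
  refine indep_of_indep_of_le_left (indep_of_indep_of_le_right h ?_) ?_
  · exact le_iSup₂ (f := fun i (_ : i ∈ ({e} : Set (NoiseIndex d k))) =>
      MeasurableSpace.comap (noise w η i) inferInstance) e rfl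
  · exact measurable_iff_comap_le.1 hY

variable [IsProbabilityMeasure Pr]

/-- Integrating out a noise variable that is independent of the past. -/
lemma lintegral_eq {β : Type*} [MeasurableSpace β] {S : Set (NoiseIndex d k)} {e : NoiseIndex d k}
    (he : e ∉ S) {Y : Ω → β} (hY : Measurable[noiseSigma w η S] Y) {f : β × ℝ → ℝ≥0∞}
    (hf : Measurable f) :
    ∫⁻ ω, f (Y ω, noise w η e ω) ∂Pr
      = ∫⁻ ω, ∫⁻ x, f (Y ω, x) ∂(gaussianReal 0 (Real.toNNReal (σ ^ 2))) ∂Pr := by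
  have hY' : Measurable Y := hY.mono (hN.sigma_le S) le_rfl
  have h := (indepFun_iff_map_prod_eq_prod_map_map hY'.aemeasurable
    (hN.meas e).aemeasurable).1 (hN.indepFun he hY)
  rw [(hN.hasLaw e).map_eq] at h
  have h1 : ∫⁻ ω, f (Y ω, noise w η e ω) ∂Pr
      = ∫⁻ p, f p ∂(Pr.map fun ω => (Y ω, noise w η e ω)) :=
    (lintegral_map hf (hY'.prodMk (hN.meas e))).symm
  rw [h1, h, lintegral_prod _ hf.aemeasurable, lintegral_map hf.lintegral_prod_right' hY']

lemma memLp (e : NoiseIndex d k) : MemLp (noise w η e) 2 Pr :=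
  ((hN.hasLaw e).map_eq ▸ memLp_id_gaussianReal' 2 (by simp) :
    MemLp id 2 (Pr.map (noise w η e))).comp_of_map (hN.meas e).aemeasurable

lemma integral_eq_zero (e : NoiseIndex d k) : ∫ ω, noise w η e ω ∂Pr = 0 := by
  rw [(hN.hasLaw e).integral_eq, integral_id_gaussianReal]

lemma integral_sq (e : NoiseIndex d k) : ∫ ω, noise w η e ω ^ 2 ∂Pr = σ ^ 2 := by
  have h1 := (hN.hasLaw e).variance_eq
  rw [variance_of_integral_eq_zero (hN.meas e).aemeasurable (hN.integral_eq_zero e)] at h1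
  rw [h1, variance_id_gaussianReal, Real.coe_toNNReal _ (sq_nonneg σ)]

lemma integral_mul_eq_zero {S : Set (NoiseIndex d k)} {e : NoiseIndex d k} (he : e ∉ S)
    {Y : Ω → ℝ} (hY : Measurable[noiseSigma w η S] Y) : ∫ ω, Y ω * noise w η e ω ∂Pr = 0 := by
  have hY' : Measurable Y := hY.mono (hN.sigma_le S) le_rfl
  have := (hN.indepFun he hY).integral_fun_mul_eq_mul_integral hY'.aestronglyMeasurable
    (hN.meas e).aestronglyMeasurable
  rw [this, hN.integral_eq_zero, mul_zero]

omit hN in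
lemma integrable_qf {n : ℕ} {y : Ω → Fin n → ℝ} (hy : ∀ a, MemLp (fun ω => y ω a) 2 Pr)
    (P : Matrix (Fin n) (Fin n) ℝ) : Integrable (fun ω => qf P (y ω)) Pr := by
  simp only [qf, dotProduct, Matrix.mulVec, Finset.mul_sum]
  refine integrable_finsetSum _ fun a _ => integrable_finsetSum _ fun b _ => ?_
  have := ((hy a).integrable_mul (hy b)).const_mul (P a b)
  refine this.congr (Eventually.of_forall fun ω => ?_)
  simp only [Pi.mul_apply]; ring

omit hN in
lemma memLp_mulVec {n m : ℕ} {y : Ω → Fin n → ℝ} (hy : ∀ a, MemLp (fun ω => y ω a) 2 Pr)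
    (M : Matrix (Fin m) (Fin n) ℝ) (a : Fin m) : MemLp (fun ω => (M *ᵥ y ω) a) 2 Pr := by
  simp only [Matrix.mulVec, dotProduct]
  exact memLp_finsetSum _ fun b _ => (hy b).const_mul (M a b)

lemma integral_qf_w (t : ℕ) (P : Matrix (Fin d) (Fin d) ℝ) :
    ∫ ω, qf P (w t ω) ∂Pr = σ ^ 2 * P.trace := by
  have hL : ∀ a, MemLp (fun ω => w t ω a) 2 Pr := fun a => hN.memLp (Sum.inl (t, a))
  simp only [qf, dotProduct, Matrix.mulVec, Finset.mul_sum]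
  rw [integral_finsetSum _ fun a _ => integrable_finsetSum _ fun b _ =>
    (((hL a).integrable_mul (hL b)).const_mul (P a b)).congr
      (Eventually.of_forall fun ω => by simp only [Pi.mul_apply]; ring), Matrix.trace,
    Finset.mul_sum]
  refine Finset.sum_congr rfl fun a _ => ?_
  rw [integral_finsetSum _ fun b _ =>
    (((hL a).integrable_mul (hL b)).const_mul (P a b)).congr
      (Eventually.of_forall fun ω => by simp only [Pi.mul_apply]; ring)]
  rw [Finset.sum_eq_single a]
  · have : ∀ ω, w t ω a * (P a a * w t ω a) = P a a * noise w η (Sum.inl (t, a)) ω ^ 2 := by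
      intro ω; simp only [noise, Sum.elim_inl]; ring
    simp only [this]
    rw [integral_const_mul, hN.integral_sq, Matrix.diag_apply]; ring
  · intro b _ hb
    have : ∀ ω, w t ω a * (P a b * w t ω b)
        = P a b * (noise w η (Sum.inl (t, b)) ω * noise w η (Sum.inl (t, a)) ω) := by
      intro ω; simp only [noise, Sum.elim_inl]; ring
    simp only [this]
    rw [integral_const_mul, hN.integral_mul_eq_zero (S := {Sum.inl (t, b)}) (by simpa using hb.symm)
      (measurable_noise_of_mem rfl), mul_zero]
  · simp

/-- The expected quadratic form of a sum of a past variable and fresh noise. -/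
lemma integral_qf_add_w {S : Set (NoiseIndex d k)} {t : ℕ} (hS : ∀ i, Sum.inl (t, i) ∉ S)
    {y : Ω → Fin d → ℝ} (hy : ∀ a, MemLp (fun ω => y ω a) 2 Pr)
    (hym : Measurable[noiseSigma w η S] y) {P : Matrix (Fin d) (Fin d) ℝ} (hP : Pᵀ = P) :
    ∫ ω, qf P (y ω + w t ω) ∂Pr = ∫ ω, qf P (y ω) ∂Pr + σ ^ 2 * P.trace := by
  have hL : ∀ a, MemLp (fun ω => w t ω a) 2 Pr := fun a => hN.memLp (Sum.inl (t, a))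
  have hi : ∀ a, Integrable (fun ω => (P *ᵥ y ω) a * w t ω a) Pr := fun a =>
    (memLp_mulVec hy P a).integrable_mul (hL a)
  have hc : Integrable (fun ω => w t ω ⬝ᵥ (P *ᵥ y ω)) Pr := by
    simp only [dotProduct]
    exact integrable_finsetSum _ fun a _ => (hi a).congr
      (Eventually.of_forall fun ω => mul_comm _ _)
  have h0 : ∫ ω, w t ω ⬝ᵥ (P *ᵥ y ω) ∂Pr = 0 := by
    simp only [dotProduct]
    rw [integral_finsetSum _ fun a _ => (hi a).congr
      (Eventually.of_forall fun ω => mul_comm _ _)]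
    refine Finset.sum_eq_zero fun a _ => ?_
    have hm : Measurable[noiseSigma w η S] fun ω => (P *ᵥ y ω) a :=
      (measurable_pi_apply a).comp ((measurable_mulVec P).comp hym)
    have := hN.integral_mul_eq_zero (hS a) hm
    rw [← this]
    exact integral_congr_ae (Eventually.of_forall fun ω => mul_comm _ _)
  have hexp : ∀ ω, qf P (y ω + w t ω)
      = qf P (y ω) + 2 * (w t ω ⬝ᵥ (P *ᵥ y ω)) + qf P (w t ω) := by
    intro ω; rw [qf_add hP, bilin_comm hP]
  have hi1 : Integrable (fun ω => qf P (y ω) + 2 * (w t ω ⬝ᵥ (P *ᵥ y ω))) Pr :=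
    (integrable_qf hy P).add (hc.const_mul 2)
  simp only [hexp]
  rw [integral_add hi1 (integrable_qf hL P),
    integral_add (integrable_qf hy P) (hc.const_mul 2), integral_const_mul, h0, hN.integral_qf_w]
  ring

end IsMeasurableNoise

end Noise


/-! ### The long-run cost of a linear policy -/

section LinearPolicy

variable {d k : ℕ} {Ω : Type*} [mΩ : MeasurableSpace Ω] {Pr : Measure Ω} [IsProbabilityMeasure Pr]
  {σ : ℝ} {w : ℕ → Ω → Fin d → ℝ} {η : ℕ → Ω → Fin k → ℝ}
  {A : Matrix (Fin d) (Fin d) ℝ} {B : Matrix (Fin d) (Fin k) ℝ}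
  {Q : Matrix (Fin d) (Fin d) ℝ} {R : Matrix (Fin k) (Fin k) ℝ} {K : Matrix (Fin k) (Fin d) ℝ}

/-- The state process of a linear policy. -/
noncomputable def linState (K : Matrix (Fin k) (Fin d) ℝ) (A : Matrix (Fin d) (Fin d) ℝ)
    (B : Matrix (Fin d) (Fin k) ℝ) (w : ℕ → Ω → Fin d → ℝ) (t : ℕ) (ω : Ω) : Fin d → ℝ :=
  state (linearPolicy K) A B (fun s => w s ω) (fun _ => 0) t

omit mΩ in
lemma linState_succ {t : ℕ} (ht : 1 ≤ t) (ω : Ω) :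
    linState K A B w (t + 1) ω = (A + B * K) *ᵥ linState K A B w t ω + w t ω := by
  rw [linState, state_succ _ _ _ _ _ ht, action_linearPolicy _ _ _ _ _ ht, closedLoop_mulVec]; rfl

omit mΩ in
lemma linState_one (ω : Ω) : linState K A B w 1 ω = 0 := state_one _ _ _ _ _

omit mΩ in
lemma stageCost_linear {t : ℕ} (ht : 1 ≤ t) (ω : Ω) :
    stageCost Q R (linearPolicy K) A B (fun s => w s ω) (fun _ => 0) t
      = qf (Q + Kᵀ * R * K) (linState K A B w t ω) := by
  rw [stageCost, action_linearPolicy _ _ _ _ _ ht, qf_add_left, qf_conj]; rfl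

omit mΩ in
lemma measurable_linState (S : Set (NoiseIndex d k)) (t : ℕ)
    (hS : ∀ s < t, ∀ i, Sum.inl (s, i) ∈ S) :
    Measurable[noiseSigma w η S] (linState K A B w t) := by
  let _ := noiseSigma w η S
  exact measurable_state (m := noiseSigma w η S) A B (measurablePolicy_linearPolicy K) t
    (fun s hs => measurable_w_of_subset (hS s hs)) (η := fun _ _ => 0)
    (fun s hs => measurable_const)

namespace IsMeasurableNoise

variable (hN : IsMeasurableNoise Pr σ w η)
include hN

lemma memLp_linState {t : ℕ} (ht : 1 ≤ t) (a : Fin d) :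
    MemLp (fun ω => linState K A B w t ω a) 2 Pr := by
  induction t, ht using Nat.le_induction generalizing a with
  | base => simp only [linState_one]; exact MemLp.zero
  | succ t ht ih =>
    simp only [linState_succ ht, Pi.add_apply]
    exact (memLp_mulVec ih _ a).add (hN.memLp (Sum.inl (t, a)))

lemma integral_qf_linState_succ {X : Matrix (Fin d) (Fin d) ℝ} (hX : Xᵀ = X) {t : ℕ} (ht : 1 ≤ t) :
    ∫ ω, qf X (linState K A B w (t + 1) ω) ∂Pr
      = ∫ ω, qf ((A + B * K)ᵀ * X * (A + B * K)) (linState K A B w t ω) ∂Pr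
        + σ ^ 2 * X.trace := by
  simp only [linState_succ ht, qf_conj]
  refine hN.integral_qf_add_w (S := {e | NoiseIndex.time e < t}) (t := t) (fun i => ?_)
    (memLp_mulVec (fun a => hN.memLp_linState ht a) _) ?_ hX
  · simp [NoiseIndex.time]
  · exact (measurable_mulVec _).comp (measurable_linState _ t fun s hs i => by
      simpa [NoiseIndex.time] using hs)

lemma integrable_stageCost {t : ℕ} (ht : 1 ≤ t) : Integrable (fun ω =>
    stageCost Q R (linearPolicy K) A B (fun s => w s ω) (fun _ => 0) t) Pr := by
  simp only [stageCost_linear ht]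
  exact integrable_qf (fun a => hN.memLp_linState ht a) _

lemma integrable_sum_stageCost (n : ℕ) : Integrable (fun ω => ∑ t ∈ Finset.Icc 1 n,
    stageCost Q R (linearPolicy K) A B (fun s => w s ω) (fun _ => 0) t) Pr :=
  integrable_finsetSum _ fun _ ht => hN.integrable_stageCost (Finset.mem_Icc.1 ht).1

lemma integral_sum_succ (n : ℕ) : ∫ ω, ∑ t ∈ Finset.Icc 1 (n + 1),
      stageCost Q R (linearPolicy K) A B (fun s => w s ω) (fun _ => 0) t ∂Pr
    = ∫ ω, ∑ t ∈ Finset.Icc 1 n,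
      stageCost Q R (linearPolicy K) A B (fun s => w s ω) (fun _ => 0) t ∂Pr
      + ∫ ω, qf (Q + Kᵀ * R * K) (linState K A B w (n + 1) ω) ∂Pr := by
  simp only [Finset.sum_Icc_succ_top (Nat.le_add_left 1 n)]
  rw [integral_add (hN.integrable_sum_stageCost n) (hN.integrable_stageCost (by omega))]
  simp only [stageCost_linear (Nat.le_add_left 1 n)]

/-- The expected value of `X` along the trajectory telescopes: each step pays for its stage cost,
and the fresh noise puts back `σ² tr X`. -/
lemma integral_sum_le {X : Matrix (Fin d) (Fin d) ℝ} (hX : X.PosSemidef)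
    (h : ∀ x, qf X ((A + B * K) *ᵥ x) + qf Q x + qf R (K *ᵥ x) ≤ qf X x) (n : ℕ) :
    ∫ ω, ∑ t ∈ Finset.Icc 1 n,
      stageCost Q R (linearPolicy K) A B (fun s => w s ω) (fun _ => 0) t ∂Pr
      + ∫ ω, qf X (linState K A B w (n + 1) ω) ∂Pr ≤ n * (σ ^ 2 * X.trace) := by
  induction n with
  | zero => simp [linState_one, qf_zero_right]
  | succ n ih =>
    rw [hN.integral_sum_succ, hN.integral_qf_linState_succ (posSemidef_iff_qf.1 hX).1 (by omega)]
    have hL : ∀ a, MemLp (fun ω => linState K A B w (n + 1) ω a) 2 Pr := fun a =>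
      hN.memLp_linState (by omega) a
    have h1 : ∫ ω, qf (Q + Kᵀ * R * K) (linState K A B w (n + 1) ω) ∂Pr
        + ∫ ω, qf ((A + B * K)ᵀ * X * (A + B * K)) (linState K A B w (n + 1) ω) ∂Pr
        ≤ ∫ ω, qf X (linState K A B w (n + 1) ω) ∂Pr := by
      rw [← integral_add (integrable_qf hL _) (integrable_qf hL _)]
      refine integral_mono ((integrable_qf hL _).add (integrable_qf hL _)) (integrable_qf hL _)
        fun ω => ?_
      simp only [qf_add_left, qf_conj]
      linarith [h (linState K A B w (n + 1) ω)]
    push_cast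
    linarith

lemma lintegral_sum_eq (hQ : Q.PosDef) (hR : R.PosDef) (n : ℕ) :
    ∫⁻ ω, ENNReal.ofReal (∑ t ∈ Finset.Icc 1 n,
      stageCost Q R (linearPolicy K) A B (fun s => w s ω) (fun _ => 0) t) ∂Pr
    = ENNReal.ofReal (∫ ω, ∑ t ∈ Finset.Icc 1 n,
      stageCost Q R (linearPolicy K) A B (fun s => w s ω) (fun _ => 0) t ∂Pr) := by
  rw [ofReal_integral_eq_lintegral_ofReal (hN.integrable_sum_stageCost n)]
  refine Eventually.of_forall fun ω => Finset.sum_nonneg fun t ht => ?_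
  rw [stageCost_linear (Finset.mem_Icc.1 ht).1, qf_add_left, qf_conj]
  exact add_nonneg ((posSemidef_iff_qf.1 hQ.posSemidef).2 _)
    ((posSemidef_iff_qf.1 hR.posSemidef).2 _)

lemma infiniteHorizonCost_eq (hQ : Q.PosDef) (hR : R.PosDef) :
    infiniteHorizonCost Pr w A B Q R K = limsup (fun n : ℕ => ENNReal.ofReal
      ((∫ ω, ∑ t ∈ Finset.Icc 1 n,
      stageCost Q R (linearPolicy K) A B (fun s => w s ω) (fun _ => 0) t ∂Pr) / n)) atTop := by
  rw [infiniteHorizonCost]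
  refine limsup_congr ?_
  filter_upwards [eventually_ge_atTop 1] with n hn
  rw [hN.lintegral_sum_eq hQ hR, ENNReal.ofReal_div_of_pos (by positivity), ENNReal.ofReal_natCast]

/-- A Lyapunov function bounds the long-run cost. -/
theorem infiniteHorizonCost_le (hQ : Q.PosDef) (hR : R.PosDef) {X : Matrix (Fin d) (Fin d) ℝ}
    (hX : X.PosSemidef)
    (h : ∀ x, qf X ((A + B * K) *ᵥ x) + qf Q x + qf R (K *ᵥ x) ≤ qf X x) :
    infiniteHorizonCost Pr w A B Q R K ≤ ENNReal.ofReal (σ ^ 2 * X.trace) := by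
  rw [hN.infiniteHorizonCost_eq hQ hR]
  refine limsup_le_of_le (by isBoundedDefault) ?_
  filter_upwards [eventually_ge_atTop 1] with n hn
  refine ENNReal.ofReal_le_ofReal ?_
  have hn' : (0 : ℝ) < n := by positivity
  rw [div_le_iff₀ hn', mul_comm]
  have h1 := hN.integral_sum_le hX h n
  have h2 : 0 ≤ ∫ ω, qf X (linState K A B w (n + 1) ω) ∂Pr :=
    integral_nonneg fun ω => (posSemidef_iff_qf.1 hX).2 _
  linarith

/-- A linear policy of finite cost has a Lyapunov function whose trace is the cost. -/
theorem exists_lyapunov (hσ : 0 < σ) (hQ : Q.PosDef) (hR : R.PosDef)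
    (hJ : infiniteHorizonCost Pr w A B Q R K ≠ ∞) :
    ∃ X : Matrix (Fin d) (Fin d) ℝ, X.PosSemidef ∧
      (∀ x, qf X ((A + B * K) *ᵥ x) + qf Q x + qf R (K *ᵥ x) = qf X x) ∧
      ENNReal.ofReal (σ ^ 2 * X.trace) ≤ infiniteHorizonCost Pr w A B Q R K := by
  -- `F` is the Lyapunov operator of `K`, so `V i` is the cost-to-go of `K` over `i` noiseless
  -- steps.
  set F : Matrix (Fin d) (Fin d) ℝ → Matrix (Fin d) (Fin d) ℝ := fun X =>
    (Q + Kᵀ * R * K) + (A + B * K)ᵀ * X * (A + B * K) with hF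
  have hFq : ∀ X x, qf (F X) x = qf X ((A + B * K) *ᵥ x) + qf Q x + qf R (K *ᵥ x) := by
    intro X x
    simp only [hF, qf_add_left, qf_conj]; ring
  have hFs : ∀ X, Xᵀ = X → (F X)ᵀ = F X := by
    intro X hX
    simp only [hF, Matrix.transpose_add, Matrix.transpose_mul, Matrix.transpose_transpose, hX,
      (posDef_iff_qf.1 hQ).1, (posDef_iff_qf.1 hR).1, Matrix.mul_assoc]
  set V : ℕ → Matrix (Fin d) (Fin d) ℝ := fun i => F^[i] 0 with hV
  have hsucc : ∀ i, V (i + 1) = F (V i) := fun i => Function.iterate_succ_apply' _ _ _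
  have hpsd : ∀ i, (V i).PosSemidef := by
    intro i
    induction i with
    | zero => exact Matrix.PosSemidef.zero
    | succ i ih =>
      rw [hsucc, posSemidef_iff_qf]
      refine ⟨hFs _ (posSemidef_iff_qf.1 ih).1, fun x => ?_⟩
      rw [hFq]
      have h1 := (posSemidef_iff_qf.1 ih).2 ((A + B * K) *ᵥ x)
      have h2 := (posSemidef_iff_qf.1 hQ.posSemidef).2 x
      have h3 := (posSemidef_iff_qf.1 hR.posSemidef).2 (K *ᵥ x)
      linarith
  have hmono : ∀ i x, qf (V i) x ≤ qf (V (i + 1)) x := by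
    intro i
    induction i with
    | zero =>
      intro x
      have : V 0 = 0 := rfl
      rw [this, qf_zero_left]
      exact (posSemidef_iff_qf.1 (hpsd 1)).2 x
    | succ i ih =>
      intro x
      rw [hsucc, hsucc (i + 1), hFq, hFq]
      linarith [ih ((A + B * K) *ᵥ x)]
  have hmono' : ∀ x, Monotone fun i => qf (V i) x := fun x =>
    monotone_nat_of_le_succ fun i => hmono i x
  -- Noise injected with `j` steps to go, counted with the terminal value `V m`, costs `σ² tr (V
  -- j)`. The index `m` is kept general because the induction on `n` raises it.
  have hcost : ∀ n m : ℕ, ∫ ω, ∑ t ∈ Finset.Icc 1 n,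
      stageCost Q R (linearPolicy K) A B (fun s => w s ω) (fun _ => 0) t ∂Pr
      + ∫ ω, qf (V m) (linState K A B w (n + 1) ω) ∂Pr
      = ∑ j ∈ Finset.Ico m (m + n), σ ^ 2 * (V j).trace := by
    intro n
    induction n with
    | zero => simp [linState_one, qf_zero_right]
    | succ n ih =>
      intro m
      rw [hN.integral_sum_succ,
        hN.integral_qf_linState_succ (posSemidef_iff_qf.1 (hpsd m)).1 (by omega)]
      have hL : ∀ a, MemLp (fun ω => linState K A B w (n + 1) ω a) 2 Pr := fun a =>
        hN.memLp_linState (by omega) a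
      have h1 : ∫ ω, qf (V (m + 1)) (linState K A B w (n + 1) ω) ∂Pr =
          ∫ ω, qf (Q + Kᵀ * R * K) (linState K A B w (n + 1) ω) ∂Pr
          + ∫ ω, qf ((A + B * K)ᵀ * V m * (A + B * K)) (linState K A B w (n + 1) ω) ∂Pr := by
        rw [← integral_add (integrable_qf hL _) (integrable_qf hL _), hsucc]
        simp only [hF, qf_add_left _ ((A + B * K)ᵀ * V m * (A + B * K))]
      have h2 := ih (m + 1)
      rw [Finset.sum_eq_sum_Ico_succ_bot (by omega)]
      rw [show m + 1 + n = m + (n + 1) by omega] at h2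
      linarith
  have htr0 : ∀ j, 0 ≤ (V j).trace := fun j => by
    rw [trace_eq_sum_qf]; exact Finset.sum_nonneg fun i _ => (posSemidef_iff_qf.1 (hpsd j)).2 _
  -- A Cesàro argument: the traces increase, so at most `m` of the first `n` are smaller than that
  -- of `V m`, a fraction that vanishes as `n` grows.
  have htr : ∀ m, ENNReal.ofReal (σ ^ 2 * (V m).trace) ≤ infiniteHorizonCost Pr w A B Q R K := by
    intro m
    rw [hN.infiniteHorizonCost_eq hQ hR]
    have hlim : Tendsto (fun n : ℕ => ENNReal.ofReal
        ((1 - (m : ℝ) / n) * (σ ^ 2 * (V m).trace))) atTop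
        (nhds (ENNReal.ofReal (σ ^ 2 * (V m).trace))) := by
      refine (ENNReal.continuous_ofReal.tendsto _).comp ?_
      have := ((tendsto_const_div_atTop_nhds_zero_nat (m : ℝ)).const_sub 1).mul_const
        (σ ^ 2 * (V m).trace)
      simpa using this
    rw [← hlim.limsup_eq]
    refine limsup_le_limsup ?_ (by isBoundedDefault) (by isBoundedDefault)
    filter_upwards [eventually_ge_atTop (m + 1)] with n hn
    refine ENNReal.ofReal_le_ofReal ?_
    have hn' : (0 : ℝ) < n := by
      have : 0 < n := by omega
      exact_mod_cast this
    have h0 := hcost n 0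
    have hz : ∫ ω, qf (V 0) (linState K A B w (n + 1) ω) ∂Pr = 0 := by
      have : V 0 = 0 := rfl
      simp [this, qf_zero_left]
    rw [hz, add_zero, zero_add] at h0
    rw [h0, le_div_iff₀ hn']
    have h1 : (n - m : ℝ) * (σ ^ 2 * (V m).trace)
        ≤ ∑ j ∈ Finset.Ico m n, σ ^ 2 * (V j).trace := by
      have := Finset.card_nsmul_le_sum (Finset.Ico m n) (fun j => σ ^ 2 * (V j).trace)
        (σ ^ 2 * (V m).trace) (fun j hj => by
          have := trace_mono (fun x => hmono' x (Finset.mem_Ico.1 hj).1)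
          gcongr)
      rw [nsmul_eq_mul, Nat.card_Ico, Nat.cast_sub (by omega)] at this
      exact this
    have h2 : ∑ j ∈ Finset.Ico m n, σ ^ 2 * (V j).trace
        ≤ ∑ j ∈ Finset.Ico 0 n, σ ^ 2 * (V j).trace :=
      Finset.sum_le_sum_of_subset_of_nonneg (Finset.Ico_subset_Ico_left (by omega))
        (fun j _ _ => mul_nonneg (sq_nonneg σ) (htr0 j))
    calc (1 - (m : ℝ) / n) * (σ ^ 2 * (V m).trace) * n
        = (n - m : ℝ) * (σ ^ 2 * (V m).trace) := by field_simp
      _ ≤ _ := h1.trans h2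
  set c := (infiniteHorizonCost Pr w A B Q R K).toReal with hc
  have htr' : ∀ m, (V m).trace ≤ c / σ ^ 2 := by
    intro m
    rw [le_div_iff₀ (by positivity), mul_comm]
    rw [← ENNReal.ofReal_le_iff_le_toReal hJ]
    exact htr m
  obtain ⟨X, hX⟩ := exists_tendsto_of_monotone V (fun i => (posSemidef_iff_qf.1 (hpsd i)).1)
    hmono' (fun x => ⟨c / σ ^ 2 * en x ^ 2, fun i => (qf_le_trace (hpsd i) x).trans
      (mul_le_mul_of_nonneg_right (htr' i) (sq_nonneg _))⟩)
  have hXpsd : X.PosSemidef := isClosed_posSemidef.mem_of_tendsto hX (Eventually.of_forall hpsd)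
  refine ⟨X, hXpsd, fun x => ?_, ?_⟩
  · have h1 : Tendsto (fun i => qf (V (i + 1)) x) atTop (nhds (qf X x)) :=
      ((continuous_qf x).tendsto X).comp ((tendsto_add_atTop_iff_nat 1).2 hX)
    simp only [hsucc, hFq] at h1
    have h2 : Tendsto (fun i => qf (V i) ((A + B * K) *ᵥ x) + qf Q x + qf R (K *ᵥ x)) atTop
        (nhds (qf X ((A + B * K) *ᵥ x) + qf Q x + qf R (K *ᵥ x))) :=
      ((((continuous_qf _).tendsto X).comp hX).add_const _).add_const _
    exact tendsto_nhds_unique h2 h1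
  · have h1 : Tendsto (fun i => ENNReal.ofReal (σ ^ 2 * (V i).trace)) atTop
        (nhds (ENNReal.ofReal (σ ^ 2 * X.trace))) := by
      refine (ENNReal.continuous_ofReal.tendsto _).comp (Tendsto.const_mul _ ?_)
      have : Continuous fun X : Matrix (Fin d) (Fin d) ℝ => X.trace := by fun_prop
      exact (this.tendsto X).comp hX
    exact le_of_tendsto' h1 htr

/-- The minimizer of the long-run cost is the Riccati controller. -/
theorem exists_riccati_of_isMin (hσ : 0 < σ) (hQ : Q.PosDef) (hR : R.PosDef)
    (hJ : infiniteHorizonCost Pr w A B Q R K ≠ ∞)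
    (hmin : ∀ K', infiniteHorizonCost Pr w A B Q R K ≤ infiniteHorizonCost Pr w A B Q R K') :
    ∃ P, IsRiccatiSolution A B Q R P ∧ optController Q R A B = K ∧
      infiniteHorizonCost Pr w A B Q R K = ENNReal.ofReal (σ ^ 2 * P.trace) := by
  obtain ⟨X, hX, hXeq, hXJ⟩ := hN.exists_lyapunov hσ hQ hR hJ
  obtain ⟨P, hP, hPX⟩ := exists_riccati hQ hR hX (fun x => (hXeq x).le)
  have h1 := hN.infiniteHorizonCost_le hQ hR hP.1.posSemidef (fun x => (hP.qf_eq hR x).le)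
  -- Minimality gives `σ² tr X ≤ J(K) ≤ σ² tr P`, while `P ≤ X` in the Loewner order. A positive
  -- semidefinite matrix without positive trace vanishes, so `X = P`.
  have h2 := hXJ.trans ((hmin _).trans h1)
  have htrP : 0 ≤ P.trace := by
    rw [trace_eq_sum_qf]
    exact Finset.sum_nonneg fun i _ => (posSemidef_iff_qf.1 hP.1.posSemidef).2 _
  have htr : X.trace ≤ P.trace := by
    rw [ENNReal.ofReal_le_ofReal_iff (by positivity)] at h2
    exact le_of_mul_le_mul_left h2 (by positivity)
  have hsP := (posDef_iff_qf.1 hP.1).1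
  have hsX := (posSemidef_iff_qf.1 hX).1
  have hD : (X - P).PosSemidef := by
    rw [posSemidef_iff_qf]
    refine ⟨by rw [Matrix.transpose_sub, hsX, hsP], fun x => ?_⟩
    rw [qf_sub_left]; linarith [hPX x]
  have hXP : X = P := by
    refine eq_of_qf_eq hsX hsP fun x => le_antisymm ?_ (hPX x)
    have := qf_le_trace hD x
    rw [qf_sub_left, Matrix.trace_sub] at this
    nlinarith [sq_nonneg (en x)]
  subst hXP
  refine ⟨X, hP, ?_, le_antisymm ((hmin _).trans h1) hXJ⟩
  rw [optController_eq hQ hR hP]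
  -- `K` attains equality in the Bellman minimum, so the completed square, a positive definite form
  -- of `(K - ctrl) x`, is zero.
  have hz : ∀ x, (K - ctrl A B R X) *ᵥ x = 0 := by
    intro x
    have h3 := complete_square (A := A) (B := B) (Q := Q) hR hX x (K *ᵥ x)
    have h4 : ric A B Q R X = X := hP.2.symm
    rw [h4, ← closedLoop_mulVec, ← Matrix.sub_mulVec, hXeq] at h3
    by_contra hne
    have := (posDef_iff_qf.1 (posDef_gram (B := B) hR hX)).2 _ hne
    linarith
  have : K - ctrl A B R X = 0 := by
    ext i j
    have := congrFun (hz (Pi.single j 1)) i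
    simpa using this
  exact (sub_eq_zero.1 this).symm

end IsMeasurableNoise

end LinearPolicy


/-! ### Gaussian integrals -/

section GaussianIntegrals

variable {σ : ℝ}

lemma lintegral_exp_linear_gaussian (c : ℝ) :
    ∫⁻ x, ENNReal.ofReal (Real.exp (c * x - c ^ 2 * σ ^ 2 / 2))
      ∂(gaussianReal 0 (Real.toNNReal (σ ^ 2))) ≤ 1 := by
  have h1 : ∀ x, Real.exp (c * x - c ^ 2 * σ ^ 2 / 2)
      = Real.exp (-(c ^ 2 * σ ^ 2 / 2)) * Real.exp (c * x) := fun x => by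
    rw [← Real.exp_add]; ring_nf
  have hi := integrable_exp_mul_gaussianReal (μ := 0) (v := Real.toNNReal (σ ^ 2)) c
  have hm : ∫ x, Real.exp (c * x) ∂(gaussianReal 0 (Real.toNNReal (σ ^ 2)))
      = Real.exp (c ^ 2 * σ ^ 2 / 2) := by
    have := congrFun (mgf_id_gaussianReal (μ := 0) (v := Real.toNNReal (σ ^ 2))) c
    rw [mgf] at this
    simp only [id_eq] at this
    rw [this, Real.coe_toNNReal _ (sq_nonneg σ)]
    ring_nf
  simp only [h1]
  rw [← ofReal_integral_eq_lintegral_ofReal (hi.const_mul _)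
    (Eventually.of_forall fun x => by positivity), integral_const_mul, hm, ← Real.exp_add]
  simp

/-- Multiplying the density by this exponential gives an unnormalized Gaussian whose precision is
multiplied by `1 - 2a`. -/
lemma lintegral_exp_sq_gaussian (hσ : 0 < σ) {a : ℝ} (ha : 0 < 1 - 2 * a) :
    ∫⁻ x, ENNReal.ofReal (Real.exp (a * x ^ 2 / σ ^ 2))
      ∂(gaussianReal 0 (Real.toNNReal (σ ^ 2))) = ENNReal.ofReal (√(1 - 2 * a))⁻¹ := by
  have hv : Real.toNNReal (σ ^ 2) ≠ 0 := by
    rw [Ne, Real.toNNReal_eq_zero, not_le]; positivity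
  rw [gaussianReal_of_var_ne_zero _ hv,
    lintegral_withDensity_eq_lintegral_mul _ (measurable_gaussianPDF _ _) (by fun_prop)]
  set b := (1 - 2 * a) / (2 * σ ^ 2) with hb
  have hb0 : 0 < b := by positivity
  have h1 : ∀ x, (gaussianPDF 0 (Real.toNNReal (σ ^ 2)) * fun x =>
      ENNReal.ofReal (Real.exp (a * x ^ 2 / σ ^ 2))) x
      = ENNReal.ofReal ((√(2 * Real.pi * σ ^ 2))⁻¹ * Real.exp (-b * x ^ 2)) := fun x => by
    rw [Pi.mul_apply, gaussianPDF, gaussianPDFReal, ← ENNReal.ofReal_mul (by positivity),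
      Real.coe_toNNReal _ (sq_nonneg σ), mul_assoc, ← Real.exp_add]
    congr 3
    rw [hb]; field_simp; ring
  simp only [h1]
  rw [← ofReal_integral_eq_lintegral_ofReal ((integrable_exp_neg_mul_sq hb0).const_mul _)
    (Eventually.of_forall fun x => by positivity), integral_const_mul, integral_gaussian]
  congr 1
  rw [← Real.sqrt_inv, ← Real.sqrt_mul (by positivity), ← Real.sqrt_inv]
  congr 1
  rw [hb]; field_simp

/-- The case `a = 1/4`, where the integral is `√2 < e`. The shift by one normalizes it, as the
product argument in `lintegral_prod_le_one` requires. -/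
lemma lintegral_exp_sq_sub_one_le (hσ : 0 < σ) :
    ∫⁻ x, ENNReal.ofReal (Real.exp (x ^ 2 / (4 * σ ^ 2) - 1))
      ∂(gaussianReal 0 (Real.toNNReal (σ ^ 2))) ≤ 1 := by
  have h := lintegral_exp_sq_gaussian hσ (a := 1 / 4) (by norm_num)
  have h1 : ∀ x, ENNReal.ofReal (Real.exp (x ^ 2 / (4 * σ ^ 2) - 1))
      = ENNReal.ofReal (Real.exp (-1)) * ENNReal.ofReal (Real.exp (1 / 4 * x ^ 2 / σ ^ 2)) := by
    intro x
    rw [← ENNReal.ofReal_mul (by positivity), ← Real.exp_add]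
    congr 2; field_simp; ring
  simp only [h1]
  rw [lintegral_const_mul _ (by fun_prop), h, ← ENNReal.ofReal_mul (by positivity)]
  rw [← ENNReal.ofReal_one]
  refine ENNReal.ofReal_le_ofReal ?_
  have h2 : (√(1 - 2 * (1 / 4 : ℝ)))⁻¹ ≤ 2 := by
    rw [inv_le_comm₀ (Real.sqrt_pos.2 (by norm_num)) (by norm_num)]
    exact Real.le_sqrt_of_sq_le (by norm_num)
  have h3 : Real.exp (-1) ≤ 1 / 2 := by
    rw [Real.exp_neg, inv_le_comm₀ (Real.exp_pos 1) (by norm_num)]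
    have := Real.add_one_le_exp (1 : ℝ)
    norm_num at this ⊢; linarith
  calc Real.exp (-1) * (√(1 - 2 * (1 / 4 : ℝ)))⁻¹ ≤ 1 / 2 * 2 := by gcongr
    _ = 1 := by norm_num

/-- The case `a = -1`, where the integral is `1/√3 ≤ e^{-1/2}` because `e ≤ 3`. -/
lemma lintegral_exp_half_sub_sq_le (hσ : 0 < σ) :
    ∫⁻ x, ENNReal.ofReal (Real.exp (1 / 2 - x ^ 2 / σ ^ 2))
      ∂(gaussianReal 0 (Real.toNNReal (σ ^ 2))) ≤ 1 := by
  have h := lintegral_exp_sq_gaussian hσ (a := -1) (by norm_num)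
  have h1 : ∀ x, ENNReal.ofReal (Real.exp (1 / 2 - x ^ 2 / σ ^ 2))
      = ENNReal.ofReal (Real.exp (1 / 2)) * ENNReal.ofReal (Real.exp (-1 * x ^ 2 / σ ^ 2)) := by
    intro x
    rw [← ENNReal.ofReal_mul (by positivity), ← Real.exp_add]
    congr 2; ring
  simp only [h1]
  rw [lintegral_const_mul _ (by fun_prop), h, ← ENNReal.ofReal_mul (by positivity)]
  rw [← ENNReal.ofReal_one]
  refine ENNReal.ofReal_le_ofReal ?_
  have e1 : Real.exp (1 / 2) = √(Real.exp 1) := by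
    rw [Real.sqrt_eq_rpow, ← Real.exp_mul]; norm_num
  rw [e1, show (1 - 2 * (-1 : ℝ)) = 3 by norm_num]
  have h3 : √(Real.exp 1) ≤ √3 := Real.sqrt_le_sqrt (by linarith [Real.exp_one_lt_d9])
  rw [← div_eq_mul_inv, div_le_one (Real.sqrt_pos.2 (by norm_num))]
  exact h3

end GaussianIntegrals

/-! ### Concentration -/

section Concentration

variable {d k : ℕ} {Ω : Type*} [mΩ : MeasurableSpace Ω] {Pr : Measure Ω} [IsProbabilityMeasure Pr]
  {σ : ℝ} {w : ℕ → Ω → Fin d → ℝ} {η : ℕ → Ω → Fin k → ℝ}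

omit mΩ in
lemma measurable_prod_comp {m : MeasurableSpace Ω} {z g : ℕ → Ω → ℝ} {f : ℝ × ℝ → ℝ≥0∞}
    (hf : Measurable f) (s : Finset ℕ) (hz : ∀ i ∈ s, Measurable (z i))
    (hg : ∀ i ∈ s, Measurable (g i)) : Measurable fun ω => ∏ i ∈ s, f (z i ω, g i ω) :=
  Finset.measurable_prod _ fun i hi => hf.comp ((hz i hi).prodMk (hg i hi))

/-- The variables drawn up to the time of `e`, other than `e`. -/
def pastOf (e : NoiseIndex d k) : Set (NoiseIndex d k) :=
  {i | NoiseIndex.time i ≤ NoiseIndex.time e ∧ i ≠ e}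

lemma not_mem_pastOf (e : NoiseIndex d k) : e ∉ pastOf e := fun h => h.2 rfl

namespace IsMeasurableNoise

variable (hN : IsMeasurableNoise Pr σ w η)
include hN

/-- Products of conditionally normalized functions of successive noise variables have expectation
at most one. -/
lemma lintegral_prod_le_one {e : ℕ → NoiseIndex d k} (he : ∀ s, (e s).time = s)
    {z : ℕ → Ω → ℝ} (hz : ∀ s, Measurable[noiseSigma w η (pastOf (e s))] (z s))
    {f : ℝ × ℝ → ℝ≥0∞} (hf : Measurable f)
    (hf1 : ∀ y, ∫⁻ x, f (y, x) ∂(gaussianReal 0 (Real.toNNReal (σ ^ 2))) ≤ 1) (a n : ℕ) :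
    ∫⁻ ω, ∏ s ∈ Finset.Ico a (a + n), f (z s ω, noise w η (e s) ω) ∂Pr ≤ 1 := by
  induction n with
  | zero => simp
  | succ n ih =>
    rw [← Nat.add_assoc]
    simp only [Finset.prod_Ico_succ_top (Nat.le_add_right a n)]
    set b := a + n
    have hsub : ∀ s < b, pastOf (e s) ⊆ pastOf (e b) := fun s hs i hi => by
      have h1 : i.time ≤ s := (he s) ▸ hi.1
      refine ⟨by rw [he b]; omega, ?_⟩
      rintro rfl
      rw [he b] at h1; omega
    have hmem : ∀ s < b, e s ∈ pastOf (e b) := fun s hs =>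
      ⟨by rw [he, he]; omega, fun h => by have := congrArg NoiseIndex.time h; rw [he, he] at this; omega⟩
    have hY1 : Measurable[noiseSigma w η (pastOf (e b))] fun ω => ∏ s ∈ Finset.Ico a b, f (z s ω, noise w η (e s) ω) := by
      refine measurable_prod_comp (m := noiseSigma w η (pastOf (e b))) hf _ (fun s hs => ?_) (fun s hs => ?_)
      · exact (hz s).mono (noiseSigma_mono (hsub s (Finset.mem_Ico.1 hs).2)) le_rfl
      · exact measurable_noise_of_mem (hmem s (Finset.mem_Ico.1 hs).2)
    -- The product of the earlier factors and the coefficient `z b` are known before the variable `e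
    -- b` is drawn, so that variable is integrated out alone, and its factor has conditional mean at
    -- most one.
    have hY : Measurable[noiseSigma w η (pastOf (e b))] fun ω =>
        (∏ s ∈ Finset.Ico a b, f (z s ω, noise w η (e s) ω), z b ω) := hY1.prodMk (hz b)
    have := hN.lintegral_eq (not_mem_pastOf (e b)) hY (f := fun p => p.1.1 * f (p.1.2, p.2))
      (by fun_prop)
    dsimp only at this
    rw [this]
    refine le_trans (lintegral_mono fun ω => ?_) ih
    rw [lintegral_const_mul _ (by fun_prop)]
    exact mul_le_of_le_one_right' (hf1 _)

/-- Markov's inequality for such products. -/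
lemma measure_le_exp_neg {e : ℕ → NoiseIndex d k} (he : ∀ s, (e s).time = s)
    {z : ℕ → Ω → ℝ} (hz : ∀ s, Measurable[noiseSigma w η (pastOf (e s))] (z s))
    {f : ℝ → ℝ → ℝ} (hf : Measurable (Function.uncurry f))
    (hf1 : ∀ y, ∫⁻ x, ENNReal.ofReal (Real.exp (f y x))
      ∂(gaussianReal 0 (Real.toNNReal (σ ^ 2))) ≤ 1) (a b : ℕ) (q : ℝ) (E : Set Ω)
    (hE : ∀ ω ∈ E, q ≤ ∑ s ∈ Finset.Ico a b, f (z s ω) (noise w η (e s) ω)) :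
    Pr E ≤ ENNReal.ofReal (Real.exp (-q)) := by
  have h1 : ∫⁻ ω, ∏ s ∈ Finset.Ico a b,
      ENNReal.ofReal (Real.exp (f (z s ω) (noise w η (e s) ω))) ∂Pr ≤ 1 := by
    rcases le_total a b with hab | hab
    · obtain ⟨n, rfl⟩ := Nat.exists_eq_add_of_le hab
      exact hN.lintegral_prod_le_one he hz
        (f := fun p => ENNReal.ofReal (Real.exp (Function.uncurry f p))) (by fun_prop) hf1 a n
    · simp [Finset.Ico_eq_empty_of_le hab]
  have h2 : ENNReal.ofReal (Real.exp q) * Pr E ≤ 1 := by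
    refine le_trans ?_ h1
    have hm : AEMeasurable (fun ω => ∏ s ∈ Finset.Ico a b,
        ENNReal.ofReal (Real.exp (f (z s ω) (noise w η (e s) ω)))) Pr := by
      refine Finset.aemeasurable_fun_prod _ fun s _ => Measurable.aemeasurable ?_
      refine ENNReal.measurable_ofReal.comp (Real.measurable_exp.comp ?_)
      exact hf.comp (((hz s).mono (hN.sigma_le _) le_rfl).prodMk (hN.meas (e s)))
    refine le_trans ?_ (mul_meas_ge_le_lintegral₀ hm (ENNReal.ofReal (Real.exp q)))
    gcongr
    intro ω hω
    rw [Set.mem_ofPred_eq, ← ENNReal.ofReal_prod_of_nonneg (fun _ _ => (Real.exp_pos _).le),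
      ← Real.exp_sum]
    exact ENNReal.ofReal_le_ofReal (Real.exp_le_exp.2 (hE ω hω))
  rw [Real.exp_neg, ENNReal.ofReal_inv_of_pos (Real.exp_pos q)]
  rw [mul_comm] at h2
  rw [ENNReal.le_inv_iff_mul_le]; exact h2

/-- Tail bound for a Gaussian martingale on the event that its quadratic variation is small. -/
lemma measure_martingale_le (hσ : 0 < σ) {e : ℕ → NoiseIndex d k} (he : ∀ s, (e s).time = s)
    {z : ℕ → Ω → ℝ} (hz : ∀ s, Measurable[noiseSigma w η (pastOf (e s))] (z s)) (a b : ℕ)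
    {q v : ℝ} (hq : 0 ≤ q) (hv : 0 < v) :
    Pr {ω | ¬(∑ s ∈ Finset.Ico a b, z s ω ^ 2 ≤ v →
      |∑ s ∈ Finset.Ico a b, z s ω * noise w η (e s) ω| ≤ √(2 * q * σ ^ 2 * v))}
      ≤ 2 * ENNReal.ofReal (Real.exp (-q)) := by
  set r := √(2 * q * σ ^ 2 * v) with hr
  -- The optimal Chernoff parameter: on the event the exponent is at least `θ r - θ² σ² v / 2 = 2q -
  -- q`.
  set θ := r / (σ ^ 2 * v) with hθ
  have hr2 : r ^ 2 = 2 * q * σ ^ 2 * v := Real.sq_sqrt (by positivity)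
  have hθr : θ * r = 2 * q := by
    rw [hθ, div_mul_eq_mul_div, ← sq, hr2]; field_simp
  have hθ2 : θ ^ 2 * σ ^ 2 * v = 2 * q := by
    rw [hθ, div_pow, hr2]; field_simp
  have hθ0 : 0 ≤ θ := by positivity
  have main : ∀ c : ℝ, c = 1 ∨ c = -1 → Pr {ω | ∑ s ∈ Finset.Ico a b, z s ω ^ 2 ≤ v ∧
      r < c * ∑ s ∈ Finset.Ico a b, z s ω * noise w η (e s) ω}
      ≤ ENNReal.ofReal (Real.exp (-q)) := by
    intro c hc
    have hc2 : c ^ 2 = 1 := by rcases hc with rfl | rfl <;> norm_num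
    refine hN.measure_le_exp_neg he hz
      (f := fun y x => (θ * c * y) * x - (θ * c * y) ^ 2 * σ ^ 2 / 2) (by fun_prop)
      (fun y => lintegral_exp_linear_gaussian _) a b q _ ?_
    rintro ω ⟨h1, h2⟩
    have e1 : ∑ s ∈ Finset.Ico a b, ((θ * c * z s ω) * noise w η (e s) ω
        - (θ * c * z s ω) ^ 2 * σ ^ 2 / 2)
        = θ * (c * ∑ s ∈ Finset.Ico a b, z s ω * noise w η (e s) ω)
          - θ ^ 2 * σ ^ 2 / 2 * ∑ s ∈ Finset.Ico a b, z s ω ^ 2 := by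
      rw [Finset.sum_sub_distrib, Finset.mul_sum, Finset.mul_sum, Finset.mul_sum]
      congr 1
      · exact Finset.sum_congr rfl fun s _ => by ring
      · refine Finset.sum_congr rfl fun s _ => ?_
        have : (θ * c * z s ω) ^ 2 = c ^ 2 * (θ ^ 2 * z s ω ^ 2) := by ring
        rw [this, hc2]; ring
    rw [e1]
    have h3 : θ * r ≤ θ * (c * ∑ s ∈ Finset.Ico a b, z s ω * noise w η (e s) ω) := by gcongr
    have h4 : θ ^ 2 * σ ^ 2 / 2 * ∑ s ∈ Finset.Ico a b, z s ω ^ 2 ≤ θ ^ 2 * σ ^ 2 / 2 * v := by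
      gcongr
    linarith
  refine (measure_mono (t := _ ∪ _) ?_).trans ((measure_union_le _ _).trans
    ((add_le_add (main 1 (Or.inl rfl)) (main (-1) (Or.inr rfl))).trans_eq (two_mul _).symm))
  intro ω hω
  simp only [Set.mem_ofPred_eq, Classical.not_imp, not_le] at hω
  rcases lt_abs.1 hω.2 with h | h
  · exact Or.inl ⟨hω.1, by rwa [one_mul]⟩
  · exact Or.inr ⟨hω.1, by rwa [neg_one_mul]⟩

/-- The martingale bound for a sum with one term and coefficient one. The variable is embedded into
a sequence `e'` with one variable per time, as that bound requires. -/
lemma measure_sq_gt_le (hσ : 0 < σ) (e : NoiseIndex d k) {q : ℝ} (hq : 0 ≤ q) :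
    Pr {ω | ¬(noise w η e ω ^ 2 ≤ 2 * q * σ ^ 2)} ≤ 2 * ENNReal.ofReal (Real.exp (-q)) := by
  set e' : ℕ → NoiseIndex d k := fun s => match e with
    | Sum.inl p => Sum.inl (s, p.2)
    | Sum.inr p => Sum.inr (s, p.2) with he'
  have he : ∀ s, (e' s).time = s := by
    intro s; rcases e with p | p <;> rfl
  have hee : e' e.time = e := by rcases e with p | p <;> rfl
  have h := hN.measure_martingale_le hσ he (z := fun _ _ => 1) (fun _ => measurable_const)
    e.time (e.time + 1) hq one_pos
  refine (measure_mono ?_).trans h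
  intro ω hω
  simp only [Nat.Ico_succ_singleton, Finset.sum_singleton, hee, Set.mem_ofPred_eq] at hω ⊢
  intro hc
  apply hω
  have := hc (by norm_num)
  rw [one_mul, mul_one] at this
  have h2 := Real.sq_sqrt (show 0 ≤ 2 * q * σ ^ 2 by positivity)
  rw [← sq_abs, ← h2]
  exact pow_le_pow_left₀ (abs_nonneg _) this 2

/-- Chernoff's bound with the normalized factors `exp (x² / (4σ²) - 1)`. The lower tail below uses
`exp (1/2 - x² / σ²)`, which accounts for the factor `1/2` there. -/
lemma measure_sum_sq_gt_le (hσ : 0 < σ) {e : ℕ → NoiseIndex d k} (he : ∀ s, (e s).time = s)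
    (a b : ℕ) (q : ℝ) :
    Pr {ω | ¬(∑ s ∈ Finset.Ico a b, noise w η (e s) ω ^ 2 ≤ 4 * σ ^ 2 * ((b - a : ℕ) + q))}
      ≤ ENNReal.ofReal (Real.exp (-q)) := by
  refine hN.measure_le_exp_neg he (z := fun _ _ => 0) (fun _ => measurable_const)
    (f := fun _ x => x ^ 2 / (4 * σ ^ 2) - 1) (by fun_prop)
    (fun y => lintegral_exp_sq_sub_one_le hσ) a b q _ ?_
  intro ω hω
  simp only [Set.mem_ofPred_eq, not_le] at hω
  rw [Finset.sum_sub_distrib, ← Finset.sum_div, Finset.sum_const, Nat.card_Ico, nsmul_eq_mul,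
    mul_one, le_sub_iff_add_le, le_div_iff₀ (by positivity)]
  linarith

lemma measure_sum_sq_lt_le (hσ : 0 < σ) {e : ℕ → NoiseIndex d k} (he : ∀ s, (e s).time = s)
    (a b : ℕ) (q : ℝ) :
    Pr {ω | ¬(σ ^ 2 * ((b - a : ℕ) / 2 - q) ≤ ∑ s ∈ Finset.Ico a b, noise w η (e s) ω ^ 2)}
      ≤ ENNReal.ofReal (Real.exp (-q)) := by
  refine hN.measure_le_exp_neg he (z := fun _ _ => 0) (fun _ => measurable_const)
    (f := fun _ x => 1 / 2 - x ^ 2 / σ ^ 2) (by fun_prop)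
    (fun y => lintegral_exp_half_sub_sq_le hσ) a b q _ ?_
  intro ω hω
  simp only [Set.mem_ofPred_eq, not_le] at hω
  rw [Finset.sum_sub_distrib, Finset.sum_const, ← Finset.sum_div, Nat.card_Ico, nsmul_eq_mul,
    le_sub_iff_add_le, ← le_sub_iff_add_le', div_le_iff₀ (by positivity)]
  linarith

end IsMeasurableNoise

end Concentration


/-! ### Regularized least squares -/

section LeastSquares

variable {d k : ℕ}

/-- The regularized Gram matrix of the actions. -/
noncomputable def lsGram (lam : ℝ) (h : History d k) (n : ℕ) : Matrix (Fin k) (Fin k) ℝ :=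
  lam • 1 + ∑ s ∈ Finset.Ico 1 n, Matrix.vecMulVec (h.2 s) (h.2 s)

/-- The cross correlation between residuals and actions. -/
noncomputable def lsCross (A : Matrix (Fin d) (Fin d) ℝ) (h : History d k) (n : ℕ) :
    Matrix (Fin d) (Fin k) ℝ :=
  ∑ s ∈ Finset.Ico 1 n, Matrix.vecMulVec (h.1 (s + 1) - A *ᵥ h.1 s) (h.2 s)

lemma sum_mulVec' {m n : ℕ} {ι : Type*} (s : Finset ι) (f : ι → Matrix (Fin m) (Fin n) ℝ)
    (x : Fin n → ℝ) : (∑ i ∈ s, f i) *ᵥ x = ∑ i ∈ s, f i *ᵥ x := by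
  classical
  induction s using Finset.induction_on with
  | empty => simp
  | insert a s ha ih => rw [Finset.sum_insert ha, Finset.sum_insert ha, Matrix.add_mulVec, ih]

lemma dot_lsGram (lam : ℝ) (h : History d k) (n : ℕ) (v v' : Fin k → ℝ) :
    v ⬝ᵥ (lsGram lam h n *ᵥ v')
      = lam * (v ⬝ᵥ v') + ∑ s ∈ Finset.Ico 1 n, (v ⬝ᵥ h.2 s) * (v' ⬝ᵥ h.2 s) := by
  rw [lsGram, Matrix.add_mulVec, Matrix.smul_mulVec, Matrix.one_mulVec, dotProduct_add,
    dotProduct_smul, smul_eq_mul, sum_mulVec', dotProduct_sum]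
  congr 1
  refine Finset.sum_congr rfl fun s _ => ?_
  rw [Matrix.vecMulVec_mulVec]
  rw [dotProduct_smul, MulOpposite.smul_eq_mul_unop, MulOpposite.unop_op,
    dotProduct_comm (h.2 s) v']

lemma qf_lsGram (lam : ℝ) (h : History d k) (n : ℕ) (v : Fin k → ℝ) :
    qf (lsGram lam h n) v = lam * en v ^ 2 + ∑ s ∈ Finset.Ico 1 n, (v ⬝ᵥ h.2 s) ^ 2 := by
  rw [qf, dot_lsGram, en_sq]
  simp only [sq]

lemma lsGram_transpose (lam : ℝ) (h : History d k) (n : ℕ) :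
    (lsGram lam h n)ᵀ = lsGram lam h n := by
  rw [lsGram, Matrix.transpose_add, Matrix.transpose_smul, Matrix.transpose_one,
    Matrix.transpose_sum]
  congr 1
  exact Finset.sum_congr rfl fun s _ => Matrix.transpose_vecMulVec _ _

lemma posDef_lsGram {lam : ℝ} (hlam : 0 < lam) (h : History d k) (n : ℕ) :
    (lsGram lam h n).PosDef := by
  rw [posDef_iff_qf]
  refine ⟨lsGram_transpose _ _ _, fun x hx => ?_⟩
  rw [qf_lsGram]
  have := en_pos hx
  have h2 : 0 ≤ ∑ s ∈ Finset.Ico 1 n, (x ⬝ᵥ h.2 s) ^ 2 := Finset.sum_nonneg fun _ _ => sq_nonneg _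
  positivity

lemma dot_lsCross (A : Matrix (Fin d) (Fin d) ℝ) (h : History d k) (n : ℕ) (i : Fin d)
    (v : Fin k → ℝ) : v ⬝ᵥ (lsCross A h n i)
      = ∑ s ∈ Finset.Ico 1 n, (h.1 (s + 1) i - (A *ᵥ h.1 s) i) * (v ⬝ᵥ h.2 s) := by
  have : lsCross A h n i
      = ∑ s ∈ Finset.Ico 1 n, (h.1 (s + 1) i - (A *ᵥ h.1 s) i) • h.2 s := by
    rw [lsCross]
    ext j
    simp [Matrix.sum_apply, Matrix.vecMulVec_apply]
  rw [this, dotProduct_sum]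
  exact Finset.sum_congr rfl fun s _ => by rw [dotProduct_smul, smul_eq_mul]

/-- The least squares objective, split into rows. -/
lemma lsObjective_eq_rows (A : Matrix (Fin d) (Fin d) ℝ) (lam : ℝ) (h : History d k) (n : ℕ)
    (B : Matrix (Fin d) (Fin k) ℝ) : lsObjective A lam h n B
      = ∑ i, (∑ s ∈ Finset.Ico 1 n, (h.1 (s + 1) i - (A *ᵥ h.1 s) i) ^ 2
        - 2 * (B i ⬝ᵥ lsCross A h n i) + qf (lsGram lam h n) (B i)) := by
  rw [lsObjective, Finset.sum_comm, Finset.mul_sum, ← Finset.sum_add_distrib]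
  refine Finset.sum_congr rfl fun i _ => ?_
  have h1 : ∑ s ∈ Finset.Ico 1 n, (h.1 (s + 1) i - (A *ᵥ h.1 s) i - (B *ᵥ h.2 s) i) ^ 2
      = ∑ s ∈ Finset.Ico 1 n, (h.1 (s + 1) i - (A *ᵥ h.1 s) i) ^ 2
        - 2 * ∑ s ∈ Finset.Ico 1 n, (h.1 (s + 1) i - (A *ᵥ h.1 s) i) * (B i ⬝ᵥ h.2 s)
        + ∑ s ∈ Finset.Ico 1 n, (B i ⬝ᵥ h.2 s) ^ 2 := by
    rw [Finset.mul_sum, ← Finset.sum_sub_distrib, ← Finset.sum_add_distrib]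
    refine Finset.sum_congr rfl fun s _ => ?_
    have : (B *ᵥ h.2 s) i = B i ⬝ᵥ h.2 s := rfl
    rw [this]; ring
  rw [dot_lsCross, qf_lsGram, en_sq_eq_sum]
  linarith

/-- Around the solution of the normal equations the objective is its minimum plus a positive
definite form of each row of the difference. This makes the chosen minimizer explicit, hence
measurable and dependent only on the data that enter the sums. -/
lemma lsEstimate_eq (A : Matrix (Fin d) (Fin d) ℝ) {lam : ℝ} (hlam : 0 < lam) (h : History d k)
    (n : ℕ) : lsEstimate A lam h n = lsCross A h n * (lsGram lam h n)⁻¹ := by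
  set U := lsGram lam h n with hUdef
  have hU : IsUnit U.det := (Matrix.isUnit_iff_isUnit_det _).1 (posDef_lsGram hlam h n).isUnit
  have hUs : Uᵀ = U := lsGram_transpose _ _ _
  set B₀ := lsCross A h n * U⁻¹ with hB₀
  have hrow : ∀ i, U *ᵥ B₀ i = lsCross A h n i := by
    intro i
    have h1 : B₀ * U = lsCross A h n := by
      rw [hB₀, Matrix.mul_assoc, Matrix.nonsing_inv_mul U hU, Matrix.mul_one]
    have h2 := congrFun h1 i
    rw [← h2]
    conv_lhs => rw [← hUs, Matrix.mulVec_transpose]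
    rfl
  have hobj : ∀ B, lsObjective A lam h n B
      = lsObjective A lam h n B₀ + ∑ i, qf U (B i - B₀ i) := by
    intro B
    rw [lsObjective_eq_rows, lsObjective_eq_rows, ← Finset.sum_add_distrib]
    refine Finset.sum_congr rfl fun i _ => ?_
    rw [qf_sub hUs, ← hrow i]
    change _ = _ - 2 * qf U (B₀ i) + qf U (B₀ i) + _
    ring
  have hn : ∀ v, 0 ≤ qf U v := (posSemidef_iff_qf.1 (posDef_lsGram hlam h n).posSemidef).2
  have hex : ∃ B, ∀ B', lsObjective A lam h n B ≤ lsObjective A lam h n B' :=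
    ⟨B₀, fun B' => by
      have h3 : 0 ≤ ∑ i, qf U (B' i - B₀ i) := Finset.sum_nonneg fun i _ => hn _
      rw [hobj B']; linarith⟩
  rw [lsEstimate, dif_pos hex]
  have h1 := hex.choose_spec B₀
  rw [hobj hex.choose] at h1
  have h2 : ∑ i, qf U (hex.choose i - B₀ i) = 0 :=
    le_antisymm (by linarith) (Finset.sum_nonneg fun i _ => hn _)
  rw [Finset.sum_eq_zero_iff_of_nonneg (fun i _ => hn _)] at h2
  have hz : ∀ i, hex.choose i - B₀ i = 0 := by
    intro i
    by_contra hne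
    have := (posDef_iff_qf.1 (posDef_lsGram hlam h n)).2 _ hne
    rw [h2 i (Finset.mem_univ i)] at this
    exact lt_irrefl _ this
  funext i
  exact sub_eq_zero.1 (hz i)

/-- The normal equations of the least squares estimate, tested against a vector. -/
lemma dot_lsEstimate (A : Matrix (Fin d) (Fin d) ℝ) {lam : ℝ} (hlam : 0 < lam) (h : History d k)
    (n : ℕ) (i : Fin d) (v : Fin k → ℝ) :
    v ⬝ᵥ (lsGram lam h n *ᵥ lsEstimate A lam h n i) = v ⬝ᵥ lsCross A h n i := by
  have hU : IsUnit (lsGram lam h n).det :=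
    (Matrix.isUnit_iff_isUnit_det _).1 (posDef_lsGram hlam h n).isUnit
  have h1 : lsEstimate A lam h n * lsGram lam h n = lsCross A h n := by
    rw [lsEstimate_eq A hlam, Matrix.mul_assoc, Matrix.nonsing_inv_mul _ hU, Matrix.mul_one]
  rw [← h1]
  congr 1
  conv_lhs => rw [← lsGram_transpose, Matrix.mulVec_transpose]
  rfl

end LeastSquares

/-! ### Measurability of the algorithm -/

section Measurability

instance {m n : ℕ} : MeasurableSpace (Matrix (Fin m) (Fin n) ℝ) :=
  inferInstanceAs (MeasurableSpace (Fin m → Fin n → ℝ))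

instance {m n : ℕ} : BorelSpace (Matrix (Fin m) (Fin n) ℝ) :=
  inferInstanceAs (BorelSpace (Fin m → Fin n → ℝ))

instance {m n : ℕ} : SecondCountableTopology (Matrix (Fin m) (Fin n) ℝ) :=
  inferInstanceAs (SecondCountableTopology (Fin m → Fin n → ℝ))

variable {d k : ℕ} {Ω : Type*} [MeasurableSpace Ω]

lemma measurable_matrix_mul {a b c : ℕ} {f : Ω → Matrix (Fin a) (Fin b) ℝ}
    {g : Ω → Matrix (Fin b) (Fin c) ℝ} (hf : Measurable f) (hg : Measurable g) :
    Measurable fun ω => f ω * g ω :=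
  (by fun_prop : Continuous fun p : Matrix (Fin a) (Fin b) ℝ × Matrix (Fin b) (Fin c) ℝ =>
    p.1 * p.2).measurable.comp (hf.prodMk hg)

lemma measurable_matrix_inv {a : ℕ} {f : Ω → Matrix (Fin a) (Fin a) ℝ} (hf : Measurable f) :
    Measurable fun ω => (f ω)⁻¹ := by
  simp only [Matrix.inv_def, Ring.inverse_eq_inv']
  have hd : Measurable fun ω => (f ω).det :=
    (Continuous.matrix_det continuous_id).measurable.comp hf
  have ha : Measurable fun ω => (f ω).adjugate :=
    (Continuous.matrix_adjugate continuous_id).measurable.comp hf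
  exact (by fun_prop : Continuous fun p : ℝ × Matrix (Fin a) (Fin a) ℝ =>
    p.1 • p.2).measurable.comp (hd.inv.prodMk ha)

lemma measurable_matrix_of_entry {a b : ℕ} {f : Ω → Matrix (Fin a) (Fin b) ℝ}
    (hf : ∀ i j, Measurable fun ω => f ω i j) : Measurable f :=
  measurable_pi_iff.2 fun i => measurable_pi_iff.2 fun j => hf i j

lemma measurable_hist_fst (s : ℕ) : Measurable fun h : History d k => h.1 s :=
  (measurable_pi_apply s).comp measurable_fst

lemma measurable_hist_snd (s : ℕ) : Measurable fun h : History d k => h.2 s :=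
  (measurable_pi_apply s).comp measurable_snd

lemma measurable_lsEstimate (A : Matrix (Fin d) (Fin d) ℝ) {lam : ℝ} (hlam : 0 < lam) (n : ℕ) :
    Measurable fun h : History d k => lsEstimate A lam h n := by
  simp only [lsEstimate_eq A hlam]
  refine measurable_matrix_mul ?_ (measurable_matrix_inv ?_)
  · refine measurable_matrix_of_entry fun i j => ?_
    simp only [lsCross, Matrix.sum_apply, Matrix.vecMulVec_apply]
    refine Finset.measurable_sum _ fun s _ => Measurable.mul ?_ ?_
    · exact (measurable_pi_apply i).comp ((measurable_hist_fst (s + 1)).sub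
        ((measurable_mulVec A).comp (measurable_hist_fst s)))
    · exact (measurable_pi_apply j).comp (measurable_hist_snd s)
  · refine measurable_matrix_of_entry fun i j => ?_
    simp only [lsGram, Matrix.add_apply, Matrix.sum_apply, Matrix.vecMulVec_apply]
    refine measurable_const.add (Finset.measurable_sum _ fun s _ => Measurable.mul ?_ ?_)
    · exact (measurable_pi_apply i).comp (measurable_hist_snd s)
    · exact (measurable_pi_apply j).comp (measurable_hist_snd s)

/-- A qualitative version of `riccati_sensitivity`, with a constant that depends on the system. It
serves for the measurability of the controller. -/
lemma optController_locally_lipschitz {A : Matrix (Fin d) (Fin d) ℝ}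
    {B : Matrix (Fin d) (Fin k) ℝ} {Q : Matrix (Fin d) (Fin d) ℝ} {R : Matrix (Fin k) (Fin k) ℝ}
    {P : Matrix (Fin d) (Fin d) ℝ} (hQ : Q.PosDef) (hR : R.PosDef)
    (h : IsRiccatiSolution A B Q R P) :
    ∃ Y : ℝ, 0 < Y ∧ ∀ B' : Matrix (Fin d) (Fin k) ℝ, Y ^ 7 * ‖B' - B‖ ≤ 1 →
      (∃ P', IsRiccatiSolution A B' Q R P') ∧
      ‖optController Q R A B' - optController Q R A B‖ ≤ Y ^ 14 * ‖B' - B‖ := by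
  obtain ⟨a, ha, haQ⟩ := exists_pos_mul_le_qf hQ
  obtain ⟨b, hb, hbR⟩ := exists_pos_mul_le_qf hR
  set Y := 1000 + a⁻¹ + b⁻¹ + ‖P‖ + ‖A‖ + ‖B‖
  have ha' : 0 < a⁻¹ := inv_pos.2 ha
  have hb' : 0 < b⁻¹ := inv_pos.2 hb
  have h1 := norm_nonneg P
  have h2 := norm_nonneg A
  have h3 := norm_nonneg B
  have hY : 0 < Y := by positivity
  refine ⟨Y, hY, fun B' hB' => ?_⟩
  have hYa : Y⁻¹ ≤ a := by rw [inv_le_comm₀ hY ha]; simp only [Y]; linarith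
  have hYb : Y⁻¹ ≤ b := by rw [inv_le_comm₀ hY hb]; simp only [Y]; linarith
  obtain ⟨P', hP', hle⟩ := riccati_sensitivity hQ hR h (Y := Y) (ε := ‖B' - B‖)
    (by simp only [Y]; linarith) (norm_nonneg _) hB'
    (fun x => (mul_le_mul_of_nonneg_right hYa (sq_nonneg _)).trans (haQ x))
    (fun x => (mul_le_mul_of_nonneg_right hYb (sq_nonneg _)).trans (hbR x))
    (by simp only [Y]; linarith) (by simp only [Y]; linarith) (by simp only [Y]; linarith)
    (A' := A) (by rw [sub_self, norm_zero]; exact norm_nonneg _) le_rfl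
  exact ⟨⟨P', hP'⟩, hle⟩

/-- The matrices `B` with a Riccati solution form an open set on which the controller is continuous.
Off this set it is zero by convention. -/
lemma measurable_optController (A : Matrix (Fin d) (Fin d) ℝ) {Q : Matrix (Fin d) (Fin d) ℝ}
    {R : Matrix (Fin k) (Fin k) ℝ} (hQ : Q.PosDef) (hR : R.PosDef) :
    Measurable fun B : Matrix (Fin d) (Fin k) ℝ => optController Q R A B := by
  classical
  set U : Set (Matrix (Fin d) (Fin k) ℝ) := {B | ∃ P, IsRiccatiSolution A B Q R P}
  have hUo : IsOpen U := by
    rw [Metric.isOpen_iff]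
    rintro B ⟨P, hP⟩
    obtain ⟨Y, hY, hB⟩ := optController_locally_lipschitz hQ hR hP
    refine ⟨(Y ^ 7)⁻¹, by positivity, fun B' hB' => (hB B' ?_).1⟩
    rw [Metric.mem_ball, dist_eq_norm] at hB'
    rw [mul_comm, ← le_div_iff₀ (by positivity), one_div]
    exact hB'.le
  have hc : ContinuousOn (fun B : Matrix (Fin d) (Fin k) ℝ => optController Q R A B) U := by
    rintro B ⟨P, hP⟩
    refine ContinuousAt.continuousWithinAt ?_
    obtain ⟨Y, hY, hB⟩ := optController_locally_lipschitz hQ hR hP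
    rw [ContinuousAt, tendsto_iff_norm_sub_tendsto_zero]
    have h0 : Tendsto (fun B' => Y ^ 14 * ‖B' - B‖) (nhds B) (nhds 0) := by
      have : Continuous fun B' => Y ^ 14 * ‖B' - B‖ := by fun_prop
      simpa using this.tendsto B
    refine squeeze_zero' (Eventually.of_forall fun _ => norm_nonneg _) ?_ h0
    filter_upwards [Metric.ball_mem_nhds B (inv_pos.2 (pow_pos hY 7))] with B' hB'
    refine (hB B' ?_).2
    rw [Metric.mem_ball, dist_eq_norm] at hB'
    rw [mul_comm, ← le_div_iff₀ (by positivity), one_div]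
    exact hB'.le
  have heq : (fun B : Matrix (Fin d) (Fin k) ℝ => optController Q R A B)
      = U.piecewise (fun B => optController Q R A B) (fun _ => 0) := by
    funext B
    by_cases hB : B ∈ U
    · rw [Set.piecewise_eq_of_mem _ _ _ hB]
    · rw [Set.piecewise_eq_of_notMem _ _ _ hB, optController, dif_neg (show ¬ ∃ P, _ from hB)]
  rw [heq]
  exact hc.measurable_piecewise continuousOn_const hUo.measurableSet

namespace AlgInput

variable (I : AlgInput d k)

lemma measurable_greedy (hQ : I.Q.PosDef) (hR : I.R.PosDef) (hlam : 0 < I.lam) (i : ℕ) :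
    Measurable fun h : History d k => I.greedy h i :=
  (measurable_optController I.A hQ hR).comp (measurable_lsEstimate I.A hlam _)

lemma measurableSet_breakTest (hQ : I.Q.PosDef) (hR : I.R.PosDef) (hlam : 0 < I.lam) (i : ℕ) :
    MeasurableSet {h : History d k | I.breakTest h i} := by
  have hg := I.measurable_greedy hQ hR hlam i
  refine isClosed_posSemidef.measurableSet.preimage (f := fun h : History d k =>
    I.greedy h i * (I.greedy h i)ᵀ
      - (3 * (I.μ₀ * (2 ^ i)⁻¹) / 2) • (1 : Matrix (Fin k) (Fin k) ℝ)) ?_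
  exact (by fun_prop : Continuous fun K : Matrix (Fin k) (Fin d) ℝ =>
    K * Kᵀ - (3 * (I.μ₀ * (2 ^ i)⁻¹) / 2) • (1 : Matrix (Fin k) (Fin k) ℝ)).measurable.comp hg

lemma measurableSet_inWarmup (hQ : I.Q.PosDef) (hR : I.R.PosDef) (hlam : 0 < I.lam) (t : ℕ) :
    MeasurableSet {h : History d k | I.inWarmup h t} := by
  have : {h : History d k | I.inWarmup h t}
      = ⋂ i, {h | i ≤ I.nT → I.τ i ≤ t → ¬ I.breakTest h i} := by
    ext h; simp [inWarmup]
  rw [this]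
  refine MeasurableSet.iInter fun i => ?_
  by_cases h1 : i ≤ I.nT
  · by_cases h2 : I.τ i ≤ t
    · simp only [h1, h2, true_imp_iff]
      exact (I.measurableSet_breakTest hQ hR hlam i).compl
    · simp only [h2, false_imp_iff, imp_true_iff]; exact MeasurableSet.univ
  · simp only [h1, false_imp_iff]; exact MeasurableSet.univ

lemma measurableSet_aborted (hQ : I.Q.PosDef) (hR : I.R.PosDef) (hlam : 0 < I.lam) (t : ℕ) :
    MeasurableSet {h : History d k | I.aborted h t} := by
  have : {h : History d k | I.aborted h t} = ⋃ s ∈ Finset.Icc 1 t,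
      {h | I.inWarmup h s}ᶜ ∩ ({h | I.xb < h.1 s ⬝ᵥ h.1 s} ∪ {h | I.κ < ‖I.greedy h (I.phase s)‖})
      := by
    ext h; simp only [aborted, Set.mem_iUnion, Set.mem_inter_iff, Set.mem_union, Set.mem_compl_iff,
      Set.mem_ofPred_eq, exists_prop]
  rw [this]
  refine Finset.measurableSet_biUnion _ fun s _ => ?_
  refine (I.measurableSet_inWarmup hQ hR hlam s).compl.inter (MeasurableSet.union ?_ ?_)
  · refine measurableSet_lt measurable_const ?_
    exact (by fun_prop : Continuous fun x : Fin d → ℝ => x ⬝ᵥ x).measurable.comp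
      (measurable_hist_fst s)
  · exact measurableSet_lt measurable_const
      (continuous_norm.measurable.comp (I.measurable_greedy hQ hR hlam _))

theorem measurablePolicy (hQ : I.Q.PosDef) (hR : I.R.PosDef) (hlam : 0 < I.lam) :
    MeasurablePolicy I.policy := by
  intro t
  have hx : Measurable fun p : History d k × (Fin k → ℝ) => p.1.1 t :=
    (measurable_hist_fst t).comp measurable_fst
  unfold policy
  refine Measurable.ite ((I.measurableSet_inWarmup hQ hR hlam t).preimage measurable_fst) ?_
    (Measurable.ite ((I.measurableSet_aborted hQ hR hlam t).preimage measurable_fst) ?_ ?_)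
  · exact ((measurable_mulVec _).comp hx).add measurable_snd
  · exact (measurable_mulVec _).comp hx
  · have hg : Measurable fun p : History d k × (Fin k → ℝ) => I.greedy p.1 (I.phase t) :=
      (I.measurable_greedy hQ hR hlam _).comp measurable_fst
    exact (by fun_prop : Continuous fun p : Matrix (Fin k) (Fin d) ℝ × (Fin d → ℝ) =>
      p.1 *ᵥ p.2).measurable.comp (hg.prodMk hx)

end AlgInput

end Measurability


/-! ### Lyapunov recursions -/

section Lyapunov

/-- Young's inequality with weight `r / (1 - r)`, where `r = 1/(2s)`. Half of the contraction rate
is given up, because `1 - 2r ≤ (1 - r)²`, and the disturbance enters with factor `1/r`. -/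
lemma qf_add_le_of_contraction {n : ℕ} {P : Matrix (Fin n) (Fin n) ℝ} (hP : P.PosSemidef) {s c : ℝ}
    (hs : 1 ≤ s) (y g : Fin n → ℝ) (hc : 0 ≤ c) (hy : qf P y ≤ (1 - s⁻¹) * c) :
    qf P (y + g) ≤ (1 - (2 * s)⁻¹) * c + 2 * s * qf P g := by
  have hs0 : 0 < s := by linarith
  have hPs := (posSemidef_iff_qf.1 hP).1
  set r := (2 * s)⁻¹ with hr
  have hr0 : 0 < r := by positivity
  have hr1 : r ≤ 1 / 2 := by
    rw [hr, inv_le_comm₀ (by positivity) (by norm_num)]; linarith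
  have hsr : s⁻¹ = 2 * r := by rw [hr]; field_simp
  have h2s : 2 * s = r⁻¹ := by rw [hr, inv_inv]
  have h0 := (posSemidef_iff_qf.1 hP).2 (r • y - (1 - r) • g)
  rw [qf_sub hPs, qf_smul_right, qf_smul_right, Matrix.mulVec_smul, dotProduct_smul,
    smul_dotProduct, smul_eq_mul, smul_eq_mul] at h0
  rw [qf_add hPs, h2s]
  have hr' : 0 < 1 - r := by linarith
  have h1 : 2 * (y ⬝ᵥ (P *ᵥ g)) ≤ r / (1 - r) * qf P y + (1 - r) / r * qf P g := by
    have : 2 * (y ⬝ᵥ (P *ᵥ g)) * (r * (1 - r)) ≤ r ^ 2 * qf P y + (1 - r) ^ 2 * qf P g := by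
      linarith
    rw [← le_div_iff₀ (by positivity)] at this
    refine this.trans_eq ?_
    field_simp
  have h2 : qf P y + r / (1 - r) * qf P y = (1 - r)⁻¹ * qf P y := by field_simp; ring
  have h3 : (1 - r) / r * qf P g + qf P g = r⁻¹ * qf P g := by field_simp; ring
  have h4 : (1 - r)⁻¹ * qf P y ≤ (1 - r) * c := by
    rw [inv_mul_le_iff₀ hr']
    refine hy.trans ?_
    rw [hsr]
    nlinarith [mul_nonneg (sq_nonneg r) hc]
  linarith

/-- The geometric series of the disturbances sums to `2s · 2s G`. -/
lemma lyapunov_max {φ : ℕ → ℝ} {s G : ℝ} (hs : 1 ≤ s) (hG : 0 ≤ G) {a b : ℕ} (hab : a ≤ b)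
    (hφ : 0 ≤ φ a)
    (h : ∀ t, a ≤ t → t < b → φ (t + 1) ≤ (1 - (2 * s)⁻¹) * φ t + 2 * s * G) :
    φ b ≤ φ a + 4 * s ^ 2 * G := by
  have hs0 : 0 < s := by linarith
  induction b, hab using Nat.le_induction with
  | base => have : 0 ≤ 4 * s ^ 2 * G := by positivity
            linarith
  | succ b hb ih =>
    have ih' := ih (fun t h1 h2 => h t h1 (by omega))
    have h1 := h b hb (by omega)
    have hr1 : (2 * s)⁻¹ ≤ 1 := by
      rw [inv_le_comm₀ (by positivity) one_pos]; linarith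
    have h2 : (1 - (2 * s)⁻¹) * φ b ≤ (1 - (2 * s)⁻¹) * (φ a + 4 * s ^ 2 * G) :=
      mul_le_mul_of_nonneg_left ih' (by linarith)
    have h3 : (2 * s)⁻¹ * (4 * s ^ 2 * G) = 2 * s * G := by field_simp; ring
    have h4 : 0 ≤ (2 * s)⁻¹ * φ a := by positivity
    nlinarith

/-- Each step loses the fraction `1/(2s)` of `φ`. Adding the inequalities, multiplied by `2s`,
telescopes. -/
lemma lyapunov_sum {φ g : ℕ → ℝ} {s : ℝ} (hs : 1 ≤ s) {a b : ℕ} (hab : a ≤ b) (hφ : 0 ≤ φ b)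
    (h : ∀ t, a ≤ t → t < b → φ (t + 1) ≤ (1 - (2 * s)⁻¹) * φ t + 2 * s * g t) :
    ∑ t ∈ Finset.Ico a b, φ t ≤ 2 * s * φ a + 4 * s ^ 2 * ∑ t ∈ Finset.Ico a b, g t := by
  have hs0 : 0 < s := by linarith
  have key : ∀ c, a ≤ c → c ≤ b → ∑ t ∈ Finset.Ico a c, φ t + 2 * s * φ c
      ≤ 2 * s * φ a + 4 * s ^ 2 * ∑ t ∈ Finset.Ico a c, g t := by
    intro c hac
    induction c, hac using Nat.le_induction with
    | base => intro _; simp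
    | succ c hc ih =>
      intro hcb
      rw [Finset.sum_Ico_succ_top hc, Finset.sum_Ico_succ_top hc]
      have h1 := mul_le_mul_of_nonneg_left (h c hc (by omega)) (by positivity : 0 ≤ 2 * s)
      have h2 : 2 * s * ((1 - (2 * s)⁻¹) * φ c + 2 * s * g c)
          = 2 * s * φ c - φ c + 4 * s ^ 2 * g c := by field_simp; ring
      have := ih (by omega)
      linarith
  have := key b hab le_rfl
  have h0 : 0 ≤ 2 * s * φ b := by positivity
  linarith

end Lyapunov

/-! ### The setting of the regret analysis -/

/-- The system, its optimal and its initial controller, together with bounds of all the parameters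
in terms of a single large number `Y`. -/
structure Setting {d k : ℕ} (A : Matrix (Fin d) (Fin d) ℝ) (B : Matrix (Fin d) (Fin k) ℝ)
    (Q : Matrix (Fin d) (Fin d) ℝ) (R : Matrix (Fin k) (Fin k) ℝ)
    (K₀ Kstar : Matrix (Fin k) (Fin d) ℝ) (P P₀ : Matrix (Fin d) (Fin d) ℝ)
    (α ϑ p p₀ σ κ κ₀ Y : ℝ) : Prop where
  Y_ge : 1000 ≤ Y
  σ_pos : 0 < σ
  σ_le : σ ^ 2 ≤ Y
  σ_ge : Y⁻¹ ≤ σ ^ 2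
  d_le : (d : ℝ) ≤ Y
  d_pos : 0 < d
  k_pos : 0 < k
  k_le : k ≤ d
  α_pos : 0 < α
  α_ge : Y⁻¹ ≤ α
  ϑ_nonneg : 0 ≤ ϑ
  ϑ_le : ϑ ≤ Y
  Q_posDef : Q.PosDef
  R_posDef : R.PosDef
  Q_ge : ∀ x, α * en x ^ 2 ≤ qf Q x
  R_ge : ∀ x, α * en x ^ 2 ≤ qf R x
  R_le : ‖R‖ ≤ Y
  A_le : ‖A‖ ≤ Y
  B_le : ‖B‖ ≤ ϑ
  riccati : IsRiccatiSolution A B Q R P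
  Kstar_eq : optController Q R A B = Kstar
  P_le : ∀ x, qf P x ≤ p * en x ^ 2
  p_pos : 0 < p
  p_le : p ≤ Y
  P₀_psd : P₀.PosSemidef
  P₀_lyap : ∀ x, qf P₀ ((A + B * K₀) *ᵥ x) + qf Q x + qf R (K₀ *ᵥ x) ≤ qf P₀ x
  P₀_le : ∀ x, qf P₀ x ≤ p₀ * en x ^ 2
  p₀_pos : 0 < p₀
  p₀_le : p₀ ≤ Y
  κ_one : 1 ≤ κ
  κ_le : κ ^ 2 ≤ Y
  -- The slack `Y⁻¹³⁶` pays for playing a controller within `Y⁻⁷⁰` of the optimal one: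
  -- `near_optimal` charges `Y⁴ (Y⁻⁷⁰)²`.
  κ_ge : p ≤ (α - (Y ^ 136)⁻¹) * κ ^ 2
  κ₀_one : 1 ≤ κ₀
  κ₀_le : κ₀ ^ 2 ≤ Y
  κ₀_ge : p₀ ≤ α * κ₀ ^ 2

/-- A controller that contracts the optimal value function and is not too large. -/
def GoodController {d k : ℕ} (A : Matrix (Fin d) (Fin d) ℝ) (B : Matrix (Fin d) (Fin k) ℝ)
    (P : Matrix (Fin d) (Fin d) ℝ) (κ : ℝ) (K : Matrix (Fin k) (Fin d) ℝ) : Prop :=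
  (∀ x, qf P ((A + B * K) *ᵥ x) ≤ (1 - (κ ^ 2)⁻¹) * qf P x) ∧ ‖K‖ ≤ κ

namespace Setting

variable {d k : ℕ} {A : Matrix (Fin d) (Fin d) ℝ} {B : Matrix (Fin d) (Fin k) ℝ}
  {Q : Matrix (Fin d) (Fin d) ℝ} {R : Matrix (Fin k) (Fin k) ℝ}
  {K₀ Kstar : Matrix (Fin k) (Fin d) ℝ} {P P₀ : Matrix (Fin d) (Fin d) ℝ}
  {α ϑ p p₀ σ κ κ₀ Y : ℝ}
  (S : Setting A B Q R K₀ Kstar P P₀ α ϑ p p₀ σ κ κ₀ Y)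
include S

lemma Y_pos : 0 < Y := by linarith [S.Y_ge]

lemma Y_one : 1 ≤ Y := by linarith [S.Y_ge]

lemma κ_pos : 0 < κ := by linarith [S.κ_one]

lemma κ₀_pos : 0 < κ₀ := by linarith [S.κ₀_one]

lemma k_leY : (k : ℝ) ≤ Y := by
  have : (k : ℝ) ≤ d := by exact_mod_cast S.k_le
  linarith [S.d_le]

/-- One spare power of `Y ≥ 1000` absorbs a numerical constant. Most of the bookkeeping below has
this form. -/
lemma pow_mul_le {i j : ℕ} {c : ℝ} (hc : c ≤ 1000) (hij : i < j) : c * Y ^ i ≤ Y ^ j := by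
  have h1 : Y ^ (i + 1) ≤ Y ^ j := pow_le_pow_right₀ S.Y_one hij
  have h2 : 0 < Y ^ i := pow_pos S.Y_pos i
  rw [pow_succ] at h1
  nlinarith [S.Y_ge]

lemma qf_P_nonneg (x : Fin d → ℝ) : 0 ≤ qf P x :=
  (posSemidef_iff_qf.1 S.riccati.1.posSemidef).2 x

lemma qf_P₀_nonneg (x : Fin d → ℝ) : 0 ≤ qf P₀ x := (posSemidef_iff_qf.1 S.P₀_psd).2 x

lemma qf_R_nonneg (u : Fin k → ℝ) : 0 ≤ qf R u := (posSemidef_iff_qf.1 S.R_posDef.posSemidef).2 u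

lemma qf_Q_nonneg (x : Fin d → ℝ) : 0 ≤ qf Q x := (posSemidef_iff_qf.1 S.Q_posDef.posSemidef).2 x

lemma P_ge (x : Fin d → ℝ) : α * en x ^ 2 ≤ qf P x := by
  have h := S.riccati.qf_eq S.R_posDef x
  linarith [S.Q_ge x, S.qf_P_nonneg ((A + B * ctrl A B R P) *ᵥ x),
    S.qf_R_nonneg (ctrl A B R P *ᵥ x)]

lemma P₀_ge (x : Fin d → ℝ) : α * en x ^ 2 ≤ qf P₀ x := by
  linarith [S.Q_ge x, S.P₀_lyap x, S.qf_P₀_nonneg ((A + B * K₀) *ᵥ x), S.qf_R_nonneg (K₀ *ᵥ x)]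

lemma en_sq_le_qf_P (x : Fin d → ℝ) : en x ^ 2 ≤ Y * qf P x := by
  have h1 := (mul_le_mul_of_nonneg_right S.α_ge (sq_nonneg (en x))).trans (S.P_ge x)
  rwa [inv_mul_le_iff₀ S.Y_pos] at h1

lemma en_sq_le_qf_P₀ (x : Fin d → ℝ) : en x ^ 2 ≤ Y * qf P₀ x := by
  have h1 := (mul_le_mul_of_nonneg_right S.α_ge (sq_nonneg (en x))).trans (S.P₀_ge x)
  rwa [inv_mul_le_iff₀ S.Y_pos] at h1

lemma norm_P_le : ‖P‖ ≤ Y := by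
  refine norm_le_of_abs_qf_le (posDef_iff_qf.1 S.riccati.1).1 S.Y_pos.le fun x => ?_
  rw [abs_of_nonneg (S.qf_P_nonneg x)]
  exact (S.P_le x).trans (mul_le_mul_of_nonneg_right S.p_le (sq_nonneg _))

lemma p_le_mul : p ≤ α * κ ^ 2 := by
  have h := S.κ_ge
  have : 0 ≤ (Y ^ 136)⁻¹ * κ ^ 2 := by have := S.Y_pos; positivity
  nlinarith

lemma norm_K₀_le : ‖K₀‖ ≤ κ₀ := by
  refine opNorm_le S.κ₀_pos.le fun x => le_of_sq_le_sq ?_ (mul_nonneg S.κ₀_pos.le (en_nonneg _))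
  rw [mul_pow]
  have h1 : α * en (K₀ *ᵥ x) ^ 2 ≤ α * (κ₀ ^ 2 * en x ^ 2) := by
    have h2 : p₀ * en x ^ 2 ≤ α * κ₀ ^ 2 * en x ^ 2 :=
      mul_le_mul_of_nonneg_right S.κ₀_ge (sq_nonneg _)
    linarith [S.R_ge (K₀ *ᵥ x), S.P₀_lyap x, S.P₀_le x, S.qf_P₀_nonneg ((A + B * K₀) *ᵥ x),
      S.qf_Q_nonneg x]
  exact le_of_mul_le_mul_left h1 S.α_pos

/-- Controllers near the optimal one are good. -/
lemma goodController {K : Matrix (Fin k) (Fin d) ℝ} (hK : ‖K - Kstar‖ ≤ (Y ^ 70)⁻¹) :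
    GoodController A B P κ K := by
  have hY := S.Y_pos
  have h := S.riccati.near_optimal S.Q_posDef S.R_posDef (by linarith [S.Y_ge]) S.R_le S.norm_P_le
    (S.B_le.trans S.ϑ_le) (K := K) (e := (Y ^ 70)⁻¹) (by rw [S.Kstar_eq]; exact hK)
  have e1 : Y ^ 4 * (Y ^ 70)⁻¹ ^ 2 = (Y ^ 136)⁻¹ := by field_simp
  simp only [e1] at h
  have hκ2 : 0 < κ ^ 2 := pow_pos S.κ_pos 2
  set δ := (Y ^ 136)⁻¹
  have hδ : 0 ≤ δ := by positivity
  have hcon : 0 < α - δ := by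
    by_contra hneg
    have := S.κ_ge
    nlinarith [S.p_pos]
  have hα : ∀ x, (κ ^ 2)⁻¹ * qf P x ≤ (α - δ) * en x ^ 2 := by
    intro x
    rw [inv_mul_le_iff₀ hκ2]
    calc qf P x ≤ p * en x ^ 2 := S.P_le x
      _ ≤ (α - δ) * κ ^ 2 * en x ^ 2 := mul_le_mul_of_nonneg_right S.κ_ge (sq_nonneg _)
      _ = _ := by ring
  refine ⟨fun x => ?_, ?_⟩
  · have h1 := h x
    have h2 := hα x
    linarith [S.Q_ge x, S.qf_R_nonneg (K *ᵥ x)]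
  · refine opNorm_le S.κ_pos.le fun x => le_of_sq_le_sq ?_ (mul_nonneg S.κ_pos.le (en_nonneg _))
    rw [mul_pow]
    have h1 : α * en (K *ᵥ x) ^ 2 ≤ α * (κ ^ 2 * en x ^ 2) := by
      have h2 : p * en x ^ 2 ≤ α * κ ^ 2 * en x ^ 2 :=
        mul_le_mul_of_nonneg_right S.p_le_mul (sq_nonneg _)
      have h3 : 0 ≤ (α - δ) * en x ^ 2 := by positivity
      linarith [S.R_ge (K *ᵥ x), h x, S.P_le x, S.qf_P_nonneg ((A + B * K) *ᵥ x), S.Q_ge x]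
    exact le_of_mul_le_mul_left h1 S.α_pos

lemma goodController_Kstar : GoodController A B P κ Kstar :=
  S.goodController (by rw [sub_self, norm_zero]; have := S.Y_pos; positivity)

/-- One step of the warm-up. -/
lemma warm_step (x w : Fin d → ℝ) (η : Fin k → ℝ) :
    qf P₀ (A *ᵥ x + B *ᵥ (K₀ *ᵥ x + η) + w)
      ≤ (1 - (2 * κ₀ ^ 2)⁻¹) * qf P₀ x + 2 * κ₀ ^ 2 * qf P₀ (w + B *ᵥ η) := by
  have e : A *ᵥ x + B *ᵥ (K₀ *ᵥ x + η) + w = (A + B * K₀) *ᵥ x + (w + B *ᵥ η) := by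
    rw [closedLoop_mulVec, Matrix.mulVec_add]; abel
  rw [e]
  have hκ2 : 0 < κ₀ ^ 2 := pow_pos S.κ₀_pos 2
  refine qf_add_le_of_contraction S.P₀_psd (one_le_pow₀ S.κ₀_one) _ _ (S.qf_P₀_nonneg x) ?_
  have h1 : (κ₀ ^ 2)⁻¹ * qf P₀ x ≤ α * en x ^ 2 := by
    rw [inv_mul_le_iff₀ hκ2]
    calc qf P₀ x ≤ p₀ * en x ^ 2 := S.P₀_le x
      _ ≤ α * κ₀ ^ 2 * en x ^ 2 := mul_le_mul_of_nonneg_right S.κ₀_ge (sq_nonneg _)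
      _ = _ := by ring
  linarith [S.P₀_lyap x, S.Q_ge x, S.qf_R_nonneg (K₀ *ᵥ x)]

/-- One step with a good controller. -/
lemma main_step {K : Matrix (Fin k) (Fin d) ℝ} (hK : GoodController A B P κ K) (x w : Fin d → ℝ) :
    qf P (A *ᵥ x + B *ᵥ (K *ᵥ x) + w)
      ≤ (1 - (2 * κ ^ 2)⁻¹) * qf P x + 2 * κ ^ 2 * qf P w := by
  rw [← closedLoop_mulVec]
  exact qf_add_le_of_contraction S.riccati.1.posSemidef (one_le_pow₀ S.κ_one) _ _
    (S.qf_P_nonneg x) (hK.1 x)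

lemma en_mixed_noise_le (w : Fin d → ℝ) (η : Fin k → ℝ) {W : ℝ} (hw : en w ^ 2 ≤ W)
    (hη : en η ^ 2 ≤ W) : en (w + B *ᵥ η) ^ 2 ≤ (1 + ϑ) ^ 2 * W := by
  have hW : 0 ≤ W := (sq_nonneg _).trans hw
  have h1 : en w ≤ √W := Real.le_sqrt_of_sq_le hw
  have h2 : en η ≤ √W := Real.le_sqrt_of_sq_le hη
  have h3 : en (w + B *ᵥ η) ≤ (1 + ϑ) * √W := by
    have h4 : en (B *ᵥ η) ≤ ϑ * √W :=
      (en_mulVec B η).trans (mul_le_mul S.B_le h2 (en_nonneg _) S.ϑ_nonneg)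
    linarith [en_add_le w (B *ᵥ η)]
  calc _ ≤ ((1 + ϑ) * √W) ^ 2 := pow_le_pow_left₀ (en_nonneg _) h3 2
    _ = _ := by rw [mul_pow, Real.sq_sqrt hW]

lemma qf_mixed_noise_le (w : Fin d → ℝ) (η : Fin k → ℝ) :
    qf P₀ (w + B *ᵥ η) ≤ 2 * Y ^ 3 * (en w ^ 2 + en η ^ 2) := by
  have hY := S.Y_pos
  have hBY : ‖B‖ ≤ Y := S.B_le.trans S.ϑ_le
  have h1 : en (B *ᵥ η) ^ 2 ≤ Y ^ 2 * en η ^ 2 := (en_mulVec_sq_le B _).trans (by gcongr)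
  have h2 := en_sq_add_le w (B *ᵥ η)
  have h3 : en w ^ 2 ≤ Y ^ 2 * en w ^ 2 :=
    le_mul_of_one_le_left (sq_nonneg _) (one_le_pow₀ S.Y_one)
  calc qf P₀ (w + B *ᵥ η) ≤ p₀ * en (w + B *ᵥ η) ^ 2 := S.P₀_le _
    _ ≤ Y * (2 * (Y ^ 2 * en w ^ 2) + 2 * (Y ^ 2 * en η ^ 2)) := by
      refine mul_le_mul S.p₀_le (by linarith) (sq_nonneg _) hY.le
    _ = _ := by ring

variable {x : ℕ → Fin d → ℝ} {u : ℕ → Fin k → ℝ} {w : ℕ → Fin d → ℝ} {η : ℕ → Fin k → ℝ}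

/-- The function `P₀` contracts at rate `1/(2κ₀²)`. The constants are kept explicit, rather than as
powers of `Y`, because they are compared with the prescribed threshold `x_b`. -/
lemma warm_state_le {n : ℕ} (hn : 1 ≤ n) (hx1 : x 1 = 0)
    (hstep : ∀ t, 1 ≤ t → t < n → x (t + 1) = A *ᵥ x t + B *ᵥ u t + w t)
    (hu : ∀ t, 1 ≤ t → t < n → u t = K₀ *ᵥ x t + η t) {W : ℝ} (hW : 0 ≤ W)
    (hw : ∀ t, 1 ≤ t → t < n → en (w t) ^ 2 ≤ W) (hη : ∀ t, 1 ≤ t → t < n → en (η t) ^ 2 ≤ W) :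
    en (x n) ^ 2 ≤ 4 * κ₀ ^ 6 * (1 + ϑ) ^ 2 * W := by
  have h := lyapunov_max (φ := fun t => qf P₀ (x t)) (s := κ₀ ^ 2) (G := p₀ * ((1 + ϑ) ^ 2 * W))
    (one_le_pow₀ S.κ₀_one) (mul_nonneg S.p₀_pos.le (by positivity)) hn (S.qf_P₀_nonneg _)
    (fun t h1 h2 => by
      rw [hstep t h1 h2, hu t h1 h2]
      refine (S.warm_step _ _ _).trans ?_
      gcongr
      exact (S.P₀_le _).trans (mul_le_mul_of_nonneg_left
        (S.en_mixed_noise_le _ _ (hw t h1 h2) (hη t h1 h2)) S.p₀_pos.le))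
  rw [hx1, qf_zero_right, zero_add] at h
  have h2 : α * en (x n) ^ 2 ≤ α * (4 * κ₀ ^ 6 * (1 + ϑ) ^ 2 * W) := by
    refine (S.P₀_ge _).trans (h.trans ?_)
    calc 4 * (κ₀ ^ 2) ^ 2 * (p₀ * ((1 + ϑ) ^ 2 * W))
        ≤ 4 * (κ₀ ^ 2) ^ 2 * (α * κ₀ ^ 2 * ((1 + ϑ) ^ 2 * W)) := by gcongr; exact S.κ₀_ge
      _ = _ := by ring
  exact le_of_mul_le_mul_left h2 S.α_pos

/-- The controller may change at every step, since all good controllers share the Lyapunov function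
`P`. The last factor `κ²` is the ratio of the upper and lower bounds of `P`. -/
lemma main_state_le {N n : ℕ} (hn : N ≤ n) {K : ℕ → Matrix (Fin k) (Fin d) ℝ}
    (hstep : ∀ t, N ≤ t → t < n → x (t + 1) = A *ᵥ x t + B *ᵥ u t + w t)
    (hu : ∀ t, N ≤ t → t < n → u t = K t *ᵥ x t ∧ GoodController A B P κ (K t)) {W : ℝ}
    (hW : 0 ≤ W) (hw : ∀ t, N ≤ t → t < n → en (w t) ^ 2 ≤ W) :
    en (x n) ^ 2 ≤ κ ^ 2 * en (x N) ^ 2 + 4 * κ ^ 6 * W := by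
  have h := lyapunov_max (φ := fun t => qf P (x t)) (s := κ ^ 2) (G := p * W)
    (one_le_pow₀ S.κ_one) (mul_nonneg S.p_pos.le hW) hn (S.qf_P_nonneg _)
    (fun t h1 h2 => by
      rw [hstep t h1 h2, (hu t h1 h2).1]
      refine (S.main_step (hu t h1 h2).2 _ _).trans ?_
      gcongr
      exact (S.P_le _).trans (mul_le_mul_of_nonneg_left (hw t h1 h2) S.p_pos.le))
  have h2 : α * en (x n) ^ 2 ≤ α * (κ ^ 2 * en (x N) ^ 2 + 4 * κ ^ 6 * W) := by
    refine (S.P_ge _).trans (h.trans ?_)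
    calc qf P (x N) + 4 * (κ ^ 2) ^ 2 * (p * W)
        ≤ p * en (x N) ^ 2 + 4 * (κ ^ 2) ^ 2 * (p * W) := by gcongr; exact S.P_le _
      _ ≤ (α * κ ^ 2) * en (x N) ^ 2 + 4 * (κ ^ 2) ^ 2 * ((α * κ ^ 2) * W) := by
        have := S.p_le_mul
        gcongr
      _ = _ := by ring
  exact le_of_mul_le_mul_left h2 S.α_pos

/-- During the warm-up the energy of the states is bounded by the energy of the noise. -/
lemma warm_sum_le {n : ℕ} (hn : 1 ≤ n) (hx1 : x 1 = 0)
    (hstep : ∀ t, 1 ≤ t → t < n → x (t + 1) = A *ᵥ x t + B *ᵥ u t + w t)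
    (hu : ∀ t, 1 ≤ t → t < n → u t = K₀ *ᵥ x t + η t) :
    ∑ t ∈ Finset.Ico 1 n, en (x t) ^ 2
      ≤ Y ^ 7 * ∑ t ∈ Finset.Ico 1 n, (en (w t) ^ 2 + en (η t) ^ 2) := by
  have hY := S.Y_pos
  have h := lyapunov_sum (φ := fun t => qf P₀ (x t)) (s := κ₀ ^ 2)
    (g := fun t => qf P₀ (w t + B *ᵥ η t)) (one_le_pow₀ S.κ₀_one) hn (S.qf_P₀_nonneg _)
    (fun t h1 h2 => by
      rw [hstep t h1 h2, hu t h1 h2]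
      exact S.warm_step _ _ _)
  rw [hx1, qf_zero_right, mul_zero, zero_add] at h
  have hg := fun t => S.qf_mixed_noise_le (w t) (η t)
  set E := ∑ t ∈ Finset.Ico 1 n, (en (w t) ^ 2 + en (η t) ^ 2) with hE
  have hE0 : 0 ≤ E := Finset.sum_nonneg fun t _ => by positivity
  have h4 : ∑ t ∈ Finset.Ico 1 n, qf P₀ (w t + B *ᵥ η t) ≤ 2 * Y ^ 3 * E := by
    rw [hE, Finset.mul_sum]; exact Finset.sum_le_sum fun t _ => hg t
  have h5 : ∑ t ∈ Finset.Ico 1 n, en (x t) ^ 2 ≤ Y * ∑ t ∈ Finset.Ico 1 n, qf P₀ (x t) := by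
    rw [Finset.mul_sum]; exact Finset.sum_le_sum fun t _ => S.en_sq_le_qf_P₀ _
  have hκ4 : 4 * (κ₀ ^ 2) ^ 2 ≤ 4 * Y ^ 2 := by have := S.κ₀_le; gcongr
  calc ∑ t ∈ Finset.Ico 1 n, en (x t) ^ 2 ≤ Y * (4 * (κ₀ ^ 2) ^ 2 * (2 * Y ^ 3 * E)) := by
        refine h5.trans (mul_le_mul_of_nonneg_left (h.trans ?_) hY.le)
        gcongr
    _ ≤ Y * (4 * Y ^ 2 * (2 * Y ^ 3 * E)) := by gcongr
    _ = (8 * Y ^ 6) * E := by ring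
    _ ≤ Y ^ 7 * E := by gcongr; exact S.pow_mul_le (by norm_num) (by norm_num)

/-- With good controllers the energy of the states is bounded by the energy of the noise. -/
lemma main_sum_le {N n : ℕ} (hn : N ≤ n) {K : ℕ → Matrix (Fin k) (Fin d) ℝ}
    (hstep : ∀ t, N ≤ t → t < n → x (t + 1) = A *ᵥ x t + B *ᵥ u t + w t)
    (hu : ∀ t, N ≤ t → t < n → u t = K t *ᵥ x t ∧ GoodController A B P κ (K t)) :
    ∑ t ∈ Finset.Ico N n, en (x t) ^ 2
      ≤ Y ^ 5 * (en (x N) ^ 2 + ∑ t ∈ Finset.Ico N n, en (w t) ^ 2) := by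
  have hY := S.Y_pos
  have h := lyapunov_sum (φ := fun t => qf P (x t)) (s := κ ^ 2)
    (g := fun t => qf P (w t)) (one_le_pow₀ S.κ_one) hn (S.qf_P_nonneg _)
    (fun t h1 h2 => by
      rw [hstep t h1 h2, (hu t h1 h2).1]
      exact S.main_step (hu t h1 h2).2 _ _)
  have hP : ∀ y, qf P y ≤ Y * en y ^ 2 := fun y =>
    (S.P_le y).trans (mul_le_mul_of_nonneg_right S.p_le (sq_nonneg _))
  set E := ∑ t ∈ Finset.Ico N n, en (w t) ^ 2 with hE
  have hE0 : 0 ≤ E := Finset.sum_nonneg fun t _ => by positivity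
  have h4 : ∑ t ∈ Finset.Ico N n, qf P (w t) ≤ Y * E := by
    rw [hE, Finset.mul_sum]; exact Finset.sum_le_sum fun t _ => hP _
  have h5 : ∑ t ∈ Finset.Ico N n, en (x t) ^ 2 ≤ Y * ∑ t ∈ Finset.Ico N n, qf P (x t) := by
    rw [Finset.mul_sum]; exact Finset.sum_le_sum fun t _ => S.en_sq_le_qf_P _
  have hκ2 := S.κ_le
  have hκ4 : 4 * (κ ^ 2) ^ 2 ≤ 4 * Y ^ 2 := by gcongr
  have h6 : 0 ≤ en (x N) ^ 2 := sq_nonneg _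
  have h7 : 2 * κ ^ 2 * qf P (x N) ≤ 2 * Y * (Y * en (x N) ^ 2) :=
    mul_le_mul (by linarith) (hP _) (S.qf_P_nonneg _) (by positivity)
  have h8 : 4 * (κ ^ 2) ^ 2 * ∑ t ∈ Finset.Ico N n, qf P (w t) ≤ 4 * Y ^ 2 * (Y * E) :=
    mul_le_mul hκ4 h4 (Finset.sum_nonneg fun t _ => S.qf_P_nonneg _) (by positivity)
  have e1 : 2 * Y ^ 3 ≤ Y ^ 5 := S.pow_mul_le (by norm_num) (by norm_num)
  have e2 : 4 * Y ^ 4 ≤ Y ^ 5 := S.pow_mul_le (by norm_num) (by norm_num)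
  have h9 := mul_le_mul_of_nonneg_left (h.trans (add_le_add h7 h8)) hY.le
  have h10 := mul_le_mul_of_nonneg_right e1 h6
  have h11 := mul_le_mul_of_nonneg_right e2 hE0
  refine h5.trans (h9.trans ?_)
  linarith

end Setting


/-! ### Lower bounds of empirical Gram matrices -/

section Gram

lemma sum_dot_mul_dot {m : ℕ} (s : Finset ℕ) (p g : ℕ → Fin m → ℝ) (v : Fin m → ℝ) :
    ∑ t ∈ s, (v ⬝ᵥ p t) * (v ⬝ᵥ g t) = ∑ i, ∑ j, v i * v j * ∑ t ∈ s, p t i * g t j := by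
  simp only [dotProduct, Finset.sum_mul_sum]
  simp only [Finset.mul_sum]
  rw [Finset.sum_comm]
  refine Finset.sum_congr rfl fun i _ => ?_
  rw [Finset.sum_comm]
  exact Finset.sum_congr rfl fun j _ => Finset.sum_congr rfl fun t _ => by ring

lemma sum_sum_avg_sq {m : ℕ} (v : Fin m → ℝ) (β : ℝ) :
    ∑ i, ∑ j, (v i ^ 2 + v j ^ 2) / 2 * β = m * β * en v ^ 2 := by
  rw [en_sq_eq_sum]
  simp only [add_div, add_mul, Finset.sum_add_distrib, Finset.sum_const, Finset.card_univ,
    Fintype.card_fin, nsmul_eq_mul, ← Finset.sum_mul, ← Finset.sum_div, ← Finset.mul_sum]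
  ring

lemma abs_mul_mul_le {a b M β : ℝ} (hM : |M| ≤ β) : |a * b * M| ≤ (a ^ 2 + b ^ 2) / 2 * β := by
  rw [abs_mul]
  have h1 : |a * b| ≤ (a ^ 2 + b ^ 2) / 2 := by
    rw [abs_mul]
    nlinarith [sq_nonneg (|a| - |b|), sq_abs a, sq_abs b]
  exact mul_le_mul h1 hM (abs_nonneg _) (by positivity)

/-- Expand the squares and drop those of the predictable part `p`. The diagonal of the noise gives
`γ`; the cross terms (twice) and the off-diagonal noise terms cost `m β` each. -/
lemma gram_lower {m : ℕ} (s : Finset ℕ) (p g : ℕ → Fin m → ℝ) {γ β : ℝ} (hβ : 0 ≤ β)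
    (hγ : ∀ a, γ ≤ ∑ t ∈ s, g t a ^ 2)
    (hg : ∀ a b, a ≠ b → |∑ t ∈ s, g t a * g t b| ≤ β)
    (hp : ∀ a b, |∑ t ∈ s, p t a * g t b| ≤ β) (v : Fin m → ℝ) :
    (γ - 3 * m * β) * en v ^ 2 ≤ ∑ t ∈ s, (v ⬝ᵥ (p t + g t)) ^ 2 := by
  have h1 : ∑ t ∈ s, (v ⬝ᵥ (p t + g t)) ^ 2 = ∑ t ∈ s, (v ⬝ᵥ p t) ^ 2
      + 2 * ∑ t ∈ s, (v ⬝ᵥ p t) * (v ⬝ᵥ g t) + ∑ t ∈ s, (v ⬝ᵥ g t) * (v ⬝ᵥ g t) := by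
    rw [Finset.mul_sum, ← Finset.sum_add_distrib, ← Finset.sum_add_distrib]
    exact Finset.sum_congr rfl fun t _ => by rw [dotProduct_add]; ring
  have h2 : -(m * β * en v ^ 2) ≤ ∑ t ∈ s, (v ⬝ᵥ p t) * (v ⬝ᵥ g t) := by
    rw [sum_dot_mul_dot, ← sum_sum_avg_sq, ← Finset.sum_neg_distrib]
    refine Finset.sum_le_sum fun i _ => ?_
    rw [← Finset.sum_neg_distrib]
    exact Finset.sum_le_sum fun j _ => neg_le_of_abs_le (abs_mul_mul_le (hp i j))
  have h3 : γ * en v ^ 2 - m * β * en v ^ 2 ≤ ∑ t ∈ s, (v ⬝ᵥ g t) * (v ⬝ᵥ g t) := by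
    have e : γ * en v ^ 2 = ∑ i, ∑ j, if i = j then γ * v i ^ 2 else 0 := by
      simp [en_sq_eq_sum, Finset.mul_sum]
    rw [sum_dot_mul_dot, ← sum_sum_avg_sq, e, ← Finset.sum_sub_distrib]
    refine Finset.sum_le_sum fun i _ => ?_
    rw [← Finset.sum_sub_distrib]
    refine Finset.sum_le_sum fun j _ => ?_
    split_ifs with hij
    · subst hij
      have : γ * v i ^ 2 ≤ v i ^ 2 * ∑ t ∈ s, g t i ^ 2 := by
        rw [mul_comm]; exact mul_le_mul_of_nonneg_left (hγ i) (sq_nonneg _)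
      have h4 : 0 ≤ (v i ^ 2 + v i ^ 2) / 2 * β := by positivity
      simp only [← sq]
      linarith
    · rw [zero_sub]; exact neg_le_of_abs_le (abs_mul_mul_le (hg i j hij))
  have h4 : 0 ≤ ∑ t ∈ s, (v ⬝ᵥ p t) ^ 2 := Finset.sum_nonneg fun _ _ => sq_nonneg _
  rw [h1]
  linarith

end Gram

/-! ### Good realizations of the noise -/

/-- The sums `∑ z_s ξ_s` over all intervals of `[1, T]` satisfy a subgaussian bound, if the energy
of `z` grows at most like `V r`. -/
def MartingaleBound (T : ℕ) (σ L V : ℝ) (z ξ : ℕ → ℝ) : Prop :=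
  ∀ l r, 1 ≤ l → l ≤ r → r ≤ T + 1 → ∑ s ∈ Finset.Ico l r, z s ^ 2 ≤ V * r →
    |∑ s ∈ Finset.Ico l r, z s * ξ s| ≤ √(2 * (7 * L) * σ ^ 2 * (V * r))

/-- A trajectory of the system, on an event where the noise has typical size. -/
structure GoodRun {d k : ℕ} (A : Matrix (Fin d) (Fin d) ℝ) (B : Matrix (Fin d) (Fin k) ℝ)
    (K₀ : Matrix (Fin k) (Fin d) ℝ) (σ L V : ℝ) (T : ℕ)
    (x : ℕ → Fin d → ℝ) (u : ℕ → Fin k → ℝ) (w : ℕ → Fin d → ℝ) (η : ℕ → Fin k → ℝ) : Prop where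
  x_one : x 1 = 0
  step : ∀ t, 1 ≤ t → x (t + 1) = A *ᵥ x t + B *ᵥ u t + w t
  w_sq : ∀ t ≤ T, ∀ i, w t i ^ 2 ≤ 2 * (7 * L) * σ ^ 2
  η_sq : ∀ t ≤ T, ∀ j, η t j ^ 2 ≤ 2 * (7 * L) * σ ^ 2
  w_sum_le : ∀ n ≤ T + 1, ∀ i,
    ∑ s ∈ Finset.Ico 1 n, w s i ^ 2 ≤ 4 * σ ^ 2 * ((n - 1 : ℕ) + 7 * L)
  η_sum_le : ∀ n ≤ T + 1, ∀ j,
    ∑ s ∈ Finset.Ico 1 n, η s j ^ 2 ≤ 4 * σ ^ 2 * ((n - 1 : ℕ) + 7 * L)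
  w_sum_ge : ∀ l r, l ≤ r → r ≤ T + 1 → ∀ i,
    σ ^ 2 * ((r - l : ℕ) / 2 - 7 * L) ≤ ∑ s ∈ Finset.Ico l r, w s i ^ 2
  η_sum_ge : ∀ l r, l ≤ r → r ≤ T + 1 → ∀ j,
    σ ^ 2 * ((r - l : ℕ) / 2 - 7 * L) ≤ ∑ s ∈ Finset.Ico l r, η s j ^ 2
  uw : ∀ j i, MartingaleBound T σ L V (fun s => u s j) (fun s => w s i)
  xw : ∀ a i, MartingaleBound T σ L V (fun s => x s a) (fun s => w s i)
  yw : ∀ a i, MartingaleBound T σ L V (fun s => (A *ᵥ x s + B *ᵥ u s) a) (fun s => w s i)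
  xη : ∀ a j, MartingaleBound T σ L V (fun s => (K₀ *ᵥ x s) a) (fun s => η s j)
  ww : ∀ a b, a ≠ b → MartingaleBound T σ L V (fun s => w s a) (fun s => w s b)
  ηη : ∀ a b, a ≠ b → MartingaleBound T σ L V (fun s => η s a) (fun s => η s b)

/-- Exploration around `K₀` before time `N`, then good controllers up to time `n`. -/
structure IsPlayed {d k : ℕ} (A : Matrix (Fin d) (Fin d) ℝ) (B : Matrix (Fin d) (Fin k) ℝ)
    (K₀ : Matrix (Fin k) (Fin d) ℝ) (P : Matrix (Fin d) (Fin d) ℝ) (κ : ℝ)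
    (K : ℕ → Matrix (Fin k) (Fin d) ℝ) (N n : ℕ)
    (x : ℕ → Fin d → ℝ) (u : ℕ → Fin k → ℝ) (η : ℕ → Fin k → ℝ) : Prop where
  one_le : 1 ≤ N
  le : N ≤ n
  warm : ∀ t, 1 ≤ t → t < N → u t = K₀ *ᵥ x t + η t
  main : ∀ t, N ≤ t → t < n → u t = K t *ᵥ x t ∧ GoodController A B P κ (K t)

/-! ### Energy bounds and excitation on a good run. -/

namespace Setting

variable {d k : ℕ} {A : Matrix (Fin d) (Fin d) ℝ} {B : Matrix (Fin d) (Fin k) ℝ}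
  {Q : Matrix (Fin d) (Fin d) ℝ} {R : Matrix (Fin k) (Fin k) ℝ}
  {K₀ Kstar : Matrix (Fin k) (Fin d) ℝ} {P P₀ : Matrix (Fin d) (Fin d) ℝ}
  {α ϑ p p₀ σ κ κ₀ Y L : ℝ} {T : ℕ}
  {x : ℕ → Fin d → ℝ} {u : ℕ → Fin k → ℝ} {w : ℕ → Fin d → ℝ} {η : ℕ → Fin k → ℝ}
  (S : Setting A B Q R K₀ Kstar P P₀ α ϑ p p₀ σ κ κ₀ Y) (hL : 1 ≤ L)
  (G : GoodRun A B K₀ σ L (Y ^ 19) T x u w η)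

include S hL G

lemma en_noise_le {t : ℕ} (ht : t ≤ T) :
    en (w t) ^ 2 ≤ 15 * d * σ ^ 2 * L ∧ en (η t) ^ 2 ≤ 15 * d * σ ^ 2 * L := by
  have hσ : 0 < σ ^ 2 := pow_pos S.σ_pos 2
  have hk : (k : ℝ) ≤ d := by exact_mod_cast S.k_le
  have h0 : 0 ≤ 2 * (7 * L) * σ ^ 2 := by positivity
  constructor
  · rw [en_sq_eq_sum]
    calc ∑ i, w t i ^ 2 ≤ ∑ _i : Fin d, 2 * (7 * L) * σ ^ 2 :=
          Finset.sum_le_sum fun i _ => G.w_sq t ht i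
      _ = d * (2 * (7 * L) * σ ^ 2) := by simp
      _ ≤ _ := by
        have : 0 ≤ d * (σ ^ 2 * L) := by positivity
        nlinarith
  · rw [en_sq_eq_sum]
    calc ∑ i, η t i ^ 2 ≤ ∑ _i : Fin k, 2 * (7 * L) * σ ^ 2 :=
          Finset.sum_le_sum fun i _ => G.η_sq t ht i
      _ = k * (2 * (7 * L) * σ ^ 2) := by simp
      _ ≤ d * (2 * (7 * L) * σ ^ 2) := by gcongr
      _ ≤ _ := by
        have : 0 ≤ d * (σ ^ 2 * L) := by positivity
        nlinarith

lemma noise_energy_le {n : ℕ} (hn : n ≤ T + 1) (hLn : L ≤ n) :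
    ∑ t ∈ Finset.Ico 1 n, (en (w t) ^ 2 + en (η t) ^ 2) ≤ Y ^ 3 * n := by
  have hσ : 0 < σ ^ 2 := pow_pos S.σ_pos 2
  have hY := S.Y_pos
  have hn1 : ((n - 1 : ℕ) : ℝ) ≤ n := by exact_mod_cast Nat.sub_le n 1
  have hb : 4 * σ ^ 2 * (((n - 1 : ℕ) : ℝ) + 7 * L) ≤ 32 * Y * n := by
    calc _ ≤ 4 * Y * (n + 7 * n) := by
          have := S.σ_le
          gcongr
      _ = _ := by ring
  have h1 : ∑ t ∈ Finset.Ico 1 n, en (w t) ^ 2 ≤ Y * (32 * Y * n) := by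
    simp only [en_sq_eq_sum]
    rw [Finset.sum_comm]
    calc _ ≤ ∑ _i : Fin d, 32 * Y * n := Finset.sum_le_sum fun i _ => (G.w_sum_le n hn i).trans hb
      _ = d * (32 * Y * n) := by simp
      _ ≤ _ := by have := S.d_le; gcongr
  have h2 : ∑ t ∈ Finset.Ico 1 n, en (η t) ^ 2 ≤ Y * (32 * Y * n) := by
    simp only [en_sq_eq_sum]
    rw [Finset.sum_comm]
    calc _ ≤ ∑ _i : Fin k, 32 * Y * n := Finset.sum_le_sum fun i _ => (G.η_sum_le n hn i).trans hb
      _ = k * (32 * Y * n) := by simp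
      _ ≤ _ := by have := S.k_leY; gcongr
  rw [Finset.sum_add_distrib]
  calc _ ≤ (64 * Y ^ 2) * n := by linarith
    _ ≤ _ := by gcongr; exact S.pow_mul_le (by norm_num) (by norm_num)

lemma warm_end_le {K : ℕ → Matrix (Fin k) (Fin d) ℝ} {N n : ℕ}
    (hp : IsPlayed A B K₀ P κ K N n x u η) (hn : n ≤ T + 1) :
    en (x N) ^ 2 ≤ 4 * κ₀ ^ 6 * (1 + ϑ) ^ 2 * (15 * d * σ ^ 2 * L) := by
  have hNn := hp.le
  exact S.warm_state_le hp.one_le G.x_one (fun t h1 _ => G.step t h1) hp.warm (by positivity)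
    (fun t _ h2 => (S.en_noise_le hL G (by omega)).1)
    (fun t _ h2 => (S.en_noise_le hL G (by omega)).2)

/-- The noise energy drives the warm-up through `P₀` and the main phases through `P`, restarted from
the bounded state `x N`. The condition `L ≤ n` absorbs the logarithms into the linear bound. -/
lemma state_energy_le {K : ℕ → Matrix (Fin k) (Fin d) ℝ} {N n : ℕ}
    (hp : IsPlayed A B K₀ P κ K N n x u η) (hn : n ≤ T + 1) (hLn : L ≤ n) :
    ∑ t ∈ Finset.Ico 1 n, en (x t) ^ 2 ≤ Y ^ 14 * n := by
  have hY := S.Y_pos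
  have hσ : 0 < σ ^ 2 := pow_pos S.σ_pos 2
  set E := ∑ t ∈ Finset.Ico 1 n, (en (w t) ^ 2 + en (η t) ^ 2) with hE
  have hE1 : E ≤ Y ^ 3 * n := S.noise_energy_le hL G hn hLn
  have h1 : ∑ t ∈ Finset.Ico 1 N, en (x t) ^ 2 ≤ Y ^ 7 * (Y ^ 3 * n) := by
    refine (S.warm_sum_le hp.one_le G.x_one (fun t h1 _ => G.step t h1) hp.warm).trans ?_
    gcongr
    refine le_trans ?_ hE1
    exact Finset.sum_le_sum_of_subset_of_nonneg (Finset.Ico_subset_Ico le_rfl hp.le)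
      fun t _ _ => by positivity
  have h2 : en (x N) ^ 2 ≤ Y ^ 8 * n := by
    refine (S.warm_end_le hL G hp hn).trans ?_
    have hϑ : (1 + ϑ) ^ 2 ≤ (2 * Y) ^ 2 :=
      pow_le_pow_left₀ (by linarith [S.ϑ_nonneg]) (by linarith [S.ϑ_le, S.Y_one]) 2
    have hκ : κ₀ ^ 6 ≤ Y ^ 3 := by
      calc κ₀ ^ 6 = (κ₀ ^ 2) ^ 3 := by ring
        _ ≤ _ := pow_le_pow_left₀ (sq_nonneg _) S.κ₀_le 3
    calc 4 * κ₀ ^ 6 * (1 + ϑ) ^ 2 * (15 * d * σ ^ 2 * L)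
        ≤ 4 * Y ^ 3 * (2 * Y) ^ 2 * (15 * Y * Y * n) := by
          have := S.d_le
          have := S.σ_le
          gcongr
      _ = (240 * Y ^ 7) * n := by ring
      _ ≤ Y ^ 8 * n := by gcongr; exact S.pow_mul_le (by norm_num) (by norm_num)
  have h3 : ∑ t ∈ Finset.Ico N n, en (x t) ^ 2 ≤ Y ^ 5 * (Y ^ 8 * n + Y ^ 3 * n) := by
    refine (S.main_sum_le hp.le (fun t h1 _ => G.step t (hp.one_le.trans h1)) hp.main).trans ?_
    gcongr
    refine le_trans ?_ hE1
    refine (Finset.sum_le_sum fun t _ => ?_).trans (Finset.sum_le_sum_of_subset_of_nonneg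
      (Finset.Ico_subset_Ico hp.one_le le_rfl) fun t _ _ => by positivity)
    linarith [sq_nonneg (en (η t))]
  rw [← Finset.sum_Ico_consecutive _ hp.one_le hp.le]
  have hn0 : (0 : ℝ) ≤ n := Nat.cast_nonneg n
  calc _ ≤ Y ^ 7 * (Y ^ 3 * n) + Y ^ 5 * (Y ^ 8 * n + Y ^ 3 * n) := add_le_add h1 h3
    _ = (Y ^ 10 + Y ^ 13 + Y ^ 8) * n := by ring
    _ ≤ Y ^ 14 * n := by
      gcongr
      have e1 : 1 * Y ^ 10 ≤ Y ^ 13 := S.pow_mul_le (by norm_num) (by norm_num)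
      have e2 : 1 * Y ^ 8 ≤ Y ^ 13 := S.pow_mul_le (by norm_num) (by norm_num)
      have e3 : 3 * Y ^ 13 ≤ Y ^ 14 := S.pow_mul_le (by norm_num) (by norm_num)
      linarith

lemma action_energy_le {K : ℕ → Matrix (Fin k) (Fin d) ℝ} {N n : ℕ}
    (hp : IsPlayed A B K₀ P κ K N n x u η) (hn : n ≤ T + 1) (hLn : L ≤ n) :
    ∑ t ∈ Finset.Ico 1 n, en (u t) ^ 2 ≤ Y ^ 16 * n := by
  have hY := S.Y_pos
  have hn0 : (0 : ℝ) ≤ n := Nat.cast_nonneg n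
  have h1 : ∀ t ∈ Finset.Ico 1 n,
      en (u t) ^ 2 ≤ 2 * Y * en (x t) ^ 2 + 2 * (en (w t) ^ 2 + en (η t) ^ 2) := by
    intro t ht
    rw [Finset.mem_Ico] at ht
    have hx := sq_nonneg (en (x t))
    rcases lt_or_ge t N with h | h
    · rw [hp.warm t ht.1 h]
      have h2 : en (K₀ *ᵥ x t) ^ 2 ≤ Y * en (x t) ^ 2 := by
        refine (en_mulVec_sq_le _ _).trans (mul_le_mul_of_nonneg_right ?_ hx)
        exact (pow_le_pow_left₀ (norm_nonneg _) S.norm_K₀_le 2).trans S.κ₀_le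
      linarith [en_sq_add_le (K₀ *ᵥ x t) (η t), sq_nonneg (en (w t))]
    · obtain ⟨hu, hg⟩ := hp.main t h ht.2
      rw [hu]
      have h2 : en (K t *ᵥ x t) ^ 2 ≤ Y * en (x t) ^ 2 := by
        refine (en_mulVec_sq_le _ _).trans (mul_le_mul_of_nonneg_right ?_ hx)
        exact (pow_le_pow_left₀ (norm_nonneg _) hg.2 2).trans S.κ_le
      have := mul_nonneg hY.le hx
      linarith [sq_nonneg (en (w t)), sq_nonneg (en (η t))]
  refine (Finset.sum_le_sum h1).trans ?_
  rw [Finset.sum_add_distrib, ← Finset.mul_sum, ← Finset.mul_sum]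
  calc _ ≤ 2 * Y * (Y ^ 14 * n) + 2 * (Y ^ 3 * n) := by
        gcongr
        · exact S.state_energy_le hL G hp hn hLn
        · exact S.noise_energy_le hL G hn hLn
    _ = (2 * Y ^ 15 + 2 * Y ^ 3) * n := by ring
    _ ≤ _ := by
      gcongr
      have e1 : 2 * Y ^ 3 ≤ Y ^ 15 := S.pow_mul_le (by norm_num) (by norm_num)
      have e2 : 3 * Y ^ 15 ≤ Y ^ 16 := S.pow_mul_le (by norm_num) (by norm_num)
      linarith

omit hL G in
lemma sqrt_bound_le (hL0 : 0 ≤ L) (r : ℕ) :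
    √(2 * (7 * L) * σ ^ 2 * (Y ^ 19 * r)) ≤ Y ^ 11 * √(L * r) := by
  have hY := S.Y_pos
  rw [Real.sqrt_le_left (by positivity), mul_pow, Real.sq_sqrt (by positivity)]
  calc 2 * (7 * L) * σ ^ 2 * (Y ^ 19 * r) ≤ 2 * (7 * L) * Y * (Y ^ 19 * r) := by
        have := S.σ_le
        gcongr
    _ = (14 * Y ^ 20) * (L * r) := by ring
    _ ≤ Y ^ 22 * (L * r) := by gcongr; exact S.pow_mul_le (by norm_num) (by norm_num)
    _ = _ := by ring

omit G in
/-- A martingale bound with energy control. -/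
lemma martingale_le {z ξ : ℕ → ℝ} (hz : MartingaleBound T σ L (Y ^ 19) z ξ) {l r : ℕ}
    (hl : 1 ≤ l) (hlr : l ≤ r) (hr : r ≤ T + 1) {c : ℕ} (hc : c ≤ 19)
    (hE : ∑ t ∈ Finset.Ico 1 r, z t ^ 2 ≤ Y ^ c * r) :
    |∑ s ∈ Finset.Ico l r, z s * ξ s| ≤ Y ^ 11 * √(L * r) := by
  refine (hz l r hl hlr hr ?_).trans (S.sqrt_bound_le (by linarith) r)
  refine (Finset.sum_le_sum_of_subset_of_nonneg (Finset.Ico_subset_Ico hl le_rfl)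
    fun t _ _ => sq_nonneg _).trans (hE.trans ?_)
  have := pow_le_pow_right₀ S.Y_one hc
  gcongr

omit S hL G in
lemma sum_coord_sq_le {m : ℕ} (z : ℕ → Fin m → ℝ) (s : Finset ℕ) (a : Fin m) :
    ∑ t ∈ s, z t a ^ 2 ≤ ∑ t ∈ s, en (z t) ^ 2 :=
  Finset.sum_le_sum fun t _ => sq_coord_le (z t) a

/-- The energy bounds discharge the condition in `MartingaleBound`, so empirical correlations with
fresh noise are of order `√(L r)`. The exponent 19 comes from the largest energy involved, that of
`A x + B u`. -/
lemma w_mart {K : ℕ → Matrix (Fin k) (Fin d) ℝ} {N l r : ℕ}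
    (hp : IsPlayed A B K₀ P κ K N r x u η) (hn : r ≤ T + 1) (hLn : L ≤ r) (hl : 1 ≤ l)
    (hlr : l ≤ r) :
    (∀ j i, |∑ s ∈ Finset.Ico l r, u s j * w s i| ≤ Y ^ 11 * √(L * r)) ∧
    (∀ j i, |∑ s ∈ Finset.Ico l r, x s j * w s i| ≤ Y ^ 11 * √(L * r)) ∧
    (∀ j i, |∑ s ∈ Finset.Ico l r, (A *ᵥ x s + B *ᵥ u s) j * w s i| ≤ Y ^ 11 * √(L * r)) ∧
    (∀ j i, |∑ s ∈ Finset.Ico l r, (K₀ *ᵥ x s) j * η s i| ≤ Y ^ 11 * √(L * r)) ∧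
    (∀ a b, a ≠ b → |∑ s ∈ Finset.Ico l r, w s a * w s b| ≤ Y ^ 11 * √(L * r)) ∧
    (∀ a b, a ≠ b → |∑ s ∈ Finset.Ico l r, η s a * η s b| ≤ Y ^ 11 * √(L * r)) := by
  have hY := S.Y_pos
  have hx := S.state_energy_le hL G hp hn hLn
  have hu := S.action_energy_le hL G hp hn hLn
  have hw := S.noise_energy_le hL G hn hLn
  have hr0 : (0 : ℝ) ≤ r := Nat.cast_nonneg r
  have hy : ∑ t ∈ Finset.Ico 1 r, en (A *ᵥ x t + B *ᵥ u t) ^ 2 ≤ Y ^ 19 * r := by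
    have h1 : ∀ t ∈ Finset.Ico 1 r, en (A *ᵥ x t + B *ᵥ u t) ^ 2
        ≤ 2 * Y ^ 2 * en (x t) ^ 2 + 2 * Y ^ 2 * en (u t) ^ 2 := by
      intro t _
      have h1 : en (A *ᵥ x t) ^ 2 ≤ Y ^ 2 * en (x t) ^ 2 :=
        (en_mulVec_sq_le _ _).trans (by gcongr; exact S.A_le)
      have h2 : en (B *ᵥ u t) ^ 2 ≤ Y ^ 2 * en (u t) ^ 2 :=
        (en_mulVec_sq_le _ _).trans (by gcongr; exact S.B_le.trans S.ϑ_le)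
      linarith [en_sq_add_le (A *ᵥ x t) (B *ᵥ u t)]
    refine (Finset.sum_le_sum h1).trans ?_
    rw [Finset.sum_add_distrib, ← Finset.mul_sum, ← Finset.mul_sum]
    calc _ ≤ 2 * Y ^ 2 * (Y ^ 14 * r) + 2 * Y ^ 2 * (Y ^ 16 * r) := by gcongr
      _ = (2 * Y ^ 16 + 2 * Y ^ 18) * r := by ring
      _ ≤ _ := by
        gcongr
        have e1 : 2 * Y ^ 16 ≤ Y ^ 18 := S.pow_mul_le (by norm_num) (by norm_num)
        have e2 : 3 * Y ^ 18 ≤ Y ^ 19 := S.pow_mul_le (by norm_num) (by norm_num)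
        linarith
  have hKx : ∑ t ∈ Finset.Ico 1 r, en (K₀ *ᵥ x t) ^ 2 ≤ Y ^ 15 * r := by
    calc _ ≤ ∑ t ∈ Finset.Ico 1 r, Y * en (x t) ^ 2 := by
          refine Finset.sum_le_sum fun t _ => (en_mulVec_sq_le _ _).trans ?_
          refine mul_le_mul_of_nonneg_right ?_ (sq_nonneg _)
          exact (pow_le_pow_left₀ (norm_nonneg _) S.norm_K₀_le 2).trans S.κ₀_le
      _ ≤ Y * (Y ^ 14 * r) := by rw [← Finset.mul_sum]; gcongr
      _ = _ := by ring
  have hw' : ∑ t ∈ Finset.Ico 1 r, en (w t) ^ 2 ≤ Y ^ 3 * r :=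
    (Finset.sum_le_sum fun t _ => by linarith [sq_nonneg (en (η t))]).trans hw
  have hη' : ∑ t ∈ Finset.Ico 1 r, en (η t) ^ 2 ≤ Y ^ 3 * r :=
    (Finset.sum_le_sum fun t _ => by linarith [sq_nonneg (en (w t))]).trans hw
  refine ⟨fun j i => ?_, fun j i => ?_, fun j i => ?_, fun j i => ?_, fun a b hab => ?_,
    fun a b hab => ?_⟩
  · exact S.martingale_le hL (G.uw j i) hl hlr hn (c := 16) (by norm_num)
      ((sum_coord_sq_le u _ j).trans hu)
  · exact S.martingale_le hL (G.xw j i) hl hlr hn (c := 14) (by norm_num)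
      ((sum_coord_sq_le x _ j).trans hx)
  · exact S.martingale_le hL (G.yw j i) hl hlr hn (c := 19) (by norm_num)
      ((sum_coord_sq_le (fun s => A *ᵥ x s + B *ᵥ u s) _ j).trans hy)
  · exact S.martingale_le hL (G.xη j i) hl hlr hn (c := 15) (by norm_num)
      ((sum_coord_sq_le (fun s => K₀ *ᵥ x s) _ j).trans hKx)
  · exact S.martingale_le hL (G.ww a b hab) hl hlr hn (c := 3) (by norm_num)
      ((sum_coord_sq_le w _ a).trans hw')
  · exact S.martingale_le hL (G.ηη a b hab) hl hlr hn (c := 3) (by norm_num)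
      ((sum_coord_sq_le η _ a).trans hη')

omit hL G in
/-- The arithmetic behind the lower bounds of the Gram matrices. -/
lemma gram_const_le {r m : ℕ} (hm : (m : ℝ) ≤ Y) {a : ℝ} (ha : 1 / 4 * (r : ℝ) ≤ a)
    (hr : Y ^ 100 * L ≤ r) :
    2 * ((r : ℝ) / Y ^ 2) ≤ σ ^ 2 * (a - 7 * L) - 3 * m * (Y ^ 11 * √(L * r)) := by
  have hY := S.Y_pos
  have hr0 : (0 : ℝ) ≤ r := Nat.cast_nonneg r
  -- The burn-in `r ≥ Y¹⁰⁰ L` makes correlations of order `√(L r)` negligible against a signal of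
  -- order `r / Y²`.
  have h1 : √(L * r) ≤ r / Y ^ 50 := by
    rw [Real.sqrt_le_left (by positivity), div_pow, le_div_iff₀ (by positivity)]
    calc L * (r : ℝ) * (Y ^ 50) ^ 2 = (Y ^ 100 * L) * r := by ring
      _ ≤ (r : ℝ) * r := mul_le_mul_of_nonneg_right hr hr0
      _ = _ := by ring
  have h2 : L ≤ r / Y ^ 100 := by rw [le_div_iff₀ (by positivity)]; linarith
  have h3 : (r : ℝ) / Y ^ 100 ≤ r / 1000 := by
    have : 1 * Y ^ 1 ≤ Y ^ 100 := S.pow_mul_le (by norm_num) (by norm_num)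
    have : 1000 ≤ Y ^ 100 := by linarith [S.Y_ge]
    gcongr
  have h4 : 1 / 5 * (r : ℝ) ≤ a - 7 * L := by linarith
  have h5 : Y⁻¹ * (1 / 5 * (r : ℝ)) ≤ σ ^ 2 * (a - 7 * L) :=
    mul_le_mul S.σ_ge h4 (by positivity) (sq_nonneg _)
  have h6 : 3 * m * (Y ^ 11 * √(L * r)) ≤ r / Y ^ 2 := by
    calc _ ≤ 3 * Y * (Y ^ 11 * (r / Y ^ 50)) := by gcongr
      _ = (3 * Y ^ 12) * (r / Y ^ 50) := by ring
      _ ≤ Y ^ 48 * (r / Y ^ 50) :=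
        mul_le_mul_of_nonneg_right (S.pow_mul_le (by norm_num) (by norm_num))
          (div_nonneg hr0 (pow_nonneg hY.le _))
      _ = _ := by field_simp
  have h7 : 3 * (r / Y ^ 2) ≤ Y⁻¹ * (1 / 5 * (r : ℝ)) := by
    rw [← sub_nonneg]
    have : Y⁻¹ * (1 / 5 * (r : ℝ)) - 3 * (r / Y ^ 2) = r / Y ^ 2 * (Y / 5 - 3) := by field_simp
    rw [this]
    have := S.Y_ge
    exact mul_nonneg (by positivity) (by linarith)
  linarith

/-- The exploration noise excites all actions. -/
lemma warm_gram {K : ℕ → Matrix (Fin k) (Fin d) ℝ} {N n : ℕ}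
    (hp : IsPlayed A B K₀ P κ K N n x u η) (hn : N ≤ T + 1) (hN : Y ^ 100 * L ≤ N)
    (v : Fin k → ℝ) :
    (N : ℝ) / Y ^ 2 * en v ^ 2 ≤ ∑ s ∈ Finset.Ico 1 N, (v ⬝ᵥ u s) ^ 2 := by
  have hY := S.Y_pos
  have hYL : L ≤ Y ^ 100 * L := le_mul_of_one_le_left (by linarith) (one_le_pow₀ S.Y_one)
  have hp' : IsPlayed A B K₀ P κ K N N x u η :=
    ⟨hp.one_le, le_rfl, hp.warm, fun t h1 h2 => absurd h1 (by omega)⟩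
  obtain ⟨-, -, -, hm, -, hη⟩ := S.w_mart hL G hp' hn (by linarith) le_rfl hp.one_le
  have h := gram_lower (Finset.Ico 1 N) (fun s => K₀ *ᵥ x s) η (by positivity)
    (G.η_sum_ge 1 N hp.one_le hn) hη hm v
  have h2 : ∑ s ∈ Finset.Ico 1 N, (v ⬝ᵥ u s) ^ 2
      = ∑ s ∈ Finset.Ico 1 N, (v ⬝ᵥ (K₀ *ᵥ x s + η s)) ^ 2 := by
    refine Finset.sum_congr rfl fun s hs => ?_
    rw [Finset.mem_Ico] at hs
    rw [hp.warm s hs.1 hs.2]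
  rw [h2]
  refine le_trans (mul_le_mul_of_nonneg_right ?_ (sq_nonneg _)) h
  have hN0 : 0 ≤ (N : ℝ) / Y ^ 2 := by positivity
  refine le_trans (by linarith) (S.gram_const_le S.k_leY ?_ hN)
  have hN1 : (1000 : ℝ) ≤ N := by
    have : 1 * Y ^ 1 ≤ Y ^ 100 := S.pow_mul_le (by norm_num) (by norm_num)
    nlinarith [S.Y_ge]
  rw [Nat.cast_sub hp.one_le, Nat.cast_one]
  linarith

/-- The process noise excites all states. -/
lemma state_gram {K : ℕ → Matrix (Fin k) (Fin d) ℝ} {N n l : ℕ}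
    (hp : IsPlayed A B K₀ P κ K N n x u η) (hNl : N ≤ l) (hn : 4 * l ≤ n) (hT : n ≤ T + 1)
    (hl : Y ^ 200 * L ≤ l) (v : Fin d → ℝ) :
    ((4 * l : ℕ) : ℝ) / Y ^ 2 * en v ^ 2 ≤ ∑ s ∈ Finset.Ico l (4 * l), (v ⬝ᵥ x s) ^ 2 := by
  have hY := S.Y_pos
  have hl1 : (1000 : ℝ) ≤ l := by
    have : 1 * Y ^ 1 ≤ Y ^ 200 := S.pow_mul_le (by norm_num) (by norm_num)
    nlinarith [S.Y_ge]
  have hl1' : 1000 ≤ l := by exact_mod_cast hl1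
  -- The state at time `s + 1` contains the noise of time `s`, so states on `[l, 4l)` are compared
  -- with noise on the interval shifted by one, `[m, r)`.
  obtain ⟨m, rfl⟩ : ∃ m, l = m + 1 := ⟨l - 1, by omega⟩
  set r := 4 * (m + 1) - 1 with hr
  have hr' : 4 * (m + 1) = r + 1 := by omega
  have hrc : (r : ℝ) = 4 * m + 3 := by
    have : r = 4 * m + 3 := by omega
    rw [this]; push_cast; ring
  push_cast at hl hl1
  have hrL : Y ^ 100 * L ≤ r := by
    have h1 : Y ^ 100 * L ≤ Y ^ 200 * L := by
      have := S.Y_one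
      gcongr
      norm_num
    linarith
  have hYL : L ≤ Y ^ 100 * L := le_mul_of_one_le_left (by linarith) (one_le_pow₀ S.Y_one)
  have hp' : IsPlayed A B K₀ P κ K N r x u η :=
    ⟨hp.one_le, by omega, hp.warm, fun t h1 h2 => hp.main t h1 (by omega)⟩
  obtain ⟨-, -, hm, -, hw, -⟩ := S.w_mart hL G (l := m) hp' (by omega) (by linarith)
    (by omega) (by omega)
  have h := gram_lower (Finset.Ico m r) (fun s => A *ᵥ x s + B *ᵥ u s) w (by positivity)
    (G.w_sum_ge m r (by omega) (by omega)) hw hm v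
  rw [hr', ← Finset.sum_Ico_add' (fun s => (v ⬝ᵥ x s) ^ 2) m r 1]
  have h2 : ∑ s ∈ Finset.Ico m r, (v ⬝ᵥ x (s + 1)) ^ 2
      = ∑ s ∈ Finset.Ico m r, (v ⬝ᵥ (A *ᵥ x s + B *ᵥ u s + w s)) ^ 2 := by
    refine Finset.sum_congr rfl fun s hs => ?_
    rw [Finset.mem_Ico] at hs
    rw [G.step s (by omega)]
  rw [h2]
  refine le_trans (mul_le_mul_of_nonneg_right ?_ (sq_nonneg _)) h
  refine le_trans ?_ (S.gram_const_le S.d_le (r := r) ?_ hrL)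
  · rw [← mul_div_assoc]
    refine div_le_div_of_nonneg_right ?_ (pow_nonneg hY.le _)
    push_cast
    linarith
  · rw [Nat.cast_sub (by omega : m ≤ r), hrc]
    linarith

end Setting


/-! ### The error of the least squares estimate -/

lemma abs_coord_le {m : ℕ} (v : Fin m → ℝ) (j : Fin m) : |v j| ≤ en v := by
  have := sq_le_sq.1 (sq_coord_le v j)
  rwa [abs_of_nonneg (en_nonneg v)] at this

lemma abs_sum_dot_mul_le {m : ℕ} (s : Finset ℕ) (z : ℕ → Fin m → ℝ) (ξ : ℕ → ℝ) {β : ℝ}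
    (h : ∀ j, |∑ t ∈ s, z t j * ξ t| ≤ β) (v : Fin m → ℝ) :
    |∑ t ∈ s, (v ⬝ᵥ z t) * ξ t| ≤ m * β * en v := by
  have e : ∑ t ∈ s, (v ⬝ᵥ z t) * ξ t = ∑ j, v j * ∑ t ∈ s, z t j * ξ t := by
    simp only [dotProduct, Finset.sum_mul, Finset.mul_sum]
    rw [Finset.sum_comm]
    exact Finset.sum_congr rfl fun j _ => Finset.sum_congr rfl fun t _ => by ring
  rw [e]
  calc |∑ j, v j * ∑ t ∈ s, z t j * ξ t| ≤ ∑ j, |v j * ∑ t ∈ s, z t j * ξ t| :=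
        Finset.abs_sum_le_sum_abs _ _
    _ ≤ ∑ _j : Fin m, en v * β := by
        refine Finset.sum_le_sum fun j _ => ?_
        rw [abs_mul]
        exact mul_le_mul (abs_coord_le v j) (h j) (abs_nonneg _) (en_nonneg v)
    _ = _ := by simp; ring

/-- The normal equations, tested against a row of the estimation error. -/
lemma ls_identity {d k : ℕ} {A : Matrix (Fin d) (Fin d) ℝ} {B : Matrix (Fin d) (Fin k) ℝ}
    {x : ℕ → Fin d → ℝ} {u : ℕ → Fin k → ℝ} {w : ℕ → Fin d → ℝ}
    (hstep : ∀ t, 1 ≤ t → x (t + 1) = A *ᵥ x t + B *ᵥ u t + w t) {lam : ℝ} (hlam : 0 < lam)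
    (n : ℕ) (a : Fin d) {v : Fin k → ℝ} (hv : v = (lsEstimate A lam (x, u) n - B) a) :
    lam * en v ^ 2 + ∑ s ∈ Finset.Ico 1 n, (v ⬝ᵥ u s) ^ 2
      = ∑ s ∈ Finset.Ico 1 n, (v ⬝ᵥ u s) * w s a - lam * (v ⬝ᵥ B a) := by
  have h := dot_lsEstimate A hlam (x, u) n a v
  have hB : lsEstimate A lam (x, u) n a = v + B a := by
    rw [hv]; change _ = (_ - B a) + B a; rw [sub_add_cancel]
  rw [hB, dot_lsGram, dot_lsCross, dotProduct_add, ← en_sq] at h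
  have h1 : ∑ s ∈ Finset.Ico 1 n, (v ⬝ᵥ u s) * ((v + B a) ⬝ᵥ u s)
      = ∑ s ∈ Finset.Ico 1 n, (v ⬝ᵥ u s) ^ 2
        + ∑ s ∈ Finset.Ico 1 n, (v ⬝ᵥ u s) * (B a ⬝ᵥ u s) := by
    rw [← Finset.sum_add_distrib]
    exact Finset.sum_congr rfl fun s _ => by rw [add_dotProduct]; ring
  have h2 : ∑ s ∈ Finset.Ico 1 n, (x (s + 1) a - (A *ᵥ x s) a) * (v ⬝ᵥ u s)
      = ∑ s ∈ Finset.Ico 1 n, (v ⬝ᵥ u s) * (B a ⬝ᵥ u s)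
        + ∑ s ∈ Finset.Ico 1 n, (v ⬝ᵥ u s) * w s a := by
    rw [← Finset.sum_add_distrib]
    refine Finset.sum_congr rfl fun s hs => ?_
    rw [hstep s (Finset.mem_Ico.1 hs).1]
    change ((A *ᵥ x s) a + B a ⬝ᵥ u s + w s a - _) * _ = _
    ring
  rw [h1, h2] at h
  linarith

/-- Used with `a = √τ_j ‖v‖`, `b = √τ_i ‖K⋆ᵀ v‖` and `q = √L`. The Gram matrix is quadratic in `a,
b` and the noise only linear, so both are at most a multiple of `q`. -/
lemma quadratic_bound {Y q a b X : ℝ} (hY : 1000 ≤ Y) (hq : 0 ≤ q) (ha : 0 ≤ a) (hb : 0 ≤ b)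
    (h1 : (a ^ 2 + b ^ 2 / 4) / Y ^ 2 ≤ X) (h2 : X ≤ Y ^ 12 * q * a + 4 * Y ^ 12 * q * b + q * a) :
    a ^ 2 ≤ Y ^ 30 * q ^ 2 ∧ b ^ 2 ≤ Y ^ 30 * q ^ 2 := by
  have hY0 : 0 < Y := by linarith
  have h3 : q * a ≤ Y ^ 12 * q * a := by
    have : 1 ≤ Y ^ 12 := one_le_pow₀ (by linarith)
    have h4 := mul_nonneg hq ha
    nlinarith
  have h4 : 0 ≤ Y ^ 12 * q * a := by positivity
  have h4' : 0 ≤ Y ^ 12 * q * b := by positivity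
  have h5 : (a ^ 2 + b ^ 2 / 4) / Y ^ 2 ≤ 5 * (Y ^ 12 * q) * (a + b) := by linarith
  rw [div_le_iff₀ (by positivity)] at h5
  set D := Y ^ 14 * q with hD
  have hD0 : 0 ≤ D := by positivity
  have e : 5 * (Y ^ 12 * q) * (a + b) * Y ^ 2 = 5 * D * (a + b) := by rw [hD]; ring
  rw [e] at h5
  have h6 : (a + b) * (a + b) ≤ (40 * D) * (a + b) := by
    nlinarith [sq_nonneg (a - b), sq_nonneg a]
  have h7 : a + b ≤ 40 * D := by
    rcases (add_nonneg ha hb).eq_or_lt with h0 | h0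
    · rw [← h0]; positivity
    · exact le_of_mul_le_mul_right h6 h0
  have h8 : (40 * D) ^ 2 ≤ Y ^ 30 * q ^ 2 := by
    have : (40 * D) ^ 2 = 1600 * (Y ^ 28 * q ^ 2) := by rw [hD]; ring
    rw [this]
    have h9 : (1600 : ℝ) ≤ Y ^ 2 := by nlinarith
    have h10 : 0 ≤ Y ^ 28 * q ^ 2 := by positivity
    calc 1600 * (Y ^ 28 * q ^ 2) ≤ Y ^ 2 * (Y ^ 28 * q ^ 2) := mul_le_mul_of_nonneg_right h9 h10
      _ = _ := by ring
  exact ⟨(pow_le_pow_left₀ ha (by linarith) 2).trans h8,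
    (pow_le_pow_left₀ hb (by linarith) 2).trans h8⟩

namespace Setting

variable {d k : ℕ} {A : Matrix (Fin d) (Fin d) ℝ} {B : Matrix (Fin d) (Fin k) ℝ}
  {Q : Matrix (Fin d) (Fin d) ℝ} {R : Matrix (Fin k) (Fin k) ℝ}
  {K₀ Kstar : Matrix (Fin k) (Fin d) ℝ} {P P₀ : Matrix (Fin d) (Fin d) ℝ}
  {α ϑ p p₀ σ κ κ₀ Y L : ℝ} {T : ℕ}
  {x : ℕ → Fin d → ℝ} {u : ℕ → Fin k → ℝ} {w : ℕ → Fin d → ℝ} {η : ℕ → Fin k → ℝ}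
  (S : Setting A B Q R K₀ Kstar P P₀ α ϑ p p₀ σ κ κ₀ Y) (hL : 1 ≤ L)
  (G : GoodRun A B K₀ σ L (Y ^ 19) T x u w η)

section
include S

/-- The optimal controller depends in a Lipschitz way on `B`. -/
lemma optController_sub_le {B' : Matrix (Fin d) (Fin k) ℝ} {ε : ℝ} (hε : 0 ≤ ε)
    (hε1 : Y ^ 7 * ε ≤ 1) (hB : ‖B' - B‖ ≤ ε) : ‖optController Q R A B' - Kstar‖ ≤ Y ^ 14 * ε := by
  obtain ⟨-, -, h⟩ := riccati_sensitivity S.Q_posDef S.R_posDef S.riccati S.Y_ge hε hε1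
    (fun x => (mul_le_mul_of_nonneg_right S.α_ge (sq_nonneg _)).trans (S.Q_ge x))
    (fun x => (mul_le_mul_of_nonneg_right S.α_ge (sq_nonneg _)).trans (S.R_ge x))
    S.norm_P_le S.A_le (S.B_le.trans S.ϑ_le) (A' := A) (B' := B')
    (by rw [sub_self, norm_zero]; exact hε) hB
  rwa [S.Kstar_eq] at h

end

include S hL G

/-- In the main phases, the noise enters through the controllers of these phases only. -/
lemma phase_noise_le {K : ℕ → Matrix (Fin k) (Fin d) ℝ} {n j i τ₀ : ℕ} (hji : j ≤ i)
    (hp : IsPlayed A B K₀ P κ K (τ₀ * 4 ^ j) n x u η) (hn : τ₀ * 4 ^ i ≤ n) (hT : n ≤ T + 1)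
    (hτ : L ≤ τ₀) {Kl : ℕ → Matrix (Fin k) (Fin d) ℝ}
    (hKl : ∀ l, j ≤ l → l < i → ∀ s, τ₀ * 4 ^ l ≤ s → s < τ₀ * 4 ^ (l + 1) → u s = Kl l *ᵥ x s)
    (v : Fin k → ℝ) {c : ℝ} (hc0 : 0 ≤ c)
    (hc : ∀ l, j ≤ l → l < i → en ((Kl l)ᵀ *ᵥ v) ≤ 2 * c) (a : Fin d) :
    |∑ s ∈ Finset.Ico (τ₀ * 4 ^ j) (τ₀ * 4 ^ i), (v ⬝ᵥ u s) * w s a|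
      ≤ 4 * c * Y ^ 12 * √(L * (τ₀ * 4 ^ i : ℕ)) := by
  have hY := S.Y_pos
  induction i, hji using Nat.le_induction with
  | base => simp only [Finset.Ico_self, Finset.sum_empty, abs_zero]; positivity
  | succ i hji ih =>
    have hm : τ₀ * 4 ^ i ≤ τ₀ * 4 ^ (i + 1) :=
      Nat.mul_le_mul_left _ (Nat.pow_le_pow_right (by norm_num) (by omega))
    have hmj : τ₀ * 4 ^ j ≤ τ₀ * 4 ^ i :=
      Nat.mul_le_mul_left _ (Nat.pow_le_pow_right (by norm_num) hji)
    have ih' := ih (by omega) (fun l h1 h2 => hKl l h1 (by omega)) (fun l h1 h2 => hc l h1 (by omega))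
    have hp' : IsPlayed A B K₀ P κ K (τ₀ * 4 ^ j) (τ₀ * 4 ^ (i + 1)) x u η :=
      ⟨hp.one_le, by omega, hp.warm, fun t h1 h2 => hp.main t h1 (by omega)⟩
    have hLr : L ≤ (τ₀ * 4 ^ (i + 1) : ℕ) := by
      refine hτ.trans ?_
      exact_mod_cast Nat.le_mul_of_pos_right _ (by positivity)
    obtain ⟨-, hx, -⟩ := S.w_mart hL G hp' (by omega) hLr (hp.one_le.trans hmj) hm
    have h2 : |∑ s ∈ Finset.Ico (τ₀ * 4 ^ i) (τ₀ * 4 ^ (i + 1)), (v ⬝ᵥ u s) * w s a|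
        ≤ 2 * c * Y ^ 12 * √(L * (τ₀ * 4 ^ (i + 1) : ℕ)) := by
      -- As `u = K x`, the direction `v` enters only through `Kᵀ v`. The noise is therefore
      -- proportional to `‖Kᵀ v‖`, matching what the phase explores.
      have e : ∑ s ∈ Finset.Ico (τ₀ * 4 ^ i) (τ₀ * 4 ^ (i + 1)), (v ⬝ᵥ u s) * w s a
          = ∑ s ∈ Finset.Ico (τ₀ * 4 ^ i) (τ₀ * 4 ^ (i + 1)), (((Kl i)ᵀ *ᵥ v) ⬝ᵥ x s) * w s a := by
        refine Finset.sum_congr rfl fun s hs => ?_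
        rw [Finset.mem_Ico] at hs
        rw [hKl i hji (by omega) s hs.1 hs.2, dot_mulVec]
      rw [e]
      refine (abs_sum_dot_mul_le _ x (fun s => w s a) (fun b => hx b a) _).trans ?_
      calc d * (Y ^ 11 * √(L * (τ₀ * 4 ^ (i + 1) : ℕ))) * en ((Kl i)ᵀ *ᵥ v)
          ≤ Y * (Y ^ 11 * √(L * (τ₀ * 4 ^ (i + 1) : ℕ))) * (2 * c) := by
            refine mul_le_mul (mul_le_mul_of_nonneg_right S.d_le (by positivity))
              (hc i hji (by omega)) (en_nonneg _) (by positivity)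
        _ = _ := by ring
    -- The square root doubles from phase to phase: the contributions `2c` per phase form a
    -- geometric series, dominated by `4c` times the last root.
    have h3 : √(L * (τ₀ * 4 ^ (i + 1) : ℕ)) = 2 * √(L * (τ₀ * 4 ^ i : ℕ)) := by
      have : L * ((τ₀ * 4 ^ (i + 1) : ℕ) : ℝ) = 2 ^ 2 * (L * (τ₀ * 4 ^ i : ℕ)) := by
        push_cast; ring
      rw [this, Real.sqrt_mul (by norm_num), Real.sqrt_sq (by norm_num)]
    rw [← Finset.sum_Ico_consecutive _ hmj hm]
    refine (abs_add_le _ _).trans ((add_le_add ih' h2).trans ?_)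
    rw [h3]
    exact le_of_eq (by ring)

/-- The rows of the estimation error are small, in the directions that were explored. -/
lemma ls_error {K : ℕ → Matrix (Fin k) (Fin d) ℝ} {j i τ₀ : ℕ} (hji : j ≤ i)
    (hp : IsPlayed A B K₀ P κ K (τ₀ * 4 ^ j) (τ₀ * 4 ^ i) x u η) (hT : τ₀ * 4 ^ i ≤ T + 1)
    (hτ : Y ^ 200 * L ≤ τ₀) {Kl : ℕ → Matrix (Fin k) (Fin d) ℝ}
    (hKl : ∀ l, j ≤ l → l < i → ∀ s, τ₀ * 4 ^ l ≤ s → s < τ₀ * 4 ^ (l + 1) → u s = Kl l *ᵥ x s)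
    (hc : ∀ l, j ≤ l → l < i → ∀ v, en ((Kl l)ᵀ *ᵥ v) ≤ 2 * en (Kstarᵀ *ᵥ v) ∧
      en (Kstarᵀ *ᵥ v) ≤ 2 * en ((Kl l)ᵀ *ᵥ v)) {lam : ℝ} (hlam : 0 < lam)
    (hlam_le : lam ≤ Y ^ 10 * L) (a : Fin d) {v : Fin k → ℝ}
    (hv : v = (lsEstimate A lam (x, u) (τ₀ * 4 ^ i) - B) a) :
    (τ₀ * 4 ^ j : ℕ) * en v ^ 2 ≤ Y ^ 30 * L ∧
      (j < i → (τ₀ * 4 ^ i : ℕ) * en (Kstarᵀ *ᵥ v) ^ 2 ≤ Y ^ 30 * L) := by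
  have hY := S.Y_pos
  have hL0 : 0 ≤ L := by linarith
  have hYL : ∀ m ≤ 200, Y ^ m * L ≤ τ₀ := fun m hm =>
    (mul_le_mul_of_nonneg_right (pow_le_pow_right₀ S.Y_one hm) hL0).trans hτ
  have hτm : ∀ l, (τ₀ : ℝ) ≤ (τ₀ * 4 ^ l : ℕ) := fun l => by
    exact_mod_cast Nat.le_mul_of_pos_right _ (by positivity)
  have hLτ : L ≤ τ₀ := by simpa using hYL 0 (by norm_num)
  have hid := ls_identity G.step hlam (τ₀ * 4 ^ i) a hv
  rw [← Finset.sum_Ico_consecutive _ hp.one_le hp.le,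
    ← Finset.sum_Ico_consecutive _ hp.one_le hp.le] at hid
  have hp0 : IsPlayed A B K₀ P κ K (τ₀ * 4 ^ j) (τ₀ * 4 ^ j) x u η :=
    ⟨hp.one_le, le_rfl, hp.warm, fun t h1 h2 => absurd h1 (by omega)⟩
  have hjT : τ₀ * 4 ^ j ≤ T + 1 := hp.le.trans hT
  set E := en v with hE
  have hE0 : 0 ≤ E := en_nonneg v
  set q := √L with hq
  have hq2 : q ^ 2 = L := Real.sq_sqrt hL0
  have hq0 : 0 ≤ q := Real.sqrt_nonneg _
  -- lower bound of the first block
  have hX1 := S.warm_gram hL G hp0 hjT ((hYL 100 (by norm_num)).trans (hτm j)) v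
  -- noise of the first block
  have hN1 : |∑ s ∈ Finset.Ico 1 (τ₀ * 4 ^ j), (v ⬝ᵥ u s) * w s a|
      ≤ Y ^ 12 * q * (√(τ₀ * 4 ^ j : ℕ) * E) := by
    obtain ⟨hu, -⟩ := S.w_mart hL G hp0 hjT (hLτ.trans (hτm j)) le_rfl hp.one_le
    refine (abs_sum_dot_mul_le _ u (fun s => w s a) (fun b => hu b a) _).trans ?_
    rw [Real.sqrt_mul hL0]
    calc k * (Y ^ 11 * (q * √(τ₀ * 4 ^ j : ℕ))) * E
        ≤ Y * (Y ^ 11 * (q * √(τ₀ * 4 ^ j : ℕ))) * E := by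
          refine mul_le_mul_of_nonneg_right (mul_le_mul_of_nonneg_right S.k_leY ?_) hE0
          positivity
      _ = _ := by ring
  -- regularization
  have hreg : |lam * (v ⬝ᵥ B a)| ≤ q * (√(τ₀ * 4 ^ j : ℕ) * E) := by
    rw [abs_mul, abs_of_pos hlam]
    have h1 : |v ⬝ᵥ B a| ≤ E * Y := (abs_dot_le v (B a)).trans
      (mul_le_mul_of_nonneg_left ((en_row_le B a).trans (S.B_le.trans S.ϑ_le)) hE0)
    have h2 : Y ^ 11 * q ≤ √(τ₀ * 4 ^ j : ℕ) := by
      refine Real.le_sqrt_of_sq_le ?_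
      calc (Y ^ 11 * q) ^ 2 = Y ^ 22 * L := by rw [mul_pow, hq2]; ring
        _ ≤ _ := (hYL 22 (by norm_num)).trans (hτm j)
    calc lam * |v ⬝ᵥ B a| ≤ (Y ^ 10 * L) * (E * Y) :=
          mul_le_mul hlam_le h1 (abs_nonneg _) (by positivity)
      _ = q * ((Y ^ 11 * q) * E) := by rw [← hq2]; ring
      _ ≤ _ := by gcongr
  have hlamE : 0 ≤ lam * E ^ 2 := by positivity
  have hsq : ∀ (n : ℕ) (y : ℝ), (√(n : ℝ) * y) ^ 2 = n * y ^ 2 := fun n y => by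
    rw [mul_pow, Real.sq_sqrt (Nat.cast_nonneg n)]
  rcases hji.eq_or_lt with rfl | hlt
  · rw [Finset.Ico_self, Finset.sum_empty, Finset.sum_empty, add_zero, add_zero] at hid
    have := quadratic_bound (b := 0) (X := ∑ s ∈ Finset.Ico 1 (τ₀ * 4 ^ j), (v ⬝ᵥ u s) ^ 2)
      S.Y_ge hq0 (a := √(τ₀ * 4 ^ j : ℕ) * E) (by positivity) le_rfl
      (by rw [hsq]; refine le_trans (le_of_eq ?_) hX1; ring)
      (by linarith [le_abs_self (∑ s ∈ Finset.Ico 1 (τ₀ * 4 ^ j), (v ⬝ᵥ u s) * w s a),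
            neg_abs_le (lam * (v ⬝ᵥ B a))])
    rw [hsq, hq2] at this
    exact ⟨this.1, fun h => absurd h (lt_irrefl _)⟩
  · obtain ⟨m, rfl⟩ : ∃ m, i = m + 1 := ⟨i - 1, by omega⟩
    set c := en (Kstarᵀ *ᵥ v) with hcdef
    have hc0 : 0 ≤ c := en_nonneg _
    have hN2 := S.phase_noise_le hL G hji hp le_rfl hT hLτ hKl v hc0
      (fun l h1 h2 => (hc l h1 h2 v).1) a
    rw [Real.sqrt_mul hL0] at hN2
    have hjm : τ₀ * 4 ^ j ≤ τ₀ * 4 ^ m :=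
      Nat.mul_le_mul_left _ (Nat.pow_le_pow_right (by norm_num) (by omega))
    have h4 : τ₀ * 4 ^ (m + 1) = 4 * (τ₀ * 4 ^ m) := by ring
    -- Only the last phase, with controller `Kl m`, is used for the lower bound. It makes up three
    -- quarters of all the times.
    have hX2 : ((τ₀ * 4 ^ (m + 1) : ℕ) : ℝ) / Y ^ 2 * (c ^ 2 / 4)
        ≤ ∑ s ∈ Finset.Ico (τ₀ * 4 ^ j) (τ₀ * 4 ^ (m + 1)), (v ⬝ᵥ u s) ^ 2 := by
      have hg := S.state_gram hL G hp hjm h4.symm.le hT (hτ.trans (hτm m)) ((Kl m)ᵀ *ᵥ v)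
      have h5 : c ^ 2 / 4 ≤ en ((Kl m)ᵀ *ᵥ v) ^ 2 := by
        have h6 := pow_le_pow_left₀ hc0 (hc m (by omega) (by omega) v).2 2
        linarith
      rw [← h4] at hg
      refine (mul_le_mul_of_nonneg_left h5 (by positivity)).trans (hg.trans ?_)
      refine le_trans (le_of_eq ?_) (Finset.sum_le_sum_of_subset_of_nonneg
        (Finset.Ico_subset_Ico hjm le_rfl) fun s _ _ => sq_nonneg _)
      refine Finset.sum_congr rfl fun s hs => ?_
      rw [Finset.mem_Ico] at hs
      rw [hKl m (by omega) (by omega) s hs.1 hs.2, dot_mulVec]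
    have := quadratic_bound (X := ∑ s ∈ Finset.Ico 1 (τ₀ * 4 ^ j), (v ⬝ᵥ u s) ^ 2
        + ∑ s ∈ Finset.Ico (τ₀ * 4 ^ j) (τ₀ * 4 ^ (m + 1)), (v ⬝ᵥ u s) ^ 2)
      S.Y_ge hq0 (a := √(τ₀ * 4 ^ j : ℕ) * E) (b := √(τ₀ * 4 ^ (m + 1) : ℕ) * c)
      (by positivity) (by positivity)
      (by rw [hsq, hsq]; refine le_trans (le_of_eq ?_) (add_le_add hX1 hX2); ring)
      (by linarith [le_abs_self (∑ s ∈ Finset.Ico 1 (τ₀ * 4 ^ j), (v ⬝ᵥ u s) * w s a),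
            neg_abs_le (lam * (v ⬝ᵥ B a)), le_abs_self (∑ s ∈ Finset.Ico (τ₀ * 4 ^ j)
              (τ₀ * 4 ^ (m + 1)), (v ⬝ᵥ u s) * w s a)])
    rw [hsq, hsq, hq2] at this
    exact ⟨this.1, fun _ => this.2⟩

/-- The certainty equivalent controllers are close to the optimal one. -/
lemma controller_error {K : ℕ → Matrix (Fin k) (Fin d) ℝ} {j i τ₀ : ℕ} (hji : j ≤ i)
    (hp : IsPlayed A B K₀ P κ K (τ₀ * 4 ^ j) (τ₀ * 4 ^ i) x u η) (hT : τ₀ * 4 ^ i ≤ T + 1)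
    (hτ : Y ^ 200 * L ≤ τ₀) {Kl : ℕ → Matrix (Fin k) (Fin d) ℝ}
    (hKl : ∀ l, j ≤ l → l < i → ∀ s, τ₀ * 4 ^ l ≤ s → s < τ₀ * 4 ^ (l + 1) → u s = Kl l *ᵥ x s)
    (hc : ∀ l, j ≤ l → l < i → ∀ v, en ((Kl l)ᵀ *ᵥ v) ≤ 2 * en (Kstarᵀ *ᵥ v) ∧
      en (Kstarᵀ *ᵥ v) ≤ 2 * en ((Kl l)ᵀ *ᵥ v)) {lam : ℝ} (hlam : 0 < lam)
    (hlam_le : lam ≤ Y ^ 10 * L) {μ : ℝ} (hμ : 0 < μ) (hμY : μ ≤ Y)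
    (hKμ : ∀ v, μ * en v ^ 2 ≤ en (Kstarᵀ *ᵥ v) ^ 2) :
    ‖optController Q R A (lsEstimate A lam (x, u) (τ₀ * 4 ^ i)) - Kstar‖
        ≤ (Y ^ 70)⁻¹ * (2 ^ j)⁻¹ ∧
      ‖optController Q R A (lsEstimate A lam (x, u) (τ₀ * 4 ^ i)) - Kstar‖ ^ 2
        ≤ Y ^ 60 * L / (μ * (τ₀ * 4 ^ i : ℕ)) := by
  have hY := S.Y_pos
  have hL0 : 0 < L := by linarith
  have hτ0 : (0 : ℝ) < τ₀ := lt_of_lt_of_le (by positivity) hτ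
  have hτpos : ∀ l, (0 : ℝ) < (τ₀ * 4 ^ l : ℕ) := fun l => by push_cast; positivity
  have hls := fun a => S.ls_error hL G hji hp hT hτ hKl hc hlam hlam_le a rfl
  set Δ := lsEstimate A lam (x, u) (τ₀ * 4 ^ i) - B with hΔ
  have hrow : ∀ {M t : ℝ}, 0 < t → (∀ a, t * en (Δ a) ^ 2 ≤ M) → ‖Δ‖ ≤ √(Y * M / t) := by
    intro M t ht h
    have hM : 0 ≤ M := le_trans (by positivity) (h ⟨0, S.d_pos⟩)
    refine norm_le_of_rows (Real.sqrt_nonneg _) ?_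
    rw [Real.sq_sqrt (by positivity)]
    calc ∑ a, en (Δ a) ^ 2 ≤ ∑ _a : Fin d, M / t :=
          Finset.sum_le_sum fun a _ => by rw [le_div_iff₀ ht]; linarith [h a]
      _ = d * (M / t) := by simp
      _ ≤ Y * (M / t) := mul_le_mul_of_nonneg_right S.d_le (by positivity)
      _ = _ := by ring
  -- This bound uses exploration during the warm-up only. Since `τ₀ ≥ Y²⁰⁰ L`, it is of order
  -- `2^{-j}` with a tiny constant, independently of `μ`.
  have h1 : ‖Δ‖ ≤ (Y ^ 84)⁻¹ * (2 ^ j)⁻¹ := by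
    refine (hrow (hτpos j) fun a => (hls a).1).trans ?_
    rw [Real.sqrt_le_left (by positivity), div_le_iff₀ (hτpos j)]
    have e : ((Y ^ 84)⁻¹ * (2 ^ j)⁻¹) ^ 2 * ((τ₀ * 4 ^ j : ℕ) : ℝ) = τ₀ / Y ^ 168 := by
      push_cast
      have : (4 : ℝ) ^ j = 2 ^ j * 2 ^ j := by rw [← mul_pow]; norm_num
      rw [this]
      field_simp
    rw [e, le_div_iff₀ (by positivity)]
    calc Y * (Y ^ 30 * L) * Y ^ 168 = Y ^ 199 * L := by ring
      _ ≤ Y ^ 200 * L := mul_le_mul_of_nonneg_right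
          (pow_le_pow_right₀ S.Y_one (by norm_num)) hL0.le
      _ ≤ τ₀ := hτ
  have hone : (Y ^ 84)⁻¹ * ((2 : ℝ) ^ j)⁻¹ ≤ (Y ^ 84)⁻¹ :=
    mul_le_of_le_one_right (by positivity) (inv_le_one_of_one_le₀ (one_le_pow₀ (by norm_num)))
  have hsmall : Y ^ 7 * ‖Δ‖ ≤ 1 := by
    calc Y ^ 7 * ‖Δ‖ ≤ Y ^ 7 * (Y ^ 84)⁻¹ := mul_le_mul_of_nonneg_left (h1.trans hone) (by positivity)
      _ ≤ 1 := by
        rw [← div_eq_mul_inv, div_le_one (by positivity)]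
        exact pow_le_pow_right₀ S.Y_one (by norm_num)
  have hK := S.optController_sub_le (norm_nonneg Δ) hsmall le_rfl
  refine ⟨hK.trans ?_, ?_⟩
  · calc Y ^ 14 * ‖Δ‖ ≤ Y ^ 14 * ((Y ^ 84)⁻¹ * (2 ^ j)⁻¹) := by gcongr
      _ = _ := by field_simp
  -- In main phases the error is controlled along `K⋆ᵀ v`, and `μ` converts this into `v`. With no
  -- main phase yet, `i = j`, the warm-up bound suffices because `μ ≤ Y`.
  · have h2 : ‖Δ‖ ≤ √(Y * (Y ^ 31 * L) / (μ * (τ₀ * 4 ^ i : ℕ))) := by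
      refine hrow (mul_pos hμ (hτpos i)) fun a => ?_
      rcases hji.eq_or_lt with rfl | hlt
      · calc μ * ((τ₀ * 4 ^ j : ℕ) : ℝ) * en (Δ a) ^ 2
            = μ * (((τ₀ * 4 ^ j : ℕ) : ℝ) * en (Δ a) ^ 2) := by ring
          _ ≤ Y * (Y ^ 30 * L) := mul_le_mul hμY (hls a).1 (by positivity) hY.le
          _ = _ := by ring
      · calc μ * ((τ₀ * 4 ^ i : ℕ) : ℝ) * en (Δ a) ^ 2
            = ((τ₀ * 4 ^ i : ℕ) : ℝ) * (μ * en (Δ a) ^ 2) := by ring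
          _ ≤ ((τ₀ * 4 ^ i : ℕ) : ℝ) * en (Kstarᵀ *ᵥ Δ a) ^ 2 :=
            mul_le_mul_of_nonneg_left (hKμ _) (hτpos i).le
          _ ≤ Y ^ 30 * L := (hls a).2 hlt
          _ ≤ _ := mul_le_mul_of_nonneg_right
            (pow_le_pow_right₀ S.Y_one (by norm_num)) hL0.le
    have h3 := pow_le_pow_left₀ (norm_nonneg _) hK 2
    have h4 := pow_le_pow_left₀ (norm_nonneg _) h2 2
    rw [Real.sq_sqrt (by have := hτpos i; positivity)] at h4
    calc _ ≤ (Y ^ 14 * ‖Δ‖) ^ 2 := h3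
      _ = Y ^ 28 * ‖Δ‖ ^ 2 := by ring
      _ ≤ Y ^ 28 * (Y * (Y ^ 31 * L) / (μ * (τ₀ * 4 ^ i : ℕ))) :=
        mul_le_mul_of_nonneg_left h4 (by positivity)
      _ = _ := by ring

end Setting


/-! ### The algorithm only uses past observations -/

namespace AlgInput

variable {d k : ℕ} (I : AlgInput d k)

lemma tau_mono {i j : ℕ} (h : i ≤ j) : I.τ i ≤ I.τ j :=
  Nat.mul_le_mul_left _ (Nat.pow_le_pow_right (by norm_num) h)

lemma tau_phase_le {i t : ℕ} (hi : i ≤ I.nT) (ht : I.τ i ≤ t) : I.τ (I.phase t) ≤ t :=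
  Nat.findGreatest_spec (P := fun i => I.τ i ≤ t) hi ht

lemma le_phase {i t : ℕ} (hi : i ≤ I.nT) (ht : I.τ i ≤ t) : i ≤ I.phase t :=
  Nat.le_findGreatest hi ht

lemma phase_le (t : ℕ) : I.phase t ≤ I.nT := Nat.findGreatest_le _

lemma lsEstimate_congr (A : Matrix (Fin d) (Fin d) ℝ) {lam : ℝ} (hlam : 0 < lam)
    {h h' : History d k} {n : ℕ} (h1 : ∀ s ≤ n, h.1 s = h'.1 s) (h2 : ∀ s < n, h.2 s = h'.2 s) :
    lsEstimate A lam h n = lsEstimate A lam h' n := by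
  have e1 : lsCross A h n = lsCross A h' n := by
    refine Finset.sum_congr rfl fun s hs => ?_
    rw [Finset.mem_Ico] at hs
    rw [h1 (s + 1) hs.2, h1 s hs.2.le, h2 s hs.2]
  have e2 : lsGram lam h n = lsGram lam h' n := by
    rw [lsGram, lsGram]
    congr 1
    refine Finset.sum_congr rfl fun s hs => ?_
    rw [h2 s (Finset.mem_Ico.1 hs).2]
  rw [lsEstimate_eq A hlam, lsEstimate_eq A hlam, e1, e2]

variable {I} {h h' : History d k} {t : ℕ}

lemma greedy_congr (hlam : 0 < I.lam) (h1 : ∀ s ≤ t, h.1 s = h'.1 s)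
    (h2 : ∀ s < t, h.2 s = h'.2 s) {i : ℕ} (hi : I.τ i ≤ t) : I.greedy h i = I.greedy h' i := by
  rw [greedy, greedy, lsEstimate_congr I.A hlam (fun s hs => h1 s (hs.trans hi))
    (fun s hs => h2 s (hs.trans_le hi))]

lemma breakTest_congr (hlam : 0 < I.lam) (h1 : ∀ s ≤ t, h.1 s = h'.1 s)
    (h2 : ∀ s < t, h.2 s = h'.2 s) {i : ℕ} (hi : I.τ i ≤ t) :
    I.breakTest h i ↔ I.breakTest h' i := by
  rw [breakTest, breakTest, greedy_congr hlam h1 h2 hi]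

lemma inWarmup_congr (hlam : 0 < I.lam) (h1 : ∀ s ≤ t, h.1 s = h'.1 s)
    (h2 : ∀ s < t, h.2 s = h'.2 s) : I.inWarmup h t ↔ I.inWarmup h' t :=
  forall_congr' fun _ => imp_congr_right fun _ => forall_congr' fun hi =>
    not_congr (breakTest_congr hlam h1 h2 hi)

lemma exists_of_not_inWarmup (hw : ¬ I.inWarmup h t) :
    ∃ i ≤ I.nT, I.τ i ≤ t ∧ I.breakTest h i := by
  simpa [inWarmup] using hw

lemma aborted_congr (hlam : 0 < I.lam) (h1 : ∀ s ≤ t, h.1 s = h'.1 s)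
    (h2 : ∀ s < t, h.2 s = h'.2 s) : I.aborted h t ↔ I.aborted h' t := by
  refine exists_congr fun s => and_congr_right fun hs => ?_
  rw [Finset.mem_Icc] at hs
  have h1' : ∀ r ≤ s, h.1 r = h'.1 r := fun r hr => h1 r (hr.trans hs.2)
  have h2' : ∀ r < s, h.2 r = h'.2 r := fun r hr => h2 r (hr.trans_le hs.2)
  rw [inWarmup_congr hlam h1' h2']
  refine and_congr_right fun hw => ?_
  obtain ⟨i, hi, hit, -⟩ := exists_of_not_inWarmup hw
  rw [h1' s le_rfl, greedy_congr hlam h1' h2' (I.tau_phase_le hi hit)]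

/-- The decision at time `t` depends on states up to `t` and actions before `t`: a phase is
consulted only once it has started. This permits evaluating the policy on the complete trajectory.
-/
lemma policy_congr (hlam : 0 < I.lam) (h1 : ∀ s ≤ t, h.1 s = h'.1 s)
    (h2 : ∀ s < t, h.2 s = h'.2 s) (η : Fin k → ℝ) : I.policy t h η = I.policy t h' η := by
  by_cases hw : I.inWarmup h t
  · rw [policy, policy, if_pos hw, if_pos ((inWarmup_congr hlam h1 h2).1 hw), h1 t le_rfl]
  · have hw' : ¬ I.inWarmup h' t := fun h => hw ((inWarmup_congr hlam h1 h2).2 h)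
    obtain ⟨i, hi, hit, -⟩ := exists_of_not_inWarmup hw
    by_cases ha : I.aborted h t
    · rw [policy, policy, if_neg hw, if_neg hw', if_pos ha,
        if_pos ((aborted_congr hlam h1 h2).1 ha), h1 t le_rfl]
    · have ha' : ¬ I.aborted h' t := fun h => ha ((aborted_congr hlam h1 h2).2 h)
      rw [policy, policy, if_neg hw, if_neg hw', if_neg ha, if_neg ha', h1 t le_rfl,
        greedy_congr hlam h1 h2 (I.tau_phase_le hi hit)]

/-- The actions of the algorithm, as functions of the complete trajectory. -/
lemma action_eq_policy (hlam : 0 < I.lam) (B : Matrix (Fin d) (Fin k) ℝ)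
    (A : Matrix (Fin d) (Fin d) ℝ) (w : ℕ → Fin d → ℝ) (η : ℕ → Fin k → ℝ) (ht : 1 ≤ t) :
    action I.policy A B w η t
      = I.policy t (state I.policy A B w η, action I.policy A B w η) (η t) := by
  obtain ⟨n, rfl⟩ : ∃ n, t = n + 1 := ⟨t - 1, by omega⟩
  rw [action_succ]
  exact policy_congr hlam (fun s hs => run_fst_eq_state _ _ _ _ _ hs)
    (fun s hs => run_snd_eq_action _ _ _ _ _ (by omega)) _

lemma tau_nT_le (hτ : 0 < I.τ₀) (hT : I.τ₀ ≤ I.T) : I.τ I.nT ≤ I.T := by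
  have hτ' : (0 : ℝ) < I.τ₀ := by exact_mod_cast hτ
  have hT' : (I.τ₀ : ℝ) ≤ I.T := by exact_mod_cast hT
  have h1 : 1 ≤ (I.T : ℝ) / I.τ₀ := by rwa [le_div_iff₀ hτ', one_mul]
  have h2 : (I.nT : ℝ) ≤ Real.logb 4 ((I.T : ℝ) / I.τ₀) :=
    Nat.floor_le (Real.logb_nonneg (by norm_num) h1)
  rw [Real.le_logb_iff_rpow_le (by norm_num) (by linarith), Real.rpow_natCast,
    le_div_iff₀ hτ'] at h2
  rw [τ]
  have : ((I.τ₀ * 4 ^ I.nT : ℕ) : ℝ) ≤ I.T := by push_cast; linarith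
  exact_mod_cast this

lemma lt_tau_nT (hτ : 0 < I.τ₀) (hT : I.τ₀ ≤ I.T) : I.T < I.τ (I.nT + 1) := by
  have hτ' : (0 : ℝ) < I.τ₀ := by exact_mod_cast hτ
  have hT' : (I.τ₀ : ℝ) ≤ I.T := by exact_mod_cast hT
  have h1 : 1 ≤ (I.T : ℝ) / I.τ₀ := by rwa [le_div_iff₀ hτ', one_mul]
  have h2 : Real.logb 4 ((I.T : ℝ) / I.τ₀) < (I.nT + 1 : ℕ) := by
    push_cast; exact Nat.lt_floor_add_one _
  rw [Real.logb_lt_iff_lt_rpow (by norm_num) (by linarith), Real.rpow_natCast,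
    div_lt_iff₀ hτ'] at h2
  rw [τ]
  have : (I.T : ℝ) < ((I.τ₀ * 4 ^ (I.nT + 1) : ℕ) : ℝ) := by push_cast at h2 ⊢; linarith
  exact_mod_cast this

lemma lt_tau_phase (hτ : 0 < I.τ₀) (hT : I.τ₀ ≤ I.T) (ht : t ≤ I.T) :
    t < I.τ (I.phase t + 1) := by
  by_contra hcon
  rw [not_lt] at hcon
  rcases (I.phase_le t).eq_or_lt with h | h
  · rw [h] at hcon
    exact absurd (lt_tau_nT hτ hT) (by omega)
  · have := I.le_phase h hcon
    omega

lemma phase_eq {l : ℕ} (hl : l ≤ I.nT) (h1 : I.τ l ≤ t) (h2 : t < I.τ (l + 1)) :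
    I.phase t = l := by
  refine le_antisymm ?_ (I.le_phase hl h1)
  by_contra hcon
  have := I.tau_mono (show l + 1 ≤ I.phase t by omega)
  have := I.tau_phase_le hl h1
  omega

end AlgInput

/-! ### Nondegeneracy of controllers -/

lemma posSemidef_mul_transpose_sub_iff {d k : ℕ} (K : Matrix (Fin k) (Fin d) ℝ) (c : ℝ) :
    (K * Kᵀ - c • (1 : Matrix (Fin k) (Fin k) ℝ)).PosSemidef
      ↔ ∀ v, c * en v ^ 2 ≤ en (Kᵀ *ᵥ v) ^ 2 := by
  have h : ∀ v, qf (K * Kᵀ - c • (1 : Matrix (Fin k) (Fin k) ℝ)) v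
      = en (Kᵀ *ᵥ v) ^ 2 - c * en v ^ 2 := by
    intro v
    rw [qf_sub_left, qf_smul_left, qf_one, qf, ← Matrix.mulVec_mulVec, dot_mulVec, ← en_sq]
  rw [posSemidef_iff_qf]
  simp only [h, sub_nonneg]
  refine and_iff_right ?_
  rw [Matrix.transpose_sub, Matrix.transpose_mul, Matrix.transpose_transpose,
    Matrix.transpose_smul, Matrix.transpose_one]

lemma en_transpose_sub_le {d k : ℕ} {K K' : Matrix (Fin k) (Fin d) ℝ} {e : ℝ} (h : ‖K - K'‖ ≤ e)
    (v : Fin k → ℝ) : en (Kᵀ *ᵥ v) ≤ en (K'ᵀ *ᵥ v) + e * en v ∧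
      en (K'ᵀ *ᵥ v) ≤ en (Kᵀ *ᵥ v) + e * en v := by
  have h1 : en ((K - K')ᵀ *ᵥ v) ≤ e * en v := by
    refine (en_mulVec _ _).trans (mul_le_mul_of_nonneg_right ?_ (en_nonneg _))
    rwa [norm_transpose']
  rw [Matrix.transpose_sub, Matrix.sub_mulVec] at h1
  have h2 := en_add_le (Kᵀ *ᵥ v - K'ᵀ *ᵥ v) (K'ᵀ *ᵥ v)
  have h3 := en_sub_le (Kᵀ *ᵥ v) (Kᵀ *ᵥ v - K'ᵀ *ᵥ v)
  rw [sub_add_cancel] at h2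
  rw [sub_sub_cancel] at h3
  constructor <;> linarith

/-- The test gives `‖Kjᵀ v‖ ≥ 3e ‖v‖`. Passing to `Kstar` and from there to `K` changes the norm by
at most `e ‖v‖` each time, which leaves the two within a factor 2 of each other. -/
lemma compare_of_test {d k : ℕ} {K Kj Kstar : Matrix (Fin k) (Fin d) ℝ} {c e : ℝ} (he : 0 ≤ e)
    (hj : ∀ v, c * en v ^ 2 ≤ en (Kjᵀ *ᵥ v) ^ 2) (h1 : ‖Kj - Kstar‖ ≤ e) (h2 : ‖K - Kstar‖ ≤ e)
    (hc : 9 * e ^ 2 ≤ c) (v : Fin k → ℝ) :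
    en (Kᵀ *ᵥ v) ≤ 2 * en (Kstarᵀ *ᵥ v) ∧ en (Kstarᵀ *ᵥ v) ≤ 2 * en (Kᵀ *ᵥ v) := by
  have ha : 3 * e * en v ≤ en (Kjᵀ *ᵥ v) := by
    refine le_of_sq_le_sq ?_ (en_nonneg _)
    refine le_trans (le_of_eq ?_) ((mul_le_mul_of_nonneg_right hc (sq_nonneg _)).trans (hj v))
    ring
  have hb := en_transpose_sub_le h1 v
  have hd := en_transpose_sub_le h2 v
  have h0 := mul_nonneg he (en_nonneg v)
  constructor <;> linarith

/-! ### The algorithm on a good event -/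

/-- The input of the algorithm is tuned to the system. -/
structure Tuned {d k : ℕ} (I : AlgInput d k) (B : Matrix (Fin d) (Fin k) ℝ)
    (Kstar : Matrix (Fin k) (Fin d) ℝ) (P P₀ : Matrix (Fin d) (Fin d) ℝ)
    (α ϑ p p₀ σ κ₀ Y L μ : ℝ) : Prop
    extends Setting I.A B I.Q I.R I.K₀ Kstar P P₀ α ϑ p p₀ σ I.κ κ₀ Y where
  L_one : 1 ≤ L
  lam_pos : 0 < I.lam
  lam_le : I.lam ≤ Y ^ 10 * L
  xb_le : I.xb ≤ I.lam
  τ₀_ge : Y ^ 200 * L ≤ I.τ₀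
  τ₀_le : I.τ₀ ≤ Y ^ 216 * L
  xb_ge : 9 * I.κ ^ 2 * max ((1 + ϑ) ^ 2 * κ₀ ^ 6) (4 * I.κ ^ 6) * (15 * d * σ ^ 2 * L) ≤ I.xb
  μ₀_eq : I.μ₀ = 4 * I.κ * (Y ^ 30)⁻¹
  T_ge : I.τ₀ ≤ I.T
  nT_le : (I.nT : ℝ) + 1 ≤ L
  μ_pos : 0 < μ
  μ_le : μ ≤ Y
  Kstar_ge : ∀ v, μ * en v ^ 2 ≤ en (Kstarᵀ *ᵥ v) ^ 2

namespace Tuned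

variable {d k : ℕ} {I : AlgInput d k} {B : Matrix (Fin d) (Fin k) ℝ}
  {Kstar : Matrix (Fin k) (Fin d) ℝ} {P P₀ : Matrix (Fin d) (Fin d) ℝ}
  {α ϑ p p₀ σ κ₀ Y L μ : ℝ}
  {x : ℕ → Fin d → ℝ} {u : ℕ → Fin k → ℝ} {w : ℕ → Fin d → ℝ} {η : ℕ → Fin k → ℝ}
  (S : Tuned I B Kstar P P₀ α ϑ p p₀ σ κ₀ Y L μ)

section
include S

lemma τ₀_pos : 0 < I.τ₀ := by
  have h1 : 0 < Y ^ 200 * L := mul_pos (pow_pos S.Y_pos _) (by linarith [S.L_one])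
  exact_mod_cast h1.trans_le S.τ₀_ge

lemma L_le : L ≤ I.τ₀ :=
  (le_mul_of_one_le_left (by linarith [S.L_one]) (one_le_pow₀ S.Y_one)).trans S.τ₀_ge

lemma one_le_tau (i : ℕ) : 1 ≤ I.τ i := Nat.mul_pos S.τ₀_pos (by positivity)

lemma κ_leY : I.κ ≤ Y := by
  have := S.κ_one
  nlinarith [S.κ_le]

/-- The threshold of the test decays like `2^{-i}` but the squared accuracy like `4^{-i}`, so the
hypothesis of `compare_of_test` holds in every phase. -/
lemma test_const (i : ℕ) : 9 * ((Y ^ 70)⁻¹ * (2 ^ i)⁻¹) ^ 2 ≤ 3 * (I.μ₀ * (2 ^ i)⁻¹) / 2 := by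
  have hY := S.Y_pos
  have h2 : ((2 : ℝ) ^ i)⁻¹ ≤ 1 := inv_le_one_of_one_le₀ (one_le_pow₀ (by norm_num))
  have h20 : 0 < ((2 : ℝ) ^ i)⁻¹ := by positivity
  have h3 : (Y ^ 70)⁻¹ ≤ (Y ^ 30)⁻¹ :=
    inv_anti₀ (by positivity) (pow_le_pow_right₀ S.Y_one (by norm_num))
  have h4 : (Y ^ 70)⁻¹ ≤ 1 / 1000 := by
    rw [one_div]
    refine inv_anti₀ (by norm_num) (S.Y_ge.trans ?_)
    exact le_self_pow₀ S.Y_one (by norm_num)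
  have h5 : 0 < (Y ^ 70)⁻¹ := by positivity
  rw [S.μ₀_eq]
  set b := ((2 : ℝ) ^ i)⁻¹
  set y := (Y ^ 70)⁻¹
  set z := (Y ^ 30)⁻¹
  have h6 : (y * b) ^ 2 ≤ y * b := by
    have : 0 < y * b := mul_pos h5 h20
    have h8 : y * b ≤ 1 := by nlinarith
    nlinarith
  have h7 : 9 * y * y ≤ z := by nlinarith
  have h9 : z * b ≤ I.κ * z * b := by
    have hz : 0 < z * b := by positivity
    nlinarith [S.κ_one]
  calc 9 * (y * b) ^ 2 = (9 * y * y) * (b * b) := by ring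
    _ ≤ z * (b * 1) := by
      refine mul_le_mul h7 (mul_le_mul_of_nonneg_left h2 h20.le) (by positivity) (by positivity)
    _ ≤ _ := by
      have : 0 < I.κ * z * b := lt_of_lt_of_le (by positivity) h9
      linarith

end

variable (G : GoodRun I.A B I.K₀ σ L (Y ^ 19) I.T x u w η)

include S G

/-- By induction over the phases, the controllers of the main phases are accurate. -/
lemma phase_controller {j n : ℕ} (hj : j ≤ I.nT) (htest : I.breakTest (x, u) j)
    (hwarm : ∀ t, 1 ≤ t → t < I.τ j → u t = I.K₀ *ᵥ x t + η t) (hn : n ≤ I.T + 1)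
    (hmain : ∀ t, I.τ j ≤ t → t < n → u t = I.greedy (x, u) (I.phase t) *ᵥ x t) :
    ∀ l, j ≤ l → l ≤ I.nT → I.τ l ≤ n →
      ‖I.greedy (x, u) l - Kstar‖ ≤ (Y ^ 70)⁻¹ * (2 ^ j)⁻¹ ∧
      ‖I.greedy (x, u) l - Kstar‖ ^ 2 ≤ Y ^ 60 * L / (μ * I.τ l) := by
  have hY := S.Y_pos
  intro l
  -- Accuracy in the phases `j, …, l - 1` makes their controllers good, which keeps the states
  -- bounded and their data informative, which yields accuracy at `τ_l`.
  induction l using Nat.strong_induction_on with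
  | _ l ih =>
    intro hjl hl hln
    have hphase : ∀ m, m < l → ∀ t, I.τ m ≤ t → t < I.τ (m + 1) → I.phase t = m :=
      fun m hm t h1 h2 => I.phase_eq (by omega) h1 h2
    have ih' : ∀ m, j ≤ m → m < l → ‖I.greedy (x, u) m - Kstar‖ ≤ (Y ^ 70)⁻¹ * (2 ^ j)⁻¹ :=
      fun m h1 h2 => (ih m h2 h1 (by omega) ((I.tau_mono h2.le).trans hln)).1
    have hgood : ∀ m, j ≤ m → m < l → GoodController I.A B P I.κ (I.greedy (x, u) m) :=
      fun m h1 h2 => S.goodController ((ih' m h1 h2).trans (mul_le_of_le_one_right (by positivity)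
        (inv_le_one_of_one_le₀ (one_le_pow₀ (by norm_num)))))
    have hp : IsPlayed I.A B I.K₀ P I.κ (fun t => I.greedy (x, u) (I.phase t)) (I.τ j) (I.τ l)
        x u η := by
      refine ⟨S.one_le_tau j, I.tau_mono hjl, hwarm, fun t h1 h2 => ⟨hmain t h1 (by omega), ?_⟩⟩
      refine hgood _ (I.le_phase hj h1) ?_
      by_contra hcon
      have := I.tau_mono (not_lt.1 hcon)
      have := I.tau_phase_le hj h1
      omega
    refine S.toSetting.controller_error S.L_one G hjl hp (hln.trans hn) S.τ₀_ge
      (Kl := fun m => I.greedy (x, u) m) (fun m h1 h2 s hs1 hs2 => ?_) (fun m h1 h2 v => ?_)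
      S.lam_pos S.lam_le S.μ_pos S.μ_le S.Kstar_ge
    · have e : I.phase s = m := hphase m h2 s hs1 hs2
      have hsl : s < n := by
        have h3 := I.tau_mono (show m + 1 ≤ l by omega)
        have h4 : s < I.τ (m + 1) := hs2
        omega
      rw [hmain s ((I.tau_mono h1).trans hs1) hsl, e]
    · exact compare_of_test (by positivity) ((posSemidef_mul_transpose_sub_iff _ _).1 htest)
        (ih' j le_rfl (by omega)) (ih' m h1 h2) (S.test_const j) v

lemma isPlayed_of_main {j n : ℕ} (hj : j ≤ I.nT) (htest : I.breakTest (x, u) j)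
    (hwarm : ∀ t, 1 ≤ t → t < I.τ j → u t = I.K₀ *ᵥ x t + η t) (hjn : I.τ j ≤ n)
    (hn : n ≤ I.T + 1)
    (hmain : ∀ t, I.τ j ≤ t → t < n → u t = I.greedy (x, u) (I.phase t) *ᵥ x t) :
    IsPlayed I.A B I.K₀ P I.κ (fun t => I.greedy (x, u) (I.phase t)) (I.τ j) n x u η := by
  have hY := S.Y_pos
  refine ⟨S.one_le_tau j, hjn, hwarm, fun t h1 h2 => ⟨hmain t h1 h2, ?_⟩⟩
  refine S.goodController ((S.phase_controller G hj htest hwarm hn hmain _ (I.le_phase hj h1)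
    (I.phase_le t) ((I.tau_phase_le hj h1).trans h2.le)).1.trans
    (mul_le_of_le_one_right (by positivity)
      (inv_le_one_of_one_le₀ (one_le_pow₀ (by norm_num)))))

/-- If the test fails after pure exploration, then `μ` is small. -/
lemma mu_le_of_not_breakTest {i : ℕ} (hi : I.τ i ≤ I.T + 1) (htest : ¬ I.breakTest (x, u) i)
    (hwarm : ∀ t, 1 ≤ t → t < I.τ i → u t = I.K₀ *ᵥ x t + η t) : 2 ^ i ≤ μ⁻¹ := by
  have hY := S.Y_pos
  -- There is no main phase before `τ_i`, so the controllers passed here are placeholders.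
  have hp : IsPlayed I.A B I.K₀ P I.κ (fun _ => Kstar) (I.τ i) (I.τ i) x u η :=
    ⟨S.one_le_tau i, le_rfl, hwarm, fun t h1 h2 => absurd h1 (by omega)⟩
  have h : ‖I.greedy (x, u) i - Kstar‖ ≤ (Y ^ 70)⁻¹ * (2 ^ i)⁻¹ :=
    (S.toSetting.controller_error S.L_one G le_rfl hp hi S.τ₀_ge (Kl := fun _ => Kstar)
      (fun l h1 h2 => absurd h1 (by omega)) (fun l h1 h2 => absurd h1 (by omega))
      S.lam_pos S.lam_le S.μ_pos S.μ_le S.Kstar_ge).1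
  rw [AlgInput.breakTest, posSemidef_mul_transpose_sub_iff] at htest
  push Not at htest
  obtain ⟨v, hv⟩ := htest
  have hv0 : 0 < en v ^ 2 := by
    refine lt_of_le_of_ne (sq_nonneg _) fun h0 => ?_
    rw [← h0, mul_zero] at hv
    exact absurd hv (not_lt.2 (sq_nonneg _))
  have h1 := (en_transpose_sub_le h v).2
  set e := (Y ^ 70)⁻¹ * ((2 : ℝ) ^ i)⁻¹ with he
  have h2 : en (Kstarᵀ *ᵥ v) ^ 2 ≤ 2 * en ((I.greedy (x, u) i)ᵀ *ᵥ v) ^ 2 + 2 * (e ^ 2 * en v ^ 2) := by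
    refine (pow_le_pow_left₀ (en_nonneg _) h1 2).trans ?_
    nlinarith [sq_nonneg (en ((I.greedy (x, u) i)ᵀ *ᵥ v) - e * en v)]
  -- A direction where the test fails is nearly annihilated by `K⋆ᵀ` as well. The term `2 e²` is
  -- below `μ₀ 2^{-i}`, so `μ ≤ 4 μ₀ 2^{-i} ≤ 2^{-i}`.
  have h3 : μ * en v ^ 2 ≤ (3 * (I.μ₀ * (2 ^ i)⁻¹) + 2 * e ^ 2) * en v ^ 2 := by
    linarith [S.Kstar_ge v]
  have h4 := le_of_mul_le_mul_right h3 hv0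
  have h5 := S.test_const i
  have h6 : 4 * (I.μ₀ * ((2 : ℝ) ^ i)⁻¹) ≤ (2 ^ i)⁻¹ := by
    have h7 : 16 * Y ^ 1 ≤ Y ^ 30 := S.pow_mul_le (by norm_num) (by norm_num)
    have h8 : 4 * I.μ₀ ≤ 1 := by
      rw [S.μ₀_eq]
      have : 4 * (4 * I.κ * (Y ^ 30)⁻¹) = 16 * I.κ / Y ^ 30 := by ring
      rw [this, div_le_one (by positivity)]
      have := S.κ_leY
      linarith
    have h9 : 0 < ((2 : ℝ) ^ i)⁻¹ := by positivity
    nlinarith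
  have h9 : 0 ≤ e ^ 2 := sq_nonneg _
  rw [le_inv_comm₀ (by positivity) S.μ_pos]
  have h10 : 0 < I.μ₀ * ((2 : ℝ) ^ i)⁻¹ := by
    rw [S.μ₀_eq]; have := S.κ_pos; positivity
  linarith

variable (hpol : ∀ t, 1 ≤ t → u t = I.policy t (x, u) (η t))
include hpol

/-- Strong induction on time: without an earlier abort the algorithm has explored and then played
accurate controllers up to `t`, so the state obeys `main_state_le` and the controller has norm at
most `κ`. The resulting constant `5 κ²` is below the `9 κ²` contained in `x_b`. -/
lemma not_aborted : ∀ t ≤ I.T, ¬ I.aborted (x, u) t := by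
  have hY := S.Y_pos
  suffices hok : ∀ t, 1 ≤ t → t ≤ I.T → ¬ I.inWarmup (x, u) t →
      ¬ (I.xb < x t ⬝ᵥ x t ∨ I.κ < ‖I.greedy (x, u) (I.phase t)‖) by
    rintro t ht ⟨s, hs, hw, h⟩
    rw [Finset.mem_Icc] at hs
    exact hok s hs.1 (hs.2.trans ht) hw h
  intro t
  induction t using Nat.strong_induction_on with
  | _ t ih =>
    intro ht1 htT hw
    classical
    have hex := AlgInput.exists_of_not_inWarmup hw
    -- The first phase that passes the test: before `τ_j` there is only exploration, afterwards only
    -- greedy play.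
    set j := Nat.find hex with hjdef
    obtain ⟨hj, hjt, htest⟩ : j ≤ I.nT ∧ I.τ j ≤ t ∧ I.breakTest (x, u) j := Nat.find_spec hex
    have hin : ∀ s, s ≤ t → s < I.τ j → I.inWarmup (x, u) s := by
      intro s hst hs i hi his hbr
      have hij : i < j := by
        by_contra hcon
        have := I.tau_mono (not_lt.1 hcon)
        omega
      exact Nat.find_min hex hij ⟨hi, his.trans hst, hbr⟩
    have hwarm : ∀ s, 1 ≤ s → s < I.τ j → u s = I.K₀ *ᵥ x s + η s := by
      intro s h1 h2
      rw [hpol s h1, AlgInput.policy, if_pos (hin s (by omega) h2)]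
    have hmain : ∀ s, I.τ j ≤ s → s < t → u s = I.greedy (x, u) (I.phase s) *ᵥ x s := by
      intro s h1 h2
      have hs1 := (S.one_le_tau j).trans h1
      have hns : ¬ I.inWarmup (x, u) s := fun h => h j hj h1 htest
      have hna : ¬ I.aborted (x, u) s := by
        rintro ⟨r, hr, hwr, h⟩
        rw [Finset.mem_Icc] at hr
        exact ih r (by omega) hr.1 (by omega) hwr h
      rw [hpol s hs1, AlgInput.policy, if_neg hns, if_neg hna]
    have hp := S.isPlayed_of_main G hj htest hwarm hjt (by omega) hmain
    have hg := (S.phase_controller G hj htest hwarm (n := t) (by omega) hmain _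
      (I.le_phase hj hjt) (I.phase_le t) (I.tau_phase_le hj hjt)).1
    have hgood := S.goodController (hg.trans (mul_le_of_le_one_right (by positivity)
      (inv_le_one_of_one_le₀ (one_le_pow₀ (by norm_num)))))
    rw [not_or, not_lt, not_lt]
    refine ⟨?_, hgood.2⟩
    rw [← en_sq]
    set W := 15 * d * σ ^ 2 * L with hW
    have hW0 : 0 ≤ W := by have := S.L_one; positivity
    have hx1 := S.toSetting.warm_end_le S.L_one G hp (by omega)
    have hx2 := S.toSetting.main_state_le hjt
      (fun s h1 _ => G.step s ((S.one_le_tau j).trans h1)) hp.main hW0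
      (fun s _ h2 => (S.toSetting.en_noise_le S.L_one G (by omega)).1)
    refine le_trans ?_ S.xb_ge
    set M := max ((1 + ϑ) ^ 2 * κ₀ ^ 6) (4 * I.κ ^ 6)
    have hM1 : (1 + ϑ) ^ 2 * κ₀ ^ 6 ≤ M := le_max_left _ _
    have hM2 : 4 * I.κ ^ 6 ≤ M := le_max_right _ _
    have hM0 : 0 ≤ M := le_trans (by have := S.κ_pos; positivity) hM2
    have hκ : 1 ≤ I.κ ^ 2 := one_le_pow₀ S.κ_one
    have h1 : en (x (I.τ j)) ^ 2 ≤ 4 * M * W := by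
      refine hx1.trans ?_
      calc 4 * κ₀ ^ 6 * (1 + ϑ) ^ 2 * W = 4 * ((1 + ϑ) ^ 2 * κ₀ ^ 6) * W := by ring
        _ ≤ _ := by gcongr
    calc en (x t) ^ 2 ≤ I.κ ^ 2 * (4 * M * W) + M * W := by
          refine hx2.trans (add_le_add ?_ ?_)
          · gcongr
          · gcongr
      _ ≤ I.κ ^ 2 * (4 * M * W) + I.κ ^ 2 * (M * W) := by
          have : 0 ≤ M * W := by positivity
          nlinarith
      _ ≤ _ := by
          have : 0 ≤ I.κ ^ 2 * M * W := by positivity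
          linarith

omit S G in
lemma warm_action {t : ℕ} (ht : 1 ≤ t) (hw : I.inWarmup (x, u) t) :
    u t = I.K₀ *ᵥ x t + η t := by
  rw [hpol t ht, AlgInput.policy, if_pos hw]

lemma main_action {t : ℕ} (ht : 1 ≤ t) (htT : t ≤ I.T) (hw : ¬ I.inWarmup (x, u) t) :
    u t = I.greedy (x, u) (I.phase t) *ᵥ x t := by
  rw [hpol t ht, AlgInput.policy, if_neg hw, if_neg (S.not_aborted G hpol t htT)]

/-- The structure of a good run: a short warm-up, then accurate controllers. -/
lemma exists_warmup_end : ∃ N, I.τ₀ ≤ N ∧ N ≤ I.T + 1 ∧ (N : ℝ) ≤ 4 * I.τ₀ * (1 + μ⁻¹) ^ 2 ∧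
    IsPlayed I.A B I.K₀ P I.κ (fun t => I.greedy (x, u) (I.phase t)) N (I.T + 1) x u η ∧
    ∀ t, N ≤ t → t ≤ I.T → I.τ (I.phase t) ≤ t ∧
      ‖I.greedy (x, u) (I.phase t) - Kstar‖ ^ 2 ≤ Y ^ 60 * L / (μ * I.τ (I.phase t)) := by
  have hμ := S.μ_pos
  have hTn := I.tau_nT_le S.τ₀_pos S.T_ge
  have hbound : ∀ i, (2 : ℝ) ^ i ≤ μ⁻¹ → ((I.τ (i + 1) : ℕ) : ℝ) ≤ 4 * I.τ₀ * (1 + μ⁻¹) ^ 2 := by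
    intro i hi
    have h1 : (4 : ℝ) ^ i ≤ (1 + μ⁻¹) ^ 2 := by
      have : (4 : ℝ) ^ i = (2 ^ i) ^ 2 := by rw [← pow_mul, mul_comm, pow_mul]; norm_num
      rw [this]
      exact pow_le_pow_left₀ (by positivity) (by linarith) 2
    rw [AlgInput.τ]; push_cast
    calc (I.τ₀ : ℝ) * 4 ^ (i + 1) = 4 * I.τ₀ * 4 ^ i := by ring
      _ ≤ _ := by gcongr
  by_cases hex : ∃ i ≤ I.nT, I.breakTest (x, u) i
  · classical
    set j := Nat.find hex with hjdef
    obtain ⟨hj, htest⟩ : j ≤ I.nT ∧ I.breakTest (x, u) j := Nat.find_spec hex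
    have hjT : I.τ j ≤ I.T := (I.tau_mono hj).trans hTn
    have hmin : ∀ i < j, ¬ I.breakTest (x, u) i := fun i hi hb =>
      Nat.find_min hex hi ⟨by omega, hb⟩
    have hwarm : ∀ t, 1 ≤ t → t < I.τ j → u t = I.K₀ *ᵥ x t + η t := by
      intro t h1 h2
      refine warm_action hpol h1 fun i hi hit => hmin i ?_
      by_contra hcon
      have := I.tau_mono (not_lt.1 hcon)
      omega
    have hmain : ∀ t, I.τ j ≤ t → t < I.T + 1 → u t = I.greedy (x, u) (I.phase t) *ᵥ x t :=
      fun t h1 h2 => S.main_action G hpol ((S.one_le_tau j).trans h1) (by omega)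
        fun h => h j hj h1 htest
    refine ⟨I.τ j, ?_, by omega, ?_,
      S.isPlayed_of_main G hj htest hwarm (by omega) le_rfl hmain, fun t h1 h2 => ?_⟩
    · simpa [AlgInput.τ] using I.tau_mono (Nat.zero_le j)
    · rcases Nat.eq_zero_or_pos j with h0 | h0
      · rw [h0, AlgInput.τ, pow_zero, mul_one]
        have h1 : 1 ≤ (1 + μ⁻¹) ^ 2 := one_le_pow₀ (by have := inv_pos.2 hμ; linarith)
        have h2 : (0 : ℝ) ≤ I.τ₀ := Nat.cast_nonneg _
        nlinarith
      · obtain ⟨m, hm⟩ : ∃ m, j = m + 1 := ⟨j - 1, by omega⟩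
        rw [hm]
        -- The preceding phase failed the test after pure exploration, which gives `2^m ≤ μ⁻¹` and
        -- bounds `τ_{m+1} = 4 τ₀ 4^m`.
        refine hbound m (S.mu_le_of_not_breakTest G ?_ (hmin m (by omega)) fun t h1 h2 => ?_)
        · have := I.tau_mono (show m ≤ j by omega)
          omega
        · have := I.tau_mono (show m ≤ j by omega)
          exact hwarm t h1 (by omega)
    · have h3 := I.tau_phase_le hj h1
      exact ⟨h3, (S.phase_controller G hj htest hwarm le_rfl hmain _ (I.le_phase hj h1)
        (I.phase_le t) (by omega)).2⟩
  -- If no phase passes, the warm-up covers the whole horizon. The failure of the last phase then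
  -- bounds `T` itself, because `T < τ_{n_T + 1}`.
  · push Not at hex
    have hwarm : ∀ t, 1 ≤ t → u t = I.K₀ *ᵥ x t + η t := fun t h1 =>
      warm_action hpol h1 fun i hi _ => hex i hi
    refine ⟨I.T + 1, by have := S.T_ge; omega, le_rfl, ?_,
      ⟨by omega, le_rfl, fun t h1 _ => hwarm t h1, fun t h1 h2 => absurd h1 (by omega)⟩,
      fun t h1 h2 => absurd h1 (by omega)⟩
    refine le_trans ?_ (hbound I.nT (S.mu_le_of_not_breakTest G (by omega) (hex _ le_rfl)
      fun t h1 _ => hwarm t h1))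
    exact_mod_cast I.lt_tau_nT S.τ₀_pos S.T_ge

/-- On a good event, the accumulated squared distance to the optimal actions is logarithmic. -/
theorem deviation_le :
    ∑ t ∈ Finset.Icc 1 I.T, en (u t - Kstar *ᵥ x t) ^ 2 ≤ Y ^ 240 * (1 + μ⁻¹) ^ 2 * L ^ 2 := by
  have hY := S.Y_pos
  have hμ := S.μ_pos
  have hL := S.L_one
  obtain ⟨N, hτN, hNT, hN, hp, hmain⟩ := S.exists_warmup_end G hpol
  have hLN : L ≤ N := S.L_le.trans (by exact_mod_cast hτN)
  have e : Finset.Icc 1 I.T = Finset.Ico 1 (I.T + 1) := by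
    ext; simp only [Finset.mem_Icc, Finset.mem_Ico]; omega
  rw [e, ← Finset.sum_Ico_consecutive _ hp.one_le hp.le]
  have hp0 : IsPlayed I.A B I.K₀ P I.κ (fun t => I.greedy (x, u) (I.phase t)) N N x u η :=
    ⟨hp.one_le, le_rfl, hp.warm, fun t h1 h2 => absurd h1 (by omega)⟩
  have hKs : ‖Kstar‖ ^ 2 ≤ Y :=
    (pow_le_pow_left₀ (norm_nonneg _) S.goodController_Kstar.2 2).trans S.κ_le
  have h1 : ∑ t ∈ Finset.Ico 1 N, en (u t - Kstar *ᵥ x t) ^ 2 ≤ Y ^ 17 * N := by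
    have h2 : ∀ t ∈ Finset.Ico 1 N, en (u t - Kstar *ᵥ x t) ^ 2
        ≤ 2 * en (u t) ^ 2 + 2 * Y * en (x t) ^ 2 := by
      intro t _
      have h3 := en_sq_add_le (u t) (-(Kstar *ᵥ x t))
      rw [← sub_eq_add_neg, en_neg] at h3
      have h4 := (en_mulVec_sq_le Kstar (x t)).trans
        (mul_le_mul_of_nonneg_right hKs (sq_nonneg _))
      linarith
    refine (Finset.sum_le_sum h2).trans ?_
    rw [Finset.sum_add_distrib, ← Finset.mul_sum, ← Finset.mul_sum]
    have h3 := S.toSetting.action_energy_le hL G hp0 hNT hLN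
    have h4 := S.toSetting.state_energy_le hL G hp0 hNT hLN
    have hN0 : (0 : ℝ) ≤ N := Nat.cast_nonneg N
    have e1 : 1 * Y ^ 15 ≤ Y ^ 16 := S.pow_mul_le (by norm_num) (by norm_num)
    have e2 : 4 * Y ^ 16 ≤ Y ^ 17 := S.pow_mul_le (by norm_num) (by norm_num)
    calc _ ≤ 2 * (Y ^ 16 * N) + 2 * Y * (Y ^ 14 * N) := by gcongr
      _ = (2 * Y ^ 16 + 2 * Y ^ 15) * N := by ring
      _ ≤ Y ^ 17 * N := mul_le_mul_of_nonneg_right (by linarith) hN0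
  -- Grouped by phase: a squared controller error of order `1 / τ_l` meets a state energy of order
  -- `τ_l`, so the cost of a phase does not depend on its length.
  have h2 : ∑ t ∈ Finset.Ico N (I.T + 1), en (u t - Kstar *ᵥ x t) ^ 2
      ≤ (I.nT + 1) * (4 * Y ^ 74 * L / μ) := by
    rw [← Finset.sum_fiberwise_of_maps_to (t := Finset.range (I.nT + 1)) (g := I.phase)
      (fun t _ => Finset.mem_range.2 (Nat.lt_succ_of_le (I.phase_le t)))]
    have : ((I.nT : ℝ) + 1) * (4 * Y ^ 74 * L / μ)
        = ∑ _l ∈ Finset.range (I.nT + 1), 4 * Y ^ 74 * L / μ := by simp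
    rw [this]
    refine Finset.sum_le_sum fun l _ => ?_
    have hτl : (0 : ℝ) < I.τ l := by exact_mod_cast S.one_le_tau l
    rcases Finset.eq_empty_or_nonempty ((Finset.Ico N (I.T + 1)).filter fun t => I.phase t = l)
      with h0 | ⟨t₀, ht₀⟩
    · rw [h0, Finset.sum_empty]; positivity
    · rw [Finset.mem_filter, Finset.mem_Ico] at ht₀
      -- The end of phase `l`, truncated at the horizon. The energy is bounded over all of `[1, n)`,
      -- which loses only a constant factor.
      set n := min (I.τ (l + 1)) (I.T + 1) with hn
      have hlt : ∀ t, N ≤ t → t < I.T + 1 → I.phase t = l → t < n := by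
        intro t _ h4 h5
        have := AlgInput.lt_tau_phase S.τ₀_pos S.T_ge (show t ≤ I.T by omega)
        rw [h5] at this
        exact lt_min this h4
      have hNn : N < n := lt_of_le_of_lt ht₀.1.1 (hlt t₀ ht₀.1.1 ht₀.1.2 ht₀.2)
      have hpn : IsPlayed I.A B I.K₀ P I.κ (fun t => I.greedy (x, u) (I.phase t)) N n x u η :=
        ⟨hp.one_le, hNn.le, hp.warm,
          fun t h1 h2 => hp.main t h1 (h2.trans_le (min_le_right _ _))⟩
      have hLn : L ≤ n := hLN.trans (by exact_mod_cast hNn.le)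
      have hE := S.toSetting.state_energy_le hL G hpn (min_le_right _ _) hLn
      have hn4 : (n : ℝ) ≤ 4 * I.τ l := by
        have h6 : n ≤ 4 * I.τ l := (min_le_left _ _).trans (le_of_eq (by rw [AlgInput.τ, AlgInput.τ]; ring))
        exact_mod_cast h6
      calc ∑ t ∈ (Finset.Ico N (I.T + 1)).filter (fun t => I.phase t = l),
            en (u t - Kstar *ᵥ x t) ^ 2
          ≤ ∑ t ∈ (Finset.Ico N (I.T + 1)).filter (fun t => I.phase t = l),
            Y ^ 60 * L / (μ * I.τ l) * en (x t) ^ 2 := by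
            refine Finset.sum_le_sum fun t ht => ?_
            rw [Finset.mem_filter, Finset.mem_Ico] at ht
            have h7 := (hmain t ht.1.1 (by omega)).2
            rw [(hp.main t ht.1.1 ht.1.2).1, ← Matrix.sub_mulVec]
            rw [ht.2] at h7 ⊢
            exact (en_mulVec_sq_le _ _).trans (mul_le_mul_of_nonneg_right h7 (sq_nonneg _))
        _ ≤ ∑ t ∈ Finset.Ico 1 n, Y ^ 60 * L / (μ * I.τ l) * en (x t) ^ 2 := by
            refine Finset.sum_le_sum_of_subset_of_nonneg (fun t ht => ?_) fun t _ _ => ?_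
            · rw [Finset.mem_filter, Finset.mem_Ico] at ht
              exact Finset.mem_Ico.2 ⟨hp.one_le.trans ht.1.1, hlt t ht.1.1 ht.1.2 ht.2⟩
            · positivity
        _ ≤ Y ^ 60 * L / (μ * I.τ l) * (Y ^ 14 * (4 * I.τ l)) := by
            rw [← Finset.mul_sum]
            refine mul_le_mul_of_nonneg_left (hE.trans ?_) (by positivity)
            gcongr
        _ = _ := by field_simp
  set m := 1 + μ⁻¹ with hm
  have hμi := inv_pos.2 hμ
  have hm1 : 1 ≤ m := by linarith
  have h3 : Y ^ 17 * (N : ℝ) ≤ 4 * Y ^ 233 * m ^ 2 * L ^ 2 := by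
    calc Y ^ 17 * (N : ℝ) ≤ Y ^ 17 * (4 * (Y ^ 216 * L) * m ^ 2) := by
          refine mul_le_mul_of_nonneg_left (hN.trans ?_) (by positivity)
          have := S.τ₀_le
          gcongr
      _ = 4 * Y ^ 233 * m ^ 2 * (L * 1) := by ring
      _ ≤ 4 * Y ^ 233 * m ^ 2 * (L * L) := by gcongr
      _ = _ := by ring
  have h4 : ((I.nT : ℝ) + 1) * (4 * Y ^ 74 * L / μ) ≤ 4 * Y ^ 233 * m ^ 2 * L ^ 2 := by
    calc _ ≤ L * (4 * Y ^ 74 * L / μ) := mul_le_mul_of_nonneg_right S.nT_le (by positivity)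
      _ = 4 * Y ^ 74 * μ⁻¹ * L ^ 2 := by ring
      _ ≤ 4 * Y ^ 233 * m ^ 2 * L ^ 2 := by
        have h5 : μ⁻¹ ≤ m ^ 2 := by nlinarith
        have h6 := pow_le_pow_right₀ S.Y_one (show 74 ≤ 233 by norm_num)
        refine mul_le_mul_of_nonneg_right (mul_le_mul ?_ h5 hμi.le (by positivity)) (sq_nonneg _)
        linarith
  have h5 : 8 * Y ^ 233 ≤ Y ^ 240 := S.pow_mul_le (by norm_num) (by norm_num)
  calc _ ≤ 4 * Y ^ 233 * m ^ 2 * L ^ 2 + 4 * Y ^ 233 * m ^ 2 * L ^ 2 :=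
        add_le_add (h1.trans h3) (h2.trans h4)
    _ = (8 * Y ^ 233) * (m ^ 2 * L ^ 2) := by ring
    _ ≤ Y ^ 240 * (m ^ 2 * L ^ 2) := mul_le_mul_of_nonneg_right h5 (by positivity)
    _ = _ := by ring

end Tuned


/-! ### The probability of a good run -/

section Union

variable {Ω : Type*} [MeasurableSpace Ω] {Pr : Measure Ω} {c : ℝ≥0∞}

/-- The property `p` fails with probability at most `n c`. -/
def FailsAtMost (Pr : Measure Ω) (c : ℝ≥0∞) (n : ℕ) (p : Ω → Prop) : Prop :=
  Pr {ω | ¬ p ω} ≤ n * c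

namespace FailsAtMost

lemma mono {n m : ℕ} {p q : Ω → Prop} (h : FailsAtMost Pr c n p) (hpq : ∀ ω, p ω → q ω)
    (hnm : n ≤ m) : FailsAtMost Pr c m q :=
  (measure_mono fun ω (hω : ¬ q ω) hp => hω (hpq ω hp)).trans
    (h.trans (mul_le_mul_left (Nat.cast_le.2 hnm) _))

lemma and {n m : ℕ} {p q : Ω → Prop} (hp : FailsAtMost Pr c n p) (hq : FailsAtMost Pr c m q) :
    FailsAtMost Pr c (n + m) fun ω => p ω ∧ q ω := by
  have h : {ω | ¬ (p ω ∧ q ω)} ⊆ {ω | ¬ p ω} ∪ {ω | ¬ q ω} := fun ω hω => by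
    simpa only [Set.mem_union, Set.mem_ofPred_eq, not_and_or] using hω
  refine (measure_mono h).trans ((measure_union_le _ _).trans ((add_le_add hp hq).trans ?_))
  rw [← add_mul, Nat.cast_add]

lemma forall_finset {ι : Type*} (s : Finset ι) {n : ℕ} {p : ι → Ω → Prop}
    (h : ∀ i ∈ s, FailsAtMost Pr c n (p i)) :
    FailsAtMost Pr c (s.card * n) fun ω => ∀ i ∈ s, p i ω := by
  have h' : {ω | ¬ ∀ i ∈ s, p i ω} ⊆ ⋃ i ∈ s, {ω | ¬ p i ω} := fun ω hω => by
    simpa only [Set.mem_iUnion, Set.mem_ofPred_eq, not_forall, exists_prop] using hω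
  refine (measure_mono h').trans ((measure_biUnion_finset_le _ _).trans
    ((Finset.sum_le_sum h).trans ?_))
  rw [Finset.sum_const, nsmul_eq_mul, Nat.cast_mul, mul_assoc]

lemma forall_fintype {ι : Type*} [Fintype ι] {n : ℕ} {p : ι → Ω → Prop}
    (h : ∀ i, FailsAtMost Pr c n (p i)) :
    FailsAtMost Pr c (Fintype.card ι * n) fun ω => ∀ i, p i ω :=
  (forall_finset Finset.univ fun i _ => h i).mono (fun _ hω i => hω i (Finset.mem_univ i)) le_rfl

end FailsAtMost

end Union

/-! ### Union bound over the conditions of a good run. -/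

section GoodEvent

variable {d k : ℕ} {Ω : Type*} [mΩ : MeasurableSpace Ω] {Pr : Measure Ω} [IsProbabilityMeasure Pr]
  {σ L V : ℝ} {w : ℕ → Ω → Fin d → ℝ} {η : ℕ → Ω → Fin k → ℝ}

namespace IsMeasurableNoise

variable (hN : IsMeasurableNoise Pr σ w η) (hσ : 0 < σ) (hL : 0 ≤ L)
include hN hσ hL

/-- A union bound over all pairs of end points up to `T + 1`. Pairs excluded by the definition
satisfy the condition vacuously. -/
lemma failsAtMost_martingaleBound (hV : 0 < V) (T : ℕ) {e : ℕ → NoiseIndex d k}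
    (he : ∀ s, (e s).time = s) {z : ℕ → Ω → ℝ}
    (hz : ∀ s, Measurable[noiseSigma w η (pastOf (e s))] (z s)) :
    FailsAtMost Pr (2 * ENNReal.ofReal (Real.exp (-(7 * L)))) ((T + 2) * (T + 2)) fun ω =>
      MartingaleBound T σ L V (fun s => z s ω) (fun s => noise w η (e s) ω) := by
  have h := FailsAtMost.forall_finset (Pr := Pr) (c := 2 * ENNReal.ofReal (Real.exp (-(7 * L))))
    (Finset.range (T + 2) ×ˢ Finset.range (T + 2)) (n := 1)
    (p := fun i ω => 1 ≤ i.1 → i.1 ≤ i.2 → ∑ s ∈ Finset.Ico i.1 i.2, z s ω ^ 2 ≤ V * i.2 →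
      |∑ s ∈ Finset.Ico i.1 i.2, z s ω * noise w η (e s) ω|
        ≤ √(2 * (7 * L) * σ ^ 2 * (V * i.2))) fun i _ => ?_
  · refine h.mono (fun ω hω l r h1 h2 h3 => hω (l, r) ?_ h1 h2) ?_
    · rw [Finset.mem_product, Finset.mem_range, Finset.mem_range]; constructor <;> omega
    · rw [Finset.card_product, Finset.card_range, mul_one]
  · rw [FailsAtMost, Nat.cast_one, one_mul]
    by_cases h1 : 1 ≤ i.1 ∧ i.1 ≤ i.2
    · refine le_trans (measure_mono ?_) (hN.measure_martingale_le hσ he hz i.1 i.2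
        (q := 7 * L) (v := V * i.2) (by positivity) (mul_pos hV (by
          have : 0 < i.2 := by omega
          exact_mod_cast this)))
      exact fun ω hω h => hω fun _ _ => h
    · have : {ω | ¬ (1 ≤ i.1 → i.1 ≤ i.2 → ∑ s ∈ Finset.Ico i.1 i.2, z s ω ^ 2 ≤ V * i.2 →
          |∑ s ∈ Finset.Ico i.1 i.2, z s ω * noise w η (e s) ω|
            ≤ √(2 * (7 * L) * σ ^ 2 * (V * i.2)))} = ∅ := by
        refine Set.eq_empty_of_forall_notMem fun ω hω => hω fun h2 h3 => absurd ⟨h2, h3⟩ h1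
      rw [this, measure_empty]
      exact zero_le

lemma failsAtMost_sq (e : NoiseIndex d k) :
    FailsAtMost Pr (2 * ENNReal.ofReal (Real.exp (-(7 * L)))) 1 fun ω =>
      noise w η e ω ^ 2 ≤ 2 * (7 * L) * σ ^ 2 := by
  rw [FailsAtMost, Nat.cast_one, one_mul]
  exact hN.measure_sq_gt_le hσ e (by positivity)

omit hL in
lemma failsAtMost_sum_le {e : ℕ → NoiseIndex d k} (he : ∀ s, (e s).time = s) (T : ℕ) :
    FailsAtMost Pr (2 * ENNReal.ofReal (Real.exp (-(7 * L)))) (T + 2) fun ω =>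
      ∀ n ∈ Finset.range (T + 2), ∑ s ∈ Finset.Ico 1 n, noise w η (e s) ω ^ 2
        ≤ 4 * σ ^ 2 * ((n - 1 : ℕ) + 7 * L) := by
  refine (FailsAtMost.forall_finset (n := 1) _ fun n _ => ?_).mono (fun _ h => h)
    (by rw [Finset.card_range, mul_one])
  rw [FailsAtMost, Nat.cast_one, one_mul]
  exact (hN.measure_sum_sq_gt_le hσ he 1 n (7 * L)).trans (le_mul_of_one_le_left' one_le_two)

omit hL in
lemma failsAtMost_sum_ge {e : ℕ → NoiseIndex d k} (he : ∀ s, (e s).time = s) (T : ℕ) :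
    FailsAtMost Pr (2 * ENNReal.ofReal (Real.exp (-(7 * L)))) ((T + 2) * (T + 2)) fun ω =>
      ∀ i ∈ Finset.range (T + 2) ×ˢ Finset.range (T + 2),
        σ ^ 2 * ((i.2 - i.1 : ℕ) / 2 - 7 * L) ≤ ∑ s ∈ Finset.Ico i.1 i.2, noise w η (e s) ω ^ 2 := by
  refine (FailsAtMost.forall_finset (n := 1) _ fun i _ => ?_).mono (fun _ h => h)
    (by rw [Finset.card_product, Finset.card_range, mul_one])
  rw [FailsAtMost, Nat.cast_one, one_mul]
  exact (hN.measure_sum_sq_lt_le hσ he i.1 i.2 (7 * L)).trans (le_mul_of_one_le_left' one_le_two)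

/-- Trajectories are good runs with high probability. -/
theorem failsAtMost_goodRun (hV : 0 < V) {π : Policy d k} (hπ : MeasurablePolicy π)
    (A : Matrix (Fin d) (Fin d) ℝ) (B : Matrix (Fin d) (Fin k) ℝ) (K₀ : Matrix (Fin k) (Fin d) ℝ)
    (T : ℕ) :
    FailsAtMost Pr (2 * ENNReal.ofReal (Real.exp (-(7 * L)))) (12 * (T + 2) ^ 2 * (d + k) ^ 2)
      fun ω => GoodRun A B K₀ σ L V T (state π A B (fun s => w s ω) (fun s => η s ω))
        (action π A B (fun s => w s ω) (fun s => η s ω)) (fun s => w s ω) (fun s => η s ω) := by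
  set c := 2 * ENNReal.ofReal (Real.exp (-(7 * L))) with hc
  set x : ℕ → Ω → Fin d → ℝ := fun t ω => state π A B (fun s => w s ω) (fun s => η s ω) t with hx
  set u : ℕ → Ω → Fin k → ℝ := fun t ω => action π A B (fun s => w s ω) (fun s => η s ω) t with hu
  set M := (T + 2) ^ 2 * (d + k) ^ 2 with hM
  have hTM : T + 2 ≤ (T + 2) * (T + 2) := Nat.le_mul_of_pos_left _ (by omega)
  have hd2 : d ≤ (d + k) ^ 2 := by nlinarith [Nat.le_self_pow two_ne_zero d, Nat.zero_le (d * k)]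
  have hk2 : k ≤ (d + k) ^ 2 := by nlinarith [Nat.le_self_pow two_ne_zero k, Nat.zero_le (d * k)]
  have hcard : ∀ {a b m : ℕ}, a ≤ (d + k) ^ 2 → b ≤ (T + 2) * (T + 2) → m = a * b → m ≤ M := by
    intro a b m ha hb hm
    rw [hm, hM, mul_comm, sq (T + 2)]
    exact Nat.mul_le_mul hb ha
  -- measurability with respect to the past
  have hxm : ∀ (e : NoiseIndex d k) (s : ℕ), NoiseIndex.time e = s →
      Measurable[noiseSigma w η (pastOf e)] (x s) := by
    intro e s hes
    refine measurable_state (m := noiseSigma w η (pastOf e)) A B hπ s (fun r hr => ?_)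
      fun r hr => ?_
    · refine measurable_w_of_subset fun i => ⟨?_, ?_⟩
      · rw [hes]; exact hr.le
      · rintro rfl; exact absurd hes (ne_of_lt hr)
    · refine measurable_η_of_subset fun i => ⟨?_, ?_⟩
      · rw [hes]; exact hr.le
      · rintro rfl; exact absurd hes (ne_of_lt hr)
  -- The action at time `s` may use `η_s`, which belongs to the past of each coordinate of `w_s`:
  -- `pastOf` contains the other variables of the same time.
  have hum : ∀ (i : Fin d) (s : ℕ), Measurable[noiseSigma w η (pastOf (Sum.inl (s, i)))] (u s) := by
    intro i s
    refine measurable_action (m := noiseSigma w η (pastOf (Sum.inl (s, i)))) A B hπ s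
      (fun r hr => ?_) fun r hr => ?_
    · refine measurable_w_of_subset fun j => ⟨hr.le, fun h => ?_⟩
      have := congrArg NoiseIndex.time h
      exact absurd this (ne_of_lt hr)
    · exact measurable_η_of_subset fun j => ⟨hr, fun h => by cases h⟩
  have hinl : ∀ i : Fin d, ∀ s, NoiseIndex.time (Sum.inl (s, i) : NoiseIndex d k) = s :=
    fun _ _ => rfl
  have hinr : ∀ j : Fin k, ∀ s, NoiseIndex.time (Sum.inr (s, j) : NoiseIndex d k) = s :=
    fun _ _ => rfl
  have hmart : ∀ {e : ℕ → NoiseIndex d k} (_ : ∀ s, (e s).time = s) {z : ℕ → Ω → ℝ}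
      (_ : ∀ s, Measurable[noiseSigma w η (pastOf (e s))] (z s)),
      FailsAtMost Pr c ((T + 2) * (T + 2)) fun ω =>
        MartingaleBound T σ L V (fun s => z s ω) (fun s => noise w η (e s) ω) :=
    fun he _ hz => hN.failsAtMost_martingaleBound hσ hL hV T he hz
  have f1 : FailsAtMost Pr c M fun ω => ∀ i : Fin d, ∀ t ∈ Finset.range (T + 2),
      noise w η (Sum.inl (t, i)) ω ^ 2 ≤ 2 * (7 * L) * σ ^ 2 :=
    (FailsAtMost.forall_fintype fun i => FailsAtMost.forall_finset _ fun t _ =>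
      hN.failsAtMost_sq hσ hL (Sum.inl (t, i))).mono (fun _ h => h)
      (hcard hd2 hTM (by simp))
  have f2 : FailsAtMost Pr c M fun ω => ∀ i : Fin k, ∀ t ∈ Finset.range (T + 2),
      noise w η (Sum.inr (t, i)) ω ^ 2 ≤ 2 * (7 * L) * σ ^ 2 :=
    (FailsAtMost.forall_fintype fun i => FailsAtMost.forall_finset _ fun t _ =>
      hN.failsAtMost_sq hσ hL (Sum.inr (t, i))).mono (fun _ h => h)
      (hcard hk2 hTM (by simp))
  have f3 := (FailsAtMost.forall_fintype fun i : Fin d =>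
    hN.failsAtMost_sum_le hσ (L := L) (hinl i) T).mono (m := M) (fun _ h => h)
      (hcard hd2 hTM (by simp))
  have f4 := (FailsAtMost.forall_fintype fun i : Fin k =>
    hN.failsAtMost_sum_le hσ (L := L) (hinr i) T).mono (m := M) (fun _ h => h)
      (hcard hk2 hTM (by simp))
  have f5 := (FailsAtMost.forall_fintype fun i : Fin d =>
    hN.failsAtMost_sum_ge hσ (L := L) (hinl i) T).mono (m := M) (fun _ h => h)
      (hcard hd2 le_rfl (by simp))
  have f6 := (FailsAtMost.forall_fintype fun i : Fin k =>
    hN.failsAtMost_sum_ge hσ (L := L) (hinr i) T).mono (m := M) (fun _ h => h)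
      (hcard hk2 le_rfl (by simp))
  have hdd : d * d ≤ (d + k) ^ 2 := by nlinarith [Nat.zero_le (d * k)]
  have hkd : k * d ≤ (d + k) ^ 2 := by nlinarith [Nat.zero_le (d * k)]
  have hkk : k * k ≤ (d + k) ^ 2 := by nlinarith [Nat.zero_le (d * k)]
  have f7 : FailsAtMost Pr c M fun ω => ∀ (j : Fin k) (i : Fin d),
      MartingaleBound T σ L V (fun s => u s ω j) (fun s => w s ω i) :=
    (FailsAtMost.forall_fintype fun j => FailsAtMost.forall_fintype fun i =>
      hmart (hinl i) fun s => (measurable_pi_apply j).comp (hum i s)).mono (fun _ h => h)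
      (hcard hkd le_rfl (by simp [mul_assoc]))
  have f8 : FailsAtMost Pr c M fun ω => ∀ (a i : Fin d),
      MartingaleBound T σ L V (fun s => x s ω a) (fun s => w s ω i) :=
    (FailsAtMost.forall_fintype fun a => FailsAtMost.forall_fintype fun i =>
      hmart (hinl i) fun s => (measurable_pi_apply a).comp (hxm _ s rfl)).mono (fun _ h => h)
      (hcard hdd le_rfl (by simp [mul_assoc]))
  have f9 : FailsAtMost Pr c M fun ω => ∀ (a i : Fin d),
      MartingaleBound T σ L V (fun s => (A *ᵥ x s ω + B *ᵥ u s ω) a) (fun s => w s ω i) :=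
    (FailsAtMost.forall_fintype fun a => FailsAtMost.forall_fintype fun i =>
      hmart (hinl i) fun s => (measurable_pi_apply a).comp
        (((measurable_mulVec A).comp (hxm _ s rfl)).add
          ((measurable_mulVec B).comp (hum i s)))).mono (fun _ h => h)
      (hcard hdd le_rfl (by simp [mul_assoc]))
  have f10 : FailsAtMost Pr c M fun ω => ∀ (a j : Fin k),
      MartingaleBound T σ L V (fun s => (K₀ *ᵥ x s ω) a) (fun s => η s ω j) :=
    (FailsAtMost.forall_fintype fun a => FailsAtMost.forall_fintype fun j =>
      hmart (hinr j) fun s => (measurable_pi_apply a).comp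
        ((measurable_mulVec K₀).comp (hxm _ s rfl))).mono (fun _ h => h)
      (hcard hkk le_rfl (by simp [mul_assoc]))
  have f11 : FailsAtMost Pr c M fun ω => ∀ (a b : Fin d), a ≠ b →
      MartingaleBound T σ L V (fun s => w s ω a) (fun s => w s ω b) := by
    refine (FailsAtMost.forall_fintype fun a => FailsAtMost.forall_fintype
      (n := (T + 2) * (T + 2)) fun b => ?_).mono (fun _ h => h)
      (hcard hdd le_rfl (by simp [mul_assoc]))
    by_cases hab : a = b
    · simp [FailsAtMost, hab]
    -- The coordinates of `w_s` other than `b` count as past of coordinate `b`, so off-diagonal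
    -- products are martingale increments too.
    · refine (hmart (hinl b) (z := fun s => noise w η (Sum.inl (s, a))) fun s =>
        measurable_noise_of_mem ⟨le_rfl, fun h => hab ?_⟩).mono (fun _ h _ => h) le_rfl
      simpa using h
  have f12 : FailsAtMost Pr c M fun ω => ∀ (a b : Fin k), a ≠ b →
      MartingaleBound T σ L V (fun s => η s ω a) (fun s => η s ω b) := by
    refine (FailsAtMost.forall_fintype fun a => FailsAtMost.forall_fintype
      (n := (T + 2) * (T + 2)) fun b => ?_).mono (fun _ h => h)
      (hcard hkk le_rfl (by simp [mul_assoc]))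
    by_cases hab : a = b
    · simp [FailsAtMost, hab]
    · refine (hmart (hinr b) (z := fun s => noise w η (Sum.inr (s, a))) fun s =>
        measurable_noise_of_mem ⟨le_rfl, fun h => hab ?_⟩).mono (fun _ h _ => h) le_rfl
      simpa using h
  refine ((f1.and f2).and ((f3.and f4).and ((f5.and f6).and ((f7.and f8).and ((f9.and f10).and
    (f11.and f12)))))).mono (fun ω h => ?_) (by rw [mul_assoc, ← hM]; omega)
  obtain ⟨⟨g1, g2⟩, ⟨g3, g4⟩, ⟨g5, g6⟩, ⟨g7, g8⟩, ⟨g9, g10⟩, g11, g12⟩ := h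
  exact
    { x_one := state_one _ _ _ _ _
      step := fun t ht => state_succ _ _ _ _ _ ht
      w_sq := fun t ht i => g1 i t (Finset.mem_range.2 (by omega))
      η_sq := fun t ht j => g2 j t (Finset.mem_range.2 (by omega))
      w_sum_le := fun n hn i => g3 i n (Finset.mem_range.2 (by omega))
      η_sum_le := fun n hn j => g4 j n (Finset.mem_range.2 (by omega))
      w_sum_ge := fun l r h1 h2 i => g5 i (l, r) (Finset.mem_product.2
        ⟨Finset.mem_range.2 (by dsimp only; omega), Finset.mem_range.2 (by dsimp only; omega)⟩)
      η_sum_ge := fun l r h1 h2 j => g6 j (l, r) (Finset.mem_product.2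
        ⟨Finset.mem_range.2 (by dsimp only; omega), Finset.mem_range.2 (by dsimp only; omega)⟩)
      uw := g7
      xw := g8
      yw := g9
      xη := g10
      ww := g11
      ηη := g12 }

end IsMeasurableNoise

end GoodEvent


/-! ### A bound of the trajectory that holds always -/

namespace Tuned

variable {d k : ℕ} {I : AlgInput d k} {B : Matrix (Fin d) (Fin k) ℝ}
  {Kstar : Matrix (Fin k) (Fin d) ℝ} {P P₀ : Matrix (Fin d) (Fin d) ℝ}
  {α ϑ p p₀ σ κ₀ Y L μ : ℝ}
  {x : ℕ → Fin d → ℝ} {u : ℕ → Fin k → ℝ} {w : ℕ → Fin d → ℝ} {η : ℕ → Fin k → ℝ}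
  (S : Tuned I B Kstar P P₀ α ϑ p p₀ σ κ₀ Y L μ)

include S

lemma xb_nonneg : 0 ≤ I.xb := by
  refine le_trans ?_ S.xb_ge
  have := S.κ_pos
  have := S.L_one
  have h : 0 ≤ max ((1 + ϑ) ^ 2 * κ₀ ^ 6) (4 * I.κ ^ 6) := le_max_of_le_right (by positivity)
  positivity

variable (hx1 : x 1 = 0) (hstep : ∀ t, 1 ≤ t → x (t + 1) = I.A *ᵥ x t + B *ᵥ u t + w t)
  (hpol : ∀ t, 1 ≤ t → u t = I.policy t (x, u) (η t))
include hpol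

-- Whatever the estimates are, a greedy controller is played only if the abort test has certified
-- its norm and the current state. This is all that is known off the good event.
omit S in
lemma action_cases {t : ℕ} (ht : 1 ≤ t) : u t = I.K₀ *ᵥ x t + η t ∨ u t = I.K₀ *ᵥ x t ∨
    ∃ K, u t = K *ᵥ x t ∧ ‖K‖ ≤ I.κ ∧ en (x t) ^ 2 ≤ I.xb := by
  by_cases hw : I.inWarmup (x, u) t
  · left; rw [hpol t ht, AlgInput.policy, if_pos hw]
  · by_cases ha : I.aborted (x, u) t
    · right; left; rw [hpol t ht, AlgInput.policy, if_neg hw, if_pos ha]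
    · right; right
      refine ⟨I.greedy (x, u) (I.phase t),
        by rw [hpol t ht, AlgInput.policy, if_neg hw, if_neg ha], ?_⟩
      have h : ¬ (I.xb < x t ⬝ᵥ x t ∨ I.κ < ‖I.greedy (x, u) (I.phase t)‖) := fun h =>
        ha ⟨t, Finset.mem_Icc.2 ⟨ht, le_rfl⟩, hw, h⟩
      rw [not_or, not_lt, not_lt] at h
      exact ⟨h.2, by rw [en_sq]; exact h.1⟩

lemma action_sq_le {t : ℕ} (ht : 1 ≤ t) :
    en (u t) ^ 2 ≤ 2 * Y * en (x t) ^ 2 + 2 * en (η t) ^ 2 := by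
  have hY := S.Y_pos
  have hx := sq_nonneg (en (x t))
  have hη := sq_nonneg (en (η t))
  have hYx := mul_nonneg hY.le hx
  have h0 : en (I.K₀ *ᵥ x t) ^ 2 ≤ Y * en (x t) ^ 2 := by
    refine (en_mulVec_sq_le _ _).trans (mul_le_mul_of_nonneg_right ?_ hx)
    exact (pow_le_pow_left₀ (norm_nonneg _) S.norm_K₀_le 2).trans S.κ₀_le
  rcases action_cases hpol ht with h | h | ⟨K, h, hK, -⟩
  · rw [h]; linarith [en_sq_add_le (I.K₀ *ᵥ x t) (η t)]
  · rw [h]; linarith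
  · rw [h]
    have h2 : en (K *ᵥ x t) ^ 2 ≤ Y * en (x t) ^ 2 := by
      refine (en_mulVec_sq_le _ _).trans (mul_le_mul_of_nonneg_right ?_ hx)
      exact (pow_le_pow_left₀ (norm_nonneg _) hK 2).trans S.κ_le
    linarith

include hx1 hstep

/-- While `K₀` is played, `P₀` grows by noise only. When a greedy controller is played the state is
below the threshold, so the next value is at most a multiple of `x_b` plus noise, however bad the
controller is. -/
lemma value_le {t : ℕ} (ht : 1 ≤ t) : qf P₀ (x t)
    ≤ Y ^ 6 * I.xb + Y ^ 5 * ∑ s ∈ Finset.Ico 1 t, (en (w s) ^ 2 + en (η s) ^ 2) := by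
  have hY := S.Y_pos
  have hxb := S.xb_nonneg
  induction t, ht using Nat.le_induction with
  | base => rw [hx1, qf_zero_right]; simp only [Finset.Ico_self, Finset.sum_empty]; positivity
  | succ t ht ih =>
    rw [Finset.sum_Ico_succ_top ht]
    set E := ∑ s ∈ Finset.Ico 1 t, (en (w s) ^ 2 + en (η s) ^ 2) with hE
    have hE0 : 0 ≤ E := Finset.sum_nonneg fun t _ => by positivity
    have hκ0 : 1 - (2 * κ₀ ^ 2)⁻¹ ≤ 1 := by
      have := S.κ₀_pos
      have : 0 < (2 * κ₀ ^ 2)⁻¹ := by positivity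
      linarith
    have hV := S.qf_P₀_nonneg (x t)
    have hwη : 0 ≤ en (w t) ^ 2 + en (η t) ^ 2 := by positivity
    have e4 : 4 * Y ^ 4 ≤ Y ^ 5 := S.pow_mul_le (by norm_num) (by norm_num)
    have hexp : ∀ y : Fin k → ℝ, en y ^ 2 ≤ en (η t) ^ 2 →
        qf P₀ (I.A *ᵥ x t + B *ᵥ (I.K₀ *ᵥ x t + y) + w t)
          ≤ qf P₀ (x t) + Y ^ 5 * (en (w t) ^ 2 + en (η t) ^ 2) := by
      intro y hy
      refine (S.warm_step (x t) (w t) y).trans (add_le_add ?_ ?_)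
      · exact mul_le_of_le_one_left hV hκ0
      · calc 2 * κ₀ ^ 2 * qf P₀ (w t + B *ᵥ y)
            ≤ 2 * Y * (2 * Y ^ 3 * (en (w t) ^ 2 + en y ^ 2)) := by
              refine mul_le_mul (by linarith [S.κ₀_le]) (S.qf_mixed_noise_le _ _)
                (S.qf_P₀_nonneg _) (by positivity)
          _ ≤ 2 * Y * (2 * Y ^ 3 * (en (w t) ^ 2 + en (η t) ^ 2)) := by gcongr
          _ = (4 * Y ^ 4) * (en (w t) ^ 2 + en (η t) ^ 2) := by ring
          _ ≤ _ := mul_le_mul_of_nonneg_right e4 hwη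
    rw [hstep t ht]
    rcases action_cases hpol ht with h | h | ⟨K, h, hK, hx⟩
    · rw [h]
      have := hexp (η t) le_rfl
      linarith
    · rw [h]
      have := hexp 0 (by rw [en_zero]; nlinarith [sq_nonneg (en (η t))])
      rw [add_zero] at this
      linarith
    · rw [h]
      have h1 : en (I.A *ᵥ x t + B *ᵥ (K *ᵥ x t)) ≤ 2 * Y ^ 2 * en (x t) := by
        have hx0 := en_nonneg (x t)
        have h2 : en (I.A *ᵥ x t) ≤ Y ^ 2 * en (x t) := by
          refine (en_mulVec _ _).trans (mul_le_mul_of_nonneg_right (S.A_le.trans ?_) hx0)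
          exact le_self_pow₀ S.Y_one two_ne_zero
        have h3 : en (B *ᵥ (K *ᵥ x t)) ≤ Y ^ 2 * en (x t) := by
          calc en (B *ᵥ (K *ᵥ x t)) ≤ ‖B‖ * (‖K‖ * en (x t)) :=
                (en_mulVec _ _).trans (mul_le_mul_of_nonneg_left (en_mulVec _ _) (norm_nonneg _))
            _ ≤ Y * (Y * en (x t)) := mul_le_mul (S.B_le.trans S.ϑ_le)
                (mul_le_mul_of_nonneg_right (hK.trans S.κ_leY) hx0)
                (mul_nonneg (norm_nonneg _) hx0) hY.le
            _ = _ := by ring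
        linarith [en_add_le (I.A *ᵥ x t) (B *ᵥ (K *ᵥ x t))]
      have h2 := pow_le_pow_left₀ (en_nonneg _) h1 2
      have h3 : (2 * Y ^ 2 * en (x t)) ^ 2 ≤ 4 * Y ^ 4 * I.xb := by
        calc _ = 4 * Y ^ 4 * en (x t) ^ 2 := by ring
          _ ≤ _ := mul_le_mul_of_nonneg_left hx (by positivity)
      have h4 := en_sq_add_le (I.A *ᵥ x t + B *ᵥ (K *ᵥ x t)) (w t)
      have h5 : qf P₀ (I.A *ᵥ x t + B *ᵥ (K *ᵥ x t) + w t)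
          ≤ Y * (8 * Y ^ 4 * I.xb + 2 * en (w t) ^ 2) :=
        (S.P₀_le _).trans (mul_le_mul S.p₀_le (by linarith) (sq_nonneg _) hY.le)
      have e6 : 8 * Y ^ 5 ≤ Y ^ 6 := S.pow_mul_le (by norm_num) (by norm_num)
      have e7 : 2 * Y ^ 1 ≤ Y ^ 5 := S.pow_mul_le (by norm_num) (by norm_num)
      have h6 := mul_le_mul_of_nonneg_right e6 hxb
      have h7 := mul_le_mul_of_nonneg_right e7 (sq_nonneg (en (w t)))
      have h8 : 0 ≤ Y ^ 5 * E := mul_nonneg (pow_nonneg hY.le 5) hE0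
      have h9 : 0 ≤ Y ^ 5 * en (η t) ^ 2 := mul_nonneg (pow_nonneg hY.le 5) (sq_nonneg _)
      refine h5.trans ?_
      rw [pow_one] at h7
      generalize en (w t) ^ 2 = a at h7 ⊢
      generalize en (η t) ^ 2 = b at h9 ⊢
      linear_combination h6 + h7 + h8 + h9

lemma state_sq_le {t : ℕ} (ht : 1 ≤ t) : en (x t) ^ 2
    ≤ Y ^ 7 * (I.xb + ∑ s ∈ Finset.Ico 1 t, (en (w s) ^ 2 + en (η s) ^ 2)) := by
  have hY := S.Y_pos
  set E := ∑ s ∈ Finset.Ico 1 t, (en (w s) ^ 2 + en (η s) ^ 2) with hE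
  have hE0 : 0 ≤ E := Finset.sum_nonneg fun t _ => by positivity
  have e6 : 1 * Y ^ 6 ≤ Y ^ 7 := S.pow_mul_le (by norm_num) (by norm_num)
  calc en (x t) ^ 2 ≤ Y * qf P₀ (x t) := S.en_sq_le_qf_P₀ _
    _ ≤ Y * (Y ^ 6 * I.xb + Y ^ 5 * E) :=
      mul_le_mul_of_nonneg_left (S.value_le hx1 hstep hpol ht) hY.le
    _ = Y ^ 7 * I.xb + 1 * Y ^ 6 * E := by ring
    _ ≤ Y ^ 7 * I.xb + Y ^ 7 * E := by gcongr
    _ = _ := by ring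

lemma deviation_sq_le {t T : ℕ} (ht : 1 ≤ t) (hT : t ≤ T) : en (u t - Kstar *ᵥ x t) ^ 2
    ≤ Y ^ 9 * (I.xb + ∑ s ∈ Finset.Ico 1 (T + 1), (en (w s) ^ 2 + en (η s) ^ 2)) := by
  have hY := S.Y_pos
  have hxb := S.xb_nonneg
  set E := ∑ s ∈ Finset.Ico 1 (T + 1), (en (w s) ^ 2 + en (η s) ^ 2) with hE
  have hE0 : 0 ≤ E := Finset.sum_nonneg fun t _ => by positivity
  have h1 : en (x t) ^ 2 ≤ Y ^ 7 * (I.xb + E) := by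
    refine (S.state_sq_le hx1 hstep hpol ht).trans ?_
    gcongr
    exact Finset.sum_le_sum_of_subset_of_nonneg (Finset.Ico_subset_Ico le_rfl (by omega))
      fun t _ _ => by positivity
  have h2 : en (η t) ^ 2 ≤ I.xb + E := by
    have : en (w t) ^ 2 + en (η t) ^ 2 ≤ E :=
      Finset.single_le_sum (f := fun s => en (w s) ^ 2 + en (η s) ^ 2)
        (fun s _ => by positivity) (Finset.mem_Ico.2 ⟨ht, by omega⟩)
    linarith [sq_nonneg (en (w t))]
  have h3 := en_sq_add_le (u t) (-(Kstar *ᵥ x t))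
  rw [← sub_eq_add_neg, en_neg] at h3
  have hKs : ‖Kstar‖ ^ 2 ≤ Y :=
    (pow_le_pow_left₀ (norm_nonneg _) S.goodController_Kstar.2 2).trans S.κ_le
  have h4 := (en_mulVec_sq_le Kstar (x t)).trans
    (mul_le_mul_of_nonneg_right hKs (sq_nonneg _))
  have h5 := S.action_sq_le hpol ht
  set F := I.xb + E with hF
  have hF0 : 0 ≤ F := by positivity
  calc _ ≤ 6 * Y * en (x t) ^ 2 + 4 * en (η t) ^ 2 := by linarith
    _ ≤ 6 * Y * (Y ^ 7 * F) + 4 * F := by gcongr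
    _ = (6 * Y ^ 8 + 4 * Y ^ 0) * F := by ring
    _ ≤ Y ^ 9 * F := by
      refine mul_le_mul_of_nonneg_right ?_ hF0
      have e1 : 4 * Y ^ 0 ≤ Y ^ 8 := S.pow_mul_le (by norm_num) (by norm_num)
      have e2 : 7 * Y ^ 8 ≤ Y ^ 9 := S.pow_mul_le (by norm_num) (by norm_num)
      linarith

end Tuned

/-! ### The regret identity -/

section Regret

variable {d k : ℕ} {Ω : Type*} [mΩ : MeasurableSpace Ω] {Pr : Measure Ω} [IsProbabilityMeasure Pr]
  {σ : ℝ} {w : ℕ → Ω → Fin d → ℝ} {η : ℕ → Ω → Fin k → ℝ}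

namespace IsMeasurableNoise

variable (hN : IsMeasurableNoise Pr σ w η)
include hN

-- With `z = y² / (4σ²)` one has `z² ≤ 2 e^z ≤ 6 e^{z-1}`, and the exponential on the right has mean
-- at most one. The constant is `16 · 6`.
omit [IsProbabilityMeasure Pr] in
lemma fourth_moment (hσ : 0 < σ) (e : NoiseIndex d k) :
    Integrable (fun ω => noise w η e ω ^ 4) Pr ∧ ∫ ω, noise w η e ω ^ 4 ∂Pr ≤ 96 * σ ^ 4 := by
  have hm : Measurable fun ω => noise w η e ω ^ 4 := (hN.meas e).pow_const 4
  have hpt : ∀ y : ℝ, y ^ 4 ≤ 96 * σ ^ 4 * Real.exp (y ^ 2 / (4 * σ ^ 2) - 1) := by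
    intro y
    set z := y ^ 2 / (4 * σ ^ 2) with hz
    have hz0 : 0 ≤ z := by positivity
    have hy : y ^ 4 = 16 * σ ^ 4 * z ^ 2 := by rw [hz]; field_simp; ring
    have h1 := Real.quadratic_le_exp_of_nonneg hz0
    have h2 : Real.exp z = Real.exp 1 * Real.exp (z - 1) := by rw [← Real.exp_add]; ring_nf
    have h3 : Real.exp 1 ≤ 3 := Real.exp_one_lt_three.le
    have h4 : z ^ 2 ≤ 6 * Real.exp (z - 1) := by
      have h5 := mul_le_mul_of_nonneg_right h3 (Real.exp_pos (z - 1)).le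
      linarith
    rw [hy]
    have h6 : 0 < 16 * σ ^ 4 := by positivity
    calc 16 * σ ^ 4 * z ^ 2 ≤ 16 * σ ^ 4 * (6 * Real.exp (z - 1)) :=
          mul_le_mul_of_nonneg_left h4 h6.le
      _ = _ := by ring
  have hl : ∫⁻ ω, ENNReal.ofReal (noise w η e ω ^ 4) ∂Pr ≤ ENNReal.ofReal (96 * σ ^ 4) := by
    have h1 : ∫⁻ ω, ENNReal.ofReal (noise w η e ω ^ 4) ∂Pr
        = ∫⁻ y, ENNReal.ofReal (y ^ 4) ∂(gaussianReal 0 (Real.toNNReal (σ ^ 2))) := by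
      rw [← (hN.hasLaw e).map_eq, lintegral_map (by fun_prop) (hN.meas e)]
    rw [h1]
    calc _ ≤ ∫⁻ y, ENNReal.ofReal (96 * σ ^ 4) * ENNReal.ofReal
            (Real.exp (y ^ 2 / (4 * σ ^ 2) - 1)) ∂(gaussianReal 0 (Real.toNNReal (σ ^ 2))) := by
          refine lintegral_mono fun y => ?_
          rw [← ENNReal.ofReal_mul (by positivity)]
          exact ENNReal.ofReal_le_ofReal (hpt y)
      _ = ENNReal.ofReal (96 * σ ^ 4) * _ := lintegral_const_mul _ (by fun_prop)
      _ ≤ ENNReal.ofReal (96 * σ ^ 4) * 1 :=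
          mul_le_mul_right (lintegral_exp_sq_sub_one_le hσ) _
      _ = _ := mul_one _
  have h0 : ∀ ω, 0 ≤ noise w η e ω ^ 4 := fun ω => by positivity
  refine ⟨⟨hm.aestronglyMeasurable, ?_⟩, ?_⟩
  · rw [hasFiniteIntegral_iff_ofReal (Eventually.of_forall h0)]
    exact hl.trans_lt ENNReal.ofReal_lt_top
  · rw [integral_eq_lintegral_of_nonneg_ae (Eventually.of_forall h0) hm.aestronglyMeasurable]
    exact ENNReal.toReal_le_of_le_ofReal (by positivity) hl

variable {A Q P : Matrix (Fin d) (Fin d) ℝ} {B : Matrix (Fin d) (Fin k) ℝ}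
  {R : Matrix (Fin k) (Fin k) ℝ}

/-- The expected regret is bounded by the accumulated deviation from the optimal actions. -/
theorem integral_regret_le (hR : R.PosDef) (hP : IsRiccatiSolution A B Q R P) {π : Policy d k}
    (hπ : MeasurablePolicy π)
    (hx : ∀ t a, MemLp (fun ω => state π A B (fun s => w s ω) (fun s => η s ω) t a) 2 Pr)
    (hu : ∀ t a, MemLp (fun ω => action π A B (fun s => w s ω) (fun s => η s ω) t a) 2 Pr)
    (T : ℕ) :
    Integrable (fun ω => regret Q R (σ ^ 2 * P.trace) π A B (fun s => w s ω) (fun s => η s ω) T)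
      Pr ∧
    ∫ ω, regret Q R (σ ^ 2 * P.trace) π A B (fun s => w s ω) (fun s => η s ω) T ∂Pr
      ≤ ∑ t ∈ Finset.Icc 1 T, ∫ ω, qf (R + Bᵀ * P * B)
        (action π A B (fun s => w s ω) (fun s => η s ω) t
          - ctrl A B R P *ᵥ state π A B (fun s => w s ω) (fun s => η s ω) t) ∂Pr := by
  set x : ℕ → Ω → Fin d → ℝ := fun t ω => state π A B (fun s => w s ω) (fun s => η s ω) t with hxd
  set u : ℕ → Ω → Fin k → ℝ := fun t ω => action π A B (fun s => w s ω) (fun s => η s ω) t with hud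
  set G := R + Bᵀ * P * B with hG
  have hc : ∀ t, Integrable (fun ω => qf Q (x t ω) + qf R (u t ω)) Pr := fun t =>
    (integrable_qf (hx t) Q).add (integrable_qf (hu t) R)
  have hdev : ∀ t a, MemLp (fun ω => (u t ω - ctrl A B R P *ᵥ x t ω) a) 2 Pr := fun t a =>
    (hu t a).sub (memLp_mulVec (hx t) _ a)
  have hy : ∀ t a, MemLp (fun ω => (A *ᵥ x t ω + B *ᵥ u t ω) a) 2 Pr := fun t a =>
    (memLp_mulVec (hx t) A a).add (memLp_mulVec (hu t) B a)
  have hreg : ∀ ω, regret Q R (σ ^ 2 * P.trace) π A B (fun s => w s ω) (fun s => η s ω) T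
      = ∑ t ∈ Finset.Icc 1 T, (qf Q (x t ω) + qf R (u t ω) - σ ^ 2 * P.trace) := fun ω => rfl
  have hi : ∀ t, Integrable (fun ω => qf Q (x t ω) + qf R (u t ω) - σ ^ 2 * P.trace) Pr :=
    fun t => (hc t).sub (integrable_const _)
  have hPs := (posDef_iff_qf.1 hP.1).1
  -- The Bellman equation with the completed square. The term `σ² tr P` that the noise adds to the
  -- next value cancels the subtracted optimal cost.
  have hstep : ∀ t, 1 ≤ t → ∫ ω, (qf Q (x t ω) + qf R (u t ω) - σ ^ 2 * P.trace) ∂Pr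
      = ∫ ω, qf P (x t ω) ∂Pr - ∫ ω, qf P (x (t + 1) ω) ∂Pr
        + ∫ ω, qf G (u t ω - ctrl A B R P *ᵥ x t ω) ∂Pr := by
    intro t ht
    have h1 : ∀ ω, qf Q (x t ω) + qf R (u t ω) = qf P (x t ω)
        + qf G (u t ω - ctrl A B R P *ᵥ x t ω) - qf P (A *ᵥ x t ω + B *ᵥ u t ω) := by
      intro ω
      have h2 := complete_square (A := A) (B := B) (Q := Q) hR hP.1.posSemidef (x t ω) (u t ω)
      have h3 : ric A B Q R P = P := hP.2.symm
      rw [h3] at h2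
      linarith
    have h4 : ∫ ω, qf P (x (t + 1) ω) ∂Pr
        = ∫ ω, qf P (A *ᵥ x t ω + B *ᵥ u t ω) ∂Pr + σ ^ 2 * P.trace := by
      have h5 : ∀ ω, x (t + 1) ω = A *ᵥ x t ω + B *ᵥ u t ω + w t ω := fun ω =>
        state_succ π A B _ _ ht
      simp only [h5]
      -- Everything up to time `t` except `w_t`; in particular `η_t` is included, which the action
      -- uses.
      refine hN.integral_qf_add_w (S := {i | NoiseIndex.time i ≤ t ∧ ∀ a, i ≠ Sum.inl (t, a)})
        (fun i hi => hi.2 i rfl) (hy t) ?_ hPs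
      refine ((measurable_mulVec A).comp ?_).add ((measurable_mulVec B).comp ?_)
      · refine measurable_state (m := noiseSigma w η _) A B hπ t (fun r hr => ?_) fun r hr => ?_
        · refine measurable_w_of_subset fun i => ⟨hr.le, fun a h => ?_⟩
          exact absurd (congrArg NoiseIndex.time h) (ne_of_lt hr)
        · exact measurable_η_of_subset fun i => ⟨hr.le, fun a h => by cases h⟩
      · refine measurable_action (m := noiseSigma w η _) A B hπ t (fun r hr => ?_) fun r hr => ?_
        · refine measurable_w_of_subset fun i => ⟨hr.le, fun a h => ?_⟩
          exact absurd (congrArg NoiseIndex.time h) (ne_of_lt hr)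
        · exact measurable_η_of_subset fun i => ⟨hr, fun a h => by cases h⟩
    rw [integral_sub (hc t) (integrable_const _), integral_const]
    simp only [h1]
    have hPG : Integrable (fun ω => qf P (x t ω) + qf G (u t ω - ctrl A B R P *ᵥ x t ω)) Pr :=
      (integrable_qf (hx t) P).add (integrable_qf (hdev t) G)
    rw [integral_sub hPG (integrable_qf (hy t) P), 
      integral_add (integrable_qf (y := x t) (hx t) P) (integrable_qf (hdev t) G), h4]
    simp only [probReal_univ, one_smul]
    ring
  simp only [hreg]
  refine ⟨integrable_finsetSum _ fun t _ => hi t, ?_⟩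
  rw [integral_finsetSum _ fun t _ => hi t]
  -- Telescoping from `x_1 = 0`. The terminal value is nonnegative and can be dropped.
  have key : ∀ n, ∑ t ∈ Finset.Icc 1 n, ∫ ω, (qf Q (x t ω) + qf R (u t ω) - σ ^ 2 * P.trace) ∂Pr
      = ∑ t ∈ Finset.Icc 1 n, ∫ ω, qf G (u t ω - ctrl A B R P *ᵥ x t ω) ∂Pr
        - ∫ ω, qf P (x (n + 1) ω) ∂Pr := by
    intro n
    induction n with
    | zero =>
      have : ∀ ω, x (0 + 1) ω = 0 := fun ω => state_one π A B _ _
      simp [this, qf_zero_right]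
    | succ n ih =>
      rw [Finset.sum_Icc_succ_top (Nat.le_add_left 1 n), Finset.sum_Icc_succ_top
        (Nat.le_add_left 1 n), ih, hstep (n + 1) (Nat.le_add_left 1 n)]
      ring
  rw [key]
  have h0 : 0 ≤ ∫ ω, qf P (x (T + 1) ω) ∂Pr :=
    integral_nonneg fun ω => (posSemidef_iff_qf.1 hP.1.posSemidef).2 _
  linarith

end IsMeasurableNoise

end Regret


/-! ### The expected regret of the tuned algorithm -/

/-- With `L = log (4T)` each condition fails with probability at most `2 (4T)⁻⁷`, and there are of
order `T²` of them. The remaining power `T⁻⁴` is what `integral_deviation_le` needs on the bad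
event. -/
lemma failure_prob_le {T d k : ℕ} (hT : 2 ≤ T) {Y : ℝ} (hd : (d : ℝ) ≤ Y) (hk : (k : ℝ) ≤ Y) :
    ((12 * (T + 2) ^ 2 * (d + k) ^ 2 : ℕ) : ℝ≥0∞)
      * (2 * ENNReal.ofReal (Real.exp (-(7 * Real.log (4 * T)))))
      ≤ ENNReal.ofReal (Y ^ 2 / T ^ 4) := by
  have hT' : (2 : ℝ) ≤ T := by exact_mod_cast hT
  have hT0 : (0 : ℝ) < T := by linarith
  have e1 : Real.exp (-(7 * Real.log (4 * T))) = ((4 * (T : ℝ)) ^ 7)⁻¹ := by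
    rw [Real.exp_neg]
    congr 1
    have : 7 * Real.log (4 * T) = Real.log ((4 * (T : ℝ)) ^ 7) := by rw [Real.log_pow]; norm_num
    rw [this, Real.exp_log (by positivity)]
  have e2 : (2 : ℝ≥0∞) = ENNReal.ofReal 2 := by simp
  rw [e1, e2, ← ENNReal.ofReal_natCast, ← ENNReal.ofReal_mul (by norm_num),
    ← ENNReal.ofReal_mul (Nat.cast_nonneg _)]
  refine ENNReal.ofReal_le_ofReal ?_
  rw [← mul_assoc, ← div_eq_mul_inv, div_le_div_iff₀ (by positivity) (by positivity)]
  push_cast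
  have h1 : ((T : ℝ) + 2) ^ 2 ≤ (2 * T) ^ 2 := pow_le_pow_left₀ (by positivity) (by linarith) 2
  have h2 : ((d : ℝ) + k) ^ 2 ≤ (2 * Y) ^ 2 := pow_le_pow_left₀ (by positivity) (by linarith) 2
  calc 12 * ((T : ℝ) + 2) ^ 2 * (d + k) ^ 2 * 2 * T ^ 4
      ≤ 12 * (2 * T) ^ 2 * (2 * Y) ^ 2 * 2 * T ^ 4 := by gcongr
    _ = 384 * (Y ^ 2 * T ^ 6) := by ring
    _ ≤ 16384 * T * (Y ^ 2 * T ^ 6) := mul_le_mul_of_nonneg_right (by linarith) (by positivity)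
    _ = _ := by ring

lemma sum_noise_eq {d k : ℕ} {Ω : Type*} (w : ℕ → Ω → Fin d → ℝ) (η : ℕ → Ω → Fin k → ℝ) (s : ℕ)
    (ω : Ω) : en (w s ω) ^ 2 + en (η s ω) ^ 2
      = ∑ e : Fin d ⊕ Fin k, noise w η (Sum.map (Prod.mk s) (Prod.mk s) e) ω ^ 2 := by
  rw [Fintype.sum_sum_type, en_sq_eq_sum, en_sq_eq_sum]
  rfl

namespace Tuned

variable {d k : ℕ} {I : AlgInput d k} {B : Matrix (Fin d) (Fin k) ℝ}
  {Kstar : Matrix (Fin k) (Fin d) ℝ} {P P₀ : Matrix (Fin d) (Fin d) ℝ}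
  {α ϑ p p₀ σ κ₀ Y L μ : ℝ}
  (S : Tuned I B Kstar P P₀ α ϑ p p₀ σ κ₀ Y L μ)
  {Ω : Type*} [mΩ : MeasurableSpace Ω] {Pr : Measure Ω} [IsProbabilityMeasure Pr]
  {w : ℕ → Ω → Fin d → ℝ} {η : ℕ → Ω → Fin k → ℝ} (hN : IsMeasurableNoise Pr σ w η)

include S hN

omit S in
lemma integrable_energy (t : ℕ) : Integrable
    (fun ω => ∑ s ∈ Finset.Ico 1 t, (en (w s ω) ^ 2 + en (η s ω) ^ 2)) Pr := by
  simp only [sum_noise_eq]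
  exact integrable_finsetSum _ fun s _ => integrable_finsetSum _ fun e _ =>
    (hN.memLp _).integrable_sq

lemma memLp_state (t : ℕ) (a : Fin d) :
    MemLp (fun ω => state I.policy I.A B (fun s => w s ω) (fun s => η s ω) t a) 2 Pr := by
  have hπ := I.measurablePolicy S.Q_posDef S.R_posDef S.lam_pos
  rcases Nat.eq_zero_or_pos t with rfl | ht
  · simp only [state, run, Pi.zero_apply]; exact memLp_const 0
  have hm : Measurable fun ω => state I.policy I.A B (fun s => w s ω) (fun s => η s ω) t a :=
    (measurable_pi_apply a).comp (measurable_state I.A B hπ t (fun s _ => hN.measurable_w s)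
      fun s _ => hN.measurable_η s)
  rw [memLp_two_iff_integrable_sq hm.aestronglyMeasurable]
  refine Integrable.mono' (((integrable_const I.xb).add (integrable_energy hN t)).const_mul (Y ^ 7))
    (hm.pow_const 2).aestronglyMeasurable (Eventually.of_forall fun ω => ?_)
  rw [Real.norm_of_nonneg (sq_nonneg _)]
  exact (sq_coord_le _ a).trans (S.state_sq_le (state_one _ _ _ _ _)
    (fun t ht => state_succ _ _ _ _ _ ht)
    (fun t ht => AlgInput.action_eq_policy S.lam_pos B I.A _ _ ht) ht)

lemma memLp_action (t : ℕ) (a : Fin k) :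
    MemLp (fun ω => action I.policy I.A B (fun s => w s ω) (fun s => η s ω) t a) 2 Pr := by
  have hπ := I.measurablePolicy S.Q_posDef S.R_posDef S.lam_pos
  rcases Nat.eq_zero_or_pos t with rfl | ht
  · simp only [action, run, Pi.zero_apply]; exact memLp_const 0
  have hm : Measurable fun ω => action I.policy I.A B (fun s => w s ω) (fun s => η s ω) t a :=
    (measurable_pi_apply a).comp (measurable_action I.A B hπ t (fun s _ => hN.measurable_w s)
      fun s _ => hN.measurable_η s)
  rw [memLp_two_iff_integrable_sq hm.aestronglyMeasurable]
  have h1 : Integrable (fun ω => en (state I.policy I.A B (fun s => w s ω) (fun s => η s ω) t) ^ 2)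
      Pr := by
    simp only [en_sq_eq_sum]
    exact integrable_finsetSum _ fun b _ => (S.memLp_state hN t b).integrable_sq
  have h2 : Integrable (fun ω => en (η t ω) ^ 2) Pr := by
    simp only [en_sq_eq_sum]
    exact integrable_finsetSum _ fun b _ => (hN.memLp (Sum.inr (t, b))).integrable_sq
  refine Integrable.mono' ((h1.const_mul (2 * Y)).add (h2.const_mul 2))
    (hm.pow_const 2).aestronglyMeasurable (Eventually.of_forall fun ω => ?_)
  rw [Real.norm_of_nonneg (sq_nonneg _)]
  exact (sq_coord_le _ a).trans (S.action_sq_le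
    (fun t ht => AlgInput.action_eq_policy S.lam_pos B I.A _ _ ht) ht)

/-- The expected deviation from the optimal actions. -/
lemma integral_deviation_le (hT : 2 ≤ I.T) (hLT : L = Real.log (4 * I.T)) :
    ∫ ω, ∑ t ∈ Finset.Icc 1 I.T,
      en (action I.policy I.A B (fun s => w s ω) (fun s => η s ω) t
        - Kstar *ᵥ state I.policy I.A B (fun s => w s ω) (fun s => η s ω) t) ^ 2 ∂Pr
      ≤ Y ^ 241 * (1 + μ⁻¹) ^ 2 * L ^ 2 := by
  have hY := S.Y_pos
  have hL := S.L_one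
  have hμ := inv_pos.2 S.μ_pos
  have hxb := S.xb_nonneg
  have hT' : (2 : ℝ) ≤ I.T := by exact_mod_cast hT
  have hT0 : (0 : ℝ) < I.T := by linarith
  have hπ := I.measurablePolicy S.Q_posDef S.R_posDef S.lam_pos
  set x : ℕ → Ω → Fin d → ℝ := fun t ω =>
    state I.policy I.A B (fun s => w s ω) (fun s => η s ω) t with hxd
  set u : ℕ → Ω → Fin k → ℝ := fun t ω =>
    action I.policy I.A B (fun s => w s ω) (fun s => η s ω) t with hud
  set bad : Set Ω := {ω | ¬ GoodRun I.A B I.K₀ σ L (Y ^ 19) I.T (fun t => x t ω) (fun t => u t ω)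
    (fun s => w s ω) (fun s => η s ω)} with hbad
  have hbadP : Pr bad ≤ ENNReal.ofReal (Y ^ 2 / I.T ^ 4) := by
    have h := hN.failsAtMost_goodRun S.σ_pos (L := L) (by linarith) (pow_pos hY 19) hπ I.A B I.K₀ I.T
    refine h.trans ?_
    rw [hLT]
    exact failure_prob_le hT S.d_le S.k_leY
  -- A measurable hull of the bad set spares a proof that the set itself is measurable, at no cost
  -- in probability.
  set E := toMeasurable Pr bad with hE
  have hEm : MeasurableSet E := measurableSet_toMeasurable _ _
  have hEP : Pr.real E ≤ Y ^ 2 / I.T ^ 4 := by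
    rw [Measure.real, hE, measure_toMeasurable]
    exact ENNReal.toReal_le_of_le_ofReal (by positivity) hbadP
  set b : Ω → ℝ := E.indicator (fun _ => 1) with hb
  have hbi : Integrable b Pr := (integrable_const _).indicator hEm
  have hbint : ∫ ω, b ω ∂Pr = Pr.real E := integral_indicator_one hEm
  have hb0 : ∀ ω, 0 ≤ b ω := fun ω => Set.indicator_nonneg (fun _ _ => zero_le_one) ω
  set ξ : ℕ → Fin d ⊕ Fin k → Ω → ℝ := fun s e => noise w η (Sum.map (Prod.mk s) (Prod.mk s) e)
    with hξ
  set Dev := Y ^ 240 * (1 + μ⁻¹) ^ 2 * L ^ 2 with hDev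
  have hDev0 : 0 ≤ Dev := by positivity
  -- Young's inequality `ξ² ≤ T²/2 + ξ⁴/(2T²)` on the bad event, with the first term kept only
  -- there. Both parts then have expectation of order `T⁻²` per noise variable, which offsets the
  -- `T` noise times and the `T` summands of the deviation.
  set F : Ω → ℝ := fun ω => I.xb * b ω + ∑ s ∈ Finset.Ico 1 (I.T + 1), ∑ e : Fin d ⊕ Fin k,
    (1 / 2 * I.T ^ 2 * b ω + 1 / (2 * I.T ^ 2) * ξ s e ω ^ 4) with hF
  have hpt : ∀ ω, ∑ t ∈ Finset.Icc 1 I.T, en (u t ω - Kstar *ᵥ x t ω) ^ 2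
      ≤ Dev + I.T * Y ^ 9 * F ω := by
    intro ω
    have hpol : ∀ t, 1 ≤ t → u t ω = I.policy t (fun t => x t ω, fun t => u t ω) (η t ω) :=
      fun t ht => AlgInput.action_eq_policy S.lam_pos B I.A _ _ ht
    by_cases hω : ω ∈ E
    · have hb1 : b ω = 1 := Set.indicator_of_mem hω _
      have h1 : ∀ t ∈ Finset.Icc 1 I.T, en (u t ω - Kstar *ᵥ x t ω) ^ 2 ≤ Y ^ 9 * (I.xb
          + ∑ s ∈ Finset.Ico 1 (I.T + 1), (en (w s ω) ^ 2 + en (η s ω) ^ 2)) := by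
        intro t ht
        rw [Finset.mem_Icc] at ht
        exact S.deviation_sq_le (x := fun t => x t ω) (u := fun t => u t ω)
          (w := fun t => w t ω) (η := fun t => η t ω) (state_one _ _ _ _ _)
          (fun t ht => state_succ _ _ _ _ _ ht) hpol ht.1 ht.2
      have h2 := Finset.sum_le_sum h1
      rw [Finset.sum_const, Nat.card_Icc, Nat.add_sub_cancel, nsmul_eq_mul] at h2
      have h3 : I.xb + ∑ s ∈ Finset.Ico 1 (I.T + 1), (en (w s ω) ^ 2 + en (η s ω) ^ 2) ≤ F ω := by
        simp only [hF, hb1, mul_one]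
        gcongr with s hs
        rw [sum_noise_eq]
        refine Finset.sum_le_sum fun e _ => ?_
        change ξ s e ω ^ 2 ≤ _
        have h4 := sq_nonneg ((I.T : ℝ) ^ 2 - ξ s e ω ^ 2)
        have h5 : 1 / 2 * (I.T : ℝ) ^ 2 + 1 / (2 * I.T ^ 2) * ξ s e ω ^ 4 - ξ s e ω ^ 2
            = ((I.T : ℝ) ^ 2 - ξ s e ω ^ 2) ^ 2 / (2 * I.T ^ 2) := by field_simp; ring
        have h6 : 0 ≤ ((I.T : ℝ) ^ 2 - ξ s e ω ^ 2) ^ 2 / (2 * I.T ^ 2) := by positivity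
        linarith
      have h4 := mul_le_mul_of_nonneg_left h3 (by positivity : 0 ≤ (I.T : ℝ) * Y ^ 9)
      linarith
    · have hb1 : b ω = 0 := Set.indicator_of_notMem hω _
      have hgood : GoodRun I.A B I.K₀ σ L (Y ^ 19) I.T (fun t => x t ω) (fun t => u t ω)
          (fun s => w s ω) (fun s => η s ω) := by
        by_contra hcon
        exact hω (subset_toMeasurable _ _ hcon)
      have h1 := S.deviation_le hgood hpol
      have h2 : 0 ≤ F ω := by
        simp only [hF, hb1, mul_zero, zero_add]
        exact Finset.sum_nonneg fun s _ => Finset.sum_nonneg fun e _ => by positivity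
      have h3 : 0 ≤ I.T * Y ^ 9 * F ω := by positivity
      linarith
  have hFe : ∀ s e, Integrable
      (fun ω => 1 / 2 * (I.T : ℝ) ^ 2 * b ω + 1 / (2 * I.T ^ 2) * ξ s e ω ^ 4) Pr := fun s e =>
    (hbi.const_mul _).add ((hN.fourth_moment S.σ_pos _).1.const_mul _)
  have hFs : Integrable (fun ω => ∑ s ∈ Finset.Ico 1 (I.T + 1), ∑ e : Fin d ⊕ Fin k,
      (1 / 2 * (I.T : ℝ) ^ 2 * b ω + 1 / (2 * I.T ^ 2) * ξ s e ω ^ 4)) Pr :=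
    integrable_finsetSum _ fun s _ => integrable_finsetSum _ fun e _ => hFe s e
  have hFi : Integrable F Pr := (hbi.const_mul _).add hFs
  have hFle : ∫ ω, F ω ∂Pr ≤ I.xb * (Y ^ 2 / I.T ^ 4)
      + I.T * ((2 * Y) * (1 / 2 * I.T ^ 2 * (Y ^ 2 / I.T ^ 4) + 1 / (2 * I.T ^ 2) * (96 * Y ^ 2))) := by
    simp only [hF]
    rw [integral_add (hbi.const_mul _) hFs, integral_const_mul, hbint]
    refine add_le_add (mul_le_mul_of_nonneg_left hEP hxb) ?_
    rw [integral_finsetSum _ fun s _ => integrable_finsetSum _ fun e _ => hFe s e]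
    have hσ4 : σ ^ 4 ≤ Y ^ 2 := by
      calc σ ^ 4 = (σ ^ 2) ^ 2 := by ring
        _ ≤ _ := pow_le_pow_left₀ (sq_nonneg _) S.σ_le 2
    set c := 1 / 2 * (I.T : ℝ) ^ 2 * (Y ^ 2 / I.T ^ 4) + 1 / (2 * I.T ^ 2) * (96 * Y ^ 2) with hc
    have h1 : ∀ s e, ∫ ω, (1 / 2 * (I.T : ℝ) ^ 2 * b ω + 1 / (2 * I.T ^ 2) * ξ s e ω ^ 4) ∂Pr ≤ c := by
      intro s e
      rw [integral_add (hbi.const_mul _) ((hN.fourth_moment S.σ_pos _).1.const_mul _),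
        integral_const_mul, integral_const_mul, hbint]
      have h2 := (hN.fourth_moment S.σ_pos (Sum.map (Prod.mk s) (Prod.mk s) e)).2
      rw [hc]
      gcongr
      exact h2.trans (by linarith)
    have hc0 : 0 ≤ c := by positivity
    calc _ ≤ ∑ _s ∈ Finset.Ico 1 (I.T + 1), ∑ _e : Fin d ⊕ Fin k, c := by
          refine Finset.sum_le_sum fun s _ => ?_
          rw [integral_finsetSum _ fun e _ => hFe s e]
          exact Finset.sum_le_sum fun e _ => h1 s e
      _ = I.T * ((d + k) * c) := by simp
      _ ≤ _ := by
          have h3 : (d : ℝ) + k ≤ 2 * Y := by linarith [S.d_le, S.k_leY]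
          exact mul_le_mul_of_nonneg_left (mul_le_mul_of_nonneg_right h3 hc0) hT0.le
  have hRi : Integrable (fun ω => Dev + I.T * Y ^ 9 * F ω) Pr :=
    (integrable_const _).add (hFi.const_mul _)
  have h1 : ∫ ω, ∑ t ∈ Finset.Icc 1 I.T, en (u t ω - Kstar *ᵥ x t ω) ^ 2 ∂Pr
      ≤ ∫ ω, (Dev + I.T * Y ^ 9 * F ω) ∂Pr :=
    integral_mono_of_nonneg (Eventually.of_forall fun ω => Finset.sum_nonneg fun t _ => sq_nonneg _)
      hRi (Eventually.of_forall hpt)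
  have hint : ∫ ω, (Dev + I.T * Y ^ 9 * F ω) ∂Pr = Dev + I.T * Y ^ 9 * ∫ ω, F ω ∂Pr := by
    rw [integral_add (integrable_const _) (hFi.const_mul _), integral_const, probReal_univ,
      one_smul, integral_const_mul]
  refine (h1.trans_eq hint).trans ?_
  have h2 : I.T * Y ^ 9 * ∫ ω, F ω ∂Pr ≤ Y ^ 9 * (Y ^ 12 * L + 97 * Y ^ 3) := by
    refine (mul_le_mul_of_nonneg_left hFle (by positivity)).trans ?_
    have e1 : (I.T : ℝ) * Y ^ 9 * (I.xb * (Y ^ 2 / I.T ^ 4)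
      + I.T * ((2 * Y) * (1 / 2 * I.T ^ 2 * (Y ^ 2 / I.T ^ 4) + 1 / (2 * I.T ^ 2) * (96 * Y ^ 2))))
      = Y ^ 9 * (I.xb * Y ^ 2 / I.T ^ 3 + 97 * Y ^ 3) := by field_simp; ring
    rw [e1]
    refine mul_le_mul_of_nonneg_left (add_le_add ?_ le_rfl) (by positivity)
    calc I.xb * Y ^ 2 / I.T ^ 3 ≤ I.xb * Y ^ 2 :=
          div_le_self (by positivity) (one_le_pow₀ (by linarith))
      _ ≤ Y ^ 10 * L * Y ^ 2 := by
          have := S.xb_le.trans S.lam_le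
          gcongr
      _ = _ := by ring
  have h3 : Y ^ 9 * (Y ^ 12 * L + 97 * Y ^ 3) ≤ Y ^ 240 * (1 + μ⁻¹) ^ 2 * L ^ 2 := by
    have e1 : 97 * Y ^ 3 ≤ Y ^ 12 := S.pow_mul_le (by norm_num) (by norm_num)
    have e2 : 2 * Y ^ 21 ≤ Y ^ 240 := S.pow_mul_le (by norm_num) (by norm_num)
    have hm : 1 ≤ (1 + μ⁻¹) ^ 2 := one_le_pow₀ (by linarith)
    have hLL : L ≤ L ^ 2 := le_self_pow₀ hL two_ne_zero
    calc Y ^ 9 * (Y ^ 12 * L + 97 * Y ^ 3) ≤ Y ^ 9 * (Y ^ 12 * L + Y ^ 12 * L) := by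
          refine mul_le_mul_of_nonneg_left (add_le_add le_rfl (e1.trans ?_)) (by positivity)
          exact le_mul_of_one_le_right (by positivity) hL
      _ = (2 * Y ^ 21) * L := by ring
      _ ≤ (Y ^ 240 * (1 + μ⁻¹) ^ 2) * L ^ 2 := by
          refine mul_le_mul ?_ hLL (by linarith) (by positivity)
          exact e2.trans (le_mul_of_one_le_right (by positivity) hm)
  have h4 : 2 * Y ^ 240 ≤ Y ^ 241 := S.pow_mul_le (by norm_num) (by norm_num)
  calc _ ≤ Dev + Dev := add_le_add le_rfl (h2.trans h3)
    _ = (2 * Y ^ 240) * ((1 + μ⁻¹) ^ 2 * L ^ 2) := by rw [hDev]; ring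
    _ ≤ Y ^ 241 * ((1 + μ⁻¹) ^ 2 * L ^ 2) := mul_le_mul_of_nonneg_right h4 (by positivity)
    _ = _ := by ring

/-- The expected regret of the tuned algorithm. -/
theorem integral_regret_le (hT : 2 ≤ I.T) (hLT : L = Real.log (4 * I.T)) :
    Integrable (fun ω => regret I.Q I.R (σ ^ 2 * P.trace) I.policy I.A B (fun s => w s ω)
      (fun s => η s ω) I.T) Pr ∧
    ∫ ω, regret I.Q I.R (σ ^ 2 * P.trace) I.policy I.A B (fun s => w s ω)
      (fun s => η s ω) I.T ∂Pr ≤ Y ^ 245 * (1 + μ⁻¹) ^ 2 * L ^ 2 := by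
  have hY := S.Y_pos
  have hπ := I.measurablePolicy S.Q_posDef S.R_posDef S.lam_pos
  obtain ⟨h1, h2⟩ := hN.integral_regret_le S.R_posDef S.riccati hπ (S.memLp_state hN)
    (S.memLp_action hN) I.T
  refine ⟨h1, h2.trans ?_⟩
  have hctrl : ctrl I.A B I.R P = Kstar := by
    rw [← S.Kstar_eq, optController_eq S.Q_posDef S.R_posDef S.riccati]
  rw [hctrl]
  have hdev : ∀ t a, MemLp (fun ω => (action I.policy I.A B (fun s => w s ω) (fun s => η s ω) t
      - Kstar *ᵥ state I.policy I.A B (fun s => w s ω) (fun s => η s ω) t) a) 2 Pr := fun t a =>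
    (S.memLp_action hN t a).sub (IsMeasurableNoise.memLp_mulVec (S.memLp_state hN t) _ a)
  have hdi : ∀ t, Integrable (fun ω => en (action I.policy I.A B (fun s => w s ω)
      (fun s => η s ω) t - Kstar *ᵥ state I.policy I.A B (fun s => w s ω) (fun s => η s ω) t) ^ 2)
      Pr := by
    intro t
    simp only [en_sq_eq_sum]
    exact integrable_finsetSum _ fun a _ => (hdev t a).integrable_sq
  have hG : ∀ v, qf (I.R + Bᵀ * P * B) v ≤ Y ^ 4 * en v ^ 2 := by
    intro v
    rw [qf_add_left, qf_conj]
    have h3 : qf I.R v ≤ Y * en v ^ 2 :=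
      (qf_le _ _).trans (mul_le_mul_of_nonneg_right S.R_le (sq_nonneg _))
    have h4 : qf P (B *ᵥ v) ≤ Y ^ 3 * en v ^ 2 := by
      calc qf P (B *ᵥ v) ≤ p * en (B *ᵥ v) ^ 2 := S.P_le _
        _ ≤ Y * (Y ^ 2 * en v ^ 2) := by
          refine mul_le_mul S.p_le ((en_mulVec_sq_le _ _).trans ?_) (sq_nonneg _) hY.le
          gcongr
          exact S.B_le.trans S.ϑ_le
        _ = _ := by ring
    have e1 : 1 * Y ^ 1 ≤ Y ^ 3 := S.pow_mul_le (by norm_num) (by norm_num)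
    have e2 : 2 * Y ^ 3 ≤ Y ^ 4 := S.pow_mul_le (by norm_num) (by norm_num)
    calc _ ≤ (Y + Y ^ 3) * en v ^ 2 := by linarith
      _ ≤ _ := mul_le_mul_of_nonneg_right (by linarith) (sq_nonneg _)
  calc _ ≤ ∑ t ∈ Finset.Icc 1 I.T, ∫ ω, Y ^ 4 * en (action I.policy I.A B (fun s => w s ω)
        (fun s => η s ω) t - Kstar *ᵥ state I.policy I.A B (fun s => w s ω) (fun s => η s ω) t) ^ 2
        ∂Pr :=
        Finset.sum_le_sum fun t _ => integral_mono (IsMeasurableNoise.integrable_qf (hdev t) _)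
          ((hdi t).const_mul _) fun ω => hG _
    _ = Y ^ 4 * ∫ ω, ∑ t ∈ Finset.Icc 1 I.T, en (action I.policy I.A B (fun s => w s ω)
        (fun s => η s ω) t - Kstar *ᵥ state I.policy I.A B (fun s => w s ω) (fun s => η s ω) t) ^ 2
        ∂Pr := by
        rw [integral_finsetSum _ fun t _ => hdi t, Finset.mul_sum]
        exact Finset.sum_congr rfl fun t _ => integral_const_mul _ _
    _ ≤ Y ^ 4 * (Y ^ 241 * (1 + μ⁻¹) ^ 2 * L ^ 2) :=
        mul_le_mul_of_nonneg_left (S.integral_deviation_le hN hT hLT) (by positivity)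
    _ = _ := by ring

end Tuned


/-! ### Measurable versions of the noise -/

section Versions

variable {d k : ℕ} {Ω : Type*} [MeasurableSpace Ω] {Pr : Measure Ω} {σ : ℝ}
  {w w' : ℕ → Ω → Fin d → ℝ} {η η' : ℕ → Ω → Fin k → ℝ}

/-- The laws provide only almost everywhere measurable coordinates, whereas conditioning on the past
uses the σ-algebras they generate. There are countably many coordinates, so one null set suffices
for all replacements. -/
lemma IsGaussianNoise.exists_measurable (h : IsGaussianNoise Pr σ w η) :
    ∃ (w' : ℕ → Ω → Fin d → ℝ) (η' : ℕ → Ω → Fin k → ℝ), IsMeasurableNoise Pr σ w' η' ∧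
      ∀ᵐ ω ∂Pr, (∀ t, w t ω = w' t ω) ∧ ∀ t, η t ω = η' t ω := by
  have hw := fun t i => (h.law_w t i).aemeasurable
  have hη := fun t j => (h.law_η t j).aemeasurable
  refine ⟨fun t ω i => (hw t i).mk _ ω, fun t ω j => (hη t j).mk _ ω, ⟨⟨?_, ?_, ?_⟩, ?_⟩, ?_⟩
  · exact fun t i => (h.law_w t i).congr (hw t i).ae_eq_mk.symm
  · exact fun t j => (h.law_η t j).congr (hη t j).ae_eq_mk.symm
  · refine h.indep.congr ?_
    rintro (⟨t, i⟩ | ⟨t, j⟩)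
    · exact (hw t i).ae_eq_mk
    · exact (hη t j).ae_eq_mk
  · rintro (⟨t, i⟩ | ⟨t, j⟩)
    · exact (hw t i).measurable_mk
    · exact (hη t j).measurable_mk
  · have h1 : ∀ᵐ ω ∂Pr, ∀ t i, w t ω i = (hw t i).mk _ ω :=
      ae_all_iff.2 fun t => ae_all_iff.2 fun i => (hw t i).ae_eq_mk
    have h2 : ∀ᵐ ω ∂Pr, ∀ t j, η t ω j = (hη t j).mk _ ω :=
      ae_all_iff.2 fun t => ae_all_iff.2 fun j => (hη t j).ae_eq_mk
    filter_upwards [h1, h2] with ω h1 h2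
    exact ⟨fun t => funext (h1 t), fun t => funext (h2 t)⟩

lemma infiniteHorizonCost_congr (h : ∀ᵐ ω ∂Pr, ∀ t, w t ω = w' t ω)
    (A : Matrix (Fin d) (Fin d) ℝ) (B : Matrix (Fin d) (Fin k) ℝ)
    (Q : Matrix (Fin d) (Fin d) ℝ) (R : Matrix (Fin k) (Fin k) ℝ)
    (K : Matrix (Fin k) (Fin d) ℝ) :
    infiniteHorizonCost Pr w A B Q R K = infiniteHorizonCost Pr w' A B Q R K := by
  unfold infiniteHorizonCost
  congr 1
  funext n
  congr 1
  refine lintegral_congr_ae ?_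
  filter_upwards [h] with ω h
  rw [funext h]

end Versions

/-! ### Sensitivity of the optimal policy -/

namespace Setting

variable {d k : ℕ} {A : Matrix (Fin d) (Fin d) ℝ} {B : Matrix (Fin d) (Fin k) ℝ}
  {Q : Matrix (Fin d) (Fin d) ℝ} {R : Matrix (Fin k) (Fin k) ℝ}
  {K₀ Kstar : Matrix (Fin k) (Fin d) ℝ} {P P₀ : Matrix (Fin d) (Fin d) ℝ}
  {α ϑ p p₀ σ κ κ₀ Y : ℝ}

lemma norm_optController_sub_le (S : Setting A B Q R K₀ Kstar P P₀ α ϑ p p₀ σ κ κ₀ Y) {ε : ℝ}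
    (hε : 0 ≤ ε) (hε1 : ε ≤ (Y ^ 100)⁻¹) {A' : Matrix (Fin d) (Fin d) ℝ}
    {B' : Matrix (Fin d) (Fin k) ℝ} (hA' : ‖A' - A‖ ≤ ε) (hB' : ‖B' - B‖ ≤ ε) :
    ‖optController Q R A' B' - Kstar‖ ≤ Y ^ 14 * ε := by
  have hY := S.Y_pos
  have hY1 : 1 ≤ Y := by linarith [S.Y_ge]
  have h1 : Y ^ 7 * ε ≤ 1 := by
    calc Y ^ 7 * ε ≤ Y ^ 100 * (Y ^ 100)⁻¹ :=
          mul_le_mul (pow_le_pow_right₀ hY1 (by norm_num)) hε1 hε (pow_nonneg hY.le _)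
      _ = 1 := mul_inv_cancel₀ (pow_pos hY _).ne'
  obtain ⟨-, -, h⟩ := riccati_sensitivity S.Q_posDef S.R_posDef S.riccati S.Y_ge hε h1
    (fun x => (mul_le_mul_of_nonneg_right S.α_ge (sq_nonneg _)).trans (S.Q_ge x))
    (fun x => (mul_le_mul_of_nonneg_right S.α_ge (sq_nonneg _)).trans (S.R_ge x))
    S.norm_P_le S.A_le (S.B_le.trans S.ϑ_le) hA' hB'
  rwa [S.Kstar_eq] at h

/-- The quadratic loss from `near_optimal` is absorbed by the fraction `δ = Y³³ ε²` of `Q`, so `(1 -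
δ)⁻¹ P` is a Lyapunov function for `K`. Its trace exceeds that of `P` by a factor of at most `1 +
2δ`. -/
lemma infiniteHorizonCost_le (S : Setting A B Q R K₀ Kstar P P₀ α ϑ p p₀ σ κ κ₀ Y)
    {Ω : Type*} [MeasurableSpace Ω] {Pr : Measure Ω} [IsProbabilityMeasure Pr]
    {w : ℕ → Ω → Fin d → ℝ} {η : ℕ → Ω → Fin k → ℝ} (hN : IsMeasurableNoise Pr σ w η)
    (htr : σ ^ 2 * P.trace ≤ Y) {ε : ℝ} (hε : 0 ≤ ε) (hε1 : ε ≤ (Y ^ 100)⁻¹)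
    {K : Matrix (Fin k) (Fin d) ℝ} (hK : ‖K - Kstar‖ ≤ Y ^ 14 * ε) :
    infiniteHorizonCost Pr w A B Q R K
      ≤ ENNReal.ofReal (σ ^ 2 * P.trace) + ENNReal.ofReal (Y ^ 70 * ε ^ 2) := by
  have hY := S.Y_pos
  have hY1 : 1 ≤ Y := by linarith [S.Y_ge]
  have hYge := S.Y_ge
  have hPs := S.riccati.1.posSemidef
  have htr0 : 0 ≤ P.trace := by
    rw [trace_eq_sum_qf]
    exact Finset.sum_nonneg fun i _ => (posSemidef_iff_qf.1 hPs).2 _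
  set δ := Y ^ 33 * ε ^ 2 with hδ
  have hδ0 : 0 ≤ δ := by positivity
  have hδ1 : δ ≤ 1 / 2 := by
    have h1 : Y ^ 100 * ε ≤ 1 := by
      calc Y ^ 100 * ε ≤ Y ^ 100 * (Y ^ 100)⁻¹ :=
            mul_le_mul_of_nonneg_left hε1 (pow_nonneg hY.le _)
        _ = 1 := mul_inv_cancel₀ (pow_pos hY _).ne'
    have h2 : Y ^ 20 * ε ≤ Y ^ 100 * ε :=
      mul_le_mul_of_nonneg_right (pow_le_pow_right₀ hY1 (by norm_num)) hε
    have h3 : (Y ^ 20 * ε) ^ 2 ≤ 1 := by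
      have : 0 ≤ Y ^ 20 * ε := by positivity
      exact pow_le_one₀ this (h2.trans h1)
    have h4 : Y ^ 7 * δ ≤ 1 := by
      calc Y ^ 7 * δ = (Y ^ 20 * ε) ^ 2 := by rw [hδ]; ring
        _ ≤ 1 := h3
    have h5 : 2 ≤ Y ^ 7 := by
      calc (2 : ℝ) ≤ Y := by linarith
        _ ≤ Y ^ 7 := le_self_pow₀ hY1 (by norm_num)
    nlinarith
  have hd : 0 < 1 - δ := by linarith
  have hlyap : ∀ x, qf ((1 - δ)⁻¹ • P) ((A + B * K) *ᵥ x) + qf Q x + qf R (K *ᵥ x)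
      ≤ qf ((1 - δ)⁻¹ • P) x := by
    intro x
    have h1 := S.riccati.near_optimal S.Q_posDef S.R_posDef (by linarith) S.R_le
      S.norm_P_le (S.B_le.trans S.ϑ_le) (K := K)
      (e := Y ^ 14 * ε) (by rwa [S.Kstar_eq]) x
    have h2 : Y ^ 4 * (Y ^ 14 * ε) ^ 2 * en x ^ 2 ≤ δ * qf Q x := by
      calc Y ^ 4 * (Y ^ 14 * ε) ^ 2 * en x ^ 2 = δ * (Y⁻¹ * en x ^ 2) := by
            rw [hδ]; field_simp
        _ ≤ δ * qf Q x := mul_le_mul_of_nonneg_left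
            ((mul_le_mul_of_nonneg_right S.α_ge (sq_nonneg _)).trans (S.Q_ge x)) hδ0
    have h3 := mul_nonneg hδ0 ((posSemidef_iff_qf.1 S.R_posDef.posSemidef).2 (K *ᵥ x))
    rw [qf_smul_left, qf_smul_left]
    refine le_of_mul_le_mul_left ?_ hd
    rw [mul_add, mul_add, ← mul_assoc, ← mul_assoc, mul_inv_cancel₀ hd.ne']
    linarith
  refine (hN.infiniteHorizonCost_le S.Q_posDef S.R_posDef
    (hPs.smul (inv_nonneg.2 hd.le)) hlyap).trans ?_
  rw [← ENNReal.ofReal_add (by positivity) (by positivity)]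
  refine ENNReal.ofReal_le_ofReal ?_
  have h1 : (1 - δ)⁻¹ ≤ 1 + 2 * δ := by
    rw [inv_le_iff_one_le_mul₀ hd]
    nlinarith
  have h2 : 2 * Y ^ 34 ≤ Y ^ 70 := S.pow_mul_le (by norm_num) (by norm_num)
  rw [Matrix.trace_smul, smul_eq_mul]
  calc σ ^ 2 * ((1 - δ)⁻¹ * P.trace) ≤ σ ^ 2 * ((1 + 2 * δ) * P.trace) := by gcongr
    _ = σ ^ 2 * P.trace + 2 * δ * (σ ^ 2 * P.trace) := by ring
    _ ≤ σ ^ 2 * P.trace + 2 * δ * Y := by gcongr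
    _ = σ ^ 2 * P.trace + 2 * Y ^ 34 * ε ^ 2 := by rw [hδ]; ring
    _ ≤ _ := add_le_add le_rfl (mul_le_mul_of_nonneg_right h2 (sq_nonneg _))

end Setting

/-! ### The constants -/

/-- All problem parameters are at most `Z`. -/
structure Bounds (d k : ℕ) (α₀ α₁ ϑ ν ν₀ σ Z : ℝ) : Prop where
  Z_ge : 1000 ≤ Z
  α₀_pos : 0 < α₀
  ϑ_pos : 0 < ϑ
  ν_pos : 0 < ν
  ν₀_pos : 0 < ν₀
  σ_pos : 0 < σ
  k_pos : 0 < k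
  α₀_inv_le : α₀⁻¹ ≤ Z
  α₁_le : α₁ ≤ Z
  ϑ_le : ϑ ≤ Z
  ν_le : ν ≤ Z
  ν₀_le : ν₀ ≤ Z
  d_le : (d : ℝ) ≤ Z
  σ_le : σ ≤ Z
  σ_inv_le : σ⁻¹ ≤ Z

namespace Bounds

variable {d k : ℕ} {α₀ α₁ ϑ ν ν₀ σ Z : ℝ} (H : Bounds d k α₀ α₁ ϑ ν ν₀ σ Z)

include H

lemma Z_pos : 0 < Z := by linarith [H.Z_ge]

lemma inv_sq_le : (σ ^ 2)⁻¹ ≤ Z ^ 2 := by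
  rw [← inv_pow]
  exact pow_le_pow_left₀ (inv_nonneg.2 H.σ_pos.le) H.σ_inv_le 2

lemma inv_mul_le : (α₀ * σ ^ 2)⁻¹ ≤ Z ^ 3 := by
  have := H.Z_pos
  rw [mul_inv]
  calc α₀⁻¹ * (σ ^ 2)⁻¹ ≤ Z * Z ^ 2 :=
        mul_le_mul H.α₀_inv_le H.inv_sq_le (by positivity) this.le
    _ = _ := by ring

lemma const_mul_pow_le {c : ℝ} (hc : c ≤ 1000) {m n : ℕ} (h : m < n) : c * Z ^ m ≤ Z ^ n := by
  have h1 : 1 ≤ Z := by linarith [H.Z_ge]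
  calc c * Z ^ m ≤ Z * Z ^ m :=
        mul_le_mul_of_nonneg_right (hc.trans H.Z_ge) (pow_nonneg (by linarith) _)
    _ = Z ^ (m + 1) := by ring
    _ ≤ Z ^ n := pow_le_pow_right₀ h1 h

end Bounds


lemma le_trace_of_mul_en_sq_le {n : ℕ} (hn : 0 < n) {P : Matrix (Fin n) (Fin n) ℝ}
    (hP : P.PosSemidef) {α : ℝ} (h : ∀ x, α * en x ^ 2 ≤ qf P x) : α ≤ P.trace := by
  set e : Fin n → ℝ := Pi.single ⟨0, hn⟩ 1 with he
  have he0 : 0 < en e := en_pos (by rw [he]; simp)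
  exact le_of_mul_le_mul_right ((h e).trans (qf_le_trace hP e)) (pow_pos he0 2)

/-- Nondegeneracy makes `Kᵀ` injective. Together with `0 < k` this also yields `0 < d`, which is not
assumed. -/
lemma card_le_of_mul_en_sq_le {d k : ℕ} {K : Matrix (Fin k) (Fin d) ℝ} {μ : ℝ} (hμ : 0 < μ)
    (h : ∀ v, μ * en v ^ 2 ≤ en (Kᵀ *ᵥ v) ^ 2) : k ≤ d := by
  have hinj : Function.Injective Kᵀ.mulVecLin := by
    rw [← LinearMap.ker_eq_bot, LinearMap.ker_eq_bot']
    intro v hv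
    by_contra hne
    have h1 := h v
    rw [Matrix.mulVecLin_apply] at hv
    rw [hv, en_zero] at h1
    have := mul_pos hμ (pow_pos (en_pos hne) 2)
    linarith
  simpa using LinearMap.finrank_le_finrank_of_injective hinj

/-! ### From bounded problem parameters to a `Setting`. -/

namespace Bounds

variable {d k : ℕ} {α₀ α₁ ϑ ν ν₀ σ Z : ℝ} (H : Bounds d k α₀ α₁ ϑ ν ν₀ σ Z)

include H

lemma kappa_sq_eq {C₀ ε₀ : ℝ} (hC : C₀ = Z ^ 350) (hε : ε₀ = (Z ^ 500)⁻¹) :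
    √((ν + ε₀ ^ 2 * C₀) / (α₀ * σ ^ 2)) ^ 2 = (ν + (Z ^ 650)⁻¹) / (α₀ * σ ^ 2) := by
  have hZ := H.Z_pos
  have := H.α₀_pos
  have := H.σ_pos
  have := H.ν_pos
  have e : ε₀ ^ 2 * C₀ = (Z ^ 650)⁻¹ := by
    rw [hε, hC]
    field_simp
  rw [e, Real.sq_sqrt]
  have : 0 < (Z ^ 650)⁻¹ := inv_pos.2 (pow_pos hZ _)
  positivity

lemma kappa_sq_le : (ν + (Z ^ 650)⁻¹) / (α₀ * σ ^ 2) ≤ Z ^ 5 := by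
  have hZ := H.Z_pos
  have hZ1 := H.Z_ge
  have h1 : (Z ^ 650)⁻¹ ≤ 1 := inv_le_one_of_one_le₀ (one_le_pow₀ (by linarith))
  have h2 : 0 < (Z ^ 650)⁻¹ := inv_pos.2 (pow_pos hZ _)
  rw [div_eq_mul_inv]
  calc (ν + (Z ^ 650)⁻¹) * (α₀ * σ ^ 2)⁻¹ ≤ (2 * Z) * Z ^ 3 := by
        refine mul_le_mul (by linarith [H.ν_le]) H.inv_mul_le ?_ (by positivity)
        have := H.α₀_pos
        have := H.σ_pos
        positivity
    _ = 2 * Z ^ 4 := by ring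
    _ ≤ Z ^ 5 := H.const_mul_pow_le (by norm_num) (by norm_num)

/-- The quantities of a system with bounded parameters. -/
theorem exists_setting {Ω : Type*} [MeasurableSpace Ω] {Pr : Measure Ω} [IsProbabilityMeasure Pr]
    {w : ℕ → Ω → Fin d → ℝ} {η : ℕ → Ω → Fin k → ℝ} (hN : IsMeasurableNoise Pr σ w η)
    {A : Matrix (Fin d) (Fin d) ℝ} {B : Matrix (Fin d) (Fin k) ℝ}
    {Q : Matrix (Fin d) (Fin d) ℝ} {R : Matrix (Fin k) (Fin k) ℝ}
    {K₀ Kstar : Matrix (Fin k) (Fin d) ℝ} {μ C₀ ε₀ : ℝ}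
    (hC : C₀ = Z ^ 350) (hε : ε₀ = (Z ^ 500)⁻¹)
    (hQ : Q.PosDef) (hR : R.PosDef) (hR1 : ‖R‖ ≤ α₁) (hQi : ‖Q⁻¹‖ ≤ α₀⁻¹) (hRi : ‖R⁻¹‖ ≤ α₀⁻¹)
    (hA : ‖A‖ ≤ ϑ) (hB : ‖B‖ ≤ ϑ)
    (hK₀ : infiniteHorizonCost Pr w A B Q R K₀ ≤ ENNReal.ofReal ν₀)
    (hmin : ∀ K, infiniteHorizonCost Pr w A B Q R Kstar ≤ infiniteHorizonCost Pr w A B Q R K)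
    (hJ : infiniteHorizonCost Pr w A B Q R Kstar ≤ ENNReal.ofReal ν)
    (hμ : 0 < μ) (hK : (Kstar * Kstarᵀ - μ • (1 : Matrix (Fin k) (Fin k) ℝ)).PosSemidef) :
    ∃ P P₀, Setting A B Q R K₀ Kstar P P₀ α₀ ϑ (ν / σ ^ 2) (ν₀ / σ ^ 2) σ
        (√((ν + ε₀ ^ 2 * C₀) / (α₀ * σ ^ 2))) (√(ν₀ / (α₀ * σ ^ 2))) (Z ^ 5) ∧
      infiniteHorizonCost Pr w A B Q R Kstar = ENNReal.ofReal (σ ^ 2 * P.trace) ∧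
      σ ^ 2 * P.trace ≤ Z ^ 5 ∧ 0 ≤ P.trace := by
  have hZ := H.Z_pos
  have hZ1 : 1 ≤ Z := by linarith [H.Z_ge]
  have hα := H.α₀_pos
  have hσ := H.σ_pos
  have hν := H.ν_pos
  have hν₀ := H.ν₀_pos
  have hσ2 : 0 < σ ^ 2 := by positivity
  have hKge := (posSemidef_mul_transpose_sub_iff Kstar μ).1 hK
  have hkd : k ≤ d := card_le_of_mul_en_sq_le hμ hKge
  have hd : 0 < d := H.k_pos.trans_le hkd
  have hQge := fun x => mul_en_sq_le_qf hQ hα hQi x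
  have hRge := fun x => mul_en_sq_le_qf hR hα hRi x
  obtain ⟨P, hP, hopt, hcost⟩ := hN.exists_riccati_of_isMin hσ hQ hR
    (ne_top_of_le_ne_top ENNReal.ofReal_ne_top hJ) hmin
  obtain ⟨P₀, hP₀, hP₀eq, hP₀J⟩ := hN.exists_lyapunov hσ hQ hR
    (ne_top_of_le_ne_top ENNReal.ofReal_ne_top hK₀)
  have htr : σ ^ 2 * P.trace ≤ ν :=
    (ENNReal.ofReal_le_ofReal_iff hν.le).1 (hcost ▸ hJ)
  have htr₀ : σ ^ 2 * P₀.trace ≤ ν₀ :=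
    (ENNReal.ofReal_le_ofReal_iff hν₀.le).1 (hP₀J.trans hK₀)
  have hPge : α₀ ≤ P.trace := by
    refine le_trace_of_mul_en_sq_le hd hP.1.posSemidef fun x => ?_
    have h1 := hP.qf_eq hR x
    have h2 := (posSemidef_iff_qf.1 hR.posSemidef).2 (ctrl A B R P *ᵥ x)
    have h3 := (posSemidef_iff_qf.1 hP.1.posSemidef).2 ((A + B * ctrl A B R P) *ᵥ x)
    linarith [hQge x]
  have hP₀ge : α₀ ≤ P₀.trace := by
    refine le_trace_of_mul_en_sq_le hd hP₀ fun x => ?_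
    have h1 := hP₀eq x
    have h2 := (posSemidef_iff_qf.1 hR.posSemidef).2 (K₀ *ᵥ x)
    have h3 := (posSemidef_iff_qf.1 hP₀).2 ((A + B * K₀) *ᵥ x)
    linarith [hQge x]
  have hκ := H.kappa_sq_eq hC hε
  have hκ₀ : √(ν₀ / (α₀ * σ ^ 2)) ^ 2 = ν₀ / (α₀ * σ ^ 2) := Real.sq_sqrt (by positivity)
  have hZ5 : Z ≤ Z ^ 5 := le_self_pow₀ hZ1 (by norm_num)
  have hi : 0 < (Z ^ 650)⁻¹ := inv_pos.2 (pow_pos hZ _)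
  have hdivν : ∀ c, 0 < c → c ≤ Z → c / σ ^ 2 ≤ Z ^ 5 := by
    intro c hc hcZ
    rw [div_eq_mul_inv]
    calc c * (σ ^ 2)⁻¹ ≤ Z * Z ^ 2 := mul_le_mul hcZ H.inv_sq_le (by positivity) hZ.le
      _ = 1 * Z ^ 3 := by ring
      _ ≤ _ := H.const_mul_pow_le (by norm_num) (by norm_num)
  refine ⟨P, P₀, ?_, hcost, (htr.trans H.ν_le).trans hZ5, hα.le.trans hPge⟩
  exact
    { Y_ge := H.Z_ge.trans hZ5
      σ_pos := hσ
      σ_le := by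
        calc σ ^ 2 ≤ Z ^ 2 := pow_le_pow_left₀ hσ.le H.σ_le 2
          _ ≤ _ := pow_le_pow_right₀ hZ1 (by norm_num)
      σ_ge := by
        rw [inv_le_comm₀ (by positivity) hσ2]
        exact H.inv_sq_le.trans (pow_le_pow_right₀ hZ1 (by norm_num))
      d_le := H.d_le.trans hZ5
      d_pos := hd
      k_pos := H.k_pos
      k_le := hkd
      α_pos := hα
      α_ge := by
        rw [inv_le_comm₀ (by positivity) hα]
        exact H.α₀_inv_le.trans hZ5
      ϑ_nonneg := H.ϑ_pos.le
      ϑ_le := H.ϑ_le.trans hZ5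
      Q_posDef := hQ
      R_posDef := hR
      Q_ge := hQge
      R_ge := hRge
      R_le := (hR1.trans H.α₁_le).trans hZ5
      A_le := (hA.trans H.ϑ_le).trans hZ5
      B_le := hB
      riccati := hP
      Kstar_eq := hopt
      -- A positive semidefinite matrix is at most its trace times the identity, and `σ² tr P = J⋆ ≤
      -- ν`. This explains the choice `p = ν / σ²`; the choice of `p₀` is analogous.
      P_le := by
        intro x
        refine (qf_le_trace hP.1.posSemidef x).trans
          (mul_le_mul_of_nonneg_right ?_ (sq_nonneg _))
        rw [le_div_iff₀ hσ2]
        linarith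
      p_pos := by positivity
      p_le := hdivν ν hν H.ν_le
      P₀_psd := hP₀
      P₀_lyap := fun x => (hP₀eq x).le
      P₀_le := by
        intro x
        refine (qf_le_trace hP₀ x).trans (mul_le_mul_of_nonneg_right ?_ (sq_nonneg _))
        rw [le_div_iff₀ hσ2]
        linarith
      p₀_pos := by positivity
      p₀_le := hdivν ν₀ hν₀ H.ν₀_le
      κ_one := by
        refine le_of_sq_le_sq ?_ (Real.sqrt_nonneg _)
        rw [hκ, one_pow, one_le_div (by positivity)]
        have := mul_le_mul_of_nonneg_left hPge hσ2.le
        linarith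
      κ_le := by
        rw [hκ]
        exact H.kappa_sq_le
      -- The extra `ε₀² C₀ = Z⁻⁶⁵⁰` in `κ²` creates the slack: multiplied by `α₀ ≥ Z⁻¹` it still
      -- exceeds the loss, which is of order `Y⁻¹³⁶ = Z⁻⁶⁸⁰` times `2 Z`.
      κ_ge := by
        rw [hκ]
        have e1 : ((Z ^ 5) ^ 136)⁻¹ = (Z ^ 680)⁻¹ := by rw [← pow_mul]
        have e2 : (Z ^ 680)⁻¹ * (ν + (Z ^ 650)⁻¹) ≤ α₀ * (Z ^ 650)⁻¹ := by
          have h1 : (Z ^ 650)⁻¹ ≤ Z := (inv_le_one_of_one_le₀ (one_le_pow₀ hZ1)).trans hZ1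
          have h2 : Z⁻¹ ≤ α₀ := by
            rw [inv_le_comm₀ hZ hα]
            exact H.α₀_inv_le
          have h3 : 0 < (Z ^ 680)⁻¹ := inv_pos.2 (pow_pos hZ _)
          calc (Z ^ 680)⁻¹ * (ν + (Z ^ 650)⁻¹) ≤ (Z ^ 680)⁻¹ * (2 * Z ^ 1) :=
                mul_le_mul_of_nonneg_left (by linarith [H.ν_le]) h3.le
            _ ≤ (Z ^ 680)⁻¹ * Z ^ 29 := mul_le_mul_of_nonneg_left
                (H.const_mul_pow_le (by norm_num) (by norm_num)) h3.le
            _ = Z⁻¹ * (Z ^ 650)⁻¹ := by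
                rw [← mul_inv, inv_mul_eq_iff_eq_mul₀ (pow_pos hZ _).ne', eq_comm,
                  mul_inv_eq_iff_eq_mul₀ (mul_pos hZ (pow_pos hZ _)).ne']
                ring
            _ ≤ _ := mul_le_mul_of_nonneg_right h2 hi.le
        rw [e1, ← mul_div_assoc, div_le_div_iff₀ hσ2 (by positivity)]
        have h3 : ν * α₀ ≤ (α₀ - (Z ^ 680)⁻¹) * (ν + (Z ^ 650)⁻¹) := by linarith
        have := mul_le_mul_of_nonneg_right h3 hσ2.le
        linarith
      κ₀_one := by
        refine le_of_sq_le_sq ?_ (Real.sqrt_nonneg _)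
        rw [hκ₀, one_pow, one_le_div (by positivity)]
        have := mul_le_mul_of_nonneg_left hP₀ge hσ2.le
        linarith
      κ₀_le := by
        rw [hκ₀, div_eq_mul_inv]
        calc ν₀ * (α₀ * σ ^ 2)⁻¹ ≤ Z * Z ^ 3 :=
              mul_le_mul H.ν₀_le H.inv_mul_le (by positivity) hZ.le
          _ = 1 * Z ^ 4 := by ring
          _ ≤ _ := H.const_mul_pow_le (by norm_num) (by norm_num)
      κ₀_ge := by
        rw [hκ₀]
        refine le_of_eq ?_
        field_simp }

end Bounds


/-- The crude bound `log T = 2 log √T ≤ 2 √T` suffices: it is needed only to see that `τ₀`, which is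
proportional to the logarithm, lies below the horizon. -/
lemma log_four_mul_le {T : ℝ} (hT : 0 < T) : Real.log (4 * T) ≤ 4 * √T := by
  have h1 := Real.log_le_sub_one_of_pos (Real.sqrt_pos.2 hT)
  have h2 : Real.log T = 2 * Real.log √T := by rw [Real.log_sqrt hT.le]; ring
  have h3 : Real.log 4 = 2 * Real.log 2 := by
    rw [show (4 : ℝ) = 2 ^ 2 by norm_num, Real.log_pow]; norm_num
  rw [Real.log_mul (by norm_num) hT.ne', h2, h3]
  have := Real.log_two_lt_d9
  have := Real.sqrt_nonneg T
  linarith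

lemma log_four_mul_le_log {T : ℝ} (hT : 2 ≤ T) : Real.log (4 * T) ≤ 3 * Real.log T := by
  have h : Real.log 4 = 2 * Real.log 2 := by
    rw [show (4 : ℝ) = 2 ^ 2 by norm_num, Real.log_pow]; norm_num
  rw [Real.log_mul (by norm_num) (by linarith), h]
  have := Real.log_le_log (by norm_num) hT
  linarith

/-! ### The prescribed parameters satisfy the requirements of the regret analysis. -/

namespace Setting

variable {d k : ℕ} {A : Matrix (Fin d) (Fin d) ℝ} {B : Matrix (Fin d) (Fin k) ℝ}
  {Q : Matrix (Fin d) (Fin d) ℝ} {R : Matrix (Fin k) (Fin k) ℝ}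
  {K₀ Kstar : Matrix (Fin k) (Fin d) ℝ} {P P₀ : Matrix (Fin d) (Fin d) ℝ}
  {α ϑ p p₀ σ κ κ₀ Y : ℝ}

lemma le_of_mul_en_sq_le (S : Setting A B Q R K₀ Kstar P P₀ α ϑ p p₀ σ κ κ₀ Y) {μ : ℝ}
    (hμ : ∀ v, μ * en v ^ 2 ≤ en (Kstarᵀ *ᵥ v) ^ 2) : μ ≤ Y := by
  have h1 := pow_le_pow_left₀ (norm_nonneg _) S.goodController_Kstar.2 2
  set e : Fin k → ℝ := Pi.single ⟨0, S.k_pos⟩ 1 with he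
  have he0 : 0 < en e := en_pos (by rw [he]; simp)
  refine le_of_mul_le_mul_right (((hμ e).trans (en_mulVec_sq_le _ _)).trans ?_) (pow_pos he0 2)
  rw [norm_transpose']
  exact mul_le_mul_of_nonneg_right (h1.trans S.κ_le) (sq_nonneg _)

/-- The bounds on the tuned parameters. -/
theorem tuned {ν ν₀ C₀ ε₀ μ : ℝ} {T : ℕ}
    (S : Setting A B Q R K₀ Kstar P P₀ α ϑ p p₀ σ (√((ν + ε₀ ^ 2 * C₀) / (α * σ ^ 2)))
      (√(ν₀ / (α * σ ^ 2))) Y)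
    (hC : C₀ = Y ^ 70) (hε : ε₀ = (Y ^ 100)⁻¹) (hT : 16 * Y ^ 432 ≤ T) (hμ : 0 < μ)
    (hK : ∀ v, μ * en v ^ 2 ≤ en (Kstarᵀ *ᵥ v) ^ 2) :
    Tuned (tunedInput T Q R A K₀ α ϑ ν ν₀ σ C₀ ε₀) B Kstar P P₀ α ϑ p p₀ σ
      (√(ν₀ / (α * σ ^ 2))) Y (Real.log (4 * T)) μ := by
  have hY := S.Y_pos
  have hYge := S.Y_ge
  have hY1 : 1 ≤ Y := by linarith
  set κ := √((ν + ε₀ ^ 2 * C₀) / (α * σ ^ 2)) with hκ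
  set κ₀ := √(ν₀ / (α * σ ^ 2)) with hκ₀
  set L := Real.log (4 * T) with hLdef
  set I := tunedInput T Q R A K₀ α ϑ ν ν₀ σ C₀ ε₀ with hI
  set M := max ((1 + ϑ) ^ 2 * κ₀ ^ 6) (4 * κ ^ 6) with hM
  have hκ1 := S.κ_one
  have hκ01 := S.κ₀_one
  have hσ2 : 0 < σ ^ 2 := pow_pos S.σ_pos 2
  have hϑ := S.ϑ_nonneg
  have hk1 : (1 : ℝ) ≤ k := by exact_mod_cast S.k_pos
  have hd1 : (1 : ℝ) ≤ d := by exact_mod_cast S.d_pos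
  have hκ2 : 1 ≤ κ ^ 2 := one_le_pow₀ hκ1
  have hY432 : 1 ≤ Y ^ 432 := one_le_pow₀ hY1
  have hT16 : (16 : ℝ) ≤ T := by linarith
  have hT0 : (0 : ℝ) < T := by linarith
  have hlog4 : 1 ≤ Real.log 4 := by
    rw [show (4 : ℝ) = 2 ^ 2 by norm_num, Real.log_pow]
    have := Real.log_two_gt_d9
    push_cast
    linarith
  have hlogT : 0 ≤ Real.log T := Real.log_nonneg (by linarith)
  have hLeq : L = Real.log 4 + Real.log T := Real.log_mul (by norm_num) hT0.ne'
  have hL1 : 1 ≤ L := by linarith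
  have hL0 : 0 < L := by linarith
  have exb : I.xb = 135 * d * κ ^ 2 * σ ^ 2 * M * L := rfl
  have elam : I.lam = κ ^ 2 * I.xb := rfl
  have eτ : I.τ₀ = ⌈80 * k * I.lam * (1 + ϑ ^ 2) / (σ ^ 2 * ε₀ ^ 2)⌉₊ := rfl
  have hM4 : 4 ≤ M := by
    refine le_trans ?_ (le_max_right _ _)
    have := one_le_pow₀ hκ1 (n := 6)
    linarith
  have hMY : M ≤ 4 * Y ^ 5 := by
    have h6 : ∀ x : ℝ, x ^ 2 ≤ Y → x ^ 6 ≤ Y ^ 3 := fun x hx => by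
      calc x ^ 6 = (x ^ 2) ^ 3 := by ring
        _ ≤ Y ^ 3 := pow_le_pow_left₀ (sq_nonneg _) hx 3
    refine max_le ?_ ?_
    · calc (1 + ϑ) ^ 2 * κ₀ ^ 6 ≤ (2 * Y) ^ 2 * Y ^ 3 := by
            refine mul_le_mul (pow_le_pow_left₀ (by linarith) (by linarith [S.ϑ_le]) 2)
              (h6 _ S.κ₀_le) (by positivity) (by positivity)
        _ = 4 * Y ^ 5 := by ring
    · have h1 : Y ^ 3 ≤ Y ^ 5 := pow_le_pow_right₀ hY1 (by norm_num)
      linarith [h6 _ S.κ_le]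
  have hM0 : 0 < M := by linarith
  have hxb0 : 0 < I.xb := by rw [exb]; positivity
  have hxbσ : σ ^ 2 * L ≤ I.xb := by
    have h1 : 1 ≤ 135 * (d : ℝ) * κ ^ 2 * M :=
      one_le_mul_of_one_le_of_one_le (one_le_mul_of_one_le_of_one_le (by linarith) hκ2)
        (by linarith)
    calc σ ^ 2 * L ≤ (135 * d * κ ^ 2 * M) * (σ ^ 2 * L) :=
          le_mul_of_one_le_left (by positivity) h1
      _ = _ := by rw [exb]; ring
  have hxbY : I.xb ≤ Y ^ 9 * L := by
    have h1 : 540 * Y ^ 8 ≤ Y ^ 9 := S.pow_mul_le (by norm_num) (by norm_num)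
    have h2 : (d : ℝ) * κ ^ 2 * σ ^ 2 * M ≤ Y * Y * Y * (4 * Y ^ 5) := by
      have := S.d_le
      have := S.κ_le
      have := S.σ_le
      gcongr
    calc I.xb = 135 * (d * κ ^ 2 * σ ^ 2 * M) * L := by rw [exb]; ring
      _ ≤ 135 * (Y * Y * Y * (4 * Y ^ 5)) * L := by gcongr
      _ = (540 * Y ^ 8) * L := by ring
      _ ≤ _ := mul_le_mul_of_nonneg_right h1 hL0.le
  have hxblam : I.xb ≤ I.lam := by
    rw [elam]
    exact le_mul_of_one_le_left hxb0.le hκ2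
  have hlam0 : 0 < I.lam := hxb0.trans_le hxblam
  have hlamY : I.lam ≤ Y ^ 10 * L := by
    calc I.lam ≤ Y * (Y ^ 9 * L) := mul_le_mul S.κ_le hxbY hxb0.le hY.le
      _ = _ := by ring
  have hY200 : 0 < Y ^ 200 := pow_pos hY _
  -- Division by `ε₀²` supplies the factor `Y²⁰⁰`, the length of exploration that makes the first
  -- estimate accurate.
  have earg : 80 * k * I.lam * (1 + ϑ ^ 2) / (σ ^ 2 * ε₀ ^ 2)
      = (80 * k * I.lam * (1 + ϑ ^ 2) * (σ ^ 2)⁻¹) * Y ^ 200 := by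
    have e1 : (Y ^ 100)⁻¹ ^ 2 = (Y ^ 200)⁻¹ := by rw [inv_pow, ← pow_mul]
    rw [hε, e1, div_mul_eq_div_div, div_inv_eq_mul, div_eq_mul_inv]
  have hτge : Y ^ 200 * L ≤ I.τ₀ := by
    rw [eτ]
    refine le_trans ?_ (Nat.le_ceil _)
    rw [earg, mul_comm]
    refine mul_le_mul_of_nonneg_right ?_ hY200.le
    rw [← div_eq_mul_inv, le_div_iff₀ hσ2]
    have h1 : 1 ≤ 80 * (k : ℝ) * (1 + ϑ ^ 2) :=
      one_le_mul_of_one_le_of_one_le (by linarith) (by linarith [sq_nonneg ϑ])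
    calc L * σ ^ 2 = σ ^ 2 * L := mul_comm _ _
      _ ≤ I.lam := hxbσ.trans hxblam
      _ ≤ (80 * k * (1 + ϑ ^ 2)) * I.lam := le_mul_of_one_le_left hlam0.le h1
      _ = _ := by ring
  have hτle : I.τ₀ ≤ Y ^ 216 * L := by
    rw [eτ, earg]
    refine (Nat.ceil_lt_add_one (by positivity)).le.trans ?_
    have h1 : 80 * k * I.lam * (1 + ϑ ^ 2) * (σ ^ 2)⁻¹
        ≤ 80 * Y * (Y ^ 10 * L) * (2 * Y ^ 2) * Y := by
      have t1 : (k : ℝ) ≤ Y := le_trans (by exact_mod_cast S.k_le) S.d_le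
      have t2 : 1 + ϑ ^ 2 ≤ 2 * Y ^ 2 := by
        have := pow_le_pow_left₀ hϑ S.ϑ_le 2
        have := one_le_pow₀ hY1 (n := 2)
        linarith
      have t3 : (σ ^ 2)⁻¹ ≤ Y := by
        rw [inv_le_comm₀ hσ2 hY]
        exact S.σ_ge
      gcongr
    have h2 : 1 ≤ Y ^ 215 * L :=
      one_le_mul_of_one_le_of_one_le (one_le_pow₀ hY1) hL1
    have h3 : 160 * Y ^ 214 ≤ Y ^ 215 := S.pow_mul_le (by norm_num) (by norm_num)
    have h4 : 2 * Y ^ 215 ≤ Y ^ 216 := S.pow_mul_le (by norm_num) (by norm_num)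
    calc _ ≤ (80 * Y * (Y ^ 10 * L) * (2 * Y ^ 2) * Y) * Y ^ 200 + 1 :=
          add_le_add (mul_le_mul_of_nonneg_right h1 hY200.le) le_rfl
      _ = (160 * Y ^ 214) * L + 1 := by ring
      _ ≤ Y ^ 215 * L + Y ^ 215 * L :=
          add_le_add (mul_le_mul_of_nonneg_right h3 hL0.le) h2
      _ = (2 * Y ^ 215) * L := by ring
      _ ≤ _ := mul_le_mul_of_nonneg_right h4 hL0.le
  have hτ1 : (1 : ℝ) ≤ I.τ₀ :=
    (one_le_mul_of_one_le_of_one_le (one_le_pow₀ hY1) hL1).trans hτge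
  refine { toSetting := S
           L_one := hL1
           lam_pos := hlam0
           lam_le := hlamY
           xb_le := hxblam
           τ₀_ge := hτge
           τ₀_le := hτle
           xb_ge := ?_
           μ₀_eq := ?_
           T_ge := ?_
           nT_le := ?_
           μ_pos := hμ
           μ_le := S.le_of_mul_en_sq_le hK
           Kstar_ge := hK }
  -- The prescribed constant splits as `135 = 9 · 15`: `15 d σ² L` bounds the squared noise, and `9
  -- κ²` times the maximum covers the growth of the state.
  · rw [exb]
    refine le_of_eq ?_
    change 9 * κ ^ 2 * M * (15 * d * σ ^ 2 * L) = _
    ring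
  · change 4 * κ * C₀ * ε₀ = 4 * κ * (Y ^ 30)⁻¹
    have : Y ^ 70 * (Y ^ 100)⁻¹ = (Y ^ 30)⁻¹ := by
      rw [mul_inv_eq_iff_eq_mul₀ (pow_pos hY _).ne', eq_comm,
        inv_mul_eq_iff_eq_mul₀ (pow_pos hY _).ne', ← pow_add]
    rw [hC, hε, mul_assoc, this]
  -- The threshold on `T` is the square of `4 Y²¹⁶`, so that `τ₀ ≤ Y²¹⁶ · 4 √T ≤ T`.
  · change I.τ₀ ≤ T
    have h1 : L ≤ 4 * √T := log_four_mul_le hT0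
    have h2 : 4 * Y ^ 216 ≤ √T := by
      refine Real.le_sqrt_of_sq_le ?_
      calc (4 * Y ^ 216) ^ 2 = 16 * Y ^ 432 := by ring
        _ ≤ (T : ℝ) := hT
    have h3 : (I.τ₀ : ℝ) ≤ T := by
      calc (I.τ₀ : ℝ) ≤ Y ^ 216 * (4 * √T) :=
            hτle.trans (mul_le_mul_of_nonneg_left h1 (pow_nonneg hY.le _))
        _ = (4 * Y ^ 216) * √T := by ring
        _ ≤ √T * √T := mul_le_mul_of_nonneg_right h2 (Real.sqrt_nonneg _)
        _ = T := Real.mul_self_sqrt hT0.le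
    exact_mod_cast h3
  -- Since `log 4 ≥ 1`, logarithms to base 4 are below natural ones, and the additional phase is
  -- paid for by `log 4`.
  · have h1 : (I.nT : ℝ) ≤ Real.log T := by
      rcases le_or_gt 0 (Real.logb 4 ((I.T : ℝ) / (I.τ₀ : ℝ))) with h | h
      · refine (Nat.floor_le h).trans ?_
        have h2 : Real.log (T / I.τ₀) ≤ Real.log T := by
          rw [Real.log_div hT0.ne' (by linarith)]
          linarith [Real.log_nonneg hτ1]
        change Real.log (T / I.τ₀) / Real.log 4 ≤ _
        rw [div_le_iff₀ (by linarith)]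
        exact h2.trans (le_mul_of_one_le_right hlogT hlog4)
      · rw [AlgInput.nT, Nat.floor_of_nonpos h.le]
        simpa using hlogT
    linarith

end Setting

/-! ### The polynomials -/

/-- A power of the sum of all the variables, shifted by a constant. -/
noncomputable def shiftedSumPow (n m : ℕ) : MvPolynomial (Fin n) ℝ :=
  (MvPolynomial.C 1000 + ∑ i, MvPolynomial.X i) ^ m

lemma eval_shiftedSumPow {n : ℕ} (v : Fin n → ℝ) (m : ℕ) :
    MvPolynomial.eval v (shiftedSumPow n m) = (1000 + ∑ i, v i) ^ m := by
  simp [shiftedSumPow]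

lemma sum_params (d k : ℕ) (α₀ α₁ ϑ ν ν₀ σ : ℝ) :
    ∑ i, params d k α₀ α₁ ϑ ν ν₀ σ i = α₀⁻¹ + α₁ + ϑ + ν + ν₀ + d + k + σ + σ⁻¹ := by
  simp [params, Fin.sum_univ_succ]
  ring

lemma sum_paramsμ (d k : ℕ) (α₀ α₁ ϑ ν ν₀ σ μ : ℝ) :
    ∑ i, paramsμ d k α₀ α₁ ϑ ν ν₀ σ μ i = ∑ i, params d k α₀ α₁ ϑ ν ν₀ σ i + μ⁻¹ := by
  rw [sum_params]
  simp [paramsμ, Fin.sum_univ_succ]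
  ring


lemma bounds_params {d k : ℕ} {α₀ α₁ ϑ ν ν₀ σ : ℝ} (hk : 0 < k) (hα₀ : 0 < α₀) (hα₁ : 0 < α₁)
    (hϑ : 0 < ϑ) (hν : 0 < ν) (hν₀ : 0 < ν₀) (hσ : 0 < σ) :
    Bounds d k α₀ α₁ ϑ ν ν₀ σ (1000 + ∑ i, params d k α₀ α₁ ϑ ν ν₀ σ i) := by
  rw [sum_params]
  have hαi : 0 < α₀⁻¹ := inv_pos.2 hα₀
  have hσi : 0 < σ⁻¹ := inv_pos.2 hσ
  have hk0 : (0 : ℝ) ≤ k := Nat.cast_nonneg k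
  have hd0 : (0 : ℝ) ≤ d := Nat.cast_nonneg d
  constructor <;> first | assumption | linarith

namespace Bounds

variable {d k : ℕ} {α₀ α₁ ϑ ν ν₀ σ Z : ℝ} (H : Bounds d k α₀ α₁ ϑ ν ν₀ σ Z)

include H

/-- With `Y = Z⁵` the threshold has degree `5 · 432 = 2160`; the spare powers absorb the factor 16.
-/
lemma horizon_le {m : ℝ} (hm : 0 ≤ m) : 16 * (Z ^ 5) ^ 432 ≤ (Z + m) ^ 2165 := by
  rw [← pow_mul]
  exact (H.const_mul_pow_le (by norm_num) (by norm_num)).trans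
    (pow_le_pow_left₀ H.Z_pos.le (le_add_of_nonneg_right hm) _)

/-- The factor 9 comes from `log (4T) ≤ 3 log T`, and the degree is `5 · 245 + 2 + 1`. -/
lemma regret_const_le {m : ℝ} (hm : 0 ≤ m) :
    9 * ((Z ^ 5) ^ 245 * (1 + m) ^ 2) ≤ (Z + m) ^ 1228 := by
  have hZ := H.Z_pos
  have hZ1 := H.Z_ge
  have h3 : (9 : ℝ) ≤ Z + m := by linarith
  have h0 : 0 ≤ Z + m := add_nonneg hZ.le hm
  have h1 : (1 + m) ^ 2 ≤ (Z + m) ^ 2 := pow_le_pow_left₀ (by linarith) (by linarith) 2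
  have h2 : Z ^ 1225 ≤ (Z + m) ^ 1225 := pow_le_pow_left₀ hZ.le (le_add_of_nonneg_right hm) _
  rw [← pow_mul]
  calc 9 * (Z ^ (5 * 245) * (1 + m) ^ 2) ≤ (Z + m) * ((Z + m) ^ 1225 * (Z + m) ^ 2) :=
        mul_le_mul h3 (mul_le_mul h2 h1 (sq_nonneg _) (pow_nonneg h0 _))
          (mul_nonneg (pow_nonneg hZ.le _) (sq_nonneg _)) h0
    _ = (Z + m) ^ 1228 := by rw [← pow_add, ← pow_succ']

end Bounds

end LQR

/-! ### Assembly of the sensitivity and regret statements. -/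

namespace LQR.Bounds

variable {d k : ℕ} {α₀ α₁ ϑ ν ν₀ σ Z : ℝ}

/-- Sensitivity of the optimal policy and expected regret, in terms of a common bound on the problem
parameters. -/
theorem sensitivity_and_regret (H : Bounds d k α₀ α₁ ϑ ν ν₀ σ Z) {C₀ ε₀ μ : ℝ}
    (hC : C₀ = Z ^ 350) (hε : ε₀ = (Z ^ 500)⁻¹)
    {Astar : Matrix (Fin d) (Fin d) ℝ} {Bstar : Matrix (Fin d) (Fin k) ℝ}
    {Q : Matrix (Fin d) (Fin d) ℝ} {R : Matrix (Fin k) (Fin k) ℝ}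
    {K₀ Kstar : Matrix (Fin k) (Fin d) ℝ} (hQ : Q.PosDef) (hR : R.PosDef)
    (hR1 : ‖R‖ ≤ α₁) (hQi : ‖Q⁻¹‖ ≤ α₀⁻¹) (hRi : ‖R⁻¹‖ ≤ α₀⁻¹)
    (hA : ‖Astar‖ ≤ ϑ) (hB : ‖Bstar‖ ≤ ϑ)
    {Ω : Type*} [MeasurableSpace Ω] {Pr : Measure Ω} [IsProbabilityMeasure Pr]
    {w : ℕ → Ω → Fin d → ℝ} {η : ℕ → Ω → Fin k → ℝ} (hnoise : IsGaussianNoise Pr σ w η)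
    (hK₀ : infiniteHorizonCost Pr w Astar Bstar Q R K₀ ≤ ENNReal.ofReal ν₀)
    (hmin : ∀ K, infiniteHorizonCost Pr w Astar Bstar Q R Kstar
      ≤ infiniteHorizonCost Pr w Astar Bstar Q R K)
    (hJ : infiniteHorizonCost Pr w Astar Bstar Q R Kstar ≤ ENNReal.ofReal ν)
    (hμ : 0 < μ) (hK : (Kstar * Kstarᵀ - μ • (1 : Matrix (Fin k) (Fin k) ℝ)).PosSemidef) :
    0 < C₀ ∧ 0 < ε₀ ∧
    (∀ (ε : ℝ) (A : Matrix (Fin d) (Fin d) ℝ) (B : Matrix (Fin d) (Fin k) ℝ),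
      0 ≤ ε → ε ≤ ε₀ → ‖A - Astar‖ ≤ ε → ‖B - Bstar‖ ≤ ε →
      infiniteHorizonCost Pr w Astar Bstar Q R (optController Q R A B)
          ≤ infiniteHorizonCost Pr w Astar Bstar Q R Kstar + ENNReal.ofReal (C₀ * ε ^ 2) ∧
        ‖optController Q R A B - Kstar‖ ≤ C₀ * ε) ∧
    ∀ T : ℕ, (Z + μ⁻¹) ^ 2165 ≤ (T : ℝ) →
      Integrable (fun ω => regret Q R
          (infiniteHorizonCost Pr w Astar Bstar Q R Kstar).toReal
          (tunedInput T Q R Astar K₀ α₀ ϑ ν ν₀ σ C₀ ε₀).policy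
          Astar Bstar (fun t => w t ω) (fun t => η t ω) T) Pr ∧
      ∫ ω, regret Q R
          (infiniteHorizonCost Pr w Astar Bstar Q R Kstar).toReal
          (tunedInput T Q R Astar K₀ α₀ ϑ ν ν₀ σ C₀ ε₀).policy
          Astar Bstar (fun t => w t ω) (fun t => η t ω) T ∂Pr
        ≤ (Z + μ⁻¹) ^ 1228 * Real.log T ^ 2 := by
  have hZ := H.Z_pos
  have hZ1 : 1 ≤ Z := by linarith only [H.Z_ge]
  have hμi : 0 ≤ μ⁻¹ := inv_nonneg.2 hμ.le
  -- The costs and the regret are unchanged, almost surely, when the noise is replaced by a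
  -- measurable version.
  obtain ⟨w', η', hN, hae⟩ := hnoise.exists_measurable
  have hcongr := infiniteHorizonCost_congr (hae.mono fun ω h => h.1) Astar Bstar Q R
  simp only [hcongr] at hK₀ hmin hJ ⊢
  obtain ⟨P, P₀, S, hcost, htrZ, htr0⟩ := H.exists_setting hN hC hε hQ hR hR1 hQi hRi hA hB hK₀
    hmin hJ hμ hK
  have hCY : C₀ = (Z ^ 5) ^ 70 := by rw [hC, ← pow_mul]
  have hεY : ε₀ = ((Z ^ 5) ^ 100)⁻¹ := by rw [hε, ← pow_mul]
  have hC0 : 0 < C₀ := by rw [hC]; exact pow_pos hZ _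
  have hε0 : 0 < ε₀ := by rw [hε]; exact inv_pos.2 (pow_pos hZ _)
  refine ⟨hC0, hε0, ?_, ?_⟩
  · intro ε A B h0 h1 hA' hB'
    rw [hεY] at h1
    have h2 := S.norm_optController_sub_le h0 h1 hA' hB'
    rw [hcost, hCY]
    refine ⟨S.infiniteHorizonCost_le hN htrZ h0 h1 h2, h2.trans ?_⟩
    refine mul_le_mul_of_nonneg_right (pow_le_pow_right₀ ?_ (by norm_num)) h0
    exact one_le_pow₀ hZ1
  · intro T hT
    have hT' : 16 * (Z ^ 5) ^ 432 ≤ (T : ℝ) := (H.horizon_le hμi).trans hT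
    have hT2 : (2 : ℝ) ≤ T := by
      have : 1 ≤ (Z ^ 5) ^ 432 := one_le_pow₀ (one_le_pow₀ hZ1)
      exact le_trans (by norm_num) ((le_mul_of_one_le_right (by norm_num) this).trans hT')
    have hU := S.tuned hCY hεY hT' hμ ((posSemidef_mul_transpose_sub_iff Kstar μ).1 hK)
    have hreg : (fun ω => regret Q R (σ ^ 2 * P.trace)
          (tunedInput T Q R Astar K₀ α₀ ϑ ν ν₀ σ C₀ ε₀).policy
          Astar Bstar (fun t => w t ω) (fun t => η t ω) T) =ᵐ[Pr]
        fun ω => regret Q R (σ ^ 2 * P.trace)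
          (tunedInput T Q R Astar K₀ α₀ ϑ ν ν₀ σ C₀ ε₀).policy
          Astar Bstar (fun t => w' t ω) (fun t => η' t ω) T := by
      filter_upwards [hae] with ω h
      rw [funext h.1, funext h.2]
    obtain ⟨hi, hle⟩ := hU.integral_regret_le hN (by exact_mod_cast hT2) rfl
    rw [hcost, ENNReal.toReal_ofReal (mul_nonneg (sq_nonneg _) htr0), integral_congr_ae hreg]
    refine ⟨hi.congr hreg.symm, hle.trans ?_⟩
    have hlog0 : 0 ≤ Real.log (4 * (T : ℝ)) := Real.log_nonneg (by linarith only [hT2])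
    have hlog : Real.log (4 * (T : ℝ)) ^ 2 ≤ 9 * Real.log T ^ 2 :=
      (pow_le_pow_left₀ hlog0 (log_four_mul_le_log hT2) 2).trans_eq (by rw [mul_pow]; norm_num)
    refine (mul_le_mul_of_nonneg_left hlog (mul_nonneg (pow_nonneg (pow_nonneg hZ.le _) _)
      (sq_nonneg _))).trans ?_
    rw [mul_left_comm, ← mul_assoc]
    exact mul_le_mul_of_nonneg_right (H.regret_const_le hμi) (sq_nonneg _)

end LQR.Bounds

theorem theorem2 :
    -- universal polynomials: `C₀`, `ε₀⁻¹`, the threshold for `T`, the constant of the regret bound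
    ∃ (pC pε : MvPolynomial (Fin 9) ℝ) (pT pR : MvPolynomial (Fin 10) ℝ),
    -- dimensions and known constants
    ∀ (d k : ℕ) (_ : 0 < k) (α₀ α₁ ϑ ν ν₀ σ C₀ ε₀ : ℝ)
      (_ : 0 < α₀) (_ : 0 < α₁) (_ : 0 < ϑ) (_ : 0 < ν) (_ : 0 < ν₀) (_ : 0 < σ)
      (_ : C₀ = MvPolynomial.eval (LQR.params d k α₀ α₁ ϑ ν ν₀ σ) pC)
      (_ : ε₀ = (MvPolynomial.eval (LQR.params d k α₀ α₁ ϑ ν ν₀ σ) pε)⁻¹)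
    -- the system
      (Astar : Matrix (Fin d) (Fin d) ℝ) (Bstar : Matrix (Fin d) (Fin k) ℝ)
      (Q : Matrix (Fin d) (Fin d) ℝ) (R : Matrix (Fin k) (Fin k) ℝ)
      (K₀ Kstar : Matrix (Fin k) (Fin d) ℝ) (μ : ℝ)
      (_ : Q.PosDef) (_ : R.PosDef)
      (_ : ‖Q‖ ≤ α₁) (_ : ‖R‖ ≤ α₁) (_ : ‖Q⁻¹‖ ≤ α₀⁻¹) (_ : ‖R⁻¹‖ ≤ α₀⁻¹)
      (_ : ‖Astar‖ ≤ ϑ) (_ : ‖Bstar‖ ≤ ϑ)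
    -- the noise
      (Ω : Type*) [MeasurableSpace Ω] (Pr : MeasureTheory.Measure Ω)
      [MeasureTheory.IsProbabilityMeasure Pr]
      (w : ℕ → Ω → Fin d → ℝ) (η : ℕ → Ω → Fin k → ℝ)
      (_ : LQR.IsGaussianNoise Pr σ w η)
    -- the initial policy, and the optimal policy with its nondegeneracy
      (_ : LQR.infiniteHorizonCost Pr w Astar Bstar Q R K₀ ≤ ENNReal.ofReal ν₀)
      (_ : ∀ K, LQR.infiniteHorizonCost Pr w Astar Bstar Q R Kstar
        ≤ LQR.infiniteHorizonCost Pr w Astar Bstar Q R K)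
      (_ : LQR.infiniteHorizonCost Pr w Astar Bstar Q R Kstar ≤ ENNReal.ofReal ν)
      (_ : 0 < μ)
      (_ : (Kstar * Kstarᵀ - μ • (1 : Matrix (Fin k) (Fin k) ℝ)).PosSemidef),
    -- `C₀` and `ε₀` bound the sensitivity of the optimal policy
    0 < C₀ ∧ 0 < ε₀ ∧
    (∀ (ε : ℝ) (A : Matrix (Fin d) (Fin d) ℝ) (B : Matrix (Fin d) (Fin k) ℝ),
      0 ≤ ε → ε ≤ ε₀ → ‖A - Astar‖ ≤ ε → ‖B - Bstar‖ ≤ ε →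
      LQR.infiniteHorizonCost Pr w Astar Bstar Q R (LQR.optController Q R A B)
          ≤ LQR.infiniteHorizonCost Pr w Astar Bstar Q R Kstar + ENNReal.ofReal (C₀ * ε ^ 2) ∧
        ‖LQR.optController Q R A B - Kstar‖ ≤ C₀ * ε) ∧
    -- expected regret of the algorithm
    ∀ T : ℕ, MvPolynomial.eval (LQR.paramsμ d k α₀ α₁ ϑ ν ν₀ σ μ) pT ≤ (T : ℝ) →
      MeasureTheory.Integrable (fun ω => LQR.regret Q R
          (LQR.infiniteHorizonCost Pr w Astar Bstar Q R Kstar).toReal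
          (LQR.tunedInput T Q R Astar K₀ α₀ ϑ ν ν₀ σ C₀ ε₀).policy
          Astar Bstar (fun t => w t ω) (fun t => η t ω) T) Pr ∧
      ∫ ω, LQR.regret Q R
          (LQR.infiniteHorizonCost Pr w Astar Bstar Q R Kstar).toReal
          (LQR.tunedInput T Q R Astar K₀ α₀ ϑ ν ν₀ σ C₀ ε₀).policy
          Astar Bstar (fun t => w t ω) (fun t => η t ω) T ∂Pr
        ≤ MvPolynomial.eval (LQR.paramsμ d k α₀ α₁ ϑ ν ν₀ σ μ) pR * Real.log T ^ 2 := by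
  -- `C₀ = Y⁷⁰` and `ε₀⁻¹ = Y¹⁰⁰` with `Y = Z⁵`. The other two polynomials use `Z + μ⁻¹`, with
  -- degrees from `horizon_le` and `regret_const_le`.
  refine ⟨LQR.shiftedSumPow 9 350, LQR.shiftedSumPow 9 500, LQR.shiftedSumPow 10 2165,
    LQR.shiftedSumPow 10 1228, ?_⟩
  intro d k hk α₀ α₁ ϑ ν ν₀ σ C₀ ε₀ hα₀ hα₁ hϑ hν hν₀ hσ hC hε Astar Bstar Q R K₀ Kstar μ hQ hR
    hQ1 hR1 hQi hRi hA hB Ω _ Pr _ w η hnoise hK₀ hmin hJ hμ hK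
  rw [LQR.eval_shiftedSumPow] at hC hε
  rw [LQR.eval_shiftedSumPow, LQR.eval_shiftedSumPow, LQR.sum_paramsμ, ← add_assoc]
  exact (LQR.bounds_params hk hα₀ hα₁ hϑ hν hν₀ hσ).sensitivity_and_regret hC hε hQ hR hR1 hQi hRi
    hA hB hnoise hK₀ hmin hJ hμ hK
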